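/- Let $\Sigma$ be a linearly ordered alphabet. For strings $S,w$ over $\Sigma$ let $\mathrm{occ}_S(w)$ be the number of occurrences of $w$ in $S$, and call $w$ a repeat in $S$ if $\mathrm{occ}_S(w)\ge 2$. For a repeat $w$ let $\phi_S(w)$ (its net frequency) be the number of pairs $(\alpha,\beta)\in\Sigma\times\Sigma$ with $\mathrm{occ}_S(\alpha w\beta)=\mathrm{occ}_S(\alpha w)=\mathrm{occ}_S(w\beta)=1$, and put $\phi_S(w)=0$ if $w$ is not a repeat. A repeat $w$ is maximal if ($w$ is a prefix of $S$ or $\alpha w,\alpha' w$ are substrings of $S$ for some $\alpha\ne\alpha'$) and ($w$ is a suffix of $S$ or $w\beta,w\beta'$ are substrings of $S$ for some $\beta\neq\beta'$). Let $\mathrm{PNF}(S)$ be the set of pairs $(w,\phi_S(w))$ with $w$ a maximal repeat in $S$ and $\phi_S(w)\ge 1$. The suffix tree $\mathrm{STree}(S)$ has as nodes the suffixes of $S$ and the branching substrings of $S$ (those $x$ for which $x\beta,x\beta'$ are substrings for some $\beta\ne\beta'$); the parent of a node is the longest node that is a proper prefix of it. For a node $x$ and a character $c$, the child of $x$ along $c$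 is the shortest node with prefix $xc$, the (hard or soft) Weiner link of $x$ labelled $c$ leads to the shortest node with prefix $cx$, and the suffix link of a node $cx$ leads to $x$. (If the last character of $S$ occurs nowhere else in $S$, this is the usual compacted trie of the suffixes of $S$.) Theorem. There is an online algorithm, augmenting a right-to-left online construction of the suffix tree with Weiner links, and a constant $C$, both independent of $\Sigma$ and of the input, with the following properties. The algorithm is a fixed program for a random access machine whose elementary steps are moving, adding, subtracting and comparing numbers, moving and comparing characters, and accessing memory. It starts with an empty memory and reads a string character by character from right to left. For every string $S$ of length $n$ with $\sigma$ distinct characters, once $S$ has been read: 1. the total time spent is at most $C(n+1)(1+\lfloor\log_2\sigma\rfloor)$, that is, $O(\log\sigma)$ amortized time per character; 2. the space is $O(n)$ throughout: whenever the string read so far has length $k$, only cells with addresses below $C(k+1)$ and numbers of size at most $C(k+1)$ are used; 3. the memory holds the text $S$ and $\mathrm{STree}(S)$, each node $x$ storing its parent, its suffix link, two numbers that denote the string $x$ by an occurrence in $S$, and $\phi_S(x)$; the child and the Weiner link of a given node along a given character (or its absence) are found in at most $C(1+\lfloor\log_2\sigma\rfloor)$ steps without changing the memory; 4. the memory holds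 a linked list $\mathcal L$ of the elements of $\mathrm{PNF}(S)$, each exactly once, the strings being denoted by occurrences in $S$; 5. for every character $a\in\Sigma$, when $a$ is prepended to $S$, the algorithm computes $\mathrm{PNF}(aS)\mathbin{\Delta}\mathrm{PNF}(S)$, as two linked lists of the elements of $\mathrm{PNF}(aS)\setminus\mathrm{PNF}(S)$ and of $\mathrm{PNF}(S)\setminus\mathrm{PNF}(aS)$, each exactly once. -/

import Mathlib

universe u

namespace NetFrequency

/-! ## Strings, net frequency, `PNF`

A string over the ordered alphabet `A` is a `List A`; `a :: S` is the string `aS`. -/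

section Strings

variable {A : Type u}

/-- `occ S w` is the number of occurrences of `w` in `S` (0-based starting positions). -/
noncomputable def occ (S w : List A) : ℕ :=
  {i : ℕ | i + w.length ≤ S.length ∧ (S.drop i).take w.length = w}.ncard

/-- A repeat occurs at least twice. -/
def IsRepeat (S w : List A) : Prop := 2 ≤ occ S w

/-- The pairs `(α, β)` of characters with `occ (α w β) = occ (α w) = occ (w β) = 1`, for a repeat
`w` of `S`. (For a string `w` that is not a repeat this set is empty by convention.) -/
def Phi (S w : List A) : Set (A × A) :=
  {p | IsRepeat S w ∧ occ S (p.1 :: (w ++ [p.2])) = 1 ∧ occ S (p.1 :: w) = 1 ∧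
    occ S (w ++ [p.2]) = 1}

/-- The net frequency of `w` in `S`. -/
noncomputable def phi (S w : List A) : ℕ := (Phi S w).ncard

/-- Left-maximal repeats. -/
def LM (S : List A) : Set (List A) :=
  {w | IsRepeat S w ∧
    (w <+: S ∨ ∃ α α' : A, α ≠ α' ∧ (α :: w) <:+: S ∧ (α' :: w) <:+: S)}

/-- Right-maximal repeats. -/
def RM (S : List A) : Set (List A) :=
  {w | IsRepeat S w ∧
    (w <:+ S ∨ ∃ β β' : A, β ≠ β' ∧ (w ++ [β]) <:+: S ∧ (w ++ [β']) <:+: S)}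

/-- Maximal repeats. -/
def MaxRep (S : List A) : Set (List A) := LM S ∩ RM S

/-- The maximal repeats of positive net frequency, paired with their net frequencies. -/
def PNF (S : List A) : Set (List A × ℕ) :=
  {p | p.1 ∈ MaxRep S ∧ 1 ≤ phi S p.1 ∧ p.2 = phi S p.1}

/-! ## The suffix tree and its links

A node of the suffix tree is identified with the string it represents. -/

/-- The nodes of the suffix tree of `S`: the suffixes of `S` (the root is the empty suffix) and the
branching substrings. If the last character of `S` occurs only once in `S`, then the non-empty
suffixes are exactly the leaves and this is the compacted trie of the suffixes of `S`; for
other strings it is that trie with every suffix represented by an explicit node. -/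
def IsNode (S x : List A) : Prop :=
  x <:+ S ∨ ∃ β β' : A, β ≠ β' ∧ (x ++ [β]) <:+: S ∧ (x ++ [β']) <:+: S

/-- `w` is the shortest node that has `x` as a prefix. The child of a node `v` along the edge whose
label starts with `c` is the locus of `v c`, and the (hard or soft) Weiner link of `v` labelled
`a` leads to the locus of `a v`. -/
def IsLocus (S x w : List A) : Prop :=
  IsNode S w ∧ x <+: w ∧ ∀ w', IsNode S w' → x <+: w' → w.length ≤ w'.length

/-- `v` is the parent of `w`: the longest node that is a proper prefix of `w`. -/
def IsParent (S v w : List A) : Prop :=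
  IsNode S v ∧ v <+: w ∧ v ≠ w ∧
    ∀ v', IsNode S v' → v' <+: w → v' ≠ w → v'.length ≤ v.length

/-- The pair of numbers `(p, l)` denotes the string `w`: it is the prefix of length `l` of the
suffix of `S` of length `p`. (Positions are thus counted from the right end of `S`, so that they
do not move when characters are prepended.) -/
def Denotes (S : List A) (p l : ℕ) (w : List A) : Prop :=
  l = w.length ∧ ∃ t, t <:+ S ∧ t.length = p ∧ w <+: t

end Strings

/-! ## The machine

A random access machine for a general ordered alphabet, with structured programs. It has number
cells and character cells. Numbers can be added, subtracted (truncated at 0) and compared, and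
serve as addresses; characters can only be moved and compared. -/

/-- Tests: on number registers (`eq`, `lt`) and on character registers (`clt`). -/
inductive Test : Type
  | eq (x y : ℕ)
  | lt (x y : ℕ)
  | clt (x y : ℕ)
  | neg (b : Test)

/-- Programs. The arguments are indices of registers, except for the numeral `k` in `const`. -/
inductive Prog : Type
  | nop
  | const (x k : ℕ)
  | copy (x y : ℕ)
  | add (x y z : ℕ)
  | sub (x y z : ℕ)
  | load (x y : ℕ)
  | store (x y : ℕ)
  | ccopy (x y : ℕ)
  | cload (x y : ℕ)
  | cstore (x y : ℕ)
  | seq (P Q : Prog)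
  | ite (b : Test) (P Q : Prog)
  | loop (b : Test) (P : Prog)

/-- The memory: cells for numbers and cells for characters (`none` is the blank). -/
structure Memory (A : Type u) : Type u where
  num : ℕ → ℕ
  chr : ℕ → Option A

/-- The state of the machine: memory, number registers and character registers. -/
structure State (A : Type u) : Type u where
  mem : Memory A
  reg : ℕ → ℕ
  creg : ℕ → Option A

/-- The blank memory. -/
def Memory.blank (A : Type u) : Memory A := ⟨fun _ => 0, fun _ => none⟩

/-- The state in which an operation is called on memory `m` with number argument `p` and character
argument `c`, each in register 0. All other registers are blank: only memory persists from
one operation to the next. -/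
def Memory.call {A : Type u} (m : Memory A) (p : ℕ) (c : Option A) : State A :=
  ⟨m, Function.update (fun _ => 0) 0 p, Function.update (fun _ => none) 0 c⟩

section Semantics

variable {A : Type u}

/-- Write the number `v` into register `x`. -/
def State.setReg (s : State A) (x v : ℕ) : State A :=
  { s with reg := Function.update s.reg x v }

/-- Write the character `c` into character register `x`. -/
def State.setCreg (s : State A) (x : ℕ) (c : Option A) : State A :=
  { s with creg := Function.update s.creg x c }

/-- Write the number `v` into number cell `i`. -/
def State.setNum (s : State A) (i v : ℕ) : State A :=
  { s with mem := { s.mem with num := Function.update s.mem.num i v } }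

/-- Write the character `c` into character cell `i`. -/
def State.setChr (s : State A) (i : ℕ) (c : Option A) : State A :=
  { s with mem := { s.mem with chr := Function.update s.mem.chr i c } }

/-- Truth of a test. A comparison that involves a blank character register is false. -/
def Test.Holds [LinearOrder A] : Test → State A → Prop
  | .eq x y, s => s.reg x = s.reg y
  | .lt x y, s => s.reg x < s.reg y
  | .clt x y, s => ∃ a b : A, s.creg x = some a ∧ s.creg y = some b ∧ a < b
  | .neg b, s => ¬ b.Holds s

/-- `Exec B P s s' t`: on a machine whose memory consists of the cells with addresses `< B` and
whose numbers are at most `B`, the program `P`, started in state `s`, halts in state `s'` after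
`t` steps. Every elementary instruction and every evaluation of a test is one step. A program
that leaves the memory or exceeds the range of numbers has no execution. -/
inductive Exec [LinearOrder A] (B : ℕ) : Prog → State A → State A → ℕ → Prop
  | nop (s) : Exec B .nop s s 1
  | const (s x k) : k ≤ B → Exec B (.const x k) s (s.setReg x k) 1
  | copy (s x y) : Exec B (.copy x y) s (s.setReg x (s.reg y)) 1
  | add (s x y z) : s.reg y + s.reg z ≤ B →
      Exec B (.add x y z) s (s.setReg x (s.reg y + s.reg z)) 1
  | sub (s x y z) : Exec B (.sub x y z) s (s.setReg x (s.reg y - s.reg z)) 1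
  | load (s x y) : s.reg y < B → Exec B (.load x y) s (s.setReg x (s.mem.num (s.reg y))) 1
  | store (s x y) : s.reg x < B → Exec B (.store x y) s (s.setNum (s.reg x) (s.reg y)) 1
  | ccopy (s x y) : Exec B (.ccopy x y) s (s.setCreg x (s.creg y)) 1
  | cload (s x y) : s.reg y < B → Exec B (.cload x y) s (s.setCreg x (s.mem.chr (s.reg y))) 1
  | cstore (s x y) : s.reg x < B → Exec B (.cstore x y) s (s.setChr (s.reg x) (s.creg y)) 1
  | seq {P Q s s' s'' t t'} : Exec B P s s' t → Exec B Q s' s'' t' →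
      Exec B (.seq P Q) s s'' (t + t')
  | iteTrue {b P Q s s' t} : b.Holds s → Exec B P s s' t → Exec B (.ite b P Q) s s' (t + 1)
  | iteFalse {b P Q s s' t} : ¬ b.Holds s → Exec B Q s s' t → Exec B (.ite b P Q) s s' (t + 1)
  | loopDone {b P s} : ¬ b.Holds s → Exec B (.loop b P) s s 1
  | loopStep {b P s s' s'' t t'} : b.Holds s → Exec B P s s' t →
      Exec B (.loop b P) s' s'' t' → Exec B (.loop b P) s s'' (t + t' + 1)

end Semantics

/-! ## Online algorithms -/

/-- A right-to-left online suffix tree algorithm consists of four programs: initialization, the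
update when a character is prepended, and access to the children and to the Weiner links of
a given node. -/
structure OnlineAlgorithm : Type where
  init : Prog
  update : Prog
  child : Prog
  weiner : Prog

section Online

variable {A : Type u} [LinearOrder A]

/-- `D.Run C S m T`: when the characters of `S` are fed to `D` one by one from right to left,
starting with a blank memory, then `D` processes them in `T` steps in total (including the
initialization) and ends with memory `m`; whenever the string read so far has length `n`, it uses
only cells with addresses `< C * (n + 1)` and numbers `≤ C * (n + 1)`. -/
inductive OnlineAlgorithm.Run (D : OnlineAlgorithm) (C : ℕ) :
    List A → Memory A → ℕ → Prop
  | nil {s : State A} {t : ℕ} :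
      Exec (C * (0 + 1)) D.init ((Memory.blank A).call 0 none) s t → Run D C [] s.mem t
  | cons {a : A} {S : List A} {m : Memory A} {T : ℕ} {s : State A} {t : ℕ} :
      Run D C S m T → Exec (C * ((a :: S).length + 1)) D.update (m.call 0 (some a)) s t →
      Run D C (a :: S) s.mem (T + t)

/-- The bound `1 + ⌊log₂ σ⌋`, where `σ` is the number of distinct characters of `S`. -/
def logSigma (S : List A) : ℕ := 1 + Nat.log 2 S.toFinset.card

/-- With node address `p` and character `c` as arguments, the program `Q` returns the number `r`
in register 0 within `O(log σ)` steps (with the constant `C`), without changing the memory. -/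
def Answers (C : ℕ) (S : List A) (m : Memory A) (Q : Prog) (p : ℕ) (c : A) (r : ℕ) : Prop :=
  ∃ (s : State A) (t : ℕ), Exec (C * (S.length + 1)) Q (m.call p (some c)) s t ∧
    s.mem = m ∧ s.reg 0 = r ∧ t ≤ C * logSigma S

/-- The memory `m` holds the suffix tree of `S` with its links, augmented with net frequencies.
Character cell `i` holds the `i`-th character of `S` from the right. The record of the node `x`
starts at the address `addr x ≠ 0`; it consists of the address of the parent of `x` (`0` for the
root), two numbers that denote `x`, the net frequency of `x`, and the address of the
target of the suffix link of `x`. The address of the root is in number cell `3`. Child edges and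
(hard and soft) Weiner links are accessed by the programs `D.child` and `D.weiner`, which return
`0` when the edge or link does not exist. -/
def StoresSuffixTree (D : OnlineAlgorithm) (C : ℕ) (S : List A) (m : Memory A) : Prop :=
  (∀ i < S.length, m.chr i = S.reverse[i]?) ∧
  ∃ addr : List A → ℕ, m.num 3 = addr [] ∧
    ∀ x, IsNode S x →
      addr x ≠ 0 ∧
      (x = [] → m.num (addr x) = 0) ∧
      (∀ v, IsParent S v x → m.num (addr x) = addr v) ∧
      Denotes S (m.num (addr x + 1)) (m.num (addr x + 2)) x ∧
      m.num (addr x + 3) = phi S x ∧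
      (∀ a v, x = a :: v → m.num (addr x + 4) = addr v) ∧
      (∀ c w, IsLocus S (x ++ [c]) w → Answers C S m D.child (addr x) c (addr w)) ∧
      (∀ c, ¬ (x ++ [c]) <:+: S → Answers C S m D.child (addr x) c 0) ∧
      (∀ c w, IsLocus S (c :: x) w → Answers C S m D.weiner (addr x) c (addr w)) ∧
      (∀ c, ¬ (c :: x) <:+: S → Answers C S m D.weiner (addr x) c 0)

/-- At address `p` of the memory starts a linked list with the entries `L`. The record of an entry
`(w, f)` consists of the address of the next record (`0` at the end of the list), two numbers that
denote the string `w` with respect to `S`, and the number `f`. -/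
inductive IsLinkedList (S : List A) (m : Memory A) : ℕ → List (List A × ℕ) → Prop
  | nil : IsLinkedList S m 0 []
  | cons {p : ℕ} {w : List A} {f : ℕ} {L : List (List A × ℕ)} :
      p ≠ 0 → Denotes S (m.num (p + 1)) (m.num (p + 2)) w → m.num (p + 3) = f →
      IsLinkedList S m (m.num p) L → IsLinkedList S m p ((w, f) :: L)

/-- At address `p` starts a linked list that lists every element of the set `X` exactly once. -/
def StoresSet (S : List A) (m : Memory A) (p : ℕ) (X : Set (List A × ℕ)) : Prop :=
  ∃ L, IsLinkedList S m p L ∧ L.Nodup ∧ {x | x ∈ L} = X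

end Online

end NetFrequency

/-!
The algorithm is Weiner's right-to-left construction of the suffix tree, extended by net frequencies.

*The tree.* Let `z` be the longest prefix of `aS` that occurs in `S` (`IsHead`). The nodes of the tree of
`aS` are those of the tree of `S`, the leaf `aS`, and `z` (`IsHead.node_iff`); the other loci change only by
the insertion of `z` above its old locus `w` (`IsHead.loc_sub`). If `z ≠ []`, then `z = ax`, where `x` is the
first node with a Weiner link labelled `a` on the path from `S` to the root, and this link leads to `w`. So
a walk along this path finds `z`, and gives the nodes it passes a link to the new leaf (`firstWalk_wp`). If
`z` is not yet a node, it receives copies of the Weiner links of `w`, and a second walk, from `x` on,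
redirects to `z` the links that lead to `w` (`splitDicts_wp`).

*Net frequencies.* A string of positive net frequency is a node and a maximal repeat (`PNF_eq`). The net
frequency can change at four nodes only: the parent of `S` can gain a pair, `x` and the parent of `w` can
lose one, and `z` can be new (`IsHead.phi_update`, `IsHead.phi_head`, `IsHead.phi_same`). What happens at
these nodes can be read off from the tree (`IsHead.losesLeft_iff`, `losesRight_iff`), and `sync` compares
the old and the new value at each of them to maintain the list of `PNF` and the two lists of changes.

*Time.* Each step of a walk leaves behind an ancestor `u` of the leaf `S`, or this leaf itself, such that
`au` is not an ancestor of the leaf `aS`. Since the removal of the first letter maps the ancestors of `au`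
other than the root to ancestors of `u` (`dep_cons_le`), the depth of the last leaf pays for these steps, and
it grows by a constant otherwise. Each copied link takes a new record of a dictionary; no record is ever
discarded, and a tree has only linearly many edges and soft Weiner links (`childE_card`, `weinerE_card`). So
the depth and the number of records serve as potentials (`update_wp`, `Reached`).

*Data structures.* The characters are numbered in the order of their first appearance. The number of a
character is found by comparisons in a deterministic skip list, that is, a 2-3-4 tree. The links of a node
are kept in two dictionaries, keyed by the numbers of the characters. They are digital search trees, whose
depth is bounded by the length of the keys. As the machine has no shift, there is a table of halves
and parities. All these searches take time `O(log σ)`.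

*Layout.* The cells `64 * i + f` form block `i`, which serves as node `i` of the suffix tree (`f < 16`), as
record `i` of the dictionaries (`16 ≤ f < 22`), as node `i` of the skip list (`24 ≤ f < 29`), and as entry
`i` of the table (`f = 32, 33`). The fields are
* `0` parent, `1`, `2` denotation, `3` net frequency, `4` suffix link;
* `5`, `13` root of the dictionary of the child edges and of the Weiner links, `6`, `14` list of its records;
* `8` successor in the list of `PNF`, `9`, `10` denotation, `11` net frequency, `12` predecessor;
* `16`, `17` children, `18` residue, `19` value, `20` next record, `21` key;
* `24` next sibling, `25` first child, `26` code of the last key, `27` number of the character, `28` height;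
* `32` half, `33` parity.

The cells of block `0` are global: `0`, `4` first and last record of the list of `PNF`, `1`, `2` lists of
changes (with records in `8, …, 23` and `40, …, 55`), `3` root, `56` length of the text, `57` leaf `S`,
`58`, `59`, `60` next unused node, record, and node of the skip list, `61` top level of the skip list, `62`
the largest number of a character. Pointers and numbers of characters are stored multiplied by `64`.

*Registers.* During an update, register `29` remains `0` and character register `9` remains blank.
Register `3` holds the number of `a`, `4` the new leaf, `6` the leaf `S`, `7` its parent, `12` the node `z`,
`13` the parent of `w`, and `14` the node `x`.
-/

set_option linter.unusedSectionVars false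

namespace NetFrequency

local infixr:60 " ;; " => Prog.seq

/-! ### Determinism and a program logic for the machine -/

section Logic

variable {A : Type u} [LinearOrder A]

theorem Exec.deterministic {B : ℕ} {P : Prog} {s s₁ : State A} {t₁ : ℕ}
    (h₁ : Exec B P s s₁ t₁) : ∀ {s₂ t₂}, Exec B P s s₂ t₂ → s₁ = s₂ ∧ t₁ = t₂ := by
  induction h₁ with
  | seq _ _ ih₁ ih₂ =>
    intro s₂ t₂ h
    cases h with
    | seq k₁ k₂ =>
      obtain ⟨rfl, rfl⟩ := ih₁ k₁
      obtain ⟨rfl, rfl⟩ := ih₂ k₂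
      exact ⟨rfl, rfl⟩
  | iteTrue hb _ ih =>
    intro s₂ t₂ h
    cases h with
    | iteTrue _ k => obtain ⟨rfl, rfl⟩ := ih k; exact ⟨rfl, rfl⟩
    | iteFalse hb' _ => exact absurd hb hb'
  | iteFalse hb _ ih =>
    intro s₂ t₂ h
    cases h with
    | iteTrue hb' _ => exact absurd hb' hb
    | iteFalse _ k => obtain ⟨rfl, rfl⟩ := ih k; exact ⟨rfl, rfl⟩
  | loopDone hb =>
    intro s₂ t₂ h
    cases h with
    | loopDone _ => exact ⟨rfl, rfl⟩
    | loopStep hb' _ _ => exact absurd hb' hb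
  | loopStep hb _ _ ih₁ ih₂ =>
    intro s₂ t₂ h
    cases h with
    | loopDone hb' => exact absurd hb hb'
    | loopStep _ k₁ k₂ =>
      obtain ⟨rfl, rfl⟩ := ih₁ k₁
      obtain ⟨rfl, rfl⟩ := ih₂ k₂
      exact ⟨rfl, rfl⟩
  | _ => intro s₂ t₂ h; cases h; exact ⟨rfl, rfl⟩

theorem OnlineAlgorithm.Run.deterministic {D : OnlineAlgorithm} {C : ℕ} {S : List A}
    {m₁ : Memory A} {T₁ : ℕ} (h₁ : D.Run C S m₁ T₁) :
    ∀ {m₂ T₂}, D.Run C S m₂ T₂ → m₁ = m₂ ∧ T₁ = T₂ := by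
  induction h₁ with
  | nil h =>
    intro m₂ T₂ k
    cases k with
    | nil k => obtain ⟨rfl, rfl⟩ := h.deterministic k; exact ⟨rfl, rfl⟩
  | cons _ h ih =>
    intro m₂ T₂ k
    cases k with
    | cons k₀ k =>
      obtain ⟨rfl, rfl⟩ := ih k₀
      obtain ⟨rfl, rfl⟩ := h.deterministic k
      exact ⟨rfl, rfl⟩

/-- Total correctness with time: `P`, started in `s` on a machine of size `B`, halts in a state
`s'` after `t` steps such that `R s' t`. -/
def WP (B : ℕ) (P : Prog) (s : State A) (R : State A → ℕ → Prop) : Prop :=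
  ∃ s' t, Exec B P s s' t ∧ R s' t

variable {B : ℕ} {s : State A} {R : State A → ℕ → Prop}

theorem WP.mono {P : Prog} {R' : State A → ℕ → Prop} (h : WP B P s R)
    (hR : ∀ s' t, R s' t → R' s' t) : WP B P s R' := by
  obtain ⟨s', t, he, hr⟩ := h
  exact ⟨s', t, he, hR _ _ hr⟩

@[simp] theorem wp_nop : WP B .nop s R ↔ R s 1 := by
  constructor
  · rintro ⟨s', t, he, hr⟩; cases he; exact hr
  · intro h; exact ⟨_, _, .nop _, h⟩

@[simp] theorem wp_const {x k : ℕ} : WP B (.const x k) s R ↔ k ≤ B ∧ R (s.setReg x k) 1 := by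
  constructor
  · rintro ⟨s', t, he, hr⟩; cases he; exact ⟨‹_›, hr⟩
  · rintro ⟨h, hr⟩; exact ⟨_, _, .const _ _ _ h, hr⟩

@[simp] theorem wp_copy {x y : ℕ} : WP B (.copy x y) s R ↔ R (s.setReg x (s.reg y)) 1 := by
  constructor
  · rintro ⟨s', t, he, hr⟩; cases he; exact hr
  · intro h; exact ⟨_, _, .copy _ _ _, h⟩

@[simp] theorem wp_add {x y z : ℕ} : WP B (.add x y z) s R ↔
    s.reg y + s.reg z ≤ B ∧ R (s.setReg x (s.reg y + s.reg z)) 1 := by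
  constructor
  · rintro ⟨s', t, he, hr⟩; cases he; exact ⟨‹_›, hr⟩
  · rintro ⟨h, hr⟩; exact ⟨_, _, .add _ _ _ _ h, hr⟩

@[simp] theorem wp_sub {x y z : ℕ} : WP B (.sub x y z) s R ↔
    R (s.setReg x (s.reg y - s.reg z)) 1 := by
  constructor
  · rintro ⟨s', t, he, hr⟩; cases he; exact hr
  · intro h; exact ⟨_, _, .sub _ _ _ _, h⟩

@[simp] theorem wp_load {x y : ℕ} : WP B (.load x y) s R ↔
    s.reg y < B ∧ R (s.setReg x (s.mem.num (s.reg y))) 1 := by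
  constructor
  · rintro ⟨s', t, he, hr⟩; cases he; exact ⟨‹_›, hr⟩
  · rintro ⟨h, hr⟩; exact ⟨_, _, .load _ _ _ h, hr⟩

@[simp] theorem wp_store {x y : ℕ} : WP B (.store x y) s R ↔
    s.reg x < B ∧ R (s.setNum (s.reg x) (s.reg y)) 1 := by
  constructor
  · rintro ⟨s', t, he, hr⟩; cases he; exact ⟨‹_›, hr⟩
  · rintro ⟨h, hr⟩; exact ⟨_, _, .store _ _ _ h, hr⟩

@[simp] theorem wp_ccopy {x y : ℕ} : WP B (.ccopy x y) s R ↔ R (s.setCreg x (s.creg y)) 1 := by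
  constructor
  · rintro ⟨s', t, he, hr⟩; cases he; exact hr
  · intro h; exact ⟨_, _, .ccopy _ _ _, h⟩

@[simp] theorem wp_cload {x y : ℕ} : WP B (.cload x y) s R ↔
    s.reg y < B ∧ R (s.setCreg x (s.mem.chr (s.reg y))) 1 := by
  constructor
  · rintro ⟨s', t, he, hr⟩; cases he; exact ⟨‹_›, hr⟩
  · rintro ⟨h, hr⟩; exact ⟨_, _, .cload _ _ _ h, hr⟩

@[simp] theorem wp_cstore {x y : ℕ} : WP B (.cstore x y) s R ↔
    s.reg x < B ∧ R (s.setChr (s.reg x) (s.creg y)) 1 := by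
  constructor
  · rintro ⟨s', t, he, hr⟩; cases he; exact ⟨‹_›, hr⟩
  · rintro ⟨h, hr⟩; exact ⟨_, _, .cstore _ _ _ h, hr⟩

@[simp] theorem wp_seq {P Q : Prog} : WP B (.seq P Q) s R ↔
    WP B P s (fun s' t => WP B Q s' (fun s'' t' => R s'' (t + t'))) := by
  constructor
  · rintro ⟨s', t, he, hr⟩
    cases he with
    | seq h₁ h₂ => exact ⟨_, _, h₁, _, _, h₂, hr⟩
  · rintro ⟨s', t, h₁, s'', t', h₂, hr⟩
    exact ⟨_, _, .seq h₁ h₂, hr⟩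

@[simp] theorem wp_ite {b : Test} {P Q : Prog} : WP B (.ite b P Q) s R ↔
    (b.Holds s → WP B P s (fun s' t => R s' (t + 1))) ∧
    (¬ b.Holds s → WP B Q s (fun s' t => R s' (t + 1))) := by
  constructor
  · rintro ⟨s', t, he, hr⟩
    cases he with
    | iteTrue h k => exact ⟨fun _ => ⟨_, _, k, hr⟩, fun h' => absurd h h'⟩
    | iteFalse h k => exact ⟨fun h' => absurd h' h, fun _ => ⟨_, _, k, hr⟩⟩
  · rintro ⟨h₁, h₂⟩
    by_cases hb : b.Holds s
    · obtain ⟨s', t, he, hr⟩ := h₁ hb; exact ⟨_, _, .iteTrue hb he, hr⟩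
    · obtain ⟨s', t, he, hr⟩ := h₂ hb; exact ⟨_, _, .iteFalse hb he, hr⟩

/-- Unfolding of a loop by one iteration; the induction on the number of iterations is left to the caller. -/
theorem wp_loop {b : Test} {P : Prog} : WP B (.loop b P) s R ↔
    (b.Holds s → WP B P s (fun s' t => WP B (.loop b P) s' (fun s'' t' => R s'' (t + t' + 1)))) ∧
    (¬ b.Holds s → R s 1) := by
  constructor
  · rintro ⟨s', t, he, hr⟩
    cases he with
    | loopDone h => exact ⟨fun h' => absurd h' h, fun _ => hr⟩
    | loopStep h h₁ h₂ => exact ⟨fun _ => ⟨_, _, h₁, _, _, h₂, hr⟩, fun h' => absurd h h'⟩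
  · rintro ⟨h₁, h₂⟩
    by_cases hb : b.Holds s
    · obtain ⟨s', t, h₁, s'', t', h₂, hr⟩ := h₁ hb
      exact ⟨_, _, .loopStep hb h₁ h₂, hr⟩
    · exact ⟨_, _, .loopDone hb, h₂ hb⟩

@[simp] theorem Test.holds_eq {x y : ℕ} : (Test.eq x y).Holds s ↔ s.reg x = s.reg y := Iff.rfl
@[simp] theorem Test.holds_lt {x y : ℕ} : (Test.lt x y).Holds s ↔ s.reg x < s.reg y := Iff.rfl
@[simp] theorem Test.holds_neg {b : Test} : (Test.neg b).Holds s ↔ ¬ b.Holds s := Iff.rfl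
@[simp] theorem Test.holds_clt {x y : ℕ} : (Test.clt x y).Holds s ↔
  ∃ a b : A, s.creg x = some a ∧ s.creg y = some b ∧ a < b := Iff.rfl

end Logic

section StateLemmas

variable {A : Type u} (s : State A)

@[simp] theorem State.setReg_reg (x v y : ℕ) :
    (s.setReg x v).reg y = if y = x then v else s.reg y := by
  simp [State.setReg, Function.update_apply]
@[simp] theorem State.setReg_mem (x v : ℕ) : (s.setReg x v).mem = s.mem := rfl
@[simp] theorem State.setReg_creg (x v : ℕ) : (s.setReg x v).creg = s.creg := rfl
@[simp] theorem State.setCreg_creg (x : ℕ) (c : Option A) (y : ℕ) :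
    (s.setCreg x c).creg y = if y = x then c else s.creg y := by
  simp [State.setCreg, Function.update_apply]
@[simp] theorem State.setCreg_mem (x : ℕ) (c : Option A) : (s.setCreg x c).mem = s.mem := rfl
@[simp] theorem State.setCreg_reg (x : ℕ) (c : Option A) : (s.setCreg x c).reg = s.reg := rfl
@[simp] theorem State.setNum_reg (i v : ℕ) : (s.setNum i v).reg = s.reg := rfl
@[simp] theorem State.setNum_creg (i v : ℕ) : (s.setNum i v).creg = s.creg := rfl
@[simp] theorem State.setNum_num (i v : ℕ) :
    (s.setNum i v).mem.num = Function.update s.mem.num i v := rfl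
@[simp] theorem State.setNum_chr (i v : ℕ) : (s.setNum i v).mem.chr = s.mem.chr := rfl
@[simp] theorem State.setChr_reg (i : ℕ) (c : Option A) : (s.setChr i c).reg = s.reg := rfl
@[simp] theorem State.setChr_creg (i : ℕ) (c : Option A) : (s.setChr i c).creg = s.creg := rfl
@[simp] theorem State.setChr_num (i : ℕ) (c : Option A) :
    (s.setChr i c).mem.num = s.mem.num := rfl
@[simp] theorem State.setChr_chr (i : ℕ) (c : Option A) :
    (s.setChr i c).mem.chr = Function.update s.mem.chr i c := rfl

end StateLemmas

theorem upd_ne {f : ℕ → ℕ} {i v c : ℕ} (h : c ≠ i) : Function.update f i v c = f c :=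
  Function.update_of_ne h _ _

theorem upd_self {f : ℕ → ℕ} {i v : ℕ} : Function.update f i v i = v := Function.update_self ..

/-! ### Macros for field access

Register `99` is the scratch register of all macros. -/

/-- `x := ` field `f` of the block at the address in register `q`. -/
def ldf (x q f : ℕ) : Prog := .const 99 f ;; .add 99 q 99 ;; .load x 99
/-- Field `f` of the block at the address in register `q` `:= y`. -/
def stf (q f y : ℕ) : Prog := .const 99 f ;; .add 99 q 99 ;; .store 99 y
/-- `x := ` cell `k`. -/
def lds (x k : ℕ) : Prog := .const 99 k ;; .load x 99
/-- Cell `k` `:= y`. -/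
def sts (k y : ℕ) : Prog := .const 99 k ;; .store 99 y
/-- `x := y + k` for a numeral `k`. -/
def addk (x y k : ℕ) : Prog := .const 99 k ;; .add x y 99

section Macros

variable {A : Type u} [LinearOrder A] {B : ℕ} {s : State A} {R : State A → ℕ → Prop}

omit [LinearOrder A] in
theorem State.setReg_setReg (s : State A) (x v w : ℕ) :
    (s.setReg x v).setReg x w = s.setReg x w := by
  simp [State.setReg]

@[simp] theorem wp_ldf {x q f : ℕ} (hq : q ≠ 99) : WP B (ldf x q f) s R ↔
    s.reg q + f < B ∧ R ((s.setReg 99 (s.reg q + f)).setReg x (s.mem.num (s.reg q + f))) 3 := by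
  have : s.reg q + f < B → f ≤ B ∧ s.reg q + f ≤ B := by omega
  simp only [ldf, wp_seq, wp_const, wp_add, wp_load, State.setReg_reg, State.setReg_mem, hq,
    State.setReg_setReg, if_true, if_false]
  tauto

@[simp] theorem wp_stf {y q f : ℕ} (hq : q ≠ 99) (hy : y ≠ 99) : WP B (stf q f y) s R ↔
    s.reg q + f < B ∧ R ((s.setReg 99 (s.reg q + f)).setNum (s.reg q + f) (s.reg y)) 3 := by
  have : s.reg q + f < B → f ≤ B ∧ s.reg q + f ≤ B := by omega
  simp only [stf, wp_seq, wp_const, wp_add, wp_store, State.setReg_reg, hq, hy,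
    State.setReg_setReg, if_true, if_false]
  tauto

@[simp] theorem wp_lds {x k : ℕ} : WP B (lds x k) s R ↔
    k < B ∧ R ((s.setReg 99 k).setReg x (s.mem.num k)) 2 := by
  have : k < B → k ≤ B := by omega
  simp only [lds, wp_seq, wp_const, wp_load, State.setReg_reg, State.setReg_mem, if_true]
  tauto

@[simp] theorem wp_sts {y k : ℕ} (hy : y ≠ 99) : WP B (sts k y) s R ↔
    k < B ∧ R ((s.setReg 99 k).setNum k (s.reg y)) 2 := by
  have : k < B → k ≤ B := by omega
  simp only [sts, wp_seq, wp_const, wp_store, State.setReg_reg, if_true, hy,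
    if_false]
  tauto

@[simp] theorem wp_addk {x y k : ℕ} (hy : y ≠ 99) : WP B (addk x y k) s R ↔
    s.reg y + k ≤ B ∧ R ((s.setReg 99 k).setReg x (s.reg y + k)) 2 := by
  have : s.reg y + k ≤ B → k ≤ B := by omega
  simp only [addk, wp_seq, wp_const, wp_add, State.setReg_reg, if_true, hy, if_false]
  tauto

end Macros

/-! ### Dictionaries as digital search trees -/

/-- `DT M q g`: the cell `q` of `M` holds the root pointer of a digital search tree (least
significant bit first) for the finite map `g` from keys to indices of records, `0` standing for an
absent key. A record stores the residue of its key, that is, the key without the bits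
spent on the path from the root, as a pointer `64 * k`. -/
inductive DT (M : ℕ → ℕ) : ℕ → (ℕ → ℕ) → Prop
  | nil {q g} : M q = 0 → (∀ j, g j = 0) → DT M q g
  | node {q g p k} : M q = 64 * p → p ≠ 0 → M (64 * p + 18) = 64 * k → g k = p →
      DT M (64 * p + 16) (fun j => if g (2 * j) = p then 0 else g (2 * j)) →
      DT M (64 * p + 17) (fun j => if g (2 * j + 1) = p then 0 else g (2 * j + 1)) → DT M q g

/-- Injectivity of a partial map with `0` for undefined. -/
def PInj (g : ℕ → ℕ) : Prop := ∀ i j, g i = g j → g i ≠ 0 → i = j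

theorem PInj.bit {g : ℕ → ℕ} (h : PInj g) (p b : ℕ) :
    PInj (fun j => if g (2 * j + b) = p then 0 else g (2 * j + b)) := by
  intro i j hij h0
  dsimp only at hij h0
  rw [if_neg (fun e => h0 (if_pos e))] at hij h0
  rw [if_neg (fun e => h0 (by rw [hij, if_pos e]))] at hij
  have := h _ _ hij h0; omega

theorem DT.frame {M M' : ℕ → ℕ} {q : ℕ} {g : ℕ → ℕ} (h : DT M q g) (hq : M' q = M q)
    (hM : ∀ j, g j ≠ 0 → ∀ f, 16 ≤ f → f ≤ 18 → M' (64 * g j + f) = M (64 * g j + f)) :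
    DT M' q g := by
  induction h with
  | nil h0 hg => exact .nil (hq.trans h0) hg
  | @node q g p k h0 hp hk hg _ _ ih1 ih2 =>
    have hp' : g k ≠ 0 := by rw [hg]; exact hp
    refine .node (hq.trans h0) hp ?_ hg (ih1 ?_ ?_) (ih2 ?_ ?_)
    · rw [← hk, ← hg]; exact hM k hp' 18 (by omega) (by omega)
    · rw [← hg]; exact hM k hp' 16 (by omega) (by omega)
    · grind
    · rw [← hg]; exact hM k hp' 17 (by omega) (by omega)
    · grind

/-- `q` is a pointer cell of a record of `g`. -/
def IsPtrCell (g : ℕ → ℕ) (q : ℕ) : Prop :=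
  ∃ j, g j ≠ 0 ∧ (q = 64 * g j + 16 ∨ q = 64 * g j + 17)

/-- `Slot M q₀ g j q b`: in the tree of `g` with root cell `q₀`, a new record for the key `j` is
to be attached to the empty cell `q`, with residue `b`. -/
def Slot (M : ℕ → ℕ) (q₀ : ℕ) (g : ℕ → ℕ) (j q b : ℕ) : Prop :=
  M q = 0 ∧ (q = q₀ ∨ IsPtrCell g q) ∧
  ∀ (M' : ℕ → ℕ) (p : ℕ), p ≠ 0 → (∀ i, g i ≠ p) → M' q = 64 * p →
    M' (64 * p + 18) = 64 * b → M' (64 * p + 16) = 0 → M' (64 * p + 17) = 0 →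
    (∀ i, g i ≠ 0 → ∀ f, 16 ≤ f → f ≤ 18 → 64 * g i + f ≠ q →
      M' (64 * g i + f) = M (64 * g i + f)) →
    (q₀ ≠ q → M' q₀ = M q₀) → DT M' q₀ (Function.update g j p)

theorem Slot.root {M : ℕ → ℕ} {q : ℕ} {g : ℕ → ℕ} (j : ℕ) (h0 : M q = 0) (hg : ∀ j, g j = 0) :
    Slot M q g j q j := by
  refine ⟨h0, .inl rfl, fun M' p hp _ hq h18 h16 h17 _ _ => ?_⟩
  refine .node hq hp h18 (by simp) (.nil h16 fun i => ?_) (.nil h17 fun i => ?_)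
  all_goals
    simp only [Function.update_apply, hg]
    split_ifs <;> simp_all

/-- A place for a new record in a subtree is a place in the whole tree: the hypotheses describe one step down
from the record `p` along the lowest bit `β` of the key, with `β'` the other bit. -/
theorem Slot.bit {M : ℕ → ℕ} {q₀ q : ℕ} {g : ℕ → ℕ} {p k j b β β' : ℕ} (hinj : PInj g)
    (hq₀ : ¬ IsPtrCell g q₀) (hβ : β < 2) (hβ' : β' = 1 - β)
    (h0 : M q₀ = 64 * p) (hp : p ≠ 0) (hk : M (64 * p + 18) = 64 * k)
    (hg : g k = p)
    (h2 : DT M (64 * p + 16 + β') (fun j => if g (2 * j + β') = p then 0 else g (2 * j + β')))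
    (hj : g (2 * j + β) = 0)
    (h : Slot M (64 * p + 16 + β) (fun j => if g (2 * j + β) = p then 0 else g (2 * j + β)) j q b) :
    Slot M q₀ g (2 * j + β) q b := by
  obtain ⟨hq, hc, H⟩ := h
  have hgk : g k ≠ 0 := by rw [hg]; exact hp
  have hcell : IsPtrCell g q ∧ q ≠ 64 * p + 16 + β' := by
    rcases hc with rfl | ⟨i, hi, hc⟩
    · refine ⟨⟨k, hgk, by rw [hg]; omega⟩, by omega⟩
    · dsimp only at hi hc
      split_ifs at hi hc with hh
      · exact absurd rfl hi
      · exact ⟨⟨_, hi, hc⟩, by omega⟩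
  have hne : q₀ ≠ q := fun e => hq₀ (e ▸ hcell.1)
  refine ⟨hq, .inr hcell.1, fun M' r hr hfresh hq' h18 h16 h17 hM hM0 => ?_⟩
  have hrp : r ≠ p := fun e => hfresh k (by rw [hg, e])
  have hkj : k ≠ 2 * j + β := fun e => hgk (e ▸ hj)
  have e1 : DT M' (64 * p + 16 + β)
      (fun i => if Function.update g (2 * j + β) r (2 * i + β) = p then 0 else
        Function.update g (2 * j + β) r (2 * i + β)) := by
    have := H M' r hr ?_ hq' h18 h16 h17 ?_ ?_
    · convert this using 1
      funext i
      by_cases hi : i = j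
      · subst hi; simp [hrp]
      · simp [hi]
    · grind
    · grind
    · intro hne'
      have := hM k hgk (16 + β) (by omega) (by omega)
      rw [hg, ← add_assoc] at this
      exact this (by omega)
  have e2 : DT M' (64 * p + 16 + β')
      (fun i => if Function.update g (2 * j + β) r (2 * i + β') = p then 0 else
        Function.update g (2 * j + β) r (2 * i + β')) := by
    have : (fun i => if Function.update g (2 * j + β) r (2 * i + β') = p then 0 else
        Function.update g (2 * j + β) r (2 * i + β')) =
        (fun i => if g (2 * i + β') = p then 0 else g (2 * i + β')) := by
      funext i
      have : 2 * i + β' ≠ 2 * j + β := by omega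
      simp [this]
    rw [this]
    refine h2.frame ?_ ?_
    · have := hM k hgk (16 + β') (by omega) (by omega)
      rw [hg, ← add_assoc] at this
      exact this (by omega)
    · intro i hi f hf hf'
      split_ifs at hi ⊢ with hh
      · exact absurd rfl hi
      · refine hM _ hi f hf hf' ?_
        intro e
        rcases hc with rfl | ⟨i', hi', hc'⟩
        · omega
        · dsimp only at hi' hc'
          split_ifs at hi' hc' with hh'
          · exact absurd rfl hi'
          · have : g (2 * i + β') = g (2 * i' + β) := by omega
            have := hinj _ _ this hi
            omega
  have hup : Function.update g (2 * j + β) r k = p := by simp [hkj, hg]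
  have h0' : M' q₀ = 64 * p := (hM0 hne).trans h0
  have hk' : M' (64 * p + 18) = 64 * k := by
    rw [← hk, ← hg]
    refine hM k hgk 18 (by omega) (by omega) ?_
    obtain ⟨i, hi, hc⟩ := hcell.1
    omega
  interval_cases β
  · subst hβ'; exact .node h0' hp hk' hup e1 e2
  · subst hβ'; exact .node h0' hp hk' hup e2 e1

/-- The loop test of `findSlot`: register `32` becomes the record at the cell in register `30`, and
register `33` becomes `1` if there is a record and its residue is not the one in register `31`. -/
def slotTest : Prog :=
  .load 32 30 ;; .const 33 0 ;; .const 34 0 ;;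
  .ite (.eq 32 34) .nop (ldf 34 32 18 ;; .ite (.eq 34 31) .nop (.const 33 1))

/-- One step down a digital search tree. -/
def slotStep : Prog :=
  ldf 34 31 33 ;; .add 30 32 34 ;; addk 30 30 16 ;; ldf 31 31 32

/-- Search for the key in register `31` in the digital search tree with root cell in register `30`.
Afterwards register `32` holds the record, or `0`, and register `30` the cell that points
to it. -/
def findSlot : Prog :=
  slotTest ;; .const 34 0 ;; .loop (.neg (.eq 33 34)) (slotStep ;; slotTest ;; .const 34 0)

/-- The table of the bits of the key indices `≤ N`. -/
def BitTable (M : ℕ → ℕ) (N : ℕ) : Prop :=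
  ∀ j ≤ N, M (64 * j + 32) = 64 * (j / 2) ∧ M (64 * j + 33) = j % 2

/-- The states agree outside the registers `30, …, 34, 99`. -/
def Keeps {A : Type u} (s s' : State A) : Prop :=
  s'.mem = s.mem ∧ s'.creg = s.creg ∧ ∀ r, (r < 30 ∨ 35 ≤ r) → r ≠ 99 → s'.reg r = s.reg r

section Find

variable {A : Type u} [LinearOrder A] {B N J : ℕ}
  {s : State A}

theorem slotTest_wp {q j p b : ℕ} (h30 : s.reg 30 = q) (h31 : s.reg 31 = 64 * j) (hq : q < B)
    (hp : s.mem.num q = 64 * p) (hpB : 64 * p + 18 < B)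
    (hb : p ≠ 0 → s.mem.num (64 * p + 18) = 64 * b) {R : State A → ℕ → Prop}
    (hR : ∀ s' t, Keeps s s' → s'.reg 30 = q → s'.reg 31 = 64 * j → s'.reg 32 = 64 * p →
      (s'.reg 33 = if p ≠ 0 ∧ b ≠ j then 1 else 0) → s'.reg 34 = 0 → t ≤ 11 → R s' t) :
    WP B (slotTest ;; .const 34 0) s R := by
  have hB : 1 ≤ B := by omega
  have key : ∀ r, (r < 30 ∨ 35 ≤ r) → r ≠ 99 → r ≠ 30 ∧ r ≠ 31 ∧ r ≠ 32 ∧ r ≠ 33 ∧ r ≠ 34 := by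
    omega
  simp [slotTest, h30, h31, hq, hp, hpB, hB]
  refine ⟨fun h0 => ?_, fun h0 => ⟨fun h => ?_, fun h => ?_⟩⟩
  · refine hR _ _ ⟨by simp, by simp, fun r hr h99 => ?_⟩ (by simp [h30]) (by simp [h31])
      (by simp [h0]) (by simp [h0]) (by simp) (by omega)
    obtain ⟨h1, h2, h3, h4, h5⟩ := key r hr h99
    simp [h3, h4, h5]
  · rw [hb h0] at h
    refine hR _ _ ⟨by simp, by simp, fun r hr h99 => ?_⟩ (by simp [h30]) (by simp [h31])
      (by simp) (by simp; omega) (by simp) (by omega)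
    obtain ⟨h1, h2, h3, h4, h5⟩ := key r hr h99
    simp [h3, h4, h5, h99]
  · rw [hb h0] at h
    refine hR _ _ ⟨by simp, by simp, fun r hr h99 => ?_⟩ (by simp [h30]) (by simp [h31])
      (by simp) (by simp; omega) (by simp) (by omega)
    obtain ⟨h1, h2, h3, h4, h5⟩ := key r hr h99
    simp [h3, h4, h5, h99]

omit [LinearOrder A] in
theorem Keeps.trans {s' s'' : State A} (h : Keeps s s') (h' : Keeps s' s'') : Keeps s s'' :=
  ⟨h'.1.trans h.1, h'.2.1.trans h.2.1, fun r hr h9 => (h'.2.2 r hr h9).trans (h.2.2 r hr h9)⟩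

theorem findSlot_eq {R : State A → ℕ → Prop} : WP B findSlot s R ↔
    WP B (slotTest ;; .const 34 0) s (fun s' t =>
      WP B (.loop (.neg (.eq 33 34)) (slotStep ;; slotTest ;; .const 34 0)) s'
        (fun s'' t' => R s'' (t + t'))) := by
  simp [findSlot, add_assoc]

/-- The search passes at most one record per bit of a key of the dictionary, since all keys in the tree reached
after a step are halved. -/
theorem findSlot_wp {M : ℕ → ℕ} {q₀ : ℕ} {g : ℕ → ℕ} (hB : 64 * N ≤ B) (hbits : BitTable M J) (hJ : J < N)
    (hD : DT M q₀ g) : ∀ {s : State A} {j k : ℕ}, s.mem.num = M → s.reg 30 = q₀ →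
    s.reg 31 = 64 * j → j ≤ J → q₀ < B → (∀ i, g i < N) → PInj g → ¬ IsPtrCell g q₀ →
    (∀ i, g i ≠ 0 → 1 ≤ k ∧ i < 2 ^ (k - 1)) → ∀ {R : State A → ℕ → Prop},
    (∀ s' t b, Keeps s s' → s'.reg 32 = 64 * g j → (g j = 0 → Slot M q₀ g j (s'.reg 30) b) →
      s'.reg 31 = 64 * b → s'.reg 30 < B → t ≤ 30 * k + 12 → R s' t) → WP B findSlot s R := by
  induction hD with
  | @nil q g h0 hg =>
    intro s j k hM h30 h31 hj hq hgN hinj hptr hk R hR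
    rw [findSlot_eq]
    refine slotTest_wp (p := 0) (b := 0) h30 h31 hq (by rw [hM, h0]) (by omega) (by simp)
      (fun s' t hkeep e30 e31 e32 e33 e34 ht => ?_)
    rw [wp_loop]
    refine ⟨fun h => absurd h (by simp [e33, e34]), fun _ => ?_⟩
    refine hR _ _ j hkeep (by rw [e32, hg]) (fun _ => ?_) e31 (by omega) (by omega)
    rw [e30]
    exact Slot.root j h0 hg
  | @node q g p i h0 hp hi hg h1 h2 ih1 ih2 =>
    intro s j k hM h30 h31 hj hq hgN hinj hptr hk R hR
    have hpN : p < N := hg ▸ hgN i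
    rw [findSlot_eq]
    refine slotTest_wp (p := p) (b := i) h30 h31 hq (by rw [hM, h0]) (by omega)
      (fun _ => by rw [hM, hi]) (fun s' t hkeep e30 e31 e32 e33 e34 ht => ?_)
    rw [wp_loop]
    by_cases hij : i = j
    · subst hij
      refine ⟨fun h => absurd h (by simp [e33, e34]), fun _ => ?_⟩
      refine hR _ _ i hkeep (by rw [e32, hg]) (fun e => absurd (hg.symm.trans e) hp) e31
        (by omega) (by omega)
    · refine ⟨fun _ => ?_, fun h => absurd h (by simp [e33, e34, hij, hp])⟩
      have hgi : g i ≠ 0 := by rwa [hg]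
      obtain ⟨hk1, hik⟩ := hk i hgi
      obtain ⟨hj1, hj2⟩ := hbits j hj
      have hM' : s'.mem.num = M := by rw [hkeep.1, hM]
      have hBj : 64 * j + 33 < B := by omega
      have hBj' : 64 * j + 32 < B := by omega
      have hBp : 64 * p + 17 < B := by omega
      have hmod : j % 2 < 2 := Nat.mod_lt _ (by omega)
      have hB1 : 64 * p + j % 2 ≤ B := by omega
      have hB2 : 64 * p + j % 2 + 16 ≤ B := by omega
      have hgj : ∀ b, j % 2 = b → (if g (2 * (j / 2) + b) = p then 0 else g (2 * (j / 2) + b)) =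
          g j := by
        rintro b rfl
        rw [Nat.div_add_mod, if_neg]
        intro e
        exact hij (hinj _ _ (hg.trans e.symm) hgi)
      -- the continuation after one step down is the search in the subtree
      have main : ∀ b, j % 2 = b → DT M (64 * p + 16 + (1 - b))
          (fun j => if g (2 * j + (1 - b)) = p then 0 else g (2 * j + (1 - b))) →
          (∀ {s : State A} {j k : ℕ}, s.mem.num = M → s.reg 30 = 64 * p + 16 + b →
            s.reg 31 = 64 * j → j ≤ J → 64 * p + 16 + b < B →
            (∀ i, (if g (2 * i + b) = p then 0 else g (2 * i + b)) < N) →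
            PInj (fun i => if g (2 * i + b) = p then 0 else g (2 * i + b)) →
            ¬ IsPtrCell (fun i => if g (2 * i + b) = p then 0 else g (2 * i + b))
              (64 * p + 16 + b) →
            (∀ i, (if g (2 * i + b) = p then 0 else g (2 * i + b)) ≠ 0 →
              1 ≤ k ∧ i < 2 ^ (k - 1)) → ∀ {R : State A → ℕ → Prop},
            (∀ s' t b', Keeps s s' →
              s'.reg 32 = 64 * (if g (2 * j + b) = p then 0 else g (2 * j + b)) →
              ((if g (2 * j + b) = p then 0 else g (2 * j + b)) = 0 →
                Slot M (64 * p + 16 + b) (fun i => if g (2 * i + b) = p then 0 else g (2 * i + b))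
                  j (s'.reg 30) b') →
              s'.reg 31 = 64 * b' → s'.reg 30 < B → t ≤ 30 * k + 12 → R s' t) →
            WP B findSlot s R) →
          WP B (slotStep ;; slotTest ;; .const 34 0) s' (fun s'_1 t_1 =>
            WP B (.loop (.neg (.eq 33 34)) (slotStep ;; slotTest ;; .const 34 0)) s'_1
              (fun s'' t' => R s'' (t + (t_1 + t' + 1)))) := by
        rintro b rfl hD2 ih
        rw [wp_seq]
        simp only [slotStep, wp_seq (P := ldf _ _ _), wp_seq (P := addk _ _ _),
          wp_seq (P := Prog.add _ _ _), wp_ldf, wp_addk, wp_add, State.setReg_reg,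
          State.setReg_mem, hM', e31, e32, hj1, hj2, hBj, hBj', ne_eq, Nat.reduceEqDiff,
          not_false_eq_true, if_true, if_false, true_and, hB1, hB2]
        have := @ih (((((((s'.setReg 99 (64 * j + 33)).setReg 34 (j % 2)).setReg 30
          (64 * p + j % 2)).setReg 99 16).setReg 30 (64 * p + j % 2 + 16)).setReg 99
          (64 * j + 32)).setReg 31 (64 * (j / 2))) (j / 2) (k - 1) hM' (by simp; omega) (by simp)
          (by omega) (by omega) (fun i => by split_ifs <;> [omega; exact hgN _]) (hinj.bit _ _)
          ?_ ?_ (fun s'' t' => R s'' (t + (9 + 1 + t'))) ?_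
        · rw [findSlot_eq] at this
          refine this.mono fun s₁ t₁ h => h.mono fun s₂ t₂ h => ?_
          convert h using 1
          ring
        · rintro ⟨i', hi', hc⟩
          by_cases e : g (2 * i' + j % 2) = p
          · simp [e] at hi'
          · grind
        · intro i' hi'
          rw [ne_eq, ite_eq_left_iff, not_forall] at hi'
          obtain ⟨hne, hi'⟩ := hi'
          obtain ⟨-, hi2⟩ := hk _ hi'
          rcases Nat.lt_or_ge 1 k with hk2 | hk2
          · refine ⟨by omega, ?_⟩
            obtain ⟨k, rfl⟩ := Nat.exists_eq_add_of_le hk2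
            have e1 : 1 + 1 + k - 1 = k + 1 := by omega
            have e2 : 1 + 1 + k - 1 - 1 = k := by omega
            rw [e1, pow_succ] at hi2
            rw [e2]; omega
          · grind
        · intro s₂ t₂ b' hk2 e1 e2 e3 e4 ht2
          refine hR _ _ b' (hkeep.trans ⟨by simp [hk2.1], by simp [hk2.2.1], fun r hr h9 => ?_⟩)
            (by rw [e1, hgj _ rfl]) (fun hj0 => ?_) e3 e4 (by omega)
          · rw [hk2.2.2 r hr h9]
            have : r ≠ 30 ∧ r ≠ 31 ∧ r ≠ 34 := by omega
            simp [this, h9]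
          · have hs := e2 (by rw [hgj _ rfl, hj0])
            have := Slot.bit hinj hptr hmod rfl h0 hp hi hg hD2
              (by rw [Nat.div_add_mod, hj0]) hs
            rwa [Nat.div_add_mod] at this
      rcases Nat.mod_two_eq_zero_or_one j with hb | hb
      · exact main 0 hb h2 ih1
      · exact main 1 hb h1 ih2
end Find

/-! ### The store of all dictionaries -/

/-- The root cells of the dictionaries: each block has two of them. The cell after the root cell
is the head of the list of the records of the dictionary. -/
abbrev IsDict (d : ℕ) : Prop := 64 ≤ d ∧ (d % 64 = 5 ∨ d % 64 = 13)

/-- The cells that belong to the dictionaries. -/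
abbrev DictCell (c : ℕ) : Prop :=
  c = 59 ∨ (64 ≤ c ∧ (c % 64 = 5 ∨ c % 64 = 6 ∨ c % 64 = 13 ∨ c % 64 = 14 ∨
    (16 ≤ c % 64 ∧ c % 64 ≤ 21)))

/-- A linked list with head cell `q` of the records of the keys in a list. -/
def RecChain (M : ℕ → ℕ) (g : ℕ → ℕ) : ℕ → List ℕ → Prop
  | q, [] => M q = 0
  | q, j :: l => M q = 64 * g j ∧ RecChain M g (64 * g j + 20) l

theorem RecChain.frame {M M' : ℕ → ℕ} {g g' : ℕ → ℕ} : ∀ {l : List ℕ} {q : ℕ},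
    RecChain M g q l → M' q = M q → (∀ j ∈ l, g' j = g j) →
    (∀ j ∈ l, M' (64 * g j + 20) = M (64 * g j + 20)) → RecChain M' g' q l
  | [], _, h, hq, _, _ => hq.trans h
  | j :: l, q, h, hq, hg, hM => by
    refine ⟨by rw [hq, h.1, hg j (by simp)], ?_⟩
    rw [hg j (by simp)]
    exact h.2.frame (hM j (by simp)) (fun i hi => hg i (by simp [hi]))
      (fun i hi => hM i (by simp [hi]))

/-- The memory `M` holds the dictionaries `D d`, for the root cells `d`; the value `0` stands for an
absent key. The record of the key `j` of `D d` is `rec d j`, the list of the keys of `D d` is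
`ls d`, the set of all entries is `Y`, and `r` is the first unused record. -/
structure DictRep (M : ℕ → ℕ) (D : ℕ → ℕ → ℕ) (r : ℕ) (rec : ℕ → ℕ → ℕ) (ls : ℕ → List ℕ)
    (Y : Finset (ℕ × ℕ)) : Prop where
  dt : ∀ d, IsDict d → DT M d (rec d)
  dom : ∀ d j, rec d j ≠ 0 ↔ D d j ≠ 0
  isDict : ∀ d j, D d j ≠ 0 → IsDict d
  inj : ∀ d j d' j', rec d j = rec d' j' → rec d j ≠ 0 → d = d' ∧ j = j'
  lt : ∀ d j, rec d j < r
  val : ∀ d j, D d j ≠ 0 → M (64 * rec d j + 19) = D d j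
  key : ∀ d j, D d j ≠ 0 → M (64 * rec d j + 21) = 64 * j
  chain : ∀ d, IsDict d → RecChain M (rec d) (d + 1) (ls d)
  mem : ∀ d j, j ∈ ls d ↔ D d j ≠ 0
  nodup : ∀ d, (ls d).Nodup
  free : M 59 = 64 * r
  memY : ∀ d j, (d, j) ∈ Y ↔ D d j ≠ 0
  card : r = 1 + Y.card

/-- The memory `M` holds the dictionaries `D`, in the records with index `< r`. -/
def DictStore (M : ℕ → ℕ) (D : ℕ → ℕ → ℕ) (r : ℕ) : Prop :=
  ∃ rec ls Y, DictRep M D r rec ls Y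

/-- `D` with the value `v` for the key `j` of the dictionary `d`. -/
def dupd (D : ℕ → ℕ → ℕ) (d j v : ℕ) : ℕ → ℕ → ℕ :=
  fun d' j' => if d' = d ∧ j' = j then v else D d' j'

theorem DictStore.frame {M M' : ℕ → ℕ} {D : ℕ → ℕ → ℕ} {r : ℕ} (h : DictStore M D r)
    (hM : ∀ c, DictCell c → M' c = M c) : DictStore M' D r := by
  obtain ⟨rec, ls, Y, h⟩ := h
  have hb : ∀ {g : ℕ}, g ≠ 0 → ∀ f, 16 ≤ f → f ≤ 21 → M' (64 * g + f) = M (64 * g + f) :=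
    fun {g} hg f h1 h2 => hM _ (by omega)
  refine ⟨rec, ls, Y, ?_, h.dom, h.isDict, h.inj, h.lt, ?_, ?_, ?_, h.mem, h.nodup, ?_, h.memY,
    h.card⟩
  · intro d hd
    refine (h.dt d hd).frame (hM _ ?_) (fun j hj f h1 h2 => hb hj f h1 (by omega))
    omega
  · intro d j hj
    rw [hb ((h.dom d j).2 hj) 19 (by omega) (by omega), h.val d j hj]
  · intro d j hj
    rw [hb ((h.dom d j).2 hj) 21 (by omega) (by omega), h.key d j hj]
  · intro d hd
    refine (h.chain d hd).frame (hM _ ?_) (fun _ _ => rfl) (fun j hj => ?_)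
    · omega
    · exact hb ((h.dom d j).2 ((h.mem d j).1 hj)) 20 (by omega) (by omega)
  · rw [hM 59 (by omega), h.free]

theorem DictStore.one_le {M : ℕ → ℕ} {D : ℕ → ℕ → ℕ} {r : ℕ} (h : DictStore M D r) : 1 ≤ r := by
  obtain ⟨rec, ls, Y, h⟩ := h
  have := h.card; omega

theorem DictStore.le_card {M : ℕ → ℕ} {D : ℕ → ℕ → ℕ} {r : ℕ} (h : DictStore M D r)
    {Z : Finset (ℕ × ℕ)} (hZ : ∀ d j, D d j ≠ 0 → (d, j) ∈ Z) : r ≤ 1 + Z.card := by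
  obtain ⟨rec, ls, Y, h⟩ := h
  have : Y ⊆ Z := fun ⟨d, j⟩ hp => hZ d j ((h.memY d j).1 hp)
  have := Finset.card_le_card this
  have := h.card; omega

theorem DictStore.lt_card {M : ℕ → ℕ} {D : ℕ → ℕ → ℕ} {r : ℕ} (h : DictStore M D r)
    {Z : Finset (ℕ × ℕ)} (hZ : ∀ d j, D d j ≠ 0 → (d, j) ∈ Z) {d j : ℕ} (hd : (d, j) ∈ Z)
    (h0 : D d j = 0) : r < 1 + Z.card := by
  obtain ⟨rec, ls, Y, h⟩ := h
  have : Y ⊂ Z := by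
    refine ⟨fun ⟨d, j⟩ hp => hZ d j ((h.memY d j).1 hp), fun hs => ?_⟩
    exact (h.memY d j).1 (hs hd) h0
  have := Finset.card_lt_card this
  have := h.card; omega

theorem DictStore.congr {M : ℕ → ℕ} {D D' : ℕ → ℕ → ℕ} {r : ℕ} (h : DictStore M D r)
    (e : ∀ d j, D' d j = D d j) : DictStore M D' r := by
  have : D' = D := by grind
  rwa [this]

/-- The change of a value in a record. -/
theorem DictRep.setVal {M M' : ℕ → ℕ} {D : ℕ → ℕ → ℕ} {r : ℕ} {rec : ℕ → ℕ → ℕ}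
    {ls : ℕ → List ℕ} {Y : Finset (ℕ × ℕ)} (h : DictRep M D r rec ls Y) {d j v : ℕ}
    (hj : D d j ≠ 0) (hv : v ≠ 0) (hM' : M' = Function.update M (64 * rec d j + 19) v) :
    DictRep M' (dupd D d j v) r rec ls Y := by
  have hr : rec d j ≠ 0 := (h.dom d j).2 hj
  have hne : ∀ c, c ≠ 64 * rec d j + 19 → M' c = M c := fun c hc => by
    simp_all
  have hD : ∀ d' j', dupd D d j v d' j' ≠ 0 ↔ D d' j' ≠ 0 := by
    intro d' j'
    unfold dupd
    split_ifs with hh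
    · grind
    · rfl
  refine ⟨?_, fun d' j' => (h.dom d' j').trans (hD _ _).symm,
    fun d' j' hh => h.isDict d' j' ((hD _ _).1 hh), h.inj, h.lt, ?_, ?_, ?_,
    fun d' j' => (h.mem d' j').trans (hD _ _).symm, h.nodup, ?_,
    fun d' j' => (h.memY d' j').trans (hD _ _).symm, h.card⟩
  · intro d' hd'
    refine (h.dt d' hd').frame (hne _ ?_) (fun j hj f h1 h2 => hne _ (by omega))
    omega
  · intro d' j' hh
    rw [hD] at hh
    by_cases e : d' = d ∧ j' = j
    · obtain ⟨rfl, rfl⟩ := e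
      simp [hM', dupd]
    · rw [hne, h.val _ _ hh]
      · simp [dupd, e]
      · intro e'
        exact e (h.inj _ _ _ _ (by omega) ((h.dom _ _).2 hh))
  · intro d' j' hh
    rw [hne _ (by omega), h.key _ _ ((hD _ _).1 hh)]
  · intro d' hd'
    refine (h.chain d' hd').frame (hne _ ?_) (fun _ _ => rfl) (fun j hj => hne _ (by omega))
    omega
  · rw [hne _ (by omega), h.free]

/-- The insertion of a new record. -/
theorem DictRep.insert {M M' : ℕ → ℕ} {D : ℕ → ℕ → ℕ} {r : ℕ} {rec : ℕ → ℕ → ℕ}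
    {ls : ℕ → List ℕ} {Y : Finset (ℕ × ℕ)} (h : DictRep M D r rec ls Y) {d j v q b : ℕ}
    (hd : IsDict d) (hj : D d j = 0) (hv : v ≠ 0) (hs : Slot M d (rec d) j q b)
    (hq : M' q = 64 * r) (h18 : M' (64 * r + 18) = 64 * b) (h16 : M' (64 * r + 16) = 0)
    (h17 : M' (64 * r + 17) = 0) (h21 : M' (64 * r + 21) = 64 * j)
    (h20 : M' (64 * r + 20) = M (d + 1)) (h19 : M' (64 * r + 19) = v)
    (hd1 : M' (d + 1) = 64 * r) (h59 : M' 59 = 64 * (r + 1))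
    (hne : ∀ c, c ≠ q → c ≠ d + 1 → c ≠ 59 → (c < 64 * r + 16 ∨ 64 * r + 22 ≤ c) → M' c = M c) :
    ∃ rec' ls' Y', (∀ d₁, d₁ ≠ d → rec' d₁ = rec d₁ ∧ ls' d₁ = ls d₁) ∧
      DictRep M' (dupd D d j v) (r + 1) rec' ls' Y' := by
  have hr1 : 1 ≤ r := by have := h.card; omega
  have hrec0 : rec d j = 0 := by
    by_contra hh; exact (h.dom d j).1 hh hj
  have hqc : q = d ∨ (64 ≤ q ∧ q < 64 * r ∧ (q % 64 = 16 ∨ q % 64 = 17)) := by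
    rcases hs.2.1 with rfl | ⟨i, hi, hh⟩
    · exact .inl rfl
    · have := h.lt d i; omega
  have hqown : ∀ d' i f, d' ≠ d → rec d' i ≠ 0 → 16 ≤ f → f ≤ 18 → 64 * rec d' i + f ≠ q := by
    intro d' i f hne hi h1 h2 e
    rcases hs.2.1 with rfl | ⟨i', hi', hh⟩
    · omega
    · have := h.inj d' i d i' (by omega) hi
      exact hne this.1
  have hne' : ∀ i f, i ≠ 0 → i < r → 16 ≤ f → f ≤ 21 → 64 * i + f ≠ q →
      M' (64 * i + f) = M (64 * i + f) := fun i f h0 h1 h2 h3 h4 =>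
    hne _ h4 (by omega) (by omega) (by omega)
  have hD0 : ∀ j', rec d j' = 0 → D d j' = 0 := fun j' hh => by
    by_contra h'; exact (h.dom d j').2 h' hh
  let rec' : ℕ → ℕ → ℕ := dupd rec d j r
  let ls' : ℕ → List ℕ := fun d' => if d' = d then j :: ls d else ls d'
  have hrd : rec' d = Function.update (rec d) j r := by
    funext i; simp [rec', dupd, Function.update_apply]
  have hrd' : ∀ d', d' ≠ d → rec' d' = rec d' := fun d' hh => by
    funext i; simp [rec', dupd, hh]
  have hDne : ∀ d' j', ¬ (d' = d ∧ j' = j) → dupd D d j v d' j' = D d' j' := fun d' j' hh => by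
    simp [dupd, hh]
  have hRne : ∀ d' j', ¬ (d' = d ∧ j' = j) → rec' d' j' = rec d' j' := fun d' j' hh => by
    simp [rec', dupd, hh]
  have hDe : dupd D d j v d j = v := by simp [dupd]
  have hRe : rec' d j = r := by simp [rec', dupd]
  refine ⟨rec', ls', Insert.insert (d, j) Y,
    fun d₁ h₁ => ⟨hrd' d₁ h₁, by simp [ls', h₁]⟩, ?_, ?_, ?_, ?_, ?_, ?_, ?_, ?_, ?_, ?_, ?_, ?_, ?_⟩
  · intro d' hd2
    by_cases e : d' = d
    · subst e
      rw [hrd]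
      refine hs.2.2 M' r (by omega) (fun i => (h.lt _ _).ne) hq h18 h16 h17 ?_ ?_
      · intro i hi f h1 h2 h3
        exact hne' _ _ hi (h.lt _ _) h1 (by omega) h3
      · grind
    · rw [hrd' _ e]
      refine (h.dt d' hd2).frame (hne _ (by omega) (by omega) (by omega) (by omega)) ?_
      intro i hi f h1 h2
      exact hne' _ _ hi (h.lt _ _) h1 (by omega) (hqown _ _ _ e hi h1 h2)
  · intro d' j'
    by_cases e : d' = d ∧ j' = j
    · grind
    · rw [hRne _ _ e, hDne _ _ e]; exact h.dom _ _
  · intro d' j' hh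
    by_cases e : d' = d ∧ j' = j
    · exact e.1 ▸ hd
    · rw [hDne _ _ e] at hh; exact h.isDict _ _ hh
  · intro d1 j1 d2 j2 heq hn0
    by_cases e : d1 = d ∧ j1 = j <;> by_cases e' : d2 = d ∧ j2 = j
    · omega
    · rw [hRne _ _ e', e.1, e.2, hRe] at heq
      exact absurd heq.symm (h.lt _ _).ne
    · rw [hRne _ _ e, e'.1, e'.2, hRe] at heq
      exact absurd heq (h.lt _ _).ne
    · rw [hRne _ _ e] at heq hn0
      rw [hRne _ _ e'] at heq
      exact h.inj _ _ _ _ heq hn0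
  · intro d' j'
    by_cases e : d' = d ∧ j' = j
    · rw [e.1, e.2, hRe]; omega
    · rw [hRne _ _ e]; have := h.lt d' j'; omega
  · intro d' j' hh
    by_cases e : d' = d ∧ j' = j
    · grind
    · rw [hDne _ _ e] at hh ⊢
      rw [hRne _ _ e, hne' _ _ ((h.dom _ _).2 hh) (h.lt _ _) (by omega) (by omega) (by omega),
        h.val _ _ hh]
  · intro d' j' hh
    by_cases e : d' = d ∧ j' = j
    · rw [e.1, e.2, hRe, h21]
    · rw [hDne _ _ e] at hh
      rw [hRne _ _ e, hne' _ _ ((h.dom _ _).2 hh) (h.lt _ _) (by omega) (by omega) (by omega),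
        h.key _ _ hh]
  · intro d' hd2
    have hd2 := hd2
    have hold : ∀ j' ∈ ls d', M' (64 * rec d' j' + 20) = M (64 * rec d' j' + 20) := fun j' hj' =>
      hne' _ _ ((h.dom _ _).2 ((h.mem _ _).1 hj')) (h.lt _ _) (by omega) (by omega) (by omega)
    have hold' : ∀ j' ∈ ls d', rec' d' j' = rec d' j' := fun j' hj' => by
      refine hRne _ _ ?_
      rintro ⟨rfl, rfl⟩
      exact (h.mem _ _).1 hj' hj
    by_cases e : d' = d
    · subst e
      simp only [ls', if_true]
      refine ⟨by rw [hRe, hd1], ?_⟩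
      rw [hRe]
      have hc := h.chain d' hd
      cases hl : ls d' with
      | nil => rw [hl] at hc; exact h20.trans hc
      | cons i l =>
        rw [hl] at hc hold hold'
        refine ⟨by rw [h20, hc.1, hold' i (by simp)], ?_⟩
        rw [hold' i (by simp)]
        exact hc.2.frame (hold i (by simp)) (fun i hi => hold' i (by simp [hi]))
          (fun i hi => hold i (by simp [hi]))
    · simp only [ls', e, if_false]
      exact (h.chain d' hd2).frame (hne _ (by omega) (by omega) (by omega) (by omega)) hold' hold
  · intro d' j'
    by_cases e : d' = d
    · subst e
      simp only [ls', if_true, List.mem_cons, h.mem]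
      by_cases e' : j' = j
      · subst e'; simp [hDe, hv]
      · grind
    · simp only [ls', e, if_false, h.mem]
      rw [hDne _ _ (by simp [e])]
  · intro d'
    by_cases e : d' = d
    · subst e
      simp only [ls', if_true, List.nodup_cons, h.mem]
      exact ⟨by simp [hj], h.nodup _⟩
    · simp only [ls', e, if_false]; exact h.nodup _
  · rw [h59]
  · intro d' j'
    simp only [Finset.mem_insert, Prod.mk.injEq, h.memY]
    by_cases e : d' = d ∧ j' = j
    · simp [e, hDe, hv]
    · rw [hDne _ _ e]; simp [e]
  · rw [Finset.card_insert_of_notMem, h.card]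
    · ring
    · rw [h.memY]; simp [hj]

/-! ### Operations on the dictionaries -/

/-- Set the value of the key in register `31` of the dictionary with root cell in register `30` to
the number in register `35`. -/
def dset : Prog :=
  .copy 36 30 ;; .copy 37 31 ;; findSlot ;; .const 34 0 ;;
  .ite (.eq 32 34)
    (lds 32 59 ;; .store 30 32 ;; stf 32 18 31 ;; stf 32 16 34 ;; stf 32 17 34 ;; stf 32 21 37 ;;
      ldf 38 36 1 ;; stf 32 20 38 ;; stf 36 1 32 ;; addk 38 32 64 ;; sts 59 38)
    .nop ;;
  stf 32 19 35

/-- Register `32` becomes the value of the key in register `31` of the dictionary with root cell in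
register `30`, or `0`. -/
def dget : Prog :=
  findSlot ;; .const 34 0 ;; .ite (.eq 32 34) .nop (ldf 32 32 19)

/-- Copy all entries of the dictionary with root cell in register `41` to the dictionary with
root cell in register `42`. -/
def dcopy : Prog :=
  ldf 43 41 1 ;; .const 34 0 ;;
  .loop (.neg (.eq 43 34))
    (.copy 30 42 ;; ldf 31 43 21 ;; ldf 35 43 19 ;; dset ;; ldf 43 43 20 ;; .const 34 0)

/-- The states agree on the text, on the character registers, and on the number registers outside
of `lo, …, hi - 1, 99`. -/
def KeepsR {A : Type u} (lo hi : ℕ) (s s' : State A) : Prop :=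
  s'.creg = s.creg ∧ s'.mem.chr = s.mem.chr ∧
    ∀ r, (r < lo ∨ hi ≤ r) → r ≠ 99 → s'.reg r = s.reg r

section Ops

variable {A : Type u} [LinearOrder A] {B N J r k : ℕ} {M : ℕ → ℕ} {D : ℕ → ℕ → ℕ}
  {s s' : State A} {d lo hi j : ℕ} {rec : ℕ → ℕ → ℕ}
  {R : State A → ℕ → Prop} {ls : ℕ → List ℕ} {Y : Finset (ℕ × ℕ)}

theorem KeepsR.trans {s'' : State A} (h : KeepsR lo hi s s') (h' : KeepsR lo hi s' s'') :
    KeepsR lo hi s s'' :=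
  ⟨h'.1.trans h.1, h'.2.1.trans h.2.1, fun r hr h9 => (h'.2.2 r hr h9).trans (h.2.2 r hr h9)⟩

theorem KeepsR.mono {lo' hi' : ℕ} (h : KeepsR lo hi s s') (h1 : lo' ≤ lo) (h2 : hi ≤ hi') :
    KeepsR lo' hi' s s' :=
  ⟨h.1, h.2.1, fun r hr h9 => h.2.2 r (by omega) h9⟩

theorem KeepsR.reg (h : KeepsR lo hi s s') (r : ℕ) (h1 : r < lo ∨ hi ≤ r :=  by omega)
    (h2 : r ≠ 99 := by omega) : s'.reg r = s.reg r :=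
  h.2.2 r h1 h2

theorem Keeps.keepsR (h : Keeps s s') : KeepsR 30 35 s s' :=
  ⟨h.2.1, by rw [h.1], h.2.2⟩

section

variable {lo hi i v : ℕ} {s s' : State A}

@[simp]
theorem KeepsR.refl : KeepsR lo hi s s := ⟨rfl, rfl, fun _ _ _ => rfl⟩

@[simp]
theorem keepsR_setReg (h : lo ≤ i ∧ i < hi ∨ i = 99) :
    KeepsR lo hi s (s'.setReg i v) ↔ KeepsR lo hi s s' := by
  refine and_congr_right' (and_congr_right' (forall₃_congr fun r h1 h2 => ?_))
  simp [show r ≠ i by omega]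

@[simp]
theorem keepsR_setReg_left (h : lo ≤ i ∧ i < hi ∨ i = 99) :
    KeepsR lo hi (s.setReg i v) s' ↔ KeepsR lo hi s s' := by
  refine and_congr_right' (and_congr_right' (forall₃_congr fun r h1 h2 => ?_))
  simp [show r ≠ i by omega]

@[simp]
theorem keepsR_setNum : KeepsR lo hi s (s'.setNum i v) ↔ KeepsR lo hi s s' := Iff.rfl

end

theorem DictRep.pinj (h : DictRep M D r rec ls Y) (d : ℕ) : PInj (rec d) :=
  fun i j e hi => (h.inj d i d j e hi).2

theorem DictRep.not_ptr (_ : DictRep M D r rec ls Y) (hd : IsDict d) : ¬ IsPtrCell (rec d) d := by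
  rintro ⟨j, -, hh⟩
  omega

theorem dget_wp (hB : 64 * N ≤ B) (hbits : BitTable M J) (hJ : J < N) (h : DictStore M D r)
    (hr : r ≤ N) (hk : ∀ d i, D d i ≠ 0 → i < 2 ^ k) (hM : s.mem.num = M) (h30 : s.reg 30 = d)
    (h31 : s.reg 31 = 64 * j) (hj : j ≤ J) (hd : IsDict d) (hdB : d < B)
    (hR : ∀ s' t, KeepsR 30 35 s s' → s'.mem = s.mem → s'.reg 32 = D d j → t ≤ 30 * k + 50 → R s' t) :
    WP B dget s R := by
  obtain ⟨rec, ls, Y, h⟩ := h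
  simp only [dget, wp_seq]
  refine findSlot_wp (k := k + 1) hB hbits hJ (h.dt d hd) hM h30 h31 hj hdB
    (fun i => (h.lt d i).trans_le hr) (h.pinj d) (h.not_ptr hd)
    (fun i hi => ⟨by omega, by simpa using hk d i ((h.dom d i).1 hi)⟩) ?_
  intro s' t b hkeep e32 _ _ _ ht
  have hM' : s'.mem.num = M := by rw [hkeep.1, hM]
  have hlt := (h.lt d j).trans_le hr
  have hB1 : 64 * rec d j + 19 < B := by omega
  simp [hM', e32, hB1]
  refine ⟨fun h0 => ?_, fun h0 => ?_⟩
  · refine hR _ _ (by simp [hkeep.keepsR]) (by simp [hkeep.1]) ?_ (by omega)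
    by_contra hne
    exact (h.dom d j).2 (fun e => hne (by simp [e, e32, h0])) h0
  · refine hR _ _ (by simp [hkeep.keepsR]) (by simp [hkeep.1]) ?_ (by omega)
    simp [h.val d j ((h.dom d j).1 h0)]

set_option maxHeartbeats 1000000 in
/-- Setting a value takes at most one new record, and none if the key is present. -/
theorem dset_rep_wp (hB : 64 * N ≤ B) (hbits : BitTable M J) (hJ : J < N)
    (h : DictRep M D r rec ls Y) (hr : r ≤ N) (hk : ∀ d i, D d i ≠ 0 → i < 2 ^ k) {v : ℕ}
    (hM : s.mem.num = M) (h30 : s.reg 30 = d) (h31 : s.reg 31 = 64 * j) (h35 : s.reg 35 = v)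
    (hv : v ≠ 0) (hj : j ≤ J) (hd : IsDict d) (hdB : d + 1 < B) (hrN : D d j = 0 → r < N)
    (hR : ∀ s' t, KeepsR 30 39 s s' →
      (∃ rec' ls' Y', (∀ d₁, d₁ ≠ d → rec' d₁ = rec d₁ ∧ ls' d₁ = ls d₁) ∧
        DictRep s'.mem.num (dupd D d j v) (if D d j = 0 then r + 1 else r) rec' ls' Y') →
      (∀ c, ¬ DictCell c → s'.mem.num c = M c) →
      t ≤ 30 * k + 90 → R s' t) : WP B dset s R := by
  have hst : DictStore M D r := ⟨rec, ls, Y, h⟩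
  have hN1 : 1 ≤ N := hst.one_le.trans hr
  simp only [dset, wp_seq, wp_copy]
  refine findSlot_wp (k := k + 1) (q₀ := d) (j := j) hB hbits hJ (h.dt d hd) (by simp [hM])
    (by simp [h30]) (by simp [h31]) hj (by omega)
    (fun i => (h.lt d i).trans_le hr) (h.pinj d) (h.not_ptr hd)
    (fun i hi => ⟨by omega, by simpa using hk d i ((h.dom d i).1 hi)⟩) ?_
  intro s' t b hkeep e32 hslot e31 e30 ht
  have e36 : s'.reg 36 = d := by simp [hkeep.2.2, h30]
  have e37 : s'.reg 37 = 64 * j := by simp [hkeep.2.2, h31]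
  have e35 : s'.reg 35 = v := by simp [hkeep.2.2, h35]
  have hM' : s'.mem.num = M := by rw [hkeep.1]; simp [hM]
  have hks : KeepsR 30 39 s s' := by
    simpa using hkeep.keepsR.mono (hi' := 39) le_rfl (by omega)
  have hlt := (h.lt d j).trans_le hr
  by_cases hj0 : rec d j = 0
  · have hDj : D d j = 0 := by
      by_contra hh; exact (h.dom d j).2 hh hj0
    have hrN' := hrN hDj
    have hs := hslot hj0
    have hr1 := hst.one_le
    obtain ⟨q, hq⟩ : ∃ q, q = s'.reg 30 := ⟨_, rfl⟩
    rw [← hq] at hs e30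
    have hqc : q = d ∨ (64 ≤ q ∧ q < 64 * r ∧ (q % 64 = 16 ∨ q % 64 = 17)) := by
      rcases hs.2.1 with rfl | ⟨i, hi, hh⟩
      · exact .inl rfl
      · have := h.lt d i; omega
    have b0 : 59 < B := by omega
    have b1 : 64 * r + 16 < B := by omega
    have b2 : 64 * r + 17 < B := by omega
    have b3 : 64 * r + 18 < B := by omega
    have b4 : 64 * r + 19 < B := by omega
    have b5 : 64 * r + 20 < B := by omega
    have b6 : 64 * r + 21 < B := by omega
    have b7 : 64 * r + 64 ≤ B := by omega
    have q0 : q ≠ 59 := by omega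
    have q2 : d + 1 ≠ q := by omega
    simp only [wp_const, wp_ite, Test.holds_eq, State.setReg_reg, e32, hj0, wp_seq, wp_lds, wp_store,
      wp_stf, wp_ldf, wp_addk, wp_sts, wp_nop, State.setReg_mem, State.setNum_num,
      State.setNum_reg, hM', h.free, e31, ← hq, e30, e35, e36, e37, b0, b1, b2, b3, b4, b5, b6, b7,
      Nat.reduceEqDiff, if_true, if_false, ne_eq, not_false_eq_true, true_and, mul_zero, zero_le,
      hdB, forall_true_left, not_true_eq_false, IsEmpty.forall_iff, and_true]
    refine hR _ _ (by simp [hks]) ?_ ?_ (by omega)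
    · rw [if_pos hDj]
      refine h.insert hd hDj hv hs ?_ ?_ ?_ ?_ ?_ ?_ ?_ ?_ ?_ ?_
      all_goals simp only [State.setNum_num, State.setReg_mem, hM']
      all_goals try simp (disch := omega) only [upd_ne, upd_self]
      · ring
      · intro c h1 h2 h3 h4
        simp (disch := omega) only [upd_ne]
    · intro c hc
      have : c ≠ q ∧ c ≠ d + 1 ∧ c ≠ 59 ∧ (c < 64 * r + 16 ∨ 64 * r + 22 ≤ c) := by
        omega
      obtain ⟨h1, h2, h3, h4⟩ := this
      simp only [State.setNum_num, State.setReg_mem, hM']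
      simp (disch := omega) only [upd_ne]
  · have hDj : D d j ≠ 0 := (h.dom d j).1 hj0
    have b4 : 64 * rec d j + 19 < B := by omega
    simp [e32, hj0, b4, e35, hM']
    refine hR _ _ (by simp [hks]) ?_ ?_ (by omega)
    · rw [if_neg hDj]
      refine ⟨rec, ls, Y, fun _ _ => ⟨rfl, rfl⟩, h.setVal hDj hv ?_⟩
      simp [hM']
    · intro c hc
      simp only [State.setNum_num, State.setReg_mem, hM']
      rw [Function.update_of_ne]
      omega

theorem dset_wp (hB : 64 * N ≤ B) (hbits : BitTable M J) (hJ : J < N) (h : DictStore M D r)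
    (hr : r ≤ N) (hk : ∀ d i, D d i ≠ 0 → i < 2 ^ k) {v : ℕ} (hM : s.mem.num = M)
    (h30 : s.reg 30 = d) (h31 : s.reg 31 = 64 * j) (h35 : s.reg 35 = v) (hv : v ≠ 0) (hj : j ≤ J)
    (hd : IsDict d) (hdB : d + 1 < B) (hrN : D d j = 0 → r < N) (hR : ∀ s' t, KeepsR 30 39 s s' →
      DictStore s'.mem.num (dupd D d j v) (if D d j = 0 then r + 1 else r) →
      (∀ c, ¬ DictCell c → s'.mem.num c = M c) →
      t ≤ 30 * k + 90 → R s' t) : WP B dset s R := by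
  obtain ⟨rec, ls, Y, h⟩ := h
  refine dset_rep_wp hB hbits hJ h hr hk hM h30 h31 h35 hv hj hd hdB hrN ?_
  rintro s' t h1 ⟨rec', ls', Y', -, h2⟩ h3 h4
  exact hR s' t h1 ⟨rec', ls', Y', h2⟩ h3 h4

theorem BitTable.frame {M' : ℕ → ℕ} (h : BitTable M J) (hM : ∀ c, ¬ DictCell c → M' c = M c) :
    BitTable M' J := by
  intro j hj
  rw [hM _ (by omega), hM _ (by omega)]
  exact h j hj

/-- The pointer to the record of the first key of a list. -/
def headPtr (g : ℕ → ℕ) : List ℕ → ℕ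
  | [] => 0
  | j :: _ => 64 * g j

theorem RecChain.head {g : ℕ → ℕ} : ∀ {l : List ℕ} {q : ℕ}, RecChain M g q l →
    M q = headPtr g l
  | [], _, h => h
  | _ :: _, _, h => h.1
theorem RecChain.next {g : ℕ → ℕ} {l : List ℕ} {j : ℕ} : ∀ {pre : List ℕ} {q : ℕ},
    RecChain M g q (pre ++ j :: l) → M (64 * g j + 20) = headPtr g l
  | [], _, h => h.2.head
  | _ :: pre, _, h => RecChain.next (pre := pre) h.2

/-- The keys in `pre` have been copied, those in `l` are still to be copied; `r' - r` in the time bound counts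
the new records. -/
theorem dcopy_loop_wp (hB : 64 * N ≤ B) (hJ : J < N) (d d' : ℕ) (hd : IsDict d) (hd' : IsDict d')
    (hdB' : d' + 1 < B) (hne : d' ≠ d) : ∀ (l pre : List ℕ) {s : State A}
    {D : ℕ → ℕ → ℕ} {r : ℕ} {rec : ℕ → ℕ → ℕ} {ls : ℕ → List ℕ} {Y : Finset (ℕ × ℕ)},
    BitTable s.mem.num J → DictRep s.mem.num D r rec ls Y →
    (∀ d i, D d i ≠ 0 → i < 2 ^ k ∧ i ≤ J) → ls d = pre ++ l →
    (∀ j ∈ l, D d' j = 0) → r + l.length ≤ N → s.reg 42 = d' →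
    s.reg 43 = headPtr (rec d) l → s.reg 34 = 0 →
    ∀ {R : State A → ℕ → Prop}, (∀ s' t, KeepsR 30 44 s s' →
      DictStore s'.mem.num (fun d₁ j => if d₁ = d' ∧ j ∈ l then D d j else D d₁ j) (r + l.length) →
      (∀ c, ¬ DictCell c → s'.mem.num c = s.mem.num c) →
      t ≤ l.length * (30 * k + 110) + 1 → R s' t) →
    WP B (.loop (.neg (.eq 43 34))
      (.copy 30 42 ;; ldf 31 43 21 ;; ldf 35 43 19 ;; dset ;; ldf 43 43 20 ;; .const 34 0)) s R := by
  intro l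
  induction l with
  | nil =>
    intro pre s D r rec ls Y hbits h hk hls h0 hrN h42 h43 h34 R hR
    rw [wp_loop]
    refine ⟨fun hh => absurd hh (by simp [h43, h34, headPtr]), fun _ => ?_⟩
    exact hR s 1 ⟨rfl, rfl, fun _ _ _ => rfl⟩ (by simpa using ⟨rec, ls, Y, h⟩) (fun _ _ => rfl)
      (by omega)
  | cons j l ih =>
    intro pre s D r rec ls Y hbits h hk hls h0 hrN h42 h43 h34 R hR
    have hDj : D d j ≠ 0 := by rw [← h.mem, hls]; simp
    have hrec : rec d j ≠ 0 := (h.dom d j).2 hDj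
    have hlt := h.lt d j
    simp only [List.length_cons] at hrN hR
    simp only [headPtr] at h43
    have hjl : j ∉ l := by
      have := h.nodup d
      rw [hls] at this
      exact (List.nodup_cons.1 (List.nodup_append.1 this).2.1).1
    rw [wp_loop]
    refine ⟨fun _ => ?_, fun hh => absurd hh (by simp [h43, h34, hrec])⟩
    have b1 : 64 * rec d j + 21 < B := by omega
    have b2 : 64 * rec d j + 19 < B := by omega
    have b3 : 64 * rec d j + 20 < B := by omega
    rw [wp_seq, wp_copy, wp_seq, wp_ldf (by decide)]
    refine ⟨by simpa [h43] using b1, ?_⟩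
    rw [wp_seq, wp_ldf (by decide)]
    refine ⟨by simpa [h43] using b2, ?_⟩
    rw [wp_seq]
    refine dset_rep_wp (d := d') (j := j) (v := D d j) (k := k) hB hbits hJ h (by omega)
      (fun d i hi => (hk d i hi).1) (by simp) (by simp [h42])
      (by simp [h43, h.key d j hDj]) (by simp [h43, h.val d j hDj]) hDj (hk d j hDj).2 hd' hdB'
      (fun _ => by omega) ?_
    rintro s' t hkeep ⟨rec', ls', Y', hrl, h'⟩ hfr ht
    have e43 : s'.reg 43 = 64 * rec d j := by simp [hkeep.2.2, h43]
    have e42 : s'.reg 42 = d' := by simp [hkeep.2.2, h42]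
    obtain ⟨hrd, hld⟩ := hrl d hne.symm
    rw [if_pos (h0 j (by simp))] at h'
    have hnext : s'.mem.num (64 * rec d j + 20) = headPtr (rec' d) l := by
      have := h'.chain d hd
      rw [hld, hls] at this
      rw [← hrd]
      exact this.next
    simp only [wp_seq, wp_ldf, wp_const, e43, b3, ne_eq, Nat.reduceEqDiff, not_false_eq_true,
      true_and, zero_le]
    refine ih (pre ++ [j]) (rec := rec') (ls := ls') (Y := Y')
      (by exact hbits.frame hfr) (by exact h') ?_
      (by rw [hld, hls]; simp) ?_ (by omega) (by simp [e42]) (by simp [hnext]) (by simp) ?_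
    · intro d₁ i hi
      by_cases e : d₁ = d' ∧ i = j
      · rw [e.2]; exact hk _ _ hDj
      · exact hk d₁ i (by simpa [dupd, e] using hi)
    · intro i hi
      have : i ≠ j := by rintro rfl; exact hjl hi
      simp [dupd, this, h0 i (by simp [hi])]
    · intro s₁ t₁ hk1 hst hfr1 ht1
      refine hR _ _ ((by simpa using hkeep.mono (hi' := 44) le_rfl (by omega) : KeepsR 30 44 s s').trans
        (by simpa using hk1)) ?_ (fun c hc => ?_) ?_
      · have e : r + 1 + l.length = r + (l.length + 1) := by ring
        rw [← e]
        refine hst.congr fun d₁ i => ?_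
        by_cases e1 : d₁ = d' <;> by_cases e2 : i = j
        · subst e1 e2; simp [dupd, hjl]
        · subst e1; simp [dupd, e2, hne.symm]
        · subst e2; simp [dupd, e1]
        · simp [dupd, e1]
      · rw [hfr1 c hc]; exact hfr c hc
      · rw [add_mul]; omega

theorem dcopy_wp (hB : 64 * N ≤ B) (hbits : BitTable M J) (hJ : J < N) (h : DictStore M D r)
    (hk : ∀ d i, D d i ≠ 0 → i < 2 ^ k ∧ i ≤ J) {d' : ℕ} (hM : s.mem.num = M) (h41 : s.reg 41 = d)
    (h42 : s.reg 42 = d') (hd : IsDict d) (hd' : IsDict d') (hne : d' ≠ d) (hdB : d + 1 < B)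
    (hdB' : d' + 1 < B) (h0 : ∀ j, D d' j = 0)
    (hrN : ∀ Y : Finset ℕ, (∀ j ∈ Y, D d j ≠ 0) → r + Y.card ≤ N)
    (hR : ∀ s' t r', KeepsR 30 44 s s' → r ≤ r' →
      DictStore s'.mem.num (fun d₁ j => if d₁ = d' then D d j else D d₁ j) r' →
      (∀ c, ¬ DictCell c → s'.mem.num c = M c) →
      t ≤ (r' - r + 1) * (30 * k + 110) → R s' t) : WP B dcopy s R := by
  subst hM
  obtain ⟨rec, ls, Y, h⟩ := h
  simp only [dcopy, wp_seq, wp_ldf, wp_const, h41, hdB, ne_eq, Nat.reduceEqDiff,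
    not_false_eq_true, true_and, zero_le]
  have hlen := hrN (ls d).toFinset (fun j hj => by rw [← h.mem]; simpa using hj)
  rw [List.toFinset_card_of_nodup (h.nodup d)] at hlen
  refine dcopy_loop_wp (k := k) hB hJ d d' hd hd' hdB' hne (ls d) [] (rec := rec) (ls := ls) (Y := Y)
    (D := D) (r := r) (by exact hbits) (by exact h) hk (by simp)
    (fun j _ => h0 j) hlen
    (by simp [h42]) (by simpa using (h.chain d hd).head) (by simp) ?_
  intro s' t hkeep hst hfr ht
  refine hR s' _ (r + (ls d).length) (by simpa using hkeep) (by omega) ?_ ?_ ?_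
  · refine hst.congr fun d₁ j => ?_
    by_cases e : d₁ = d'
    · subst e
      by_cases hj : j ∈ ls d
      · simp [hj]
      · have : D d j = 0 := by by_contra hh; exact hj ((h.mem _ _).2 hh)
        simp [hj, this, h0]
    · simp [e]
  · intro c hc
    rw [hfr c hc]; simp
  · rw [Nat.add_sub_cancel_left, add_mul]; omega

end Ops

/-! ### The alphabet as a deterministic skip list -/

/-- A chain of `m` siblings, starting with node `i`, that represents the list `L` of entries and
consists of `c` nodes, where `T` describes the single subtrees. -/
inductive Sibs (M : ℕ → ℕ) (T : ℕ → List (ℕ × ℕ) → ℕ → Prop) :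
    ℕ → ℕ → List (ℕ × ℕ) → ℕ → Prop
  | one {i L c} : T i L c → Sibs M T 1 i L c
  | more {i j m L₁ L₂ c₁ c₂} : T i L₁ c₁ → M (64 * i + 24) = 64 * j → Sibs M T m j L₂ c₂ →
      Sibs M T (m + 1) i (L₁ ++ L₂) (c₁ + c₂)

/-- `SkipTree M N h i L c`: node `i` is the root of a 2-3-4 tree of height `h` with `c` nodes, all
of them with index `< N`, and its leaves hold the entries `L`. An entry consists of the code of
its key and the pointer that belongs to it. Every node stores the code of the last key below
it, and its height. -/
def SkipTree (M : ℕ → ℕ) (N : ℕ) : ℕ → ℕ → List (ℕ × ℕ) → ℕ → Prop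
  | 0, i, L, c => 1 ≤ i ∧ i < N ∧ M (64 * i + 28) = 0 ∧ M (64 * i + 25) = 0 ∧
      L = [(M (64 * i + 26), M (64 * i + 27))] ∧ c = 1
  | h + 1, i, L, c => 1 ≤ i ∧ i < N ∧ M (64 * i + 28) = h + 1 ∧
      (∃ L₀ o, L = L₀ ++ [(M (64 * i + 26), o)]) ∧
      ∃ d m c', M (64 * i + 25) = 64 * d ∧ 2 ≤ m ∧ m ≤ 4 ∧ Sibs M (SkipTree M N h) m d L c' ∧
        c = c' + 1

/-- A chain of siblings from `d` to `e`, without `e`. -/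
inductive SibSeg (M : ℕ → ℕ) (T : ℕ → List (ℕ × ℕ) → ℕ → Prop) :
    ℕ → ℕ → List (ℕ × ℕ) → ℕ → ℕ → Prop
  | nil {d} : SibSeg M T 0 d [] 0 d
  | cons {i j e m L₁ L₂ c₁ c₂} : T i L₁ c₁ → M (64 * i + 24) = 64 * j → SibSeg M T m j L₂ c₂ e →
      SibSeg M T (m + 1) i (L₁ ++ L₂) (c₁ + c₂) e

/-- The siblings after `e`. -/
def SibRest (M : ℕ → ℕ) (T : ℕ → List (ℕ × ℕ) → ℕ → Prop) (e m : ℕ) (L : List (ℕ × ℕ)) (c : ℕ) :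
    Prop :=
  (m = 0 ∧ L = [] ∧ c = 0) ∨ ∃ j, M (64 * e + 24) = 64 * j ∧ Sibs M T m j L c

section SkipBasics

variable {M M' : ℕ → ℕ} {N N' : ℕ} {T T' : ℕ → List (ℕ × ℕ) → ℕ → Prop}
  {L : List (ℕ × ℕ)} {c d m h e : ℕ}

theorem SibSeg.append {m₁ m₂ c₁ c₂ : ℕ} {L₁ L₂ : List (ℕ × ℕ)} (h : SibSeg M T m₁ d L₁ c₁ e)
    (h' : Sibs M T m₂ e L₂ c₂) : Sibs M T (m₁ + m₂) d (L₁ ++ L₂) (c₁ + c₂) := by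
  induction h with
  | nil => simpa using h'
  | @cons i j e m L₁ L₂ c₁ c₂ h1 h2 _ ih =>
    have := Sibs.more h1 h2 (ih h')
    rw [List.append_assoc]
    convert this using 1 <;> ring

theorem SibRest.cons {c' : ℕ} {L' : List (ℕ × ℕ)} (h : T e L c) (h' : SibRest M T e m L' c') :
    Sibs M T (m + 1) e (L ++ L') (c + c') := by
  rcases h' with ⟨rfl, rfl, rfl⟩ | ⟨j, hj, h'⟩
  · simpa using Sibs.one h
  · exact Sibs.more h hj h'

theorem Sibs.pos (h : Sibs M T m d L c) : 1 ≤ m := by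
  cases h <;> omega

theorem Sibs.congr (h : Sibs M T m d L c) (hT : ∀ i L' c', T i L' c' → L' ⊆ L → T' i L' c')
    (hM : ∀ i L' c', T i L' c' → L' ⊆ L → M' (64 * i + 24) = M (64 * i + 24)) : Sibs M' T' m d L c := by
  induction h with
  | one h => exact .one (hT _ _ _ h (fun _ h => h))
  | @more i j m L₁ L₂ c₁ c₂ h hj _ ih =>
    refine .more (hT _ _ _ h (by simp)) ((hM _ _ _ h (by simp)).trans hj) (ih ?_ ?_)
    · exact fun i L' c' h h' => hT _ _ _ h (fun x hx => List.mem_append_right _ (h' hx))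
    · exact fun i L' c' h h' => hM _ _ _ h (fun x hx => List.mem_append_right _ (h' hx))

theorem SibSeg.congr (h : SibSeg M T m d L c e) (hT : ∀ i L' c', T i L' c' → L' ⊆ L → T' i L' c')
    (hM : ∀ i L' c', T i L' c' → L' ⊆ L → M' (64 * i + 24) = M (64 * i + 24)) :
    SibSeg M' T' m d L c e := by
  induction h with
  | nil => exact .nil
  | @cons i j m e L₁ L₂ c₁ c₂ h hj _ ih =>
    refine .cons (hT _ _ _ h (by simp)) ((hM _ _ _ h (by simp)).trans hj) (ih ?_ ?_)
    · exact fun i L' c' h h' => hT _ _ _ h (fun x hx => List.mem_append_right _ (h' hx))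
    · exact fun i L' c' h h' => hM _ _ _ h (fun x hx => List.mem_append_right _ (h' hx))

/-- The root of a subtree: its index, its height, and the last entry. -/
theorem SkipTree.root {i : ℕ} (H : SkipTree M N h i L c) :
    1 ≤ i ∧ i < N ∧ M (64 * i + 28) = h ∧ ∃ L₀ o, L = L₀ ++ [(M (64 * i + 26), o)] := by
  cases h with
  | zero => exact ⟨H.1, H.2.1, H.2.2.1, [], _, H.2.2.2.2.1⟩
  | succ h => exact ⟨H.1, H.2.1, H.2.2.1, H.2.2.2.1⟩

theorem SkipTree.code_mem {i : ℕ} (H : SkipTree M N h i L c) : M (64 * i + 26) ∈ L.map Prod.fst := by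
  obtain ⟨-, -, -, L₀, o, e⟩ := H.root
  rw [e]; simp

/-- The hypothesis under which a chain of subtrees is not affected by a change of the memory. -/
def SkipSame (M M' : ℕ → ℕ) (N h : ℕ) (L : List (ℕ × ℕ)) : Prop :=
  ∀ i, 1 ≤ i → i < N → M (64 * i + 28) ≤ h → M (64 * i + 26) ∈ L.map Prod.fst →
    ∀ f, 24 ≤ f → f ≤ 28 → M' (64 * i + f) = M (64 * i + f)

theorem SkipTree.frame (hN : N ≤ N') : ∀ {h i c : ℕ} {L : List (ℕ × ℕ)}, SkipTree M N h i L c →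
    SkipSame M M' N h L → SkipTree M' N' h i L c
  | 0, i, c, L, H, hM => by
    have hm := H.code_mem
    obtain ⟨h1, h2, h3, h4, h5, h6⟩ := H
    have := hM i h1 h2 h3.le hm
    refine ⟨h1, by omega, ?_, ?_, ?_, h6⟩
    · rw [this 28 (by omega) (by omega), h3]
    · rw [this 25 (by omega) (by omega), h4]
    · rw [this 26 (by omega) (by omega), this 27 (by omega) (by omega), h5]
  | h + 1, i, c, L, H, hM => by
    have hm := H.code_mem
    obtain ⟨h1, h2, h3, h4, d, m, c', h5, h6, h7, h8, h9⟩ := H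
    have := hM i h1 h2 h3.le hm
    refine ⟨h1, by omega, ?_, ?_, d, m, c', ?_, h6, h7, ?_, h9⟩
    · rw [this 28 (by omega) (by omega), h3]
    · rw [this 26 (by omega) (by omega)]; exact h4
    · rw [this 25 (by omega) (by omega), h5]
    · refine h8.congr (fun i L' c' ht hs => ht.frame hN fun k hk1 hk2 hk3 hk4 => ?_)
        (fun i L' c' ht hs => ?_)
      · exact hM k hk1 hk2 (by omega) (List.map_subset _ hs hk4)
      · obtain ⟨g1, g2, g3, -⟩ := ht.root
        exact hM i g1 g2 (by omega) (List.map_subset _ hs ht.code_mem) 24 (by omega) (by omega)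

theorem SkipSame.sub {L' : List (ℕ × ℕ)} (H : SkipSame M M' N h L) (hs : L' ⊆ L) :
    SkipSame M M' N h L' :=
  fun i h1 h2 h3 h4 => H i h1 h2 h3 (List.map_subset _ hs h4)

theorem Sibs.frame (hN : N ≤ N') (H : Sibs M (SkipTree M N h) m d L c) (hM : SkipSame M M' N h L) :
    Sibs M' (SkipTree M' N' h) m d L c :=
  H.congr (fun _ _ _ ht hs => ht.frame hN (hM.sub hs)) (fun i _ _ ht hs => by
    obtain ⟨g1, g2, g3, -⟩ := ht.root
    exact hM i g1 g2 g3.le (List.map_subset _ hs ht.code_mem) 24 (by omega) (by omega))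

theorem SibSeg.frame (hN : N ≤ N') (H : SibSeg M (SkipTree M N h) m d L c e)
    (hM : SkipSame M M' N h L) : SibSeg M' (SkipTree M' N' h) m d L c e :=
  H.congr (fun _ _ _ ht hs => ht.frame hN (hM.sub hs)) (fun i _ _ ht hs => by
    obtain ⟨g1, g2, g3, -⟩ := ht.root
    exact hM i g1 g2 g3.le (List.map_subset _ hs ht.code_mem) 24 (by omega) (by omega))

theorem Sibs.last (H : Sibs M (SkipTree M N h) m d L c) : L ≠ [] := by
  induction H with
  | one h => obtain ⟨-, -, -, L₀, o, e⟩ := h.root; simp [e]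
  | more h _ _ ih => simp [ih]

/-- A tree of height `h` has at least `2 ^ h` leaves, and fewer than twice as many nodes as leaves. -/
theorem SkipTree.size : ∀ {h i c : ℕ} {L : List (ℕ × ℕ)}, SkipTree M N h i L c →
    2 ^ h ≤ L.length ∧ c + 1 ≤ 2 * L.length := by
  have sibs : ∀ {h m d c : ℕ} {L : List (ℕ × ℕ)},
      (∀ {i c : ℕ} {L : List (ℕ × ℕ)}, SkipTree M N h i L c →
        2 ^ h ≤ L.length ∧ c + 1 ≤ 2 * L.length) →
      Sibs M (SkipTree M N h) m d L c → m * 2 ^ h ≤ L.length ∧ c + m ≤ 2 * L.length := by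
    intro h m d c L ih H
    induction H with
    | one H => simpa using ih H
    | more H _ _ ih' =>
      have := ih H
      simp only [List.length_append, add_mul]
      omega
  intro h
  induction h with
  | zero => rintro i c L ⟨-, -, -, -, rfl, rfl⟩; simp
  | succ h ih =>
    rintro i c L ⟨-, -, -, -, d, m, c', -, h2, h4, H, rfl⟩
    obtain ⟨h5, h6⟩ := sibs ih H
    refine ⟨le_trans ?_ h5, by omega⟩
    rw [pow_succ, mul_comm]
    exact Nat.mul_le_mul_right _ h2

theorem Sibs.size (H : Sibs M (SkipTree M N h) m d L c) : 2 ^ h ≤ L.length ∧ c + 1 ≤ 2 * L.length := by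
  induction H with
  | one H => exact H.size
  | more H _ _ ih =>
    have := H.size
    simp only [List.length_append]
    omega

end SkipBasics

section Search

variable {A : Type u} [LinearOrder A] {B NB N h m d c : ℕ} {M : ℕ → ℕ} {chr : ℕ → Option A}
  {L : List (ℕ × ℕ)}
  {s s' : State A} {v : A} {lo hi y k i : ℕ}
  {R : State A → ℕ → Prop}

/-- The character with code `k`: the one at position `k - 1` of the text; `0` is the code of `∞`. -/
def keyChr (chr : ℕ → Option A) (k : ℕ) : Option A := if k = 0 then none else chr (k - 1)

/-- The key with the given code. -/
def keyOf (chr : ℕ → Option A) (k : ℕ) : WithTop A :=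
  match keyChr chr k with
    | some a => (a : WithTop A)
    | none => ⊤

/-- The key of the node in register `y` goes to the character register `2`. -/
def loadKey (y : ℕ) : Prog :=
  ldf 44 y 26 ;; .const 45 0 ;;
  .ite (.eq 44 45) (.ccopy 2 9) (.const 45 1 ;; .sub 44 44 45 ;; .cload 2 44)

/-- Move register `46` to the right along siblings, up to the first one whose key is not less than
the character in register `1`. -/
def skipWalk : Prog :=
  loadKey 46 ;; .loop (.clt 2 1) (ldf 46 46 24 ;; loadKey 46)

/-- Register `40` becomes the pointer that belongs to the character in register `1`, or `0`. -/
def skipFind : Prog :=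
  lds 46 61 ;; skipWalk ;; ldf 47 46 25 ;; .const 45 0 ;;
  .loop (.neg (.eq 47 45)) (.copy 46 47 ;; skipWalk ;; ldf 47 46 25 ;; .const 45 0) ;;
  loadKey 46 ;; .ite (.clt 1 2) (.const 40 0) (ldf 40 46 27)

/-- The character registers other than `2` and the registers outside of `[lo, hi)` are kept. -/
def KeepsC {A : Type u} (lo hi : ℕ) (s s' : State A) : Prop :=
  (∀ r, r ≠ 2 → s'.creg r = s.creg r) ∧ s'.mem.chr = s.mem.chr ∧
    ∀ r, (r < lo ∨ hi ≤ r) → r ≠ 99 → s'.reg r = s.reg r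

theorem KeepsC.trans {s'' : State A} (h : KeepsC lo hi s s') (h' : KeepsC lo hi s' s'') :
    KeepsC lo hi s s'' :=
  ⟨fun r hr => (h'.1 r hr).trans (h.1 r hr), h'.2.1.trans h.2.1,
    fun r hr h9 => (h'.2.2 r hr h9).trans (h.2.2 r hr h9)⟩

theorem KeepsC.mono {lo' hi' : ℕ} (h : KeepsC lo hi s s') (h1 : lo' ≤ lo) (h2 : hi ≤ hi') :
    KeepsC lo' hi' s s' :=
  ⟨h.1, h.2.1, fun r hr h9 => h.2.2 r (by omega) h9⟩

theorem KeepsR.keepsC (h : KeepsR lo hi s s') : KeepsC lo hi s s' :=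
  ⟨fun r _ => by rw [h.1], h.2⟩

section

variable {lo hi i n : ℕ} {v : Option A} {s s' : State A}

@[simp]
theorem KeepsC.refl : KeepsC lo hi s s := KeepsR.refl.keepsC

@[simp]
theorem keepsC_setReg (h : lo ≤ i ∧ i < hi ∨ i = 99) :
    KeepsC lo hi s (s'.setReg i n) ↔ KeepsC lo hi s s' := by
  refine and_congr_right' (and_congr_right' (forall₃_congr fun r h1 h2 => ?_))
  simp [show r ≠ i by omega]

@[simp]
theorem keepsC_setReg_left (h : lo ≤ i ∧ i < hi ∨ i = 99) :
    KeepsC lo hi (s.setReg i n) s' ↔ KeepsC lo hi s s' := by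
  refine and_congr_right' (and_congr_right' (forall₃_congr fun r h1 h2 => ?_))
  simp [show r ≠ i by omega]

@[simp]
theorem keepsC_setNum_left : KeepsC lo hi (s.setNum i n) s' ↔ KeepsC lo hi s s' := Iff.rfl

@[simp]
theorem keepsC_setCreg : KeepsC lo hi s (s'.setCreg 2 v) ↔ KeepsC lo hi s s' :=
  and_congr_left' (forall₂_congr fun r h => by simp [h])

end

theorem clt_keyOf {x : ℕ} (hy : s.creg y = some v) (hx : s.creg x = keyChr s.mem.chr k) :
    (Test.clt x y).Holds s ↔ keyOf s.mem.chr k < v := by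
  simp only [Test.holds_clt, hx, hy, keyOf]
  cases keyChr s.mem.chr k <;> simp

theorem clt_keyOf' {x : ℕ} (hy : s.creg y = some v) (hx : s.creg x = keyChr s.mem.chr k)
    (hk : keyOf s.mem.chr k ≠ ⊤) : (Test.clt y x).Holds s ↔ (v : WithTop A) < keyOf s.mem.chr k := by
  simp only [Test.holds_clt, hx, hy, keyOf] at *
  cases h : keyChr s.mem.chr k <;> simp [h] at *

theorem loadKey_wp (hy : y ≠ 99) (hy' : s.reg y = 64 * i) (hi : 64 * i + 26 < B)
    (hk : s.mem.num (64 * i + 26) < B) (h9 : s.creg 9 = none)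
    (hR : ∀ s' t, KeepsC 44 46 s s' → s'.mem = s.mem →
      s'.creg 2 = keyChr s.mem.chr (s.mem.num (64 * i + 26)) → t ≤ 8 → R s' t) :
    WP B (loadKey y) s R := by
  have hB : 1 ≤ B := by omega
  have hk' : s.mem.num (64 * i + 26) - 1 < B := by omega
  simp [loadKey, hy, hy', hi, hB, hk']
  exact ⟨fun h0 => hR _ _ (by simp) (by simp) (by simp [h0, h9, keyChr]) (by omega),
    fun h0 => hR _ _ (by simp) (by simp) (by simp [h0, keyChr]) (by omega)⟩

/-- The list of entries is sorted by the keys of their codes. -/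
def KeySorted (chr : ℕ → Option A) (L : List (ℕ × ℕ)) : Prop :=
  (L.map Prod.fst).Pairwise (fun x y => keyOf chr x < keyOf chr y)

theorem KeySorted.append {L₁ L₂ : List (ℕ × ℕ)} :
    KeySorted chr (L₁ ++ L₂) ↔ KeySorted chr L₁ ∧ KeySorted chr L₂ ∧
      ∀ p ∈ L₁, ∀ q ∈ L₂, keyOf chr p.1 < keyOf chr q.1 := by
  unfold KeySorted
  rw [List.map_append, List.pairwise_append]
  simp

theorem SkipTree.key_le (H : SkipTree M N h i L c) (hs : KeySorted chr L) :
    ∀ p ∈ L, keyOf chr p.1 ≤ keyOf chr (M (64 * i + 26)) := by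
  obtain ⟨-, -, -, L₀, o, e⟩ := H.root
  rw [e, KeySorted.append] at hs
  rw [e]
  intro p hp
  rcases List.mem_append.1 hp with hp | hp
  · exact (hs.2.2 p hp (_, o) (by simp)).le
  · simp at hp; simp [hp]

theorem SkipTree.root_mem (H : SkipTree M N h i L c) : ∃ o, (M (64 * i + 26), o) ∈ L := by
  obtain ⟨-, -, -, L₀, o, e⟩ := H.root
  exact ⟨o, by simp [e]⟩

/-- The result of the search for `v` among siblings: the first node `e` whose key is not less than
`v`. -/
structure WalkResult (M : ℕ → ℕ) (N h : ℕ) (chr : ℕ → Option A) (v : A) (m d : ℕ)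
    (L : List (ℕ × ℕ)) (c m₁ m₂ : ℕ) (L₁ L₂ L₃ : List (ℕ × ℕ)) (c₁ c₂ c₃ e : ℕ) : Prop where
  seg : SibSeg M (SkipTree M N h) m₁ d L₁ c₁ e
  tree : SkipTree M N h e L₂ c₂
  rest : SibRest M (SkipTree M N h) e m₂ L₃ c₃
  hm : m = m₁ + 1 + m₂
  hL : L = L₁ ++ (L₂ ++ L₃)
  hc : c = c₁ + (c₂ + c₃)
  lt : ∀ p ∈ L₁, keyOf chr p.1 < v
  le : (v : WithTop A) ≤ keyOf chr (M (64 * e + 26))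

/-- The walk among siblings starting at node `d`. Some key is not less than `v`, so it ends at a node. -/
theorem skipWalk_loop_wp (hB : 64 * NB ≤ B) (hNN : N ≤ NB) (H : Sibs M (SkipTree M N h) m d L c) :
    ∀ {s : State A}, s.mem.num = M → s.mem.chr = chr → (∀ p ∈ L, p.1 < B) →
    (∃ p ∈ L, (v : WithTop A) ≤ keyOf chr p.1) → KeySorted chr L →
    s.creg 9 = none → s.creg 1 = some v → s.reg 46 = 64 * d →
    s.creg 2 = keyChr chr (M (64 * d + 26)) →
    ∀ {R : State A → ℕ → Prop},
    (∀ s' t m₁ m₂ L₁ L₂ L₃ c₁ c₂ c₃ e, KeepsC 44 47 s s' → s'.mem = s.mem → s'.reg 46 = 64 * e →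
      s'.creg 2 = keyChr chr (M (64 * e + 26)) →
      WalkResult M N h chr v m d L c m₁ m₂ L₁ L₂ L₃ c₁ c₂ c₃ e → t ≤ 12 * m → R s' t) →
    WP B (.loop (.clt 2 1) (ldf 46 46 24 ;; loadKey 46)) s R := by
  induction H with
  | @one i L c H =>
    intro s hM hchr hLB hex hs h9 h1 h46 h2 R hR
    rw [wp_loop, clt_keyOf (k := M (64 * i + 26)) h1 (by rw [h2, hchr]), hchr]
    obtain ⟨p, hp, hvp⟩ := hex
    have hle := hvp.trans (H.key_le hs p hp)
    refine ⟨fun hlt => absurd hlt (not_lt.2 hle), fun _ => ?_⟩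
    exact hR s 1 0 0 [] L [] 0 c 0 i .refl rfl h46 h2
      ⟨.nil, H, .inl ⟨rfl, rfl, rfl⟩, rfl, by simp, by simp, by simp, hle⟩ (by omega)
  | @more i j m L₁ L₂ c₁ c₂ H hj H' ih =>
    intro s hM hchr hLB hex hs h9 h1 h46 h2 R hR
    rw [wp_loop, clt_keyOf (k := M (64 * i + 26)) h1 (by rw [h2, hchr]), hchr]
    refine ⟨fun hlt => ?_, fun hle => ?_⟩
    · obtain ⟨g1, g2, -⟩ := H.root
      have b1 : 64 * i + 24 < B := by omega
      have hs' := KeySorted.append.1 hs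
      have hlt1 : ∀ p ∈ L₁, keyOf chr p.1 < v := fun p hp => (H.key_le hs'.1 p hp).trans_lt hlt
      have gj : 1 ≤ j ∧ j < N ∧ ∃ o, (M (64 * j + 26), o) ∈ L₂ := by
        cases H' with
        | one H' => exact ⟨H'.root.1, H'.root.2.1, H'.root_mem⟩
        | more H' =>
          obtain ⟨o, ho⟩ := H'.root_mem
          exact ⟨H'.root.1, H'.root.2.1, o, by simp [ho]⟩
      obtain ⟨gj1, gj2, o, ho⟩ := gj
      rw [wp_seq, wp_ldf (by decide)]
      refine ⟨by simpa [h46] using b1, ?_⟩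
      refine loadKey_wp (i := j) (by decide) (by simp [h46, hM, hj]) (by omega)
        (by simpa [hM] using hLB _ (List.mem_append_right _ ho)) (by simpa using h9) ?_
      intro s' t hk hmem hc2 ht
      simp only [State.setReg_mem] at hmem hc2
      refine ih (by rw [hmem, hM]) (by rw [hmem, hchr])
        (fun p hp => hLB p (List.mem_append_right _ hp)) ?_ hs'.2.1
        (by simp [hk.1, h9]) (by simp [hk.1, h1])
        (by simp [hk.2.2, h46, hM, hj])
        (by rw [hc2, hM, hchr]) ?_
      · obtain ⟨p, hp, hvp⟩ := hex
        rcases List.mem_append.1 hp with hp | hp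
        · exact absurd (hlt1 p hp) (not_lt.2 hvp)
        · exact ⟨p, hp, hvp⟩
      · intro s₁ t₁ m₁ m₂ K₁ K₂ K₃ d₁ d₂ d₃ e hk₁ hmem₁ e46 e2 W ht₁
        refine hR s₁ _ (m₁ + 1) m₂ (L₁ ++ K₁) K₂ K₃ (c₁ + d₁) d₂ d₃ e ?_ (by rw [hmem₁, hmem])
          e46 e2 ⟨.cons H hj W.seg, W.tree, W.rest, by rw [W.hm]; ring, by rw [W.hL]; simp,
            by rw [W.hc]; ring, ?_, W.le⟩ (by omega)
        · exact KeepsC.trans (by simpa using hk.mono (hi' := 47) le_rfl (by omega)) hk₁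
        · intro p hp
          rcases List.mem_append.1 hp with hp | hp
          · exact hlt1 p hp
          · exact W.lt p hp
    · exact hR s 1 0 m [] L₁ L₂ 0 c₁ c₂ i .refl rfl h46 h2
        ⟨.nil, H, .inr ⟨j, hj, H'⟩, by omega, by simp, by simp, by simp, not_lt.1 hle⟩ (by omega)

theorem Sibs.first
    (H : Sibs M (SkipTree M N h) m d L c) :
    1 ≤ d ∧ d < N ∧ M (64 * d + 28) = h ∧ ∃ o, (M (64 * d + 26), o) ∈ L := by
  cases H with
  | one H => exact ⟨H.root.1, H.root.2.1, H.root.2.2.1, H.root_mem⟩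
  | more H =>
    obtain ⟨o, ho⟩ := H.root_mem
    exact ⟨H.root.1, H.root.2.1, H.root.2.2.1, o, by simp [ho]⟩

theorem skipWalk_wp (hB : 64 * NB ≤ B) (hNN : N ≤ NB) (H : Sibs M (SkipTree M N h) m d L c)
    (hM : s.mem.num = M) (hchr : s.mem.chr = chr) (hLB : ∀ p ∈ L, p.1 < B)
    (hex : ∃ p ∈ L, (v : WithTop A) ≤ keyOf chr p.1) (hs : KeySorted chr L) (h9 : s.creg 9 = none)
    (h1 : s.creg 1 = some v) (h46 : s.reg 46 = 64 * d)
    (hR : ∀ s' t m₁ m₂ L₁ L₂ L₃ c₁ c₂ c₃ e, KeepsC 44 47 s s' → s'.mem = s.mem →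
      s'.reg 46 = 64 * e →
      s'.creg 2 = keyChr chr (M (64 * e + 26)) →
      WalkResult M N h chr v m d L c m₁ m₂ L₁ L₂ L₃ c₁ c₂ c₃ e → t ≤ 12 * m + 8 → R s' t) :
    WP B skipWalk s R := by
  obtain ⟨g1, g2, -, o, ho⟩ := H.first
  rw [skipWalk, wp_seq]
  refine loadKey_wp (i := d) (by decide) h46 (by omega) (by rw [hM]; exact hLB _ ho) h9 ?_
  intro s' t hk hmem hc2 ht
  refine skipWalk_loop_wp hB hNN H (by rw [hmem, hM]) (by rw [hmem, hchr]) hLB hex hs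
    (by simp [hk.1, h9]) (by simp [hk.1, h1])
    (by simp [hk.2.2, h46]) (by rw [hc2, hM, hchr]) ?_
  intro s₁ t₁ m₁ m₂ K₁ K₂ K₃ d₁ d₂ d₃ e hk₁ hmem₁ e46 e2 W ht₁
  exact hR s₁ _ m₁ m₂ K₁ K₂ K₃ d₁ d₂ d₃ e ((hk.mono le_rfl (by omega)).trans hk₁)
    (by rw [hmem₁, hmem]) e46 e2 W (by omega)

/-- The descent from a sibling list of height `h`. -/
theorem skipDescend_wp (hB : 64 * NB ≤ B) (hNN : N ≤ NB) : ∀ (h : ℕ) {m d c : ℕ} {L : List (ℕ × ℕ)},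
    Sibs M (SkipTree M N h) m d L c → m ≤ 4 → ∀ {s : State A}, s.mem.num = M → s.mem.chr = chr →
    (∀ p ∈ L, p.1 < B) → (∃ p ∈ L, (v : WithTop A) ≤ keyOf chr p.1) → KeySorted chr L →
    s.creg 9 = none → s.creg 1 = some v → s.reg 46 = 64 * d → ∀ {R : State A → ℕ → Prop},
    (∀ s' t i, KeepsC 40 48 s s' → s'.mem = s.mem → s'.reg 46 = 64 * i → 1 ≤ i → i < N →
      (M (64 * i + 26), M (64 * i + 27)) ∈ L → (v : WithTop A) ≤ keyOf chr (M (64 * i + 26)) →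
      (∀ p ∈ L, (v : WithTop A) ≤ keyOf chr p.1 → keyOf chr (M (64 * i + 26)) ≤ keyOf chr p.1) →
      t ≤ 70 * (h + 1) → R s' t) →
    WP B (skipWalk ;; ldf 47 46 25 ;; .const 45 0 ;;
      .loop (.neg (.eq 47 45)) (.copy 46 47 ;; skipWalk ;; ldf 47 46 25 ;; .const 45 0)) s R := by
  intro h
  induction h with
  | zero =>
    intro m d c L H hm s hM hchr hLB hex hs h9 h1 h46 R hR
    rw [wp_seq]
    refine skipWalk_wp hB hNN H hM hchr hLB hex hs h9 h1 h46 ?_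
    intro s' t m₁ m₂ L₁ L₂ L₃ c₁ c₂ c₃ e hk hmem e46 e2 W ht
    have hT := W.tree
    obtain ⟨g1, g2, g3, g4, g5, g6⟩ := hT
    have b : 64 * e + 25 < B := by omega
    simp only [wp_seq, wp_ldf, wp_const, e46, b, ne_eq, Nat.reduceEqDiff, not_false_eq_true,
      true_and, zero_le, hmem, hM, g4]
    rw [wp_loop]
    refine ⟨fun hh => absurd hh (by simp), fun _ => ?_⟩
    refine hR _ _ e (by simpa using hk.mono (by omega) (by omega)) (by simp [hmem]) (by simp [e46]) g1 g2
      (by rw [W.hL, g5]; simp) W.le (fun p hp hv => ?_) (by omega)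
    rw [W.hL, KeySorted.append, KeySorted.append] at hs
    rw [W.hL] at hp
    rcases List.mem_append.1 hp with hp | hp
    · exact absurd (W.lt p hp) (not_lt.2 hv)
    rcases List.mem_append.1 hp with hp | hp
    · rw [g5] at hp; simp at hp; rw [hp]
    · exact (hs.2.1.2.2 (M (64 * e + 26), M (64 * e + 27)) (by rw [g5]; simp) p hp).le
  | succ h ih =>
    intro m d c L H hm s hM hchr hLB hex hs h9 h1 h46 R hR
    rw [wp_seq]
    refine skipWalk_wp hB hNN H hM hchr hLB hex hs h9 h1 h46 ?_
    intro s' t m₁ m₂ L₁ L₂ L₃ c₁ c₂ c₃ e hk hmem e46 e2 W ht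
    have hT := W.tree
    obtain ⟨g1, g2, g3, ⟨L₀, o, g4⟩, d', m', c', g5, g6, g7, g8, -⟩ := hT
    have b : 64 * e + 25 < B := by omega
    obtain ⟨hd1, -⟩ := g8.first
    have hsL := hs
    rw [W.hL, KeySorted.append, KeySorted.append] at hsL
    have hsub : ∀ p ∈ L₂, p ∈ L := fun p hp => by rw [W.hL]; simp [hp]
    simp only [wp_seq (P := ldf _ _ _), wp_seq (P := Prog.const _ _), wp_ldf, wp_const, e46, b,
      ne_eq, Nat.reduceEqDiff, not_false_eq_true, true_and, zero_le, hmem, hM, g5]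
    rw [wp_loop]
    refine ⟨fun _ => ?_, fun hh => absurd hh (by simp; omega)⟩
    rw [wp_seq, wp_copy]
    have := @ih m' d' c' L₂ g8 g7
      ((((((s'.setReg 99 (64 * e + 25)).setReg 47 (64 * d')).setReg 45 0)).setReg 46 (64 * d')))
      (by simp [hmem, hM]) (by simp [hmem, hchr]) (fun p hp => hLB p (hsub p hp))
      ⟨(M (64 * e + 26), o), by simp [g4], W.le⟩ hsL.2.1.1
      (by simp [hk.1 9, h9]) (by simp [hk.1 1, h1]) (by simp)
      (fun s'' t' => R s'' (t + (6 + t'))) ?_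
    · simp only [wp_seq] at this ⊢
      simp only [State.setReg_reg, if_true, if_false, Nat.reduceEqDiff] at this ⊢
      refine this.mono fun s₁ t₁ h => h.mono fun s₂ t₂ h => h.mono fun s₃ t₃ h =>
        h.mono fun s₄ t₄ h => ?_
      convert h using 1
      ring
    · intro s₁ t₁ i hk₁ hmem₁ e46₁ hi1 hi2 hin hle hmin ht₁
      refine hR s₁ _ i ((hk.mono (by omega) (by omega)).trans (by simpa using hk₁))
        (by simp [hmem₁, hmem]) e46₁ hi1 hi2 (hsub _ hin) hle (fun p hp hv => ?_) (by omega)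
      rw [W.hL] at hp
      rcases List.mem_append.1 hp with hp | hp
      · exact absurd (W.lt p hp) (not_lt.2 hv)
      rcases List.mem_append.1 hp with hp | hp
      · exact hmin p hp hv
      · exact (hsL.2.1.2.2 _ hin p hp).le

/-- The skip list holds the map `ι` from characters to numbers (`0` for absent characters); there
are `σ` characters in the map, `n` is the length of the text, and `N` the first unused node. -/
structure CharMap (M : ℕ → ℕ) (chr : ℕ → Option A) (n : ℕ) (ι : A → ℕ) (σ N : ℕ)
    (h m d c : ℕ) (L : List (ℕ × ℕ)) : Prop where
  sibs : Sibs M (SkipTree M N h) m d L c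
  le4 : m ≤ 4
  top : M 61 = 64 * d
  free : M 60 = 64 * N
  hN : N = c + 1
  sorted : KeySorted chr L
  last : ∃ L₀, L = L₀ ++ [(0, 0)]
  code_le : ∀ p ∈ L, p.1 ≤ n
  entry : ∀ p ∈ L, (p.1 = 0 ∧ p.2 = 0) ∨ ∃ a, keyChr chr p.1 = some a ∧ p.2 = 64 * ι a ∧ ι a ≠ 0
  mem : ∀ a, ι a ≠ 0 → ∃ p ∈ L, keyChr chr p.1 = some a
  len : L.length = σ + 1

theorem keyOf_eq_coe {a : A} : keyOf chr k = a ↔ keyChr chr k = some a := by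
  unfold keyOf
  cases keyChr chr k <;> simp

theorem keyOf_zero : keyOf chr 0 = ⊤ := by simp [keyOf, keyChr]

/-- As a tree of height `h` has at least `2 ^ h` leaves and at most four children per node, the time is
logarithmic in the number of characters. -/
theorem CharMap.skipFind_wp {n σ : ℕ} {ι : A → ℕ} (H : CharMap M chr n ι σ N h m d c L)
    (hB : 64 * NB ≤ B) (hNN : N ≤ NB) (hn : n < B) (h61 : 61 < B) (hM : s.mem.num = M)
    (hchr : s.mem.chr = chr) (h9 : s.creg 9 = none) (h1 : s.creg 1 = some v)
    (hR : ∀ s' t, KeepsC 40 48 s s' → s'.mem = s.mem → s'.reg 40 = 64 * ι v →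
      t ≤ 70 * (h + 1) + 20 → R s' t) : WP B skipFind s R := by
  have hex : ∃ p ∈ L, (v : WithTop A) ≤ keyOf chr p.1 := by
    obtain ⟨L₀, e⟩ := H.last
    exact ⟨(0, 0), by simp [e], by simp [keyOf_zero]⟩
  have hLB : ∀ p ∈ L, p.1 < B := fun p hp => (H.code_le p hp).trans_lt hn
  have := skipDescend_wp (v := v) hB hNN h H.sibs H.le4
    (s := (s.setReg 99 61).setReg 46 (64 * d)) (by simp [hM]) (by simp [hchr]) hLB hex H.sorted
    (by simp [h9]) (by simp [h1]) (by simp)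
    (R := fun s' t => WP B (loadKey 46 ;; .ite (.clt 1 2) (.const 40 0) (ldf 40 46 27)) s'
      (fun s'' t' => R s'' (2 + (t + t')))) ?_
  · simp only [skipFind, wp_seq, wp_lds, h61, true_and, hM, H.top] at this ⊢
    refine this.mono fun s₁ t₁ h => h.mono fun s₂ t₂ h => h.mono fun s₃ t₃ h =>
        h.mono fun s₄ t₄ h => h.mono fun s₅ t₅ h => h.mono fun s₆ t₆ h => ?_
    convert h using 1
    ring
  · intro s' t i hk hmem e46 hi1 hi2 hin hle hmin ht
    have b1 : 64 * i + 26 < B := by omega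
    have b2 : 64 * i + 27 < B := by omega
    have hM' : s'.mem.num = M := by rw [hmem]; simp [hM]
    have hchr' : s'.mem.chr = chr := by rw [hmem]; simp [hchr]
    rw [wp_seq]
    refine loadKey_wp (i := i) (by decide) e46 b1 (by rw [hM']; exact hLB _ hin)
      (by simp [hk.1, h9]) ?_
    intro s₁ t₁ hk₁ hmem₁ hc2 ht₁
    have e46' : s₁.reg 46 = 64 * i := by simp [hk₁.2.2, e46]
    have hk2 : KeepsC 40 48 s s₁ := by simpa using hk.trans (hk₁.mono (by omega) (by omega))
    have hmem2 : s₁.mem = s.mem := by rw [hmem₁, hmem]; simp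
    have h1' : s₁.creg 1 = some v := by simp [hk2.1, h1]
    rw [hM', hchr'] at hc2
    have hc2' : s₁.creg 2 = keyChr s₁.mem.chr (M (64 * i + 26)) := by
      rw [hc2, hmem2, hchr]
    have absent : (v : WithTop A) < keyOf chr (M (64 * i + 26)) → ι v = 0 := by
      intro hlt
      by_contra h0
      obtain ⟨p, hp, hpv⟩ := H.mem v h0
      rw [← keyOf_eq_coe] at hpv
      have := hmin p hp hpv.ge
      rw [hpv] at this
      exact absurd hlt (not_lt.2 this)
    rw [wp_ite]
    refine ⟨fun hlt => ?_, fun hge => ?_⟩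
    · rw [wp_const]
      refine ⟨by omega, ?_⟩
      have hlt' : (v : WithTop A) < keyOf chr (M (64 * i + 26)) := by
        rw [Test.holds_clt] at hlt
        obtain ⟨a, b, h3, h4, h5⟩ := hlt
        rw [h1'] at h3
        rw [hc2] at h4
        obtain rfl := Option.some.inj h3
        rw [keyOf_eq_coe.2 h4]
        exact WithTop.coe_lt_coe.2 h5
      exact hR _ _ (by simpa using hk2) (by simp [hmem2]) (by simp [absent hlt']) (by omega)
    · rw [wp_ldf (by decide), e46', hmem2, hM]
      refine ⟨b2, ?_⟩
      refine hR _ _ (by simpa using hk2) (by simp [hmem2]) ?_ (by omega)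
      simp only [State.setReg_reg, if_true]
      rcases H.entry _ hin with ⟨h3, h4⟩ | ⟨a, h3, h4, h5⟩ <;> simp only at h3 h4
      · rw [h4, absent (by rw [h3, keyOf_zero]; exact WithTop.coe_lt_top v)]
      · have := (keyOf_eq_coe.2 h3)
        rw [clt_keyOf' h1' hc2' (by rw [hmem2, hchr, this]; simp), hmem2, hchr, this] at hge
        rw [this] at hle
        rw [h4, le_antisymm (not_lt.1 fun h7 => hge (WithTop.coe_lt_coe.2 h7)) (WithTop.coe_le_coe.1 hle)]

end Search

/-! ### Insertion into the skip list -/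

/-- Register `49` becomes `1` if there are four siblings, and `0` otherwise. The first of them is in
register `47`, and the code of the last one in register `48`. The second and the third one
go to the registers `52` and `53`. -/
def skipFull : Prog :=
  .const 49 0 ;; ldf 54 47 26 ;; .ite (.eq 54 48) .nop
    (ldf 52 47 24 ;; ldf 54 52 26 ;; .ite (.eq 54 48) .nop
      (ldf 53 52 24 ;; ldf 54 53 26 ;; .ite (.eq 54 48) .nop (.const 49 1)))

/-- Insert a new leaf before the leaf in register `46`. The data of the old leaf move to the new
node. -/
def skipLeaf : Prog :=
  lds 52 60 ;; addk 54 52 64 ;; sts 60 54 ;; ldf 54 46 24 ;; stf 52 24 54 ;; ldf 54 46 26 ;;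
  stf 52 26 54 ;; ldf 54 46 27 ;; stf 52 27 54 ;; stf 52 25 45 ;; stf 52 28 45 ;; stf 46 24 52 ;;
  stf 46 26 50 ;; stf 46 27 51 ;; .const 55 0

/-- Split the node in register `46`, whose second and third child are in the registers `52` and `53`;
register `47` becomes the first child of the part where the insertion is to be continued. -/
def skipSplit : Prog :=
  lds 56 60 ;; addk 54 56 64 ;; sts 60 54 ;; ldf 54 46 24 ;; stf 56 24 54 ;; stf 56 25 53 ;;
  stf 56 26 48 ;; ldf 54 46 28 ;; stf 56 28 54 ;; ldf 54 52 26 ;; stf 46 26 54 ;; stf 46 24 56 ;;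
  loadKey 46 ;; .ite (.clt 2 1) (.copy 47 53) .nop

/-- One level of the insertion. -/
def skipInsStep : Prog :=
  skipWalk ;; ldf 47 46 25 ;; .const 45 0 ;;
  .ite (.eq 47 45) skipLeaf
    (ldf 48 46 26 ;; skipFull ;; .const 45 0 ;; .ite (.eq 49 45) .nop skipSplit ;; .copy 46 47) ;;
  .const 45 0

/-- The insertion below the siblings that start in register `46`. -/
def skipInsLoop : Prog := .loop (.neg (.eq 55 45)) skipInsStep

/-- If there are four siblings at the top level, they get a parent. -/
def skipGrow : Prog :=
  lds 47 61 ;; .const 48 0 ;; skipFull ;; .const 45 0 ;; .ite (.eq 49 45) .nop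
    (lds 46 60 ;; addk 54 46 64 ;; sts 60 54 ;; stf 46 25 47 ;; stf 46 26 48 ;; ldf 54 47 28 ;;
      addk 54 54 1 ;; stf 46 28 54 ;; stf 46 24 45 ;; sts 61 46)

/-- Insert the character in register `1`, which has not been inserted before, with the code in
register `50` and the pointer in register `51`. -/
def skipInsert : Prog :=
  skipGrow ;; lds 46 61 ;; .const 55 1 ;; .const 45 0 ;; skipInsLoop

/-- The cells of the skip list, apart from the pointer to the top level. -/
abbrev SkipCell (a : ℕ) : Prop := a = 60 ∨ (64 ≤ a ∧ 24 ≤ a % 64 ∧ a % 64 ≤ 28)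

/-- The outcome of the insertion of the entry `(k, o)` with key `v` below siblings. -/
structure InsResult {A : Type u} [LinearOrder A] (chr : ℕ → Option A) (v : A) (k o : ℕ)
    (M M' : ℕ → ℕ) (N N' h m m' d c c' : ℕ) (L L₁ L₂ : List (ℕ × ℕ)) : Prop where
  sibs : Sibs M' (SkipTree M' N' h) m' d (L₁ ++ (k, o) :: L₂) c'
  hL : L = L₁ ++ L₂
  lt : ∀ p ∈ L₁, keyOf chr p.1 < v
  gt : ∀ p ∈ L₂, (v : WithTop A) < keyOf chr p.1
  hm : m' ≤ m + 1
  hm' : m ≤ m'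
  count : N' + c = N + c'
  hN : N ≤ N'
  hN' : N' ≤ N + h + 1
  free : M' 60 = 64 * N'
  frame : ∀ a, ¬ SkipCell a → M' a = M a
  same : ∀ i, 1 ≤ i → i < N → ¬ (M (64 * i + 28) ≤ h ∧ M (64 * i + 26) ∈ L.map Prod.fst) →
    ∀ f, 24 ≤ f → f ≤ 28 → M' (64 * i + f) = M (64 * i + f)

section Insert

variable {A : Type u} [LinearOrder A] {B NB : ℕ}
  {M M' : ℕ → ℕ} {chr : ℕ → Option A} {N m d c k h e o c₁ m₁ m₂ c₂ c₃ d' d₂ d₃ : ℕ}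
  {L L₁ L₂ L₃ : List (ℕ × ℕ)} {v : A} {s : State A}
  {R : State A → ℕ → Prop}

theorem KeySorted.nodup (h : KeySorted chr L) : (L.map Prod.fst).Nodup :=
  List.Pairwise.imp (fun hlt e => absurd hlt (by rw [e]; exact lt_irrefl _)) h

theorem KeySorted.disjoint (h : ∀ p ∈ L₁, ∀ q ∈ L₂, keyOf chr p.1 < keyOf chr q.1)
    (h1 : k ∈ L₁.map Prod.fst) : k ∉ L₂.map Prod.fst := by
  intro h2
  obtain ⟨p, hp, rfl⟩ := List.mem_map.1 h1
  obtain ⟨q, hq, e⟩ := List.mem_map.1 h2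
  have := h p hp q hq
  rw [e] at this
  exact lt_irrefl _ this

/-- The code of the last key below the parent identifies the last sibling, so counting up to four siblings
takes constant time. -/
theorem skipFull_wp (hB : 64 * NB ≤ B) (hNN : N ≤ NB) (H : Sibs M (SkipTree M N h) m d L c)
    (hm : m ≤ 4) (hs : KeySorted chr L) {L₀ : List (ℕ × ℕ)} (hL : L = L₀ ++ [(k, o)])
    (hM : s.mem.num = M) (h47 : s.reg 47 = 64 * d) (h48 : s.reg 48 = k)
    (hR : ∀ s' t, KeepsR 49 55 s s' → s'.mem = s.mem →
      (s'.reg 50 = s.reg 50 ∧ s'.reg 51 = s.reg 51 ∧ s'.reg 55 = s.reg 55) →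
      (s'.reg 49 = 0 ∧ m ≤ 3) ∨ (s'.reg 49 = 1 ∧ m = 4 ∧ ∃ d₂ d₃ La Lb ca cb La' o',
        s'.reg 52 = 64 * d₂ ∧ s'.reg 53 = 64 * d₃ ∧ L = La ++ Lb ∧ c = ca + cb ∧
        Sibs M (SkipTree M N h) 2 d La ca ∧ Sibs M (SkipTree M N h) 2 d₃ Lb cb ∧
        La = La' ++ [(M (64 * d₂ + 26), o')] ∧ 1 ≤ d₂ ∧ d₂ < N) → t ≤ 30 → R s' t) :
    WP B skipFull s R := by
  have hnd := hs.nodup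
  have hlast : ∀ {L₁ L₂ : List (ℕ × ℕ)}, L = L₁ ++ L₂ → L₂ ≠ [] → k ∈ L₂.map Prod.fst := by
    intro L₁ L₂ e hne
    obtain ⟨L₂', x, rfl⟩ := List.eq_nil_or_concat L₂ |>.resolve_left hne
    rw [hL, ← List.concat_append] at e
    have : (k, o) = x := by
      have := congrArg List.getLast? e
      simpa using this
    simp [← this]
  have hnot : ∀ {L₁ L₂ : List (ℕ × ℕ)}, L = L₁ ++ L₂ → L₂ ≠ [] → ∀ {k'}, k' ∈ L₁.map Prod.fst →
      k' ≠ k := by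
    intro L₁ L₂ e hne k' hk' e'
    rw [e, List.map_append, List.nodup_append] at hnd
    exact hnd.2.2 _ hk' _ (hlast e hne) e'
  have hone : ∀ {L₁ L₂ : List (ℕ × ℕ)} {i c'}, L = L₁ ++ L₂ → SkipTree M N h i L₂ c' →
      M (64 * i + 26) = k := by
    intro L₁ L₂ i c' e ht
    obtain ⟨-, -, -, L', o', e'⟩ := ht.root
    rw [e', hL, ← List.append_assoc] at e
    have := congrArg List.getLast? e
    simp at this
    exact this.1.symm
  have hB1 : 1 ≤ B := by have := H.first; omega
  have hfd := H.first
  have b1 : 64 * d + 26 < B := by omega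
  have b2 : 64 * d + 24 < B := by omega
  cases H with
  | one H1 =>
    have e1 := hone (L₁ := []) rfl H1
    simp [skipFull, h47, h48, hM, b1, e1]
    exact hR _ _ (by simp) (by simp) (by simp) (.inl ⟨by simp, by omega⟩) (by omega)
  | @more _ j m L₁ L₂ c₁ c₂ H1 hj H2 =>
    have e1 := hnot rfl H2.last H1.code_mem
    have hfj := H2.first
    have b3 : 64 * j + 26 < B := by omega
    have b4 : 64 * j + 24 < B := by omega
    cases H2 with
    | one H2 =>
      have e2 := hone rfl H2
      simp [skipFull, h47, h48, hM, b1, b2, b3, hj, e1, e2]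
      exact hR _ _ (by simp) (by simp) (by simp) (.inl ⟨by simp, by omega⟩) (by omega)
    | @more _ j' m' L₂ L₃ c₂ c₃ H2 hj' H3 =>
      have e2 := hnot (L₁ := L₁ ++ L₂) (L₂ := L₃) (by simp) H3.last
        (k' := M (64 * j + 26)) (by rw [List.map_append]; exact List.mem_append_right _ H2.code_mem)
      have hfj' := H3.first
      have b5 : 64 * j' + 26 < B := by omega
      cases H3 with
      | one H3 =>
        have e3 := hone (L₁ := L₁ ++ L₂) (by simp) H3
        simp [skipFull, h47, h48, hM, b1, b2, b3, b4, b5, hj, hj', e1, e2, e3]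
        refine hR _ _ (by simp) (by simp) (by simp) (.inl ⟨by simp, by omega⟩)
          (by omega)
      | @more _ j'' m'' L₃ L₄ c₃ c₄ H3 hj'' H4 =>
        have e3 := hnot (L₁ := L₁ ++ (L₂ ++ L₃)) (L₂ := L₄) (by simp) H4.last
          (k' := M (64 * j' + 26)) (by
            rw [List.map_append, List.map_append]
            exact List.mem_append_right _ (List.mem_append_right _ H3.code_mem))
        have hm1 : m'' = 1 := by have := H4.pos; omega
        subst hm1
        simp [skipFull, h47, h48, hM, b1, b2, b3, b4, b5, hj, hj', e1, e2, e3, hB1]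
        obtain ⟨La', o', hLa⟩ := H2.root.2.2.2
        refine hR _ _ (by simp) (by simp) (by simp)
          (.inr ⟨by simp, rfl, j, j', L₁ ++ L₂, L₃ ++ L₄, c₁ + c₂, c₃ + c₄, L₁ ++ La', o',
            by simp, by simp, by simp, by ring, .more H1 hj (.one H2), .more H3 hj'' H4, ?_,
            H2.root.1, H2.root.2.1⟩)
          (by omega)
        conv_lhs => rw [hLa]
        simp

/-- Insertion below node `e` of a sibling list gives insertion into the sibling list. -/
theorem WalkResult.reassemble {N' : ℕ}
    (W : WalkResult M N (h + 1) chr v m d L c m₁ m₂ L₁ L₂ L₃ c₁ c₂ c₃ e) (hs : KeySorted chr L)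
    {m' m'' c' c'' : ℕ} {K₁ K₂ : List (ℕ × ℕ)} (hd' : M (64 * e + 25) = 64 * d') (hm' : 2 ≤ m')
    (hm3 : m' ≤ 3) (hc' : c₂ = c' + 1)
    (I : InsResult chr v k o M M' N N' h m' m'' d' c' c'' L₂ K₁ K₂) :
    InsResult chr v k o M M' N N' (h + 1) m m d c (c₁ + (c'' + 1 + c₃)) L (L₁ ++ K₁) (K₂ ++ L₃) := by
  have hs' := hs
  rw [W.hL, KeySorted.append, KeySorted.append] at hs'
  obtain ⟨-, ⟨hs2, -, hs23⟩, hs123⟩ := hs'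
  obtain ⟨e1, e2, e3, L₀, o', e4⟩ := W.tree.root
  have hsame : ∀ L', (∀ k ∈ L'.map Prod.fst, k ∉ L₂.map Prod.fst) → SkipSame M M' N (h + 1) L' := by
    intro L' hd i h1 h2 h3 h4 f h5 h6
    exact I.same i h1 h2 (fun hh => hd _ h4 hh.2) f h5 h6
  have hse := I.same e e1 e2 (by omega)
  have seg := W.seg.frame I.hN (hsame L₁ fun k hk => KeySorted.disjoint
    (fun p hp q hq => hs123 p hp q (List.mem_append_left _ hq)) hk)
  have hvlast : (v : WithTop A) < keyOf chr (M (64 * e + 26)) := by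
    refine lt_of_le_of_ne W.le fun heq => ?_
    have : (M (64 * e + 26), o') ∈ K₁ ++ K₂ := by rw [← I.hL, e4]; simp
    rcases List.mem_append.1 this with h | h
    · exact absurd (I.lt _ h) (by simp [← heq])
    · exact absurd (I.gt _ h) (by simp [← heq])
  have hK2 : K₂ ≠ [] := by
    rintro rfl
    have : (M (64 * e + 26), o') ∈ K₁ := by
      have := I.hL; rw [e4] at this; simp at this; simp [← this]
    exact absurd (I.lt _ this) (not_lt.2 hvlast.le)
  have tree : SkipTree M' N' (h + 1) e (K₁ ++ (k, o) :: K₂) (c'' + 1) := by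
    refine ⟨e1, by have := I.hN; omega, ?_, ?_, d', m'', c'', ?_, ?_, ?_, I.sibs, rfl⟩
    · rw [hse 28 (by omega) (by omega), e3]
    · obtain ⟨K₂', x, rfl⟩ := List.eq_nil_or_concat K₂ |>.resolve_left hK2
      have := I.hL
      rw [e4] at this
      have := congrArg List.getLast? this
      simp at this
      refine ⟨K₁ ++ (k, o) :: K₂', o', ?_⟩
      rw [hse 26 (by omega) (by omega)]
      simp [this]
    · rw [hse 25 (by omega) (by omega), hd']
    · have := I.hm'; omega
    · have := I.hm; omega
  have rest : SibRest M' (SkipTree M' N' (h + 1)) e m₂ L₃ c₃ := by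
    rcases W.rest with hh | ⟨j, hj, hh⟩
    · exact .inl hh
    · refine .inr ⟨j, by rw [hse 24 (by omega) (by omega), hj], hh.frame I.hN (hsame L₃ ?_)⟩
      exact fun k hk hk' => KeySorted.disjoint hs23 hk' hk
  refine ⟨?_, ?_, ?_, ?_, by omega, le_rfl, ?_, I.hN, ?_, I.free, I.frame, ?_⟩
  · have := seg.append (rest.cons tree)
    rw [W.hm]
    convert this using 1
    · ring
    · simp
  · rw [W.hL, I.hL]; simp
  · intro p hp
    rcases List.mem_append.1 hp with hp | hp
    · exact W.lt p hp
    · exact I.lt p hp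
  · intro p hp
    rcases List.mem_append.1 hp with hp | hp
    · exact I.gt p hp
    · exact hvlast.trans (hs23 (_, o') (by rw [e4]; simp) p hp)
  · have := I.count; have := W.hc; omega
  · have := I.hN'; omega
  · intro i h1 h2 h3 f h5 h6
    refine I.same i h1 h2 (fun hh => h3 ⟨by omega, ?_⟩) f h5 h6
    rw [W.hL, List.map_append, List.map_append]
    exact List.mem_append_right _ (List.mem_append_left _ hh.2)

/-- The memory `M'` arises from `M` by splitting node `e` with second and third child `d₂`, `d₃` into
`e` and a new node `N`. -/
structure SplitMem (M M' : ℕ → ℕ) (N e d₂ d₃ : ℕ) : Prop where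
  free : M' 60 = 64 * (N + 1)
  n24 : M' (64 * N + 24) = M (64 * e + 24)
  n25 : M' (64 * N + 25) = 64 * d₃
  n26 : M' (64 * N + 26) = M (64 * e + 26)
  n28 : M' (64 * N + 28) = M (64 * e + 28)
  e24 : M' (64 * e + 24) = 64 * N
  e26 : M' (64 * e + 26) = M (64 * d₂ + 26)
  other : ∀ a, a ≠ 60 → (a < 64 * N + 24 ∨ 64 * N + 28 < a) → a ≠ 64 * e + 24 → a ≠ 64 * e + 26 →
    M' a = M a

theorem SibSeg.snoc {T : ℕ → List (ℕ × ℕ) → ℕ → Prop} {j : ℕ} (h : SibSeg M T m d L₁ c₁ e)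
    (ht : T e L₂ c₂) (hj : M (64 * e + 24) = 64 * j) : SibSeg M T (m + 1) d (L₁ ++ L₂) (c₁ + c₂) j := by
  induction h with
  | nil => simpa using SibSeg.cons ht hj .nil
  | cons h1 h2 _ ih =>
    have hh := SibSeg.cons h1 h2 (ih ht hj)
    rw [← List.append_assoc, ← add_assoc] at hh
    exact hh

/-- Splitting the node `e` in place leaves a chain with one more sibling and the same entries. -/
theorem WalkResult.split {La Lb : List (ℕ × ℕ)} {ca cb : ℕ}
    (W : WalkResult M N (h + 1) chr v m d L c m₁ m₂ L₁ (La ++ Lb) L₃ c₁ (ca + cb + 1) c₃ e)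
    (hs : KeySorted chr L) (hd' : M (64 * e + 25) = 64 * d')
    (ha : Sibs M (SkipTree M N h) 2 d' La ca) (hb : Sibs M (SkipTree M N h) 2 d₃ Lb cb)
    {La' : List (ℕ × ℕ)} {o' : ℕ} (hLa : La = La' ++ [(M (64 * d₂ + 26), o')])
    (S : SplitMem M M' N e d₂ d₃) :
    ∃ e' d'' m₁ m₂ L₁ L₂ L₃ c₁ c₂ c₃,
      WalkResult M' (N + 1) (h + 1) chr v (m + 1) d L (c + 1) m₁ m₂ L₁ L₂ L₃ c₁ (c₂ + 1) c₃ e' ∧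
      M' (64 * e' + 25) = 64 * d'' ∧ Sibs M' (SkipTree M' (N + 1) h) 2 d'' L₂ c₂ ∧
      d'' = if keyOf chr (M (64 * d₂ + 26)) < v then d₃ else d' := by
  have hs' := hs
  rw [W.hL, KeySorted.append, KeySorted.append, KeySorted.append] at hs'
  obtain ⟨-, ⟨⟨hsa, hsb, hsab⟩, -, hs23⟩, hs123⟩ := hs'
  obtain ⟨e1, e2, e3, L₀, o, e4⟩ := W.tree.root
  have hWle := W.le
  have hsame : ∀ L', (∀ k ∈ L'.map Prod.fst, k ∉ (La ++ Lb).map Prod.fst) →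
      SkipSame M M' N (h + 1) L' := by
    intro L' hd i h1 h2 h3 h4 f h5 h6
    have : i ≠ e := by
      rintro rfl; exact hd _ h4 W.tree.code_mem
    exact S.other _ (by omega) (by omega) (by omega) (by omega)
  have hlow : ∀ L', SkipSame M M' N h L' := by
    intro L' i h1 h2 h3 h4 f h5 h6
    have : i ≠ e := by rintro rfl; omega
    exact S.other _ (by omega) (by omega) (by omega) (by omega)
  have seg := W.seg.frame (Nat.le_succ N) (hsame L₁ fun k hk => KeySorted.disjoint
    (fun p hp q hq => hs123 p hp q (List.mem_append_left _ hq)) hk)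
  have rest : SibRest M' (SkipTree M' (N + 1) (h + 1)) N m₂ L₃ c₃ := by
    rcases W.rest with hh | ⟨j, hj, hh⟩
    · exact .inl hh
    · refine .inr ⟨j, by rw [S.n24, hj], hh.frame (Nat.le_succ N) (hsame L₃ ?_)⟩
      exact fun k hk hk' => KeySorted.disjoint hs23 hk' hk
  have ha' := ha.frame (Nat.le_succ N) (hlow La)
  have hb' := hb.frame (Nat.le_succ N) (hlow Lb)
  have he25 : M' (64 * e + 25) = 64 * d' := by
    rw [S.other _ (by omega) (by omega) (by omega) (by omega), hd']
  have te : SkipTree M' (N + 1) (h + 1) e La (ca + 1) := by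
    refine ⟨e1, by omega, ?_, ⟨La', o', by rw [S.e26]; exact hLa⟩, d', 2, ca, he25, le_rfl,
      by omega, ha', rfl⟩
    rw [S.other _ (by omega) (by omega) (by omega) (by omega), e3]
  have hLb : ∃ Lb', Lb = Lb' ++ [(M (64 * e + 26), o)] := by
    obtain ⟨Lb', x, rfl⟩ := List.eq_nil_or_concat Lb |>.resolve_left hb.last
    have := congrArg List.getLast? e4
    simp at this
    exact ⟨Lb', by simp [this]⟩
  obtain ⟨Lb', hLb⟩ := hLb
  have tN : SkipTree M' (N + 1) (h + 1) N Lb (cb + 1) := by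
    refine ⟨by omega, by omega, by rw [S.n28, e3], ⟨Lb', o, by rw [S.n26]; exact hLb⟩, d₃, 2, cb,
      S.n25, le_rfl, by omega, hb', rfl⟩
  have hWm := W.hm
  have hWc := W.hc
  by_cases hlt : keyOf chr (M (64 * d₂ + 26)) < v
  · refine ⟨N, d₃, m₁ + 1, m₂, L₁ ++ La, Lb, L₃, c₁ + (ca + 1), cb, c₃,
      ⟨?_, tN, rest, by omega, by rw [W.hL]; simp, by omega, ?_, by rw [S.n26]; exact hWle⟩, S.n25, hb',
      by rw [if_pos hlt]⟩
    · exact seg.snoc te S.e24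
    · intro p hp
      rcases List.mem_append.1 hp with hp | hp
      · exact W.lt p hp
      · refine lt_of_le_of_lt ?_ hlt
        rw [hLa] at hp hsa
        rw [KeySorted.append] at hsa
        rcases List.mem_append.1 hp with hp | hp
        · exact (hsa.2.2 p hp (M (64 * d₂ + 26), o') (by simp)).le
        · simp at hp; rw [hp]
  · refine ⟨e, d', m₁, m₂ + 1, L₁, La, Lb ++ L₃, c₁, ca, cb + 1 + c₃,
      ⟨seg, te, .inr ⟨N, S.e24, rest.cons tN⟩, by omega, by rw [W.hL]; simp, by omega, W.lt,
        by rw [S.e26]; exact not_lt.1 hlt⟩, he25, ha', by rw [if_neg hlt]⟩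

/-- Composition of a split with an insertion. -/
theorem InsResult.split {M'' : ℕ → ℕ} {N' c' : ℕ} (S : SplitMem M M' N e d₂ d₃) (he : 1 ≤ e)
    (heN : e < N) (hle : M (64 * e + 28) ≤ h) (hk : M (64 * e + 26) ∈ L.map Prod.fst)
    (I : InsResult chr v k o M' M'' (N + 1) N' h (m + 1) (m + 1) d (c + 1) c' L L₁ L₂)
    (hN' : N' ≤ N + h + 1) : InsResult chr v k o M M'' N N' h m (m + 1) d c c' L L₁ L₂ := by
  have hc := I.count
  have hN := I.hN
  refine ⟨I.sibs, I.hL, I.lt, I.gt, le_rfl, by omega, by omega, by omega, hN', I.free, ?_, ?_⟩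
  · intro a ha
    rw [I.frame a ha, S.other a]
    all_goals omega
  · intro i h1 h2 h3 f h5 h6
    have hie : i ≠ e := by rintro rfl; exact h3 ⟨hle, hk⟩
    have ho : ∀ f, 24 ≤ f → f ≤ 28 → M' (64 * i + f) = M (64 * i + f) := fun f h5 h6 =>
      S.other _ (by omega) (by omega) (by omega) (by omega)
    rw [I.same i h1 (by omega) ?_ f h5 h6, ho f h5 h6]
    rw [ho 28 (by omega) (by omega), ho 26 (by omega) (by omega)]
    exact h3

/-- The memory `M'` arises from `M` by inserting a leaf before leaf `e`. -/
structure LeafMem (M M' : ℕ → ℕ) (N e k o : ℕ) : Prop where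
  free : M' 60 = 64 * (N + 1)
  n24 : M' (64 * N + 24) = M (64 * e + 24)
  n25 : M' (64 * N + 25) = 0
  n26 : M' (64 * N + 26) = M (64 * e + 26)
  n27 : M' (64 * N + 27) = M (64 * e + 27)
  n28 : M' (64 * N + 28) = 0
  e24 : M' (64 * e + 24) = 64 * N
  e26 : M' (64 * e + 26) = k
  e27 : M' (64 * e + 27) = o
  other : ∀ a, a ≠ 60 → (a < 64 * N + 24 ∨ 64 * N + 28 < a) → a ≠ 64 * e + 24 → a ≠ 64 * e + 26 →
    a ≠ 64 * e + 27 → M' a = M a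

/-- The new leaf takes over the data of the leaf `e`, which becomes the leaf of the new entry; so the pointer
to `e` need not be found. -/
theorem WalkResult.leaf (W : WalkResult M N 0 chr v m d L c m₁ m₂ L₁ L₂ L₃ c₁ c₂ c₃ e)
    (hs : KeySorted chr L) (hv : ∀ p ∈ L, keyOf chr p.1 ≠ v) (S : LeafMem M M' N e k o) :
    InsResult chr v k o M M' N (N + 1) 0 m (m + 1) d c (c + 1) L L₁ (L₂ ++ L₃) := by
  have hs' := hs
  rw [W.hL, KeySorted.append, KeySorted.append] at hs'
  obtain ⟨-, ⟨hs2, -, hs23⟩, hs123⟩ := hs'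
  have hT := W.tree
  obtain ⟨e1, e2, e3, e4, e5, e6⟩ := hT
  have hWm := W.hm
  have hWc := W.hc
  have hsame : ∀ L', (∀ k ∈ L'.map Prod.fst, k ∉ L₂.map Prod.fst) → SkipSame M M' N 0 L' := by
    intro L' hd i h1 h2 h3 h4 f h5 h6
    have : i ≠ e := by
      rintro rfl; exact hd _ h4 W.tree.code_mem
    exact S.other _ (by omega) (by omega) (by omega) (by omega) (by omega)
  have seg := W.seg.frame (Nat.le_succ N) (hsame L₁ fun k hk => KeySorted.disjoint
    (fun p hp q hq => hs123 p hp q (List.mem_append_left _ hq)) hk)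
  have rest : SibRest M' (SkipTree M' (N + 1) 0) N m₂ L₃ c₃ := by
    rcases W.rest with hh | ⟨j, hj, hh⟩
    · exact .inl hh
    · refine .inr ⟨j, by rw [S.n24, hj], hh.frame (Nat.le_succ N) (hsame L₃ ?_)⟩
      exact fun k hk hk' => KeySorted.disjoint hs23 hk' hk
  have te : SkipTree M' (N + 1) 0 e [(k, o)] 1 := by
    refine ⟨e1, by omega, ?_, ?_, by rw [S.e26, S.e27], rfl⟩
    · rw [S.other _ (by omega) (by omega) (by omega) (by omega) (by omega), e3]
    · rw [S.other _ (by omega) (by omega) (by omega) (by omega) (by omega), e4]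
  have tN : SkipTree M' (N + 1) 0 N L₂ 1 :=
    ⟨by omega, by omega, S.n28, S.n25, by rw [S.n26, S.n27, e5], rfl⟩
  have hve : (v : WithTop A) < keyOf chr (M (64 * e + 26)) := by
    refine lt_of_le_of_ne W.le fun heq => ?_
    exact hv (M (64 * e + 26), M (64 * e + 27)) (by rw [W.hL, e5]; simp) heq.symm
  refine ⟨?_, W.hL, W.lt, ?_, le_rfl, by omega, by omega, by omega, by omega, S.free, ?_, ?_⟩
  · have := seg.append (Sibs.more te S.e24 (rest.cons tN))
    rw [hWm, hWc, e6, show m₁ + 1 + m₂ + 1 = m₁ + (m₂ + 1 + 1) by omega,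
      show c₁ + (1 + c₃) + 1 = c₁ + (1 + (1 + c₃)) by omega]
    exact this
  · intro p hp
    rcases List.mem_append.1 hp with hp | hp
    · rw [e5] at hp; simp at hp; rw [hp]; exact hve
    · exact hve.trans (hs23 (M (64 * e + 26), M (64 * e + 27)) (by rw [e5]; simp) p hp)
  · intro a ha
    rw [S.other a]
    all_goals omega
  · intro i h1 h2 h3 f h5 h6
    have hie : i ≠ e := by
      rintro rfl; refine h3 ⟨by omega, ?_⟩
      rw [W.hL, e5]; simp
    exact S.other _ (by omega) (by omega) (by omega) (by omega) (by omega)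

theorem skipLeaf_wp (hM : s.mem.num = M) (hB : 64 * (N + 1) ≤ B) (heN : e < N) (h60 : M 60 = 64 * N)
    (h46 : s.reg 46 = 64 * e) (h45 : s.reg 45 = 0) (h50 : s.reg 50 = k) (h51 : s.reg 51 = o)
    (hR : ∀ s' t, KeepsR 52 56 s s' → LeafMem M s'.mem.num N e k o → s'.reg 55 = 0 → t ≤ 60 →
      R s' t) : WP B skipLeaf s R := by
  have b : ∀ f, f < 64 → 64 * N + f < B := by omega
  have b' : ∀ f, f < 64 → 64 * e + f < B := by omega
  have b2 : 64 * N + 64 ≤ B := by omega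
  have b3 : 60 < B := by omega
  simp [skipLeaf, hM, h46, h45, h50, h51, h60, b2, b3, b, b']
  simp (disch := omega) only [upd_ne]
  refine hR _ _ (by simp) ?_ (by simp) (by omega)
  constructor
  all_goals simp only [State.setReg_mem, State.setNum_num, hM]
  all_goals intros
  all_goals simp (disch := omega) only [upd_ne, upd_self]
  ring

theorem skipSplit_wp (hM : s.mem.num = M) (hchr : s.mem.chr = chr) (hB : 64 * (N + 1) ≤ B)
    (heN : e < N) (hdN : d₂ < N) (h60 : M 60 = 64 * N) (hkB : M (64 * d₂ + 26) < B)
    (h9 : s.creg 9 = none) (h1 : s.creg 1 = some v) (h46 : s.reg 46 = 64 * e)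
    (h47 : s.reg 47 = 64 * d') (h48 : s.reg 48 = M (64 * e + 26)) (h52 : s.reg 52 = 64 * d₂)
    (h53 : s.reg 53 = 64 * d₃) (hR : ∀ s' t, KeepsC 44 57 s s' → SplitMem M s'.mem.num N e d₂ d₃ →
      (s'.reg 50 = s.reg 50 ∧ s'.reg 51 = s.reg 51 ∧ s'.reg 55 = s.reg 55) →
      s'.reg 47 = 64 * (if keyOf chr (M (64 * d₂ + 26)) < v then d₃ else d') → t ≤ 60 →
      R s' t) : WP B skipSplit s R := by
  have b : ∀ f, f < 64 → 64 * N + f < B := by omega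
  have b' : ∀ f, f < 64 → 64 * e + f < B := by omega
  have b'' : ∀ f, f < 64 → 64 * d₂ + f < B := by omega
  have b2 : 64 * N + 64 ≤ B := by omega
  have b3 : 60 < B := by omega
  simp [skipSplit, hM, h46, h48, h52, h53, h60, b2, b3, b, b', b'']
  simp (disch := omega) only [upd_ne]
  refine loadKey_wp (y := 46) (i := e) (by decide) (by simp [h46]) (b' 26 (by omega)) ?_ (by simp [h9]) ?_
  · simp only [State.setReg_mem, State.setNum_num, hM]
    simp (disch := omega) only [upd_ne, upd_self]
    exact hkB
  intro s' t hk hmem hc2 ht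
  have hS : SplitMem M s'.mem.num N e d₂ d₃ := by
    rw [hmem]
    constructor
    all_goals simp only [State.setReg_mem, State.setNum_num, hM]
    all_goals intros
    all_goals simp (disch := omega) only [upd_ne, upd_self]
    ring
  have hc2' : s'.creg 2 = keyChr s'.mem.chr (M (64 * d₂ + 26)) := by
    rw [hc2, hk.2.1]
    congr 1
    simp only [State.setReg_mem, State.setNum_num, hM]
    simp (disch := omega) only [upd_ne, upd_self]
  have h1' : s'.creg 1 = some v := by simp [hk.1, h1]
  have hchr' : s'.mem.chr = chr := by rw [hk.2.1]; simp [hchr]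
  have hcl : (∃ a, s'.creg 2 = some a ∧ ∃ x, s'.creg 1 = some x ∧ a < x) ↔
      keyOf chr (M (64 * d₂ + 26)) < v := by
    rw [← hchr', ← clt_keyOf h1' hc2', Test.holds_clt]; simp
  have hC : KeepsC 44 57 s s' := by simpa using hk.mono (hi' := 57) le_rfl (by omega)
  constructor
  · intro a hx x hy hlt
    have hl := hcl.1 ⟨a, hx, x, hy, hlt⟩
    refine hR _ _ (by simpa using hC) (by simpa using hS) (by simp [hk.2.2]) ?_ (by omega)
    rw [if_pos hl]
    simp [hk.2.2, h53]
  · intro hn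
    have hl : ¬ keyOf chr (M (64 * d₂ + 26)) < v := by
      rw [← hcl]; rintro ⟨a, h1, x, h2, h3⟩; exact absurd h3 (not_lt.2 (hn a h1 x h2))
    refine hR _ _ hC hS (by simp [hk.2.2]) ?_ (by omega)
    rw [if_neg hl]
    simp [hk.2.2, h47]

/-- The insertion below at most three siblings at height `h`. Full nodes on the way down are split,
so that there is always room. -/
theorem skipInsLoop_wp (hB : 64 * NB ≤ B) :
    ∀ (h : ℕ) {M : ℕ → ℕ} {N m d c : ℕ} {L : List (ℕ × ℕ)},
    Sibs M (SkipTree M N h) m d L c → m ≤ 3 → N + h + 1 ≤ NB → M 60 = 64 * N →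
    (∀ p ∈ L, p.1 < B) → (∃ p ∈ L, (v : WithTop A) ≤ keyOf chr p.1) → KeySorted chr L →
    (∀ p ∈ L, keyOf chr p.1 ≠ v) → ∀ {s : State A}, s.mem.num = M → s.mem.chr = chr →
    s.creg 9 = none → s.creg 1 = some v → s.reg 46 = 64 * d → s.reg 55 = 1 → s.reg 45 = 0 →
    s.reg 50 = k → s.reg 51 = o → ∀ {R : State A → ℕ → Prop},
    (∀ s' t N' m' c' L₁ L₂, KeepsC 44 57 s s' →
      InsResult chr v k o M s'.mem.num N N' h m m' d c c' L L₁ L₂ →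
      t ≤ 200 * (h + 1) → R s' t) →
    WP B skipInsLoop s R := by
  intro h
  induction h with
  | zero =>
    intro M N m d c L H hm hN h60 hLB hex hs hv s hM hchr h9 h1 h46 h55 h45 h50 h51 R hR
    rw [skipInsLoop, wp_loop]
    refine ⟨fun _ => ?_, fun hh => absurd hh (by simp [h55, h45])⟩
    rw [skipInsStep, wp_seq]
    refine skipWalk_wp (N := N) (NB := NB) hB (by omega) H hM hchr hLB hex hs h9 h1 h46 ?_
    intro s' t m₁ m₂ L₁ L₂ L₃ c₁ c₂ c₃ e hk hmem e46 e2 W ht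
    have hT := W.tree
    obtain ⟨g1, g2, g3, g4, g5, g6⟩ := hT
    subst g6
    have b : 64 * e + 25 < B := by omega
    simp only [wp_seq, wp_ldf, wp_const, wp_ite, e46, b, ne_eq, Nat.reduceEqDiff, not_false_eq_true,
      true_and, zero_le, hmem, hM, g4, Test.holds_eq, State.setReg_reg, if_true, if_false]
    refine ⟨fun _ => ?_, fun hh => absurd trivial hh⟩
    refine skipLeaf_wp (M := M) (N := N) (e := e) (k := k) (o := o) (by simp [hmem, hM]) (by omega)
      g2 h60 (by simp [e46]) (by simp)
      (by simp [hk.2.2 50, h50]) (by simp [hk.2.2 51, h51]) ?_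
    intro s₁ t₁ hk₁ S e55 ht₁
    rw [wp_loop]
    refine ⟨fun hh => absurd hh (by simp [e55]), fun _ => ?_⟩
    have hk' := (hk₁.keepsC.mono (lo' := 44) (hi' := 57) (by omega) (by omega))
    exact hR _ _ _ _ _ _ _ (by simpa using (hk.mono le_rfl (by omega)).trans (by simpa using hk'))
      (by simpa using W.leaf hs hv S) (by omega)
  | succ h ih =>
    intro M N m d c L H hm hN h60 hLB hex hs hv s hM hchr h9 h1 h46 h55 h45 h50 h51 R hR
    rw [skipInsLoop, wp_loop]
    refine ⟨fun _ => ?_, fun hh => absurd hh (by simp [h55, h45])⟩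
    rw [skipInsStep, wp_seq]
    refine skipWalk_wp (N := N) (NB := NB) hB (by omega) H hM hchr hLB hex hs h9 h1 h46 ?_
    intro s' t m₁ m₂ L₁ L₂ L₃ c₁ c₂ c₃ e hk hmem e46 e2 W ht
    have hT := W.tree
    obtain ⟨g1, g2, g3, ⟨L₀, o', g4⟩, d', m', c', g5, g6, g7, g8, hc₂⟩ := hT
    subst hc₂
    have hd1 := g8.first.1
    have b : 64 * e + 25 < B := by omega
    have b' : 64 * e + 26 < B := by omega
    have hsub : ∀ p ∈ L₂, p ∈ L := fun p hp => by rw [W.hL]; simp [hp]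
    have hsL := hs
    rw [W.hL, KeySorted.append, KeySorted.append] at hsL
    simp only [wp_seq, wp_ldf, wp_const, wp_ite, e46, b, b', ne_eq, Nat.reduceEqDiff,
      not_false_eq_true, true_and, zero_le, hmem, hM, g5, Test.holds_eq, State.setReg_reg, if_true,
      if_false, State.setReg_mem]
    refine ⟨fun hh => absurd hh (by omega), fun _ => ?_⟩
    refine skipFull_wp (N := N) (NB := NB) hB (by omega) g8 g7 hsL.2.1.1 g4 (by simp [hmem, hM])
      (by simp) (by simp) ?_
    intro s₁ t₁ hk₁ hmem₁ hr₁ hfull ht₁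
    have hmem₁' : s₁.mem = s.mem := by rw [hmem₁]; simp [hmem]
    have hK : KeepsC 44 57 s s₁ := (hk.mono le_rfl (by omega)).trans
      (by simpa using hk₁.keepsC.mono (lo' := 44) (hi' := 57) (by omega) (by omega))
    have hrr : s₁.reg 50 = s.reg 50 ∧ s₁.reg 51 = s.reg 51 ∧ s₁.reg 55 = s.reg 55 := by simp [hr₁, hk.2.2]
    have e47 : s₁.reg 47 = 64 * d' := by simp [hk₁.2.2]
    have e46' : s₁.reg 46 = 64 * e := by simp [hk₁.2.2, e46]
    have e48 : s₁.reg 48 = M (64 * e + 26) := by simp [hk₁.2.2]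
    rcases hfull with ⟨f49, fm⟩ | ⟨f49, fm, d₂, d₃, La, Lb, ca, cb, La', o₂, f52, f53, fL, fc, fa, fb,
      fLa, fd1, fd2⟩
    · refine ⟨fun _ => ?_, fun hh => absurd f49 hh⟩
      simp only [wp_nop, wp_copy, State.setReg_reg, if_false,
        Nat.reduceEqDiff, e47]
      refine ih g8 fm (by omega) h60 (fun p hp => hLB p (hsub p hp))
        ⟨_, W.tree.root_mem.choose_spec, W.le⟩ hsL.2.1.1 (fun p hp => hv p (hsub p hp))
        (by simp [hmem₁', hM]) (by simp [hmem₁', hchr]) (by simp [hK.1 9, h9]) (by simp [hK.1 1, h1])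
        (by simp) (by simp [hrr, h55]) (by simp) (by simp [hrr, h50]) (by simp [hrr, h51]) ?_
      intro s₂ t₂ N' m'' c'' K₁ K₂ hk₂ I ht₂
      exact hR _ _ _ _ _ _ _ (hK.trans (by simpa using hk₂)) (W.reassemble hs g5 g6 fm rfl I) (by omega)
    · refine ⟨fun hh => absurd (f49.symm.trans hh) (by omega), fun _ => ?_⟩
      have hd₂B : M (64 * d₂ + 26) < B :=
        hLB (M (64 * d₂ + 26), o₂) (hsub _ (by rw [fL, fLa]; simp))
      refine skipSplit_wp (M := M) (chr := chr) (v := v) (N := N) (e := e) (d' := d') (d₂ := d₂)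
        (d₃ := d₃) (by simp [hmem₁', hM]) (by simp [hmem₁', hchr]) (by omega) g2 fd2 h60 hd₂B
        (by simp [hK.1 9, h9]) (by simp [hK.1 1, h1]) (by simp [e46']) (by simp [e47]) (by simp [e48])
        (by simp [f52]) (by simp [f53]) ?_
      intro s₂ t₂ hk₂ S hr₂ e47' ht₂
      subst fL fc
      obtain ⟨e', d'', m₁', m₂', L₁', L₂', L₃', c₁', c₂', c₃', W', q25, qs, qd⟩ :=
        W.split hs g5 (by rw [← fm] at *; exact fa) fb fLa S
      rw [← qd] at e47'
      have hsub' : ∀ p ∈ L₂', p ∈ L := fun p hp => by rw [W'.hL]; simp [hp]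
      have hsL' := hs
      rw [W'.hL, KeySorted.append, KeySorted.append] at hsL'
      simp only [wp_copy, e47']
      refine ih qs (by omega) (by omega) S.free (fun p hp => hLB p (hsub' p hp))
        ⟨_, W'.tree.root_mem.choose_spec, W'.le⟩ hsL'.2.1.1 (fun p hp => hv p (hsub' p hp))
        (by simp) (by simp [hk₂.2.1, hmem₁', hchr]) (by simp [hk₂.1 9, hK.1 9, h9])
        (by simp [hk₂.1 1, hK.1 1, h1])
        (by simp) (by simp [hr₂, hrr, h55]) (by simp) (by simp [hr₂, hrr, h50])
        (by simp [hr₂, hrr, h51]) ?_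
      intro s₃ t₃ N' m'' c'' K₁ K₂ hk₃ I ht₃
      have I' := W'.reassemble hs q25 le_rfl (by omega) rfl I
      refine hR _ _ _ _ _ _ _ (hK.trans ((by simpa using hk₂ : KeepsC 44 57 s₁ s₂).trans
        (by simpa using hk₃)))
        (InsResult.split S g1 g2 g3.le ?_ I' ?_) (by omega)
      · rw [W.hL, List.map_append, List.map_append]
        exact List.mem_append_right _ (List.mem_append_left _ W.tree.code_mem)
      · have := I.hN'; omega

/-- The search structure survives extensions of the text, as a code only refers to a position that has been
read. -/
theorem CharMap.frame {chr' : ℕ → Option A} {n n' : ℕ} {ι : A → ℕ} {σ : ℕ}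
    (H : CharMap M chr n ι σ N h m d c L) (hn : n ≤ n') (hchr : ∀ i < n, chr' i = chr i)
    (hM : ∀ a, SkipCell a ∨ a = 61 → M' a = M a) : CharMap M' chr' n' ι σ N h m d c L := by
  have hkc : ∀ p ∈ L, keyChr chr' p.1 = keyChr chr p.1 := by
    intro p hp
    unfold keyChr
    split_ifs with h0
    · rfl
    · exact hchr _ (by have := H.code_le p hp; omega)
  have hko : ∀ p ∈ L, keyOf chr' p.1 = keyOf chr p.1 := fun p hp => by
    unfold keyOf; rw [hkc p hp]
  refine ⟨H.sibs.frame le_rfl ?_, H.le4, ?_, ?_, H.hN, ?_, H.last,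
    fun p hp => (H.code_le p hp).trans hn, ?_, ?_, H.len⟩
  · intro i h1 h2 h3 h4 f h5 h6
    exact hM _ (.inl (by omega))
  · rw [hM _ (.inr rfl), H.top]
  · rw [hM _ (.inl (.inl rfl)), H.free]
  · have := H.sorted
    unfold KeySorted at *
    rw [List.pairwise_map] at *
    refine this.imp_of_mem fun {a b} ha hb hab => ?_
    rwa [hko a ha, hko b hb]
  · intro p hp; rw [hkc p hp]; exact H.entry p hp
  · intro a ha
    obtain ⟨p, hp, h⟩ := H.mem a ha
    exact ⟨p, hp, by rw [hkc p hp, h]⟩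

theorem SkipTree.length_le : ∀ {h i c : ℕ} {L : List (ℕ × ℕ)}, SkipTree M N h i L c → L.length ≤ c := by
  intro h
  induction h with
  | zero => rintro i c L ⟨-, -, -, -, rfl, rfl⟩; simp
  | succ h ih =>
    rintro i c L ⟨-, -, -, -, d, m, c', -, -, -, H, rfl⟩
    have : L.length ≤ c' := by
      induction H with
      | one H => exact ih H
      | more H _ _ ih' => have := ih H; simp only [List.length_append]; omega
    omega

theorem Sibs.length_le (H : Sibs M (SkipTree M N h) m d L c) : L.length ≤ c := by
  induction H with
  | one H => exact H.length_le
  | more H _ _ ih => have := H.length_le; simp only [List.length_append]; omega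

/-- Afterwards the top level has at most three nodes, as the insertion below requires. -/
theorem skipGrow_wp (hB : 64 * NB ≤ B) (hNN : N + 1 ≤ NB) (H : Sibs M (SkipTree M N h) m d L c)
    (hm : m ≤ 4) (hs : KeySorted chr L) {L₀ : List (ℕ × ℕ)} (hL : L = L₀ ++ [(0, 0)])
    (h61 : M 61 = 64 * d) (h60 : M 60 = 64 * N) (hN : N = c + 1) (hM : s.mem.num = M)
    (hR : ∀ s' t h' m' d' c' N', KeepsR 45 55 s s' → (∀ r, r = 50 ∨ r = 51 → s'.reg r = s.reg r) →
      Sibs s'.mem.num (SkipTree s'.mem.num N' h') m' d' L c' → m' ≤ 3 → s'.mem.num 61 = 64 * d' →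
      s'.mem.num 60 = 64 * N' → N' = c' + 1 → h' ≤ h + 1 → N' ≤ N + 1 →
      (∀ a, ¬ SkipCell a → a ≠ 61 → s'.mem.num a = M a) → t ≤ 80 → R s' t) : WP B skipGrow s R := by
  have hd := H.first
  have b1 : 61 < B := by omega
  have b2 : 60 < B := by omega
  have b3 : ∀ f, f < 64 → 64 * N + f < B := by omega
  have b4 : 64 * d + 28 < B := by omega
  have b5 : 64 * N + 64 ≤ B := by omega
  rw [skipGrow, wp_seq, wp_lds]
  refine ⟨b1, ?_⟩
  rw [wp_seq, wp_const]
  refine ⟨by omega, ?_⟩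
  rw [wp_seq]
  refine skipFull_wp (N := N) (NB := NB) hB (by omega) H hm hs hL (by simp [hM]) (by simp [hM, h61])
    (by simp) ?_
  intro s₁ t₁ hk₁ hmem₁ hr₁ hfull ht₁
  have hmem : s₁.mem.num = M := by rw [hmem₁]; simp [hM]
  have e47 : s₁.reg 47 = 64 * d := by simp [hk₁.2.2, hM, h61]
  have e48 : s₁.reg 48 = 0 := by simp [hk₁.2.2]
  have hK : KeepsR 45 55 s s₁ := by simpa using hk₁.mono (lo' := 45) (by omega) le_rfl
  have h5 : ∀ r, r = 50 ∨ r = 51 → s₁.reg r = s.reg r := by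
    rintro r (rfl | rfl) <;> simp [hr₁]
  have b7 : h + 1 ≤ B := by
    have h1 := H.size.1
    have h2 := Nat.lt_two_pow_self (n := h)
    have h3 := H.length_le
    omega
  simp only [wp_seq, wp_const, wp_ite, zero_le, true_and, Test.holds_eq, State.setReg_reg, if_true,
    if_false, Nat.reduceEqDiff, wp_nop]
  rcases hfull with ⟨f49, fm⟩ | ⟨f49, fm, -⟩
  · refine ⟨fun _ => ?_, fun hh => absurd f49 hh⟩
    refine hR _ _ h m d c N (by simpa using hK) ?_ ?_ fm
      (by simp [hmem, h61]) (by simp [hmem, h60]) hN (by omega) (by omega)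
      (fun a _ _ => by simp [hmem]) (by omega)
    · rintro r (rfl | rfl) <;> simp [h5]
    · simpa [hmem] using H
  · refine ⟨fun hh => absurd (f49.symm.trans hh) (by omega), fun _ => ?_⟩
    simp [e47, e48, hmem, h60, b1, b2, b3, b4, b5]
    simp (disch := omega) only [upd_ne]
    refine ⟨by rw [hd.2.2.1]; exact b7, ?_⟩
    have hfr : ∀ M' : ℕ → ℕ, (∀ a, a ≠ 60 → a ≠ 61 → (a < 64 * N ∨ 64 * N + 64 ≤ a) → M' a = M a) →
        Sibs M' (SkipTree M' (N + 1) h) m d L c := by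
      intro M' hM'
      refine H.frame (Nat.le_succ N) fun i h1 h2 h3 h4 f h5 h6 => ?_
      exact hM' _ (by omega) (by omega) (by omega)
    refine hR _ _ (h + 1) 1 N (c + 1) (N + 1) (by simp [hK])
      ?_ (.one ⟨by omega, by omega, ?_, ⟨L₀, 0, ?_⟩, d, m, c, ?_, by omega, hm, hfr _ ?_, rfl⟩)
      (by omega) ?_ ?_ (by omega) le_rfl le_rfl ?_ (by omega)
    · rintro r (rfl | rfl) <;> simp [h5]
    all_goals simp only [State.setReg_mem, State.setNum_num, hmem]
    · simp (disch := omega) only [upd_ne, upd_self, hd.2.2.1]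
    · simp (disch := omega) only [upd_ne, upd_self, hL]
    · simp (disch := omega) only [upd_ne, upd_self]
    · intro a h1 h2 h3
      simp (disch := omega) only [upd_ne]
    · simp (disch := omega) only [upd_self]
    · simp (disch := omega) only [upd_ne, upd_self]; ring
    · intro a ha h1
      simp (disch := omega) only [upd_ne]

theorem CharMap.skipInsert_wp {n σ : ℕ} {ι : A → ℕ} (H : CharMap M chr n ι σ N h m d c L)
    (hB : 64 * NB ≤ B) (hNN : N + h + 3 ≤ NB) (hn : n < B) {j : ℕ} (hv : ι v = 0)
    (hM : s.mem.num = M) (hchr : s.mem.chr = chr) (h9 : s.creg 9 = none) (h1 : s.creg 1 = some v)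
    (h50 : s.reg 50 = k) (h51 : s.reg 51 = 64 * j) (hk : keyChr chr k = some v) (hkn : k ≤ n)
    (hj : j ≠ 0) (hR : ∀ s' t N' h' m' d' c' L', KeepsC 44 57 s s' →
      CharMap s'.mem.num chr n (Function.update ι v j) (σ + 1) N' h' m' d' c' L' →
      (∀ a, ¬ SkipCell a → a ≠ 61 → s'.mem.num a = M a) →
      t ≤ 200 * (h + 2) + 100 → R s' t) : WP B skipInsert s R := by
  obtain ⟨L₀, hL⟩ := H.last
  rw [skipInsert, wp_seq]
  refine skipGrow_wp hB (by omega) H.sibs H.le4 H.sorted hL H.top H.free H.hN hM ?_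
  intro s₁ t₁ h' m' d' c' N' hk₁ h5 hS fm f61 f60 fN fh fN' ffr ft₁
  have b61 : 61 < B := by have := H.sibs.first; omega
  simp only [wp_seq, wp_const, wp_lds, b61, true_and, zero_le, f61]
  refine ⟨by omega, ?_⟩
  have hvL : ∀ p ∈ L, keyOf chr p.1 ≠ v := by
    intro p hp heq
    rw [keyOf_eq_coe] at heq
    rcases H.entry p hp with ⟨h3, -⟩ | ⟨a, h3, -, h5⟩
    · rw [h3] at heq; simp [keyChr] at heq
    · rw [h3] at heq; obtain rfl := Option.some.inj heq; exact h5 hv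
  refine skipInsLoop_wp (chr := chr) (v := v) (k := k) (o := 64 * j) hB h' hS fm (by omega) f60
    (fun p hp => (H.code_le p hp).trans_lt hn) ⟨(0, 0), by simp [hL], by simp [keyOf_zero]⟩ H.sorted hvL
    (by simp) (by simp [hk₁.2.1, hchr]) (by simp [hk₁.1, h9]) (by simp [hk₁.1, h1]) (by simp) (by simp)
    (by simp) (by simp [h5 50, h50]) (by simp [h5 51, h51]) ?_
  intro s₂ t₂ N'' m'' c'' L₁ L₂ hk₂ I ht₂
  have hkv : keyOf chr k = v := keyOf_eq_coe.2 hk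
  have hne : ∀ a, ι a ≠ 0 → a ≠ v := by rintro a ha rfl; exact ha hv
  refine hR s₂ _ N'' h' m'' d' c'' (L₁ ++ (k, 64 * j) :: L₂)
    ((hk₁.keepsC.mono (by omega) (by omega)).trans (by simpa using hk₂))
    ⟨I.sibs, ?_, ?_, I.free, ?_, ?_, ?_, ?_, ?_, ?_, ?_⟩ ?_ ?_
  · have := I.hm; omega
  · rw [I.frame 61 (by omega), f61]
  · have := I.count; omega
  · have hs := H.sorted
    rw [I.hL, KeySorted.append] at hs
    rw [KeySorted.append]
    refine ⟨hs.1, ?_, ?_⟩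
    · unfold KeySorted
      rw [List.map_cons, List.pairwise_cons]
      refine ⟨fun x hx => ?_, hs.2.1⟩
      obtain ⟨p, hp, rfl⟩ := List.mem_map.1 hx
      rw [hkv]; exact I.gt p hp
    · intro p hp q hq
      rcases List.mem_cons.1 hq with rfl | hq
      · rw [hkv]; exact I.lt p hp
      · exact hs.2.2 p hp q hq
  · have hL2 : L₂ ≠ [] := by
      rintro rfl
      have : ((0 : ℕ), (0 : ℕ)) ∈ L₁ := by
        have := I.hL; rw [hL] at this; simp at this; simp [← this]
      have := I.lt _ this
      simp [keyOf_zero] at this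
    obtain ⟨K, x, rfl⟩ := List.eq_nil_or_concat L₂ |>.resolve_left hL2
    have := I.hL
    rw [hL] at this
    have := congrArg List.getLast? this
    simp at this
    exact ⟨L₁ ++ (k, 64 * j) :: K, by simp [this]⟩
  · intro p hp
    rcases List.mem_append.1 hp with hp | hp
    · exact H.code_le p (by rw [I.hL]; simp [hp])
    · rcases List.mem_cons.1 hp with rfl | hp
      · exact hkn
      · exact H.code_le p (by rw [I.hL]; simp [hp])
  · have hold : ∀ p ∈ L, (p.1 = 0 ∧ p.2 = 0) ∨ ∃ a, keyChr chr p.1 = some a ∧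
        p.2 = 64 * Function.update ι v j a ∧ Function.update ι v j a ≠ 0 := by
      intro p hp
      rcases H.entry p hp with h3 | ⟨a, h3, h4, h5⟩
      · exact .inl h3
      · exact .inr ⟨a, h3, by rw [Function.update_of_ne (hne a h5)]; exact ⟨h4, h5⟩⟩
    intro p hp
    rcases List.mem_append.1 hp with hp | hp
    · exact hold p (by rw [I.hL]; simp [hp])
    · rcases List.mem_cons.1 hp with rfl | hp
      · exact .inr ⟨v, hk, by simp [hj]⟩
      · exact hold p (by rw [I.hL]; simp [hp])
  · intro a ha
    by_cases hav : a = v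
    · subst hav; exact ⟨(k, 64 * j), by simp, hk⟩
    · rw [Function.update_of_ne hav] at ha
      obtain ⟨p, hp, h⟩ := H.mem a ha
      rw [I.hL] at hp
      exact ⟨p, by simp at hp ⊢; tauto, h⟩
  · have := H.len
    rw [I.hL] at this
    simp at this ⊢; omega
  · intro a ha ha1
    rw [I.frame a ha]
    simpa using ffr a ha ha1
  · nlinarith

end Insert

/-! ### Occurrences, nodes and loci -/

section Strings

variable {A : Type u} {S : List A}
  {w u q v x t : List A} {a c : A}

/-- The suffixes of `S` with prefix `w`, which stand for the occurrences of `w` in `S`. -/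
def suf (S w : List A) : Set (List A) := {t | t <:+ S ∧ w <+: t}

theorem suffixes_finite (S : List A) : {t | t <:+ S}.Finite := by
  have : {t | t <:+ S} = {t | t ∈ S.tails} := by ext; simp
  rw [this]; exact List.finite_toSet _

theorem suf_finite (S w : List A) : (suf S w).Finite :=
  (suffixes_finite S).subset fun _ h => h.1

theorem occ_eq (S w : List A) : occ S w = (suf S w).ncard := by
  unfold occ
  refine Set.ncard_congr (fun i _ => S.drop i) ?_ ?_ ?_
  · rintro i ⟨h1, h2⟩
    exact ⟨List.drop_suffix _ _, by rw [← h2]; exact List.take_prefix _ _⟩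
  · grind
  · rintro t ⟨⟨s, hs⟩, ⟨r, hr⟩⟩
    refine ⟨s.length, ⟨?_, ?_⟩, ?_⟩
    · rw [← hs, ← hr]; simp
    · rw [← hs, ← hr]; simp
    · rw [← hs]; simp

theorem sub_iff : w <:+: S ↔ (suf S w).Nonempty := by
  rw [List.infix_iff_prefix_suffix]
  exact ⟨fun ⟨t, h1, h2⟩ => ⟨t, h2, h1⟩, fun ⟨t, h2, h1⟩ => ⟨t, h1, h2⟩⟩

theorem occ_pos : 1 ≤ occ S w ↔ w <:+: S := by
  rw [occ_eq, sub_iff, Nat.one_le_iff_ne_zero, ← Nat.pos_iff_ne_zero,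
    Set.ncard_pos (suf_finite S w)]

theorem suf_mono (h : u <+: w) : suf S w ⊆ suf S u :=
  fun _ ht => ⟨ht.1, h.trans ht.2⟩

theorem occ_mono (h : u <+: w) : occ S w ≤ occ S u := by
  rw [occ_eq, occ_eq]; exact Set.ncard_le_ncard (suf_mono h) (suf_finite _ _)

theorem occ_le_one_iff : occ S w ≤ 1 ↔ ∀ t ∈ suf S w, ∀ t' ∈ suf S w, t = t' := by
  rw [occ_eq, Set.ncard_le_one (suf_finite _ _)]

theorem two_le_occ : 2 ≤ occ S w ↔ ∃ t ∈ suf S w, ∃ t' ∈ suf S w, t ≠ t' := by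
  rw [← not_lt, Nat.lt_succ_iff, occ_le_one_iff]; push Not; rfl

theorem suf_cons_of (h : w <+: a :: S) : suf (a :: S) w = insert (a :: S) (suf S w) := by
  ext t
  simp only [suf, Set.mem_ofPred_eq, Set.mem_insert_iff, List.suffix_cons_iff]
  constructor
  · grind
  · grind

theorem suf_cons_of_not (h : ¬ w <+: a :: S) : suf (a :: S) w = suf S w := by
  ext t
  simp only [suf, Set.mem_ofPred_eq, List.suffix_cons_iff]
  constructor
  · grind
  · grind

theorem cons_not_suffix : ¬ (a :: S) <:+ S := fun h => by
  have := h.length_le; simp at this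

theorem occ_cons_of (h : w <+: a :: S) : occ (a :: S) w = occ S w + 1 := by
  rw [occ_eq, occ_eq, suf_cons_of h, Set.ncard_insert_of_notMem _ (suf_finite _ _)]
  exact fun h => cons_not_suffix h.1

theorem occ_cons_of_not (h : ¬ w <+: a :: S) : occ (a :: S) w = occ S w := by
  rw [occ_eq, occ_eq, suf_cons_of_not h]

theorem sub_cons : w <:+: a :: S ↔ w <:+: S ∨ w <+: a :: S := by
  rw [List.infix_cons_iff]; tauto

theorem prefix_of_len (hu : u <+: t) (hv : v <+: t) (h : u.length ≤ v.length) : u <+: v :=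
    List.prefix_of_prefix_length_le hu hv h

theorem prefix_eq_of_len (hu : u <+: t) (hv : v <+: t) (h : u.length = v.length) : u = v :=
  (prefix_of_len hu hv h.le).eq_of_length h

theorem suffix_eq_of_len (hu : u <:+ t) (hv : v <:+ t) (h : u.length = v.length) : u = v :=
  (List.suffix_of_suffix_length_le hu hv h.le).eq_of_length h

theorem prefix_lt_len (h : u <+: v) (hne : u ≠ v) : u.length < v.length :=
  lt_of_le_of_ne h.length_le fun e => hne (h.eq_of_length e)

/-- A proper prefix is continued by some character. -/
theorem prefix_snoc (h : u <+: v) (hne : u ≠ v) : ∃ c, u ++ [c] <+: v := by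
  obtain ⟨r, rfl⟩ := h
  cases r with
  | nil => simp at hne
  | cons c r => exact ⟨c, r, by simp⟩

theorem snoc_prefix (h : u ++ [c] <+: v) : u <+: v :=
  (List.prefix_append u [c]).trans h

theorem snoc_inj {b : A} (h : u ++ [b] <+: t) (h' : u ++ [c] <+: t) : b = c := by
  have := prefix_eq_of_len h h' (by simp)
  simpa using this

/-- Two strings branch after their longest common prefix unless one is a prefix of the other. -/
theorem lcp (w t : List A) : w <+: t ∨ (t <+: w ∧ t ≠ w) ∨
    ∃ c b b', b ≠ b' ∧ c ++ [b] <+: w ∧ c ++ [b'] <+: t := by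
  induction w generalizing t with
  | nil => simp
  | cons x w ih =>
    cases t with
    | nil => simp
    | cons y t =>
      by_cases e : x = y
      · subst e
        rcases ih t with h | ⟨h, h'⟩ | ⟨c, b, b', h, h1, h2⟩
        · grind
        · grind
        · exact .inr (.inr ⟨x :: c, b, b', h, by simpa using h1, by simpa using h2⟩)
      · exact .inr (.inr ⟨[], x, y, e, by simp, by simp⟩)

theorem IsNode.sub (h : IsNode S x) : x <:+: S := by
  rcases h with h | ⟨b, b', -, h, -⟩
  · exact h.isInfix
  · exact (List.prefix_append x [b]).isInfix.trans h

theorem isNode_nil : IsNode S [] := .inl (List.nil_suffix)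

theorem isNode_of_suffix (h : t <:+ S) : IsNode S t := .inl h

theorem IsNode.of_suffix {y : List A} (h : IsNode S x) (hy : y <:+ x) : IsNode S y := by
  rcases h with h | ⟨b, b', hne, h, h'⟩
  · exact .inl (hy.trans h)
  · obtain ⟨r, rfl⟩ := hy
    exact .inr ⟨b, b', hne, (show _ <:+ _ from ⟨r, by simp⟩).isInfix.trans h,
      (show _ <:+ _ from ⟨r, by simp⟩).isInfix.trans h'⟩

theorem IsNode.tail (h : IsNode S (c :: x)) : IsNode S x :=
  h.of_suffix (List.suffix_cons c x)

/-- All occurrences of a string extend to its locus. -/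
theorem IsLocus.prefix_of (h : IsLocus S q w) (ht : t <:+ S) (hq : q <+: t) : w <+: t := by
  obtain ⟨h1, h2, h3⟩ := h
  rcases lcp w t with h | ⟨h, h'⟩ | ⟨c, b, b', hne, hb, hb'⟩
  · exact h
  · have := prefix_lt_len h h'
    have := h3 t (.inl ht) hq
    omega
  · have hqc : q <+: c := by
      rcases Nat.lt_or_ge c.length q.length with hl | hl
      · have e1 := prefix_of_len hb h2 (by simpa using hl)
        have e2 := prefix_of_len hb' hq (by simpa using hl)
        exact absurd (snoc_inj e1 e2) hne
      · exact prefix_of_len hq (snoc_prefix hb') hl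
    have := h3 c (.inr ⟨b, b', hne, hb.isInfix.trans h1.sub, hb'.isInfix.trans ht.isInfix⟩) hqc
    have := hb.length_le
    simp at this; omega

theorem IsLocus.sub (h : IsLocus S q w) : q <:+: S :=
  h.2.1.isInfix.trans h.1.sub

theorem IsLocus.unique {w' : List A} (h : IsLocus S q w) (h' : IsLocus S q w') : w = w' := by
  obtain ⟨t, ht, hq⟩ := sub_iff.1 h.sub
  exact prefix_eq_of_len (h.prefix_of ht hq) (h'.prefix_of ht hq)
    (le_antisymm (h.2.2 _ h'.1 h'.2.1) (h'.2.2 _ h.1 h.2.1))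

theorem exists_locus (h : q <:+: S) : ∃ w, IsLocus S q w := by
  classical
  obtain ⟨t, ht, hq⟩ := sub_iff.1 h
  have hex : ∃ l w, IsNode S w ∧ q <+: w ∧ w.length = l := ⟨_, t, .inl ht, hq, rfl⟩
  obtain ⟨w, h1, h2, h3⟩ := Nat.find_spec hex
  exact ⟨w, h1, h2, fun w' h1' h2' => h3 ▸ Nat.find_min' hex ⟨w', h1', h2', rfl⟩⟩

open Classical in
/-- The locus of a substring. -/
noncomputable def loc (S q : List A) : List A :=
  if h : q <:+: S then (exists_locus h).choose else []

theorem isLocus_loc (h : q <:+: S) : IsLocus S q (loc S q) := by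
  rw [loc, dif_pos h]; exact (exists_locus h).choose_spec

theorem IsLocus.eq_loc (h : IsLocus S q w) : w = loc S q :=
  h.unique (isLocus_loc h.sub)

theorem loc_node (h : q <:+: S) : IsNode S (loc S q) := (isLocus_loc h).1

theorem prefix_loc (h : q <:+: S) : q <+: loc S q := (isLocus_loc h).2.1

theorem IsNode.exists_suf (h : IsNode S u) : ∃ t, t <:+ S ∧ u <+: t :=
  sub_iff.1 h.sub

theorem loc_prefix_node (hu : IsNode S u) (h : q <+: u) : loc S q <+: u := by
  have hq := h.isInfix.trans hu.sub
  obtain ⟨t, ht, hut⟩ := hu.exists_suf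
  exact prefix_of_len ((isLocus_loc hq).prefix_of ht (h.trans hut)) hut
    ((isLocus_loc hq).2.2 u hu h)

theorem loc_of_node (hu : IsNode S u) : loc S u = u := by
  refine ((isLocus_loc hu.sub).unique ⟨hu, List.prefix_rfl, fun _ _ h => h.length_le⟩)

theorem loc_mono {q' : List A} (h : q <+: q') (hq' : q' <:+: S) : loc S q <+: loc S q' :=
  loc_prefix_node (loc_node hq') (h.trans (prefix_loc hq'))

theorem suf_loc (h : q <:+: S) : suf S (loc S q) = suf S q :=
  Set.Subset.antisymm (suf_mono (prefix_loc h)) fun _ ht =>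
    ⟨ht.1, (isLocus_loc h).prefix_of ht.1 ht.2⟩

theorem occ_loc (h : q <:+: S) : occ S (loc S q) = occ S q := by
  rw [occ_eq, occ_eq, suf_loc h]

theorem exists_parent (h : x ≠ []) : ∃ v, IsParent S v x := by
  classical
  have hex : ∃ k v, IsNode S v ∧ v <+: x ∧ v ≠ x ∧ v.length + k = x.length :=
    ⟨x.length, [], isNode_nil, List.nil_prefix, h.symm, by simp⟩
  obtain ⟨v, h1, h2, h3, h4⟩ := Nat.find_spec hex
  refine ⟨v, h1, h2, h3, fun v' h1' h2' h3' => ?_⟩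
  have := Nat.find_min' hex ⟨v', h1', h2', h3', Nat.add_sub_cancel' h2'.length_le⟩
  have := h2'.length_le
  omega

theorem IsParent.unique {v' : List A} (h : IsParent S v x) (h' : IsParent S v' x) : v = v' :=
  prefix_eq_of_len h.2.1 h'.2.1
    (le_antisymm (h'.2.2.2 _ h.1 h.2.1 h.2.2.1) (h.2.2.2 _ h'.1 h'.2.1 h'.2.2.1))

theorem IsParent.loc_eq (h : IsParent S v x) (hx : IsNode S x) (hc : v ++ [c] <+: x) :
    loc S (v ++ [c]) = x := by
  have hs := hc.isInfix.trans hx.sub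
  by_contra hne
  have h1 := h.2.2.2 _ (loc_node hs) (loc_prefix_node hx hc) hne
  have h2 := (prefix_loc hs).length_le
  simp at h2; omega

theorem isParent_loc (hv : IsNode S v) (h : v ++ [c] <:+: S) : IsParent S v (loc S (v ++ [c])) := by
  have hp := prefix_loc h
  refine ⟨hv, snoc_prefix hp, ?_, fun v' h1 h2 h3 => ?_⟩
  · intro e; rw [← e] at hp; have := hp.length_le; simp at this
  · by_contra hlt
    have h4 := prefix_of_len hp h2 (by simp; omega)
    exact h3 (h2.eq_of_length (le_antisymm h2.length_le ((isLocus_loc h).2.2 v' h1 h4)))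

/-- The leaves are the nodes that occur once. -/
theorem leaf_iff (h : IsNode S w) : (∀ c, ¬ w ++ [c] <:+: S) ↔ occ S w = 1 := by
  constructor
  · intro hc
    refine le_antisymm (occ_le_one_iff.2 ?_) (occ_pos.2 h.sub)
    have : ∀ t ∈ suf S w, t = w := by
      rintro t ⟨h1, h2⟩
      by_contra hne
      obtain ⟨c, h3⟩ := prefix_snoc h2 (Ne.symm hne)
      exact hc c (h3.isInfix.trans h1.isInfix)
    intro t ht t' ht'
    rw [this t ht, this t' ht']
  · intro ho c hc
    obtain ⟨t, ht⟩ := sub_iff.1 hc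
    have h1 := occ_le_one_iff.1 ho.le
    rcases h with h | ⟨b, b', hne, hb, hb'⟩
    · have := h1 t (suf_mono (List.prefix_append _ _) ht) w ⟨h, List.prefix_rfl⟩
      rw [this] at ht
      have := ht.2.length_le
      simp at this
    · obtain ⟨t1, ht1⟩ := sub_iff.1 hb
      obtain ⟨t2, ht2⟩ := sub_iff.1 hb'
      have := h1 t1 (suf_mono (List.prefix_append _ _) ht1) t2 (suf_mono (List.prefix_append _ _) ht2)
      subst this
      exact hne (snoc_inj ht1.2 ht2.2)

theorem leaf_suffix (h : IsNode S w) (ho : occ S w = 1) : w <:+ S := by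
  have h0 := h
  rcases h with h1 | ⟨b, b', -, hb, -⟩
  · exact h1
  · exact absurd hb ((leaf_iff h0).2 ho b)

theorem IsParent.two_le_occ (h : IsParent S v x) (hx : IsNode S x) : 2 ≤ occ S v := by
  by_contra hlt
  have h1 : occ S v = 1 := le_antisymm (by omega) (occ_pos.2 h.1.sub)
  obtain ⟨c, hc⟩ := prefix_snoc h.2.1 h.2.2.1
  exact (leaf_iff h.1).2 h1 c (hc.isInfix.trans hx.sub)

end Strings

/-! ### The suffix tree after prepending a character -/

section Update

variable {A : Type u} {S : List A} {a : A} {z : List A}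
  {v x q : List A} {c : A}

/-- `z` is the longest prefix of `aS` that occurs in `S`. -/
structure IsHead (a : A) (S z : List A) : Prop where
  pre : z <+: a :: S
  sub : z <:+: S
  max : ∀ q, q <+: a :: S → q <:+: S → q <+: z

theorem not_sub_cons : ¬ (a :: S) <:+: S := fun h => by
  have := h.length_le; simp at this

theorem IsHead.ne (h : IsHead a S z) : z ≠ a :: S := fun e => not_sub_cons (e ▸ h.sub)

/-- The head continues by a character that makes it new. -/
theorem IsHead.exists_char (h : IsHead a S z) : ∃ b, z ++ [b] <+: a :: S ∧ ¬ z ++ [b] <:+: S := by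
  obtain ⟨b, hb⟩ := prefix_snoc h.pre h.ne
  refine ⟨b, hb, fun hs => ?_⟩
  have := (h.max _ hb hs).length_le
  simp at this

theorem IsNode.cons (h : IsNode S x) : IsNode (a :: S) x := by
  rcases h with h | ⟨b, b', h1, h2, h3⟩
  · exact .inl (h.trans (List.suffix_cons a S))
  · exact .inr ⟨b, b', h1, sub_cons.2 (.inl h2), sub_cons.2 (.inl h3)⟩

/-- An old locus of the head extends it by the old character, so the head becomes branching. -/
theorem IsHead.isNode (h : IsHead a S z) : IsNode (a :: S) z := by
  by_cases hz : IsNode S z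
  · exact hz.cons
  · obtain ⟨b, hb, hbs⟩ := h.exists_char
    have hp := prefix_loc h.sub
    obtain ⟨c, hc⟩ := prefix_snoc hp fun e => hz (e ▸ loc_node h.sub)
    have hcs := hc.isInfix.trans (loc_node h.sub).sub
    exact .inr ⟨b, c, fun e => hbs (e ▸ hcs), hb.isInfix, sub_cons.2 (.inl hcs)⟩

theorem IsHead.node_iff (h : IsHead a S z) : IsNode (a :: S) q ↔ IsNode S q ∨ q = a :: S ∨ q = z := by
  constructor
  · have key : ∀ b b', b ≠ b' → q ++ [b] <+: a :: S → ¬ q ++ [b] <:+: S → q ++ [b'] <:+: a :: S →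
        q = z := by
      intro b b' hne hb hbs hb'
      have hb2 : q ++ [b'] <:+: S := by
        rcases sub_cons.1 hb' with h1 | h1
        · exact h1
        · exact absurd (snoc_inj hb h1) hne
      have hq : q <:+: S := (List.prefix_append q [b']).isInfix.trans hb2
      have h1 := h.max q (snoc_prefix hb) hq
      by_contra hqz
      obtain ⟨c, hc⟩ := prefix_snoc h1 hqz
      have := snoc_inj (hc.trans h.pre) hb
      subst this
      exact hbs (hc.isInfix.trans h.sub)
    rintro (h1 | ⟨b, b', hne, hb, hb'⟩)
    · rcases List.suffix_cons_iff.1 h1 with rfl | h1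
      · exact .inr (.inl rfl)
      · exact .inl (.inl h1)
    · by_cases hbs : q ++ [b] <:+: S
      · by_cases hbs' : q ++ [b'] <:+: S
        · exact .inl (.inr ⟨b, b', hne, hbs, hbs'⟩)
        · exact .inr (.inr (key b' b hne.symm ((sub_cons.1 hb').resolve_left hbs') hbs' hb))
      · exact .inr (.inr (key b b' hne ((sub_cons.1 hb).resolve_left hbs) hbs hb'))
  · rintro (h1 | rfl | rfl)
    · exact h1.cons
    · exact .inl List.suffix_rfl
    · exact h.isNode

/-- The loci after the update. -/
theorem IsHead.loc_sub (h : IsHead a S z) (hq : q <:+: S) :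
    (q <+: z ∧ z <+: loc S q → loc (a :: S) q = z) ∧
    (¬ (q <+: z ∧ z <+: loc S q) → loc (a :: S) q = loc S q) := by
  have hl := isLocus_loc hq
  refine ⟨fun ⟨h1, h2⟩ => ?_, fun hn => ?_⟩
  · refine (IsLocus.eq_loc ⟨h.isNode, h1, fun w' h3 h4 => ?_⟩).symm
    rcases h.node_iff.1 h3 with h3 | rfl | rfl
    · exact h2.length_le.trans (hl.2.2 w' h3 h4)
    · exact h.pre.length_le
    · exact le_rfl
  · refine (IsLocus.eq_loc ⟨hl.1.cons, hl.2.1, fun w' h3 h4 => ?_⟩).symm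
    have hz : q <+: z → (loc S q).length ≤ z.length := by
      intro h1
      have h5 := loc_mono h1 h.sub
      have h6 := prefix_loc h.sub
      by_contra hlt
      exact hn ⟨h1, prefix_of_len h6 h5 (by omega)⟩
    rcases h.node_iff.1 h3 with h3 | rfl | rfl
    · exact hl.2.2 w' h3 h4
    · exact (hz (h.max q h4 hq)).trans h.pre.length_le
    · exact hz h4

/-- A string that occurs in `aS` but not in `S` is a prefix of `aS`, and its locus is the new leaf. -/
theorem IsHead.loc_new (h : IsHead a S z) (hq : q <+: a :: S) (hs : ¬ q <:+: S) :
    loc (a :: S) q = a :: S := by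
  refine (IsLocus.eq_loc ⟨.inl List.suffix_rfl, hq, fun w' h3 h4 => ?_⟩).symm
  rcases h.node_iff.1 h3 with h3 | rfl | rfl
  · exact absurd (h4.isInfix.trans h3.sub) hs
  · exact le_rfl
  · exact absurd (h4.isInfix.trans h.sub) hs

/-- The only new child of an old node is that of the head. -/
theorem IsHead.new_child (h : IsHead a S z) (hv : v <:+: S) (hn : ¬ v ++ [c] <:+: S)
    (hs : v ++ [c] <:+: a :: S) : v = z ∧ v ++ [c] <+: a :: S := by
  have h1 := (sub_cons.1 hs).resolve_left hn
  refine ⟨?_, h1⟩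
  by_contra hne
  obtain ⟨c', h2⟩ := prefix_snoc (h.max v (snoc_prefix h1) hv) hne
  have := snoc_inj h1 (h2.trans h.pre)
  subst this
  exact hn (h2.isInfix.trans h.sub)

/-- The only child link that is redirected is the one from the parent of the locus of the head. -/
theorem IsHead.old_child (h : IsHead a S z) (hv : IsNode S v) (hs : v ++ [c] <:+: S)
    (hl : loc (a :: S) (v ++ [c]) ≠ loc S (v ++ [c])) :
    ¬ IsNode S z ∧ IsParent S v (loc S z) ∧ v ++ [c] <+: z ∧ loc (a :: S) (v ++ [c]) = z := by
  have hc : v ++ [c] <+: z ∧ z <+: loc S (v ++ [c]) := by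
    by_contra hn; exact hl ((h.loc_sub hs).2 hn)
  have hz := (h.loc_sub hs).1 hc
  have hw : loc S (v ++ [c]) = loc S z := by
    have h1 := loc_mono hc.1 h.sub
    have h2 := loc_prefix_node (loc_node hs) hc.2
    exact h1.eq_of_length (le_antisymm h1.length_le h2.length_le)
  refine ⟨fun hzn => hl ?_, hw ▸ isParent_loc hv hs, hc.1, hz⟩
  rw [hz, hw, loc_of_node hzn]

theorem IsHead.child_head (h : IsHead a S z) (hz : ¬ IsNode S z) :
    (z ++ [c] <:+: S → z ++ [c] <+: loc S z ∧ loc (a :: S) (z ++ [c]) = loc S z) := by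
  intro hs
  have hp := prefix_loc h.sub
  obtain ⟨t, ht⟩ := sub_iff.1 hs
  have hw := (isLocus_loc h.sub).prefix_of ht.1 (snoc_prefix ht.2)
  have h1 : z ++ [c] <+: loc S z := by
    refine prefix_of_len ht.2 hw ?_
    have := prefix_lt_len hp fun e => hz (e ▸ loc_node h.sub)
    simp; omega
  refine ⟨h1, ?_⟩
  rw [(h.loc_sub hs).2]
  · have h2 := loc_prefix_node (loc_node h.sub) h1
    have h3 := loc_prefix_node (loc_node hs) (snoc_prefix (prefix_loc hs))
    exact h2.eq_of_length (le_antisymm h2.length_le h3.length_le)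
  · rintro ⟨h2, -⟩
    have := h2.length_le
    simp at this

/-- Parents of the old nodes after the update. -/
theorem IsHead.parent_old (h : IsHead a S z) {u : List A} (hu : IsNode S u) (hp : IsParent S v u)
    (hne : u = loc S z → IsNode S z) : IsParent (a :: S) v u := by
  refine ⟨hp.1.cons, hp.2.1, hp.2.2.1, fun v' h1 h2 h3 => ?_⟩
  have key : IsNode S v' → v'.length ≤ v.length := fun h1 => hp.2.2.2 v' h1 h2 h3
  rcases h.node_iff.1 h1 with h1 | rfl | rfl
  · exact key h1
  · exact absurd (h2.isInfix.trans hu.sub) not_sub_cons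
  · by_cases hz : IsNode S v'
    · exact key hz
    · have h4 := loc_prefix_node hu h2
      have h5 := hp.2.2.2 _ (loc_node h.sub) h4 fun e => hz (hne e.symm)
      exact (prefix_loc h.sub).length_le.trans h5

theorem IsHead.parent_loc (h : IsHead a S z) (hz : ¬ IsNode S z) : IsParent (a :: S) z (loc S z) := by
  refine ⟨h.isNode, prefix_loc h.sub, fun e => hz (e ▸ loc_node h.sub), fun v' h1 h2 h3 => ?_⟩
  rcases h.node_iff.1 h1 with h1 | rfl | rfl
  · by_contra hlt
    have := (isLocus_loc h.sub).2.2 v' h1 (prefix_of_len (prefix_loc h.sub) h2 (by omega))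
    exact absurd (prefix_lt_len h2 h3) (by omega)
  · exact absurd (h2.isInfix.trans (loc_node h.sub).sub) not_sub_cons
  · exact le_rfl

theorem IsHead.parent_head (h : IsHead a S z) (hz : ¬ IsNode S z) (hp : IsParent S v (loc S z)) :
    IsParent (a :: S) v z := by
  have hpl := prefix_loc h.sub
  have hvz : v <+: z := by
    refine prefix_of_len hp.2.1 hpl ?_
    by_contra hlt
    have := (isLocus_loc h.sub).2.2 v hp.1 (prefix_of_len hpl hp.2.1 (by omega))
    exact absurd (prefix_lt_len hp.2.1 hp.2.2.1) (by omega)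
  refine ⟨hp.1.cons, hvz, fun e => hz (e ▸ hp.1), fun v' h1 h2 h3 => ?_⟩
  rcases h.node_iff.1 h1 with h1 | rfl | rfl
  · refine hp.2.2.2 v' h1 (h2.trans hpl) ?_
    rintro rfl
    exact h3 (h2.eq_of_length (le_antisymm h2.length_le hpl.length_le))
  · exact absurd (h2.isInfix.trans h.sub) not_sub_cons
  · exact absurd rfl h3

theorem IsHead.parent_new (h : IsHead a S z) : IsParent (a :: S) z (a :: S) := by
  refine ⟨h.isNode, h.pre, h.ne, fun v' h1 h2 h3 => ?_⟩
  rcases h.node_iff.1 h1 with h1 | rfl | rfl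
  · exact (h.max v' h2 h1.sub).length_le
  · exact absurd rfl h3
  · exact le_rfl

/-- A new Weiner link starts in a prefix of `S`. -/
theorem new_weiner (hs : c :: v <:+: a :: S) (hn : ¬ c :: v <:+: S) : c = a ∧ v <+: S := by
  have := (sub_cons.1 hs).resolve_left hn
  simpa [List.cons_prefix_cons] using this

theorem IsHead.old_weiner (h : IsHead a S (a :: x)) (hs : c :: v <:+: S)
    (hl : loc (a :: S) (c :: v) ≠ loc S (c :: v)) :
    c = a ∧ v <+: x ∧ loc S (a :: v) = loc S (a :: x) ∧ loc (a :: S) (c :: v) = a :: x ∧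
      ¬ IsNode S (a :: x) := by
  have hc : c :: v <+: a :: x ∧ a :: x <+: loc S (c :: v) := by
    by_contra hn; exact hl ((h.loc_sub hs).2 hn)
  have hz := (h.loc_sub hs).1 hc
  have hw : loc S (c :: v) = loc S (a :: x) := by
    have h1 := loc_mono hc.1 h.sub
    have h2 := loc_prefix_node (loc_node hs) hc.2
    exact h1.eq_of_length (le_antisymm h1.length_le h2.length_le)
  obtain ⟨rfl, hv⟩ := List.cons_prefix_cons.1 hc.1
  refine ⟨rfl, hv, hw, hz, fun hn => hl ?_⟩
  rw [hz, hw, loc_of_node hn]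

/-- The Weiner links that are to be redirected. -/
theorem IsHead.redirect (h : IsHead a S (a :: x)) (hv : v <+: x)
    (hl : loc S (a :: v) = loc S (a :: x)) : loc (a :: S) (a :: v) = a :: x := by
  have hva : a :: v <+: a :: x := by grind
  exact (h.loc_sub (hva.isInfix.trans h.sub)).1 ⟨hva, hl ▸ prefix_loc h.sub⟩

/-- The new node inherits the Weiner links of the old locus. -/
theorem IsHead.weiner_head (h : IsHead a S z) (c : A) :
    (c :: z <:+: a :: S ↔ c :: loc S z <:+: a :: S) ∧
    (c :: z <:+: a :: S → loc (a :: S) (c :: z) = loc (a :: S) (c :: loc S z)) := by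
  have hpl : c :: z <+: c :: loc S z := by
    simpa [List.cons_prefix_cons] using prefix_loc h.sub
  -- the part `z` of an occurrence of `cz` in `aS` lies in `S`, so it extends to the old locus
  have key : ∀ t, t <:+ a :: S → c :: z <+: t → c :: loc S z <+: t := by
    intro t ht hp
    obtain ⟨r, rfl⟩ := hp
    have ht' : z ++ r <:+ S := by
      rcases List.suffix_cons_iff.1 ht with e | h1
      · grind
      · exact (List.suffix_cons c _).trans h1
    have := (isLocus_loc h.sub).prefix_of ht' (List.prefix_append z r)
    simpa [List.cons_prefix_cons] using this
  have hsub : c :: z <:+: a :: S → c :: loc S z <:+: a :: S := by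
    intro hs
    obtain ⟨t, ht⟩ := sub_iff.1 hs
    exact (key t ht.1 ht.2).isInfix.trans ht.1.isInfix
  refine ⟨⟨hsub, fun hs => hpl.isInfix.trans hs⟩, fun hs => ?_⟩
  refine (isLocus_loc hs).unique ⟨loc_node (hsub hs), hpl.trans (prefix_loc (hsub hs)),
    fun u hu hq => ?_⟩
  obtain ⟨t, ht, hut⟩ := hu.exists_suf
  have hct := key t ht (hq.trans hut)
  rcases Nat.lt_or_ge u.length (c :: loc S z).length with hlt | hge
  · exfalso
    obtain ⟨r, rfl⟩ := hq
    have hu' : IsNode S (z ++ r) := by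
      have := hu.tail
      rcases h.node_iff.1 this with h1 | h1 | h1
      · exact h1
      · have := hu.sub.length_le
        have h2 := congrArg List.length h1
        simp at this h2; omega
      · have : r = [] := by simpa using h1
        subst this
        rw [List.append_nil] at hu ⊢
        -- `cz` is a node of `aS`, hence `z` is a node of `S`
        rcases hu with h2 | ⟨b, b', hne, h2, h3⟩
        · grind
        · refine .inr ⟨b, b', hne, ?_, ?_⟩
          · rcases sub_cons.1 h2 with h2 | h2
            · exact (List.suffix_cons c _).isInfix.trans h2
            · grind
          · rcases sub_cons.1 h3 with h2 | h2
            · exact (List.suffix_cons c _).isInfix.trans h2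
            · grind
    have := (isLocus_loc h.sub).2.2 _ hu' (List.prefix_append z r)
    simp at hlt this; omega
  · have hc := prefix_of_len hct hut hge
    exact (isLocus_loc (hsub hs)).2.2 u hu hc

/-- The head of `aS` is `ax`, where `x` is the longest prefix of `S` such that `ax` occurs in `S`; it is
a node. -/
theorem IsHead.tail_node (h : IsHead a S (a :: x)) : IsNode S x := by
  obtain ⟨b, hb, hbs⟩ := h.exists_char
  obtain ⟨t, ht⟩ := sub_iff.1 h.sub
  obtain ⟨⟨s, hs⟩, r, hr⟩ := ht
  cases r with
  | nil => exact .inl ⟨s ++ [a], by rw [← hs, ← hr]; simp⟩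
  | cons c r =>
    have hcS : a :: x ++ [c] <:+: S := ⟨s, r, by rw [← hs, ← hr]; simp⟩
    refine .inr ⟨b, c, fun e => hbs (e ▸ hcS), ?_, ?_⟩
    · grind
    · exact (List.suffix_cons a _).isInfix.trans hcS

theorem isHead_cons (hx : x <+: S) (hs : a :: x <:+: S)
    (hmax : ∀ v, IsNode S v → v <+: S → a :: v <:+: S → v <+: x) : IsHead a S (a :: x) := by
  refine ⟨by simpa [List.cons_prefix_cons] using hx, hs, ?_⟩
  -- the longest prefix of `aS` that occurs in `S`
  classical
  have hex : ∃ k, ∃ q, q <+: a :: S ∧ q <:+: S ∧ q.length + k = (a :: S).length :=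
    ⟨S.length, [a], by simp [List.cons_prefix_cons], (show [a] <+: a :: x by
      simp [List.cons_prefix_cons]).isInfix.trans hs, by simp; omega⟩
  obtain ⟨q, h1, h2, h3⟩ := Nat.find_spec hex
  have hmaxq : ∀ q', q' <+: a :: S → q' <:+: S → q'.length ≤ q.length := by
    intro q' h1' h2'
    have := Nat.find_min' hex ⟨q', h1', h2', Nat.add_sub_cancel' h1'.length_le⟩
    have := h1'.length_le
    omega
  have hq : IsHead a S q := ⟨h1, h2, fun q' h1' h2' => prefix_of_len h1' h1 (hmaxq q' h1' h2')⟩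
  have hax := hq.max (a :: x) (by simpa [List.cons_prefix_cons] using hx) hs
  obtain ⟨r, rfl⟩ := hax
  have hqn : IsNode S (x ++ r) := IsHead.tail_node (x := x ++ r) (by simpa using hq)
  have := hmax _ hqn (by simpa [List.cons_prefix_cons] using h1) (by simpa using h2)
  have : r = [] := by have := this.length_le; simpa using this
  subst this
  simpa using hq.max

theorem isHead_nil (h : ¬ [a] <:+: S) : IsHead a S [] := by
  refine ⟨List.nil_prefix, List.nil_infix, fun q h1 h2 => ?_⟩
  cases q with
  | nil => exact List.prefix_rfl
  | cons c q =>
    obtain ⟨rfl, -⟩ := List.cons_prefix_cons.1 h1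
    exact absurd ((show [c] <+: c :: q by simp [List.cons_prefix_cons]).isInfix.trans h2) h

end Update

/-! ### Net frequencies after prepending a character -/

section Phi

variable {A : Type u} {S : List A} {a : A} {z w : List A}
  {c : A} {u t : List A}

theorem occ_eq_one (h : w <:+: S) (h' : occ S w ≤ 1) : occ S w = 1 :=
  le_antisymm h' (occ_pos.2 h)

/-- The occurrences of `αu` are among those of `u`. -/
theorem suf_of_cons (h : t ∈ suf S (c :: u)) : ∃ t', t = c :: t' ∧ t' ∈ suf S u ∧ t' ≠ S := by
  obtain ⟨h1, r, rfl⟩ := h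
  refine ⟨u ++ r, rfl, ⟨(List.suffix_cons c _).trans h1, List.prefix_append _ _⟩, ?_⟩
  intro e
  have := h1.length_le
  have h2 := congrArg List.length e
  simp at this h2; omega

theorem suf_of_cons' (h : t ∈ suf (a :: S) (c :: u)) : ∃ t', t = c :: t' ∧ t' ∈ suf S u := by
  obtain ⟨t', h1, ⟨h2, h3⟩, h4⟩ := suf_of_cons h
  refine ⟨t', h1, ?_, h3⟩
  rcases List.suffix_cons_iff.1 h2 with e | h5
  · exact absurd e h4
  · exact h5

theorem Phi_sub {p : A × A} (h : p ∈ Phi S w) : p.1 :: (w ++ [p.2]) <:+: S :=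
  occ_pos.1 h.2.1.ge

theorem Phi_injOn : Set.InjOn Prod.snd (Phi S w) := by
  rintro ⟨c, b⟩ hp ⟨c', b'⟩ hq e
  simp only at e
  subst e
  obtain ⟨t, ht⟩ := sub_iff.1 (Phi_sub hp)
  obtain ⟨t', ht'⟩ := sub_iff.1 (Phi_sub hq)
  obtain ⟨r, rfl, hr, -⟩ := suf_of_cons ht
  obtain ⟨r', rfl, hr', -⟩ := suf_of_cons ht'
  have := occ_le_one_iff.1 hp.2.2.2.le r hr r' hr'
  subst this
  have := suffix_eq_of_len ht.1 ht'.1 (by simp)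
  simp at this
  rw [this]

theorem mem_of_sub {v : List A} (h : u ++ c :: v <:+: S) : c ∈ S :=
  h.subset (by simp)

theorem Phi_finite : (Phi S w).Finite := by
  refine Set.Finite.of_finite_image (s := Phi S w) (f := Prod.snd) ?_ Phi_injOn
  refine (List.finite_toSet S).subset ?_
  rintro _ ⟨p, hp, rfl⟩
  exact mem_of_sub (u := p.1 :: w) (v := []) (by simpa using Phi_sub hp)

theorem phi_le_length : phi S w ≤ S.length := by
  classical
  unfold phi
  have h1 : (Prod.snd '' Phi S w) ⊆ (S.toFinset : Set A) := by
    rintro _ ⟨p, hp, rfl⟩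
    have := mem_of_sub (u := p.1 :: w) (v := []) (by simpa using Phi_sub hp)
    simpa using this
  rw [← Phi_injOn.ncard_image]
  refine (Set.ncard_le_ncard h1 (Finset.finite_toSet _)).trans ?_
  rw [Set.ncard_coe_finset]
  exact List.toFinset_card_le S

theorem node_of_right_unique {b : A} (h : 2 ≤ occ S w) (hb : occ S (w ++ [b]) = 1) :
    IsNode S w := by
  obtain ⟨t0, ht0⟩ := sub_iff.1 (occ_pos.1 hb.ge)
  obtain ⟨t, ht, hne⟩ : ∃ t ∈ suf S w, ¬ w ++ [b] <+: t := by
    by_contra hn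
    push Not at hn
    have : occ S w ≤ 1 := occ_le_one_iff.2 fun t ht t' ht' =>
      occ_le_one_iff.1 hb.le t ⟨ht.1, hn t ht⟩ t' ⟨ht'.1, hn t' ht'⟩
    omega
  by_cases e : w = t
  · exact .inl (e ▸ ht.1)
  · obtain ⟨c, hc⟩ := prefix_snoc ht.2 e
    exact .inr ⟨b, c, fun e => hne (e ▸ hc), ht0.2.isInfix.trans ht0.1.isInfix,
      hc.isInfix.trans ht.1.isInfix⟩

theorem node_of_phi (h : 1 ≤ phi S w) : IsNode S w := by
  obtain ⟨p, hp⟩ := (Set.ncard_pos Phi_finite).1 h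
  exact node_of_right_unique hp.1 hp.2.2.2

/-- A right-unique extension of a repeat has its only occurrence as locus. -/
theorem loc_of_unique {q : List A} (h : occ S q = 1) (ht : t ∈ suf S q) : loc S q = t := by
  have hq := occ_pos.1 h.ge
  have h1 := leaf_suffix (loc_node hq) (by rw [occ_loc hq, h])
  exact occ_le_one_iff.1 h.le _ ⟨h1, prefix_loc hq⟩ _ ht

/-- Maximality need not be tested: a net occurrence makes a string left-branching and right-branching, up to
the boundary cases that the definition of a maximal repeat admits. -/
theorem PNF_eq : PNF S = {p | 1 ≤ phi S p.1 ∧ p.2 = phi S p.1} := by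
  ext ⟨w, f⟩
  simp only [PNF, Set.mem_ofPred_eq, and_iff_right_iff_imp]
  rintro ⟨h, -⟩
  obtain ⟨p, hp⟩ := (Set.ncard_pos Phi_finite).1 h
  refine ⟨⟨hp.1, ?_⟩, ⟨hp.1, ?_⟩⟩
  · obtain ⟨t0, ht0⟩ := sub_iff.1 (occ_pos.1 hp.2.2.1.ge)
    obtain ⟨r, hr, hr2, hr3⟩ := suf_of_cons ht0
    -- an occurrence of `w` that is not preceded by the same character
    obtain ⟨t, ht, hne⟩ : ∃ t ∈ suf S w, t ≠ r := by
      obtain ⟨t, ht, t', ht', hne⟩ := two_le_occ.1 hp.1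
      by_cases e : t = r
      · grind
      · exact ⟨t, ht, e⟩
    obtain ⟨s, hs⟩ := ht.1
    rcases List.eq_nil_or_concat s with rfl | ⟨s', c, rfl⟩
    · left; simp at hs; exact hs ▸ ht.2
    · right
      have hc : c :: t <:+ S := ⟨s', by rw [← hs]; simp⟩
      have hcw : c :: w <+: c :: t := by simpa [List.cons_prefix_cons] using ht.2
      refine ⟨c, p.1, ?_, hcw.isInfix.trans hc.isInfix, occ_pos.1 hp.2.2.1.ge⟩
      rintro rfl
      have := occ_le_one_iff.1 hp.2.2.1.le _ ⟨hc, hcw⟩ _ ht0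
      rw [hr] at this
      simp at this
      exact hne this
  · exact (node_of_right_unique hp.1 hp.2.2.2).imp_left id

/-- The net frequency of `w` grows. -/
def Gains (a : A) (S w : List A) : Prop := IsParent S w S ∧ ¬ a :: w <:+: S

/-- A net occurrence of `w` is lost because `aw` is not unique any more. -/
def LosesLeft (a : A) (S z w : List A) : Prop :=
  a :: w = z ∧ occ S z = 1 ∧ ∃ b, z ++ [b] <:+: S ∧ occ S (w ++ [b]) = 1

/-- A net occurrence of `w` is lost because a right extension is not unique any more. -/
def LosesRight (S z w : List A) : Prop :=
  occ S z = 1 ∧ IsParent S w (loc S z) ∧ ∃ c, c :: loc S z <:+: S ∧ occ S (c :: w) = 1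

/-- The pairs that `w` loses because `aw` occurs once more, as a prefix of `aS`. -/
theorem IsHead.losesLeft (h : IsHead a S z) :
    LosesLeft a S z w ↔ {p ∈ Phi S w | p.1 = a ∧ a :: w <+: a :: S}.Nonempty := by
  constructor
  · rintro ⟨rfl, h1, b, h2, h3⟩
    have h4 : w <+: S := by simpa [List.cons_prefix_cons] using h.pre
    obtain ⟨t, ht⟩ := sub_iff.1 h.sub
    obtain ⟨r, rfl, hr, hrS⟩ := suf_of_cons ht
    refine ⟨(a, b), ⟨two_le_occ.2 ⟨r, hr, S, ⟨List.suffix_rfl, h4⟩, hrS⟩, ?_, h1, h3⟩, rfl, h.pre⟩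
    refine occ_eq_one (by simpa using h2) ((occ_mono ?_).trans h1.le)
    exact ⟨[b], by simp⟩
  · rintro ⟨⟨c, b⟩, hp, hc, hpre⟩
    simp only at hc
    subst hc
    have hcw := occ_pos.1 hp.2.2.1.ge
    have hcwb := Phi_sub hp
    have hz : c :: w = z := by
      by_contra hne
      obtain ⟨d, hd⟩ := prefix_snoc (h.max _ hpre hcw) hne
      obtain ⟨t, ht⟩ := sub_iff.1 h.sub
      obtain ⟨t', ht'⟩ := sub_iff.1 hcwb
      have e := occ_le_one_iff.1 hp.2.2.1.le t ⟨ht.1, (snoc_prefix hd).trans ht.2⟩ t'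
        ⟨ht'.1, (show c :: w <+: c :: (w ++ [b]) from ⟨[b], by simp⟩).trans ht'.2⟩
      subst e
      have : d = b := snoc_inj (hd.trans ht.2) (by simpa using ht'.2)
      subst this
      obtain ⟨r, rfl, hr, hrS⟩ := suf_of_cons ht'
      have h5 : w ++ [d] <+: S := by
        have := hd.trans h.pre
        simpa [List.cons_prefix_cons] using this
      exact hrS (occ_le_one_iff.1 hp.2.2.2.le _ hr _ ⟨List.suffix_rfl, h5⟩)
    refine ⟨hz, hz ▸ hp.2.2.1, b, ?_, hp.2.2.2⟩
    rw [← hz]; simpa using hcwb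

/-- The pairs that `w` loses because a right extension occurs once more, as a prefix of `aS`. -/
theorem IsHead.losesRight (h : IsHead a S z) :
    LosesRight S z w ↔ {p ∈ Phi S w | w ++ [p.2] <+: a :: S}.Nonempty := by
  constructor
  · rintro ⟨h1, h2, c, h3, h4⟩
    have hT := loc_node h.sub
    obtain ⟨b, hb⟩ := prefix_snoc h2.2.1 h2.2.2.1
    have hbz : w ++ [b] <+: z := by
      refine prefix_of_len hb (prefix_loc h.sub) ?_
      by_contra hlt
      have := (isLocus_loc h.sub).2.2 w h2.1
        (prefix_of_len (prefix_loc h.sub) h2.2.1 (by simp at hlt; omega))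
      exact absurd (prefix_lt_len h2.2.1 h2.2.2.1) (by omega)
    have hbs := hbz.isInfix.trans h.sub
    refine ⟨(c, b), ⟨h2.two_le_occ hT, ?_, h4, ?_⟩, hbz.trans h.pre⟩
    · refine occ_eq_one ?_ ((occ_mono (show c :: w <+: _ from ⟨[b], by simp⟩)).trans h4.le)
      refine List.IsInfix.trans ?_ h3
      exact (List.cons_prefix_cons.2 ⟨rfl, hb⟩).isInfix
    · rw [← occ_loc hbs, h2.loc_eq hT hb, occ_loc h.sub, h1]
  · rintro ⟨⟨c, b⟩, hp, hpre⟩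
    simp only at hpre
    have hb := occ_pos.1 hp.2.2.2.ge
    have hbz := h.max _ hpre hb
    have hz1 : occ S z = 1 := occ_eq_one h.sub ((occ_mono hbz).trans hp.2.2.2.le)
    obtain ⟨t, ht⟩ := sub_iff.1 (Phi_sub hp)
    obtain ⟨r, rfl, hr, hrS⟩ := suf_of_cons ht
    have e1 := loc_of_unique hp.2.2.2 hr
    obtain ⟨t, ht2⟩ := sub_iff.1 h.sub
    have e2 := loc_of_unique hz1 ht2
    have e3 := occ_le_one_iff.1 hp.2.2.2.le _ hr _ (suf_mono hbz ht2)
    subst e3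
    refine ⟨hz1, ?_, c, by rw [e2]; exact ht.1.isInfix, hp.2.2.1⟩
    rw [e2, ← e1]
    exact isParent_loc (node_of_right_unique hp.1 hp.2.2.2) hb

theorem prefix_cons_cases {b : A} (h1 : a :: w <+: a :: S) (h2 : w ++ [b] <+: a :: S) :
    a :: w = w ++ [b] :=
  prefix_eq_of_len h1 h2 (by simp)

/-- The net occurrences of `w` that arise, where the head is excluded if it is a new node that
occurred only once. -/
theorem IsHead.gains_of (h : IsHead a S z) (hw : ¬ (w = z ∧ occ S z = 1 ∧ ¬ IsNode S z))
    {p : A × A} (hp : p ∈ Phi (a :: S) w) (hp' : p ∉ Phi S w) :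
    Gains a S w ∧ p.1 = a ∧ w ++ [p.2] <+: S := by
  obtain ⟨c, b⟩ := p
  obtain ⟨h1, h2, h3, h4⟩ := hp
  simp only at h2 h3 h4 ⊢
  have hle : ∀ u, occ S u ≤ occ (a :: S) u := fun u => by
    by_cases hu : u <+: a :: S
    · rw [occ_cons_of hu]; omega
    · rw [occ_cons_of_not hu]
  have hsub := sub_cons.1 (occ_pos.1 h2.ge)
  have hnew : c :: (w ++ [b]) <+: a :: S → c = a ∧ w ++ [b] <+: S ∧ ¬ a :: w <:+: S := by
    intro hh
    obtain ⟨rfl, h5⟩ := List.cons_prefix_cons.1 hh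
    refine ⟨rfl, h5, fun h6 => ?_⟩
    have := occ_cons_of ((show c :: w <+: c :: (w ++ [b]) from ⟨[b], by simp⟩).trans hh)
    have := occ_pos.2 h6
    omega
  rcases Nat.lt_or_ge (occ S w) 2 with hlt | hge
  · exfalso
    -- `w` was not a repeat
    have h1' : 2 ≤ occ (a :: S) w := h1
    have hpre : w <+: a :: S := by
      by_contra hn; rw [occ_cons_of_not hn] at h1'; omega
    rw [occ_cons_of hpre] at h1'
    have hw1 : occ S w = 1 := by omega
    have hws := occ_pos.1 hw1.ge
    have hwz := h.max w hpre hws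
    have hwz' : w = z → False := by
      rintro rfl
      refine hw ⟨rfl, hw1, fun hn => ?_⟩
      have hl := (leaf_iff hn).2 hw1
      rcases hsub with hh | hh
      · refine hl b (List.IsInfix.trans ?_ hh)
        exact (List.suffix_cons c _).isInfix
      · grind
    obtain ⟨d, hd⟩ := prefix_snoc hwz hwz'
    rcases hsub with hh | hh
    · obtain ⟨t, ht⟩ := sub_iff.1 hh
      obtain ⟨r, rfl, hr, -⟩ := suf_of_cons ht
      obtain ⟨t', ht'⟩ := sub_iff.1 h.sub
      have e := occ_le_one_iff.1 hw1.le _ (suf_mono (List.prefix_append w [b]) hr) _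
        (suf_mono hwz ht')
      subst e
      have := snoc_inj (hd.trans ht'.2) hr.2
      subst this
      rw [occ_cons_of (hd.trans h.pre)] at h4
      have := occ_pos.2 (hd.isInfix.trans h.sub)
      omega
    · obtain ⟨rfl, h5, h6⟩ := hnew hh
      refine h6 ((prefix_of_len ?_ h.pre ?_).isInfix.trans h.sub)
      · exact (show c :: w <+: c :: (w ++ [b]) from ⟨[b], by simp⟩).trans hh
      · grind
  · have hh : c :: (w ++ [b]) <+: a :: S := by
      rcases hsub with hh | hh
      · refine absurd ⟨hge, ?_, ?_, ?_⟩ hp'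
        · exact occ_eq_one hh ((hle _).trans h2.le)
        · exact occ_eq_one ((show c :: w <+: c :: (w ++ [b]) from ⟨[b], by simp⟩).isInfix.trans hh)
            ((hle _).trans h3.le)
        · exact occ_eq_one ((List.suffix_cons c _).isInfix.trans hh) ((hle _).trans h4.le)
      · exact hh
    obtain ⟨rfl, h5, h6⟩ := hnew hh
    refine ⟨⟨?_, h6⟩, rfl, h5⟩
    have hb1 : occ S (w ++ [b]) = 1 := occ_eq_one h5.isInfix ((hle _).trans h4.le)
    have := loc_of_unique hb1 ⟨List.suffix_rfl, h5⟩
    conv => arg 3; rw [← this]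
    exact isParent_loc (node_of_right_unique hge hb1) h5.isInfix

theorem occ_self : occ S S = 1 := by
  refine occ_eq_one List.infix_rfl (occ_le_one_iff.2 ?_)
  have : ∀ t ∈ suf S S, t = S := fun t ht => ht.1.eq_of_length_le ht.2.length_le
  intro t ht t' ht'
  rw [this t ht, this t' ht']

/-- The parent of `S` gains the pair of `a` and the character that follows this parent in `S`. -/
theorem gains_mem (hg : Gains a S w) : ∃ p, p ∈ Phi (a :: S) w ∧ p ∉ Phi S w := by
  obtain ⟨h1, h2⟩ := hg
  have hS : IsNode S S := .inl List.suffix_rfl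
  obtain ⟨b, hb⟩ := prefix_snoc h1.2.1 h1.2.2.1
  have hbs := hb.isInfix
  have h3 : occ S (w ++ [b]) = 1 := by rw [← occ_loc hbs, h1.loc_eq hS hb, occ_self]
  have h4 : a :: w <+: a :: S := List.cons_prefix_cons.2 ⟨rfl, h1.2.1⟩
  have h5 : a :: (w ++ [b]) <+: a :: S := List.cons_prefix_cons.2 ⟨rfl, hb⟩
  have h0 : occ S (a :: w) = 0 := by
    by_contra hn; exact h2 (occ_pos.1 (Nat.one_le_iff_ne_zero.2 hn))
  have h0' : occ S (a :: (w ++ [b])) = 0 := by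
    have := occ_mono (S := S) (show a :: w <+: a :: (w ++ [b]) from ⟨[b], by simp⟩)
    omega
  have hrep := h1.two_le_occ hS
  refine ⟨(a, b), ⟨?_, ?_, ?_, ?_⟩, fun hp => ?_⟩
  · show 2 ≤ occ (a :: S) w
    by_cases hw : w <+: a :: S
    · rw [occ_cons_of hw]; omega
    · rw [occ_cons_of_not hw]; exact hrep
  · rw [occ_cons_of h5, h0']
  · rw [occ_cons_of h4, h0]
  · rw [occ_cons_of_not, h3]
    intro hh
    exact h2 (prefix_cons_cases h4 hh ▸ hbs)
  · have := hp.2.2.1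
    simp only at this
    omega

open Classical in
/-- The change of the net frequencies. -/
theorem IsHead.phi_update (h : IsHead a S z) (hw : ¬ (w = z ∧ occ S z = 1 ∧ ¬ IsNode S z)) :
    phi (a :: S) w + (if LosesLeft a S z w then 1 else 0) + (if LosesRight S z w then 1 else 0) =
      phi S w + if Gains a S w then 1 else 0 := by
  -- the pairs lost at the left, those lost at the right, and the gained ones: at most one of each kind
  set PA := {p ∈ Phi S w | p.1 = a ∧ a :: w <+: a :: S} with hPA
  set PB := {p ∈ Phi S w | w ++ [p.2] <+: a :: S} with hPB
  set PG := Phi (a :: S) w \ Phi S w with hPG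
  have card1 : ∀ (X : Set (A × A)) (P : Prop), (P ↔ X.Nonempty) → X.Subsingleton →
      (if P then 1 else 0) = X.ncard := by
    intro X P hP hX
    by_cases hp : P
    · rw [if_pos hp]
      obtain ⟨x, hx⟩ := hP.1 hp
      rw [hX.eq_singleton_of_mem hx, Set.ncard_singleton]
    · rw [if_neg hp]
      have : X = ∅ := Set.not_nonempty_iff_eq_empty.1 fun hn => hp (hP.2 hn)
      rw [this, Set.ncard_empty]
  have subA : PA.Subsingleton := by
    intro p hp q hq
    have hpz := (h.losesLeft (w := w)).2 ⟨p, hp⟩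
    obtain ⟨hz, h1, -⟩ := hpz
    have key : ∀ p ∈ PA, z ++ [p.2] <:+: S := fun p hp => by
      have := Phi_sub hp.1; rw [hp.2.1] at this; rw [← hz]; simpa using this
    obtain ⟨t, ht⟩ := sub_iff.1 (key p hp)
    obtain ⟨t', ht'⟩ := sub_iff.1 (key q hq)
    have e := occ_le_one_iff.1 h1.le t (suf_mono (List.prefix_append _ _) ht) t'
      (suf_mono (List.prefix_append _ _) ht')
    subst e
    exact Prod.ext (hp.2.1.trans hq.2.1.symm) (snoc_inj ht.2 ht'.2)
  have subB : PB.Subsingleton := fun p hp q hq => Phi_injOn hp.1 hq.1 (snoc_inj hp.2 hq.2)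
  have subG : PG.Subsingleton := by
    intro p hp q hq
    obtain ⟨-, h1, h2⟩ := h.gains_of hw hp.1 hp.2
    obtain ⟨-, h3, h4⟩ := h.gains_of hw hq.1 hq.2
    exact Prod.ext (h1.trans h3.symm) (snoc_inj h2 h4)
  have hG : Gains a S w ↔ PG.Nonempty := by
    constructor
    · intro hg; obtain ⟨p, h1, h2⟩ := gains_mem hg; exact ⟨p, h1, h2⟩
    · rintro ⟨p, hp⟩; exact (h.gains_of hw hp.1 hp.2).1
  have disj : Disjoint PA PB := by
    rw [Set.disjoint_left]
    rintro ⟨c, b⟩ ⟨hp, h1, h2⟩ ⟨-, h3⟩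
    simp only at h1 h3
    subst h1
    have e := prefix_cons_cases h2 h3
    obtain ⟨t, ht⟩ := sub_iff.1 (Phi_sub hp)
    obtain ⟨r, rfl, hr, hrS⟩ := suf_of_cons ht
    have h4 := hp.2.2.1
    simp only at h4 ht hr
    have := occ_le_one_iff.1 h4.le _ ⟨ht.1, (show c :: w <+: c :: (w ++ [b]) from
      ⟨[b], by simp⟩).trans ht.2⟩ r (by rw [e]; exact hr)
    have := congrArg List.length this
    simp at this
  have hle : ∀ u, occ S u ≤ occ (a :: S) u := fun u => by
    by_cases hu : u <+: a :: S
    · rw [occ_cons_of hu]; omega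
    · rw [occ_cons_of_not hu]
  -- a pair survives unless one of its two extensions of `w` becomes a prefix of `aS`
  have hinter : Phi (a :: S) w = (Phi S w \ (PA ∪ PB)) ∪ PG := by
    ext p
    simp only [Set.mem_union, Set.mem_sdiff, hPG]
    by_cases hp : p ∈ Phi S w
    · simp only [hp, true_and, not_true, and_false, or_false]
      obtain ⟨h1, h2, h3, h4⟩ := id hp
      constructor
      · rintro ⟨k1, k2, k3, k4⟩ (⟨-, h5, h6⟩ | ⟨-, h5⟩)
        · rw [h5, occ_cons_of h6, ← h5, h3] at k3; omega
        · rw [occ_cons_of h5, h4] at k4; omega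
      · intro hn
        have n1 : ¬ p.1 :: w <+: a :: S := fun hh => hn (.inl ⟨hp, by
          obtain ⟨e, h5⟩ := List.cons_prefix_cons.1 hh
          exact ⟨e, by rw [← e] at hh ⊢; exact hh⟩⟩)
        have n2 : ¬ w ++ [p.2] <+: a :: S := fun hh => hn (.inr ⟨hp, hh⟩)
        refine ⟨h1.trans (hle w), ?_, by rw [occ_cons_of_not n1, h3], by rw [occ_cons_of_not n2, h4]⟩
        rw [occ_cons_of_not, h2]
        intro hh
        exact n1 ((show p.1 :: w <+: p.1 :: (w ++ [p.2]) from ⟨[p.2], by simp⟩).trans hh)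
    · grind
  have hsubAB : PA ∪ PB ⊆ Phi S w := by
    grind
  have fin : (Phi S w).Finite := Phi_finite
  have c1 : (Phi (a :: S) w).ncard = (Phi S w \ (PA ∪ PB)).ncard + PG.ncard := by
    rw [hinter, Set.ncard_union_eq _ (fin.subset Set.sdiff_subset)
      (Phi_finite.subset Set.sdiff_subset)]
    rw [Set.disjoint_left]
    rintro p ⟨hp, -⟩ ⟨-, hq⟩
    exact hq hp
  have c2 := Set.ncard_sdiff_add_ncard_of_subset hsubAB fin
  have c3 : (PA ∪ PB).ncard = PA.ncard + PB.ncard :=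
    Set.ncard_union_eq disj (fin.subset fun p hp => hp.1) (fin.subset fun p hp => hp.1)
  rw [card1 PA _ h.losesLeft subA, card1 PB _ h.losesRight subB, card1 PG _ hG subG]
  unfold phi
  omega

/-- The net frequency of a new branching node. -/
theorem IsHead.phi_head (h : IsHead a S z) (h1 : occ S z = 1) (hz : ¬ IsNode S z) :
    phi (a :: S) z = 1 := by
  obtain ⟨t, ht⟩ := sub_iff.1 h.sub
  obtain ⟨b, hb⟩ := prefix_snoc ht.2 fun e => hz (e ▸ isNode_of_suffix ht.1)
  have hbs := hb.isInfix.trans ht.1.isInfix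
  obtain ⟨c, hc⟩ : ∃ c, c :: t <:+ a :: S := by
    obtain ⟨s, hs⟩ := ht.1
    rcases List.eq_nil_or_concat (a :: s) with e | ⟨s', c, e⟩
    · simp at e
    · grind
  have hcz : c :: z <+: c :: t := List.cons_prefix_cons.2 ⟨rfl, ht.2⟩
  have hcb : c :: (z ++ [b]) <+: c :: t := List.cons_prefix_cons.2 ⟨rfl, hb⟩
  have h3 : occ (a :: S) (c :: z) = 1 := by
    refine occ_eq_one (hcz.isInfix.trans hc.isInfix) (occ_le_one_iff.2 ?_)
    intro t1 ht1 t2 ht2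
    obtain ⟨r1, rfl, hr1⟩ := suf_of_cons' ht1
    obtain ⟨r2, rfl, hr2⟩ := suf_of_cons' ht2
    rw [occ_le_one_iff.1 h1.le _ hr1 _ hr2]
  have hmem : (c, b) ∈ Phi (a :: S) z := by
    refine ⟨?_, ?_, h3, ?_⟩
    · show 2 ≤ occ (a :: S) z
      rw [occ_cons_of h.pre, h1]
    · exact occ_eq_one (hcb.isInfix.trans hc.isInfix)
        ((occ_mono (show c :: z <+: _ from ⟨[b], by simp⟩)).trans h3.le)
    · rw [occ_cons_of_not]
      · exact occ_eq_one hbs ((occ_mono (List.prefix_append _ _)).trans h1.le)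
      · intro hh
        have := (h.max _ hh hbs).length_le
        simp at this
  have : Phi (a :: S) z = {(c, b)} := by
    refine Set.Subsingleton.eq_singleton_of_mem (fun p hp q hq => Phi_injOn hp hq ?_) hmem
    have key : ∀ p ∈ Phi (a :: S) z, z ++ [p.2] <+: t := by
      intro p hp
      obtain ⟨t1, ht1⟩ := sub_iff.1 (Phi_sub hp)
      obtain ⟨r1, rfl, hr1⟩ := suf_of_cons' ht1
      rw [← occ_le_one_iff.1 h1.le _ (suf_mono (List.prefix_append _ _) hr1) _ ht]
      exact hr1.2
    exact snoc_inj (key p hp) (key q hq)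
  unfold phi
  rw [this, Set.ncard_singleton]

end Phi

/-! ### The number of links and the depth of the tree -/

section Count

variable {A : Type u} {S : List A} {a : A} {z : List A}
  {k : ℕ} {x : List A}

theorem nodes_finite (S : List A) : {x | IsNode S x}.Finite := by
  refine (List.finite_toSet S.sublists).subset fun x hx => ?_
  have : x <:+: S := IsNode.sub hx
  simpa using this.sublist

/-- The pairs `(x, c)` of a node and a character with a child edge. -/
def childE (S : List A) : Set (List A × A) := {p | IsNode S p.1 ∧ p.1 ++ [p.2] <:+: S}

/-- The pairs `(x, c)` of a node and a character with a Weiner link. -/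
def weinerE (S : List A) : Set (List A × A) := {p | IsNode S p.1 ∧ p.2 :: p.1 <:+: S}

theorem finite_ncard_le {α β : Type*} {s : Set α} {t : Set β} (ht : t.Finite) (hk : t.ncard ≤ k)
    (f : α → β) (hf : ∀ x ∈ s, f x ∈ t) (hinj : Set.InjOn f s) : s.Finite ∧ s.ncard ≤ k :=
  ⟨Set.Finite.of_finite_image (ht.subset (by rintro _ ⟨x, hx, rfl⟩; exact hf x hx)) hinj,
    (Set.ncard_le_ncard_of_injOn f hf hinj ht).trans hk⟩

theorem childE_card (hk : {x | IsNode S x}.ncard ≤ k) : (childE S).Finite ∧ (childE S).ncard ≤ k := by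
  refine finite_ncard_le (nodes_finite S) hk (fun p => loc S (p.1 ++ [p.2]))
    (fun p hp => loc_node hp.2) ?_
  rintro ⟨x, c⟩ ⟨h1, h2⟩ ⟨y, d⟩ ⟨h3, h4⟩ e
  simp only at h1 h2 h3 h4 e
  have := isParent_loc h1 h2
  rw [e] at this
  obtain rfl := this.unique (isParent_loc h3 h4)
  have h5 := prefix_loc h2
  rw [e] at h5
  rw [snoc_inj h5 (prefix_loc h4)]

/-- Distinct soft Weiner links have occurrences with distinct ends. -/
theorem soft_card : {p ∈ weinerE S | ¬ IsNode S (p.2 :: p.1)}.Finite ∧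
    {p ∈ weinerE S | ¬ IsNode S (p.2 :: p.1)}.ncard ≤ S.length := by
  classical
  -- `r` is what follows an occurrence of the link in `S`; its length determines the link
  have hch : ∀ p : List A × A, ∃ r, p ∈ weinerE S → p.2 :: (p.1 ++ r) <:+ S := by
    intro p
    by_cases hp : p ∈ weinerE S
    · obtain ⟨t, ht, r, rfl⟩ := sub_iff.1 hp.2
      exact ⟨r, fun _ => by simpa using ht⟩
    · simp_all
  choose f hf using hch
  refine finite_ncard_le (Finset.finite_toSet (Finset.range S.length))
    (by rw [Set.ncard_coe_finset, Finset.card_range]) (fun p => (f p).length) ?_ ?_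
  · grind
  · have key : ∀ p ∈ weinerE S, ∀ q ∈ weinerE S, ¬ IsNode S (p.2 :: p.1) →
        (f p).length = (f q).length → p.1.length ≤ q.1.length → p = q := by
      rintro ⟨x, c⟩ hp ⟨y, d⟩ hq hn e hl
      have h1 := hf _ hp
      have h2 := hf _ hq
      simp only at h1 h2 hl hn
      have ef : f (x, c) = f (y, d) := by
        refine suffix_eq_of_len (t := S) ?_ ?_ e
        · exact (show _ <:+ _ from ⟨c :: x, by simp⟩).trans h1
        · exact (show _ <:+ _ from ⟨d :: y, by simp⟩).trans h2
      rw [ef] at h1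
      rcases Nat.lt_or_ge x.length y.length with hlt | hge
      · exfalso
        have h3 : c :: (x ++ f (y, d)) <:+ y ++ f (y, d) :=
          List.suffix_of_suffix_length_le h1 ((List.suffix_cons d _).trans h2) (by simp; omega)
        have h4 : c :: x <:+ y := by
          obtain ⟨s, hs⟩ := h3
          refine ⟨s, List.append_cancel_right (bs := f (y, d)) ?_⟩
          rw [← hs]; simp
        exact hn (hq.1.of_suffix h4)
      · have h3 := suffix_eq_of_len h1 h2 (by simp; omega)
        have h4 : c = d ∧ x = y := by
          simp_all
        rw [h4.1, h4.2]
    rintro p ⟨hp, hpn⟩ q ⟨hq, hqn⟩ e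
    rcases le_total p.1.length q.1.length with hl | hl
    · grind
    · grind

theorem weinerE_card (hk : {x | IsNode S x}.ncard ≤ k) :
    (weinerE S).Finite ∧ (weinerE S).ncard ≤ k + S.length := by
  obtain ⟨f1, c1⟩ := soft_card (S := S)
  have f2 : {p ∈ weinerE S | IsNode S (p.2 :: p.1)}.Finite ∧
      {p ∈ weinerE S | IsNode S (p.2 :: p.1)}.ncard ≤ k := by
    refine finite_ncard_le (nodes_finite S) hk (fun p => p.2 :: p.1) (fun p hp => hp.2) ?_
    rintro ⟨x, c⟩ - ⟨y, d⟩ - e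
    simp at e
    rw [e.1, e.2]
  have e : weinerE S = {p ∈ weinerE S | IsNode S (p.2 :: p.1)} ∪
      {p ∈ weinerE S | ¬ IsNode S (p.2 :: p.1)} := by
    ext p; simp only [Set.mem_union, Set.mem_ofPred_eq]; tauto
  rw [e]
  refine ⟨f2.1.union f1, (Set.ncard_union_le _ _).trans (by omega)⟩

/-- The number of proper ancestors of a node. -/
noncomputable def dep (S x : List A) : ℕ := {v | IsNode S v ∧ v <+: x ∧ v ≠ x}.ncard

theorem anc_finite (x : List A) : {v | IsNode S v ∧ v <+: x ∧ v ≠ x}.Finite :=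
  (nodes_finite S).subset fun _ h => h.1

theorem dep_nil : dep S [] = 0 := by
  rw [dep, Set.ncard_eq_zero (anc_finite _)]
  ext v
  simp only [Set.mem_ofPred_eq, Set.mem_empty_iff_false, iff_false]
  rintro ⟨-, h1, h2⟩
  exact h2 (List.prefix_nil.1 h1)

theorem IsParent.dep {v : List A} (h : IsParent S v x) : dep S x = dep S v + 1 := by
  unfold NetFrequency.dep
  have : {u | IsNode S u ∧ u <+: x ∧ u ≠ x} = insert v {u | IsNode S u ∧ u <+: v ∧ u ≠ v} := by
    ext u
    simp only [Set.mem_ofPred_eq, Set.mem_insert_iff]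
    constructor
    · rintro ⟨h1, h2, h3⟩
      by_cases e : u = v
      · exact .inl e
      · exact .inr ⟨h1, prefix_of_len h2 h.2.1 (h.2.2.2 u h1 h2 h3), e⟩
    · rintro (rfl | ⟨h1, h2, h3⟩)
      · exact ⟨h.1, h.2.1, h.2.2.1⟩
      · refine ⟨h1, h2.trans h.2.1, ?_⟩
        rintro rfl
        exact h.2.2.1 (h.2.1.eq_of_length (le_antisymm h.2.1.length_le h2.length_le))
  rw [this, Set.ncard_insert_of_notMem _ (anc_finite v)]
  rintro ⟨-, -, h⟩
  exact h rfl

theorem IsHead.dep_head (h : IsHead a S z) : dep (a :: S) z = dep S z := by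
  unfold dep
  congr 1
  ext v
  simp only [Set.mem_ofPred_eq]
  constructor
  · rintro ⟨h1, h2, h3⟩
    refine ⟨?_, h2, h3⟩
    rcases h.node_iff.1 h1 with h1 | rfl | rfl
    · exact h1
    · exact absurd (h2.isInfix.trans h.sub) not_sub_cons
    · exact absurd rfl h3
  · rintro ⟨h1, h2, h3⟩
    exact ⟨h1.cons, h2, h3⟩

theorem IsHead.dep_new (h : IsHead a S z) : dep (a :: S) (a :: S) = dep S z + 1 := by
  rw [h.parent_new.dep, h.dep_head]

/-- Removal of the first character maps the proper ancestors of `ax` other than the root to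
ancestors of `b`. -/
theorem dep_cons_le {b : List A}
    (hb : ∀ u, IsNode S u → IsNode S (a :: u) → u <+: x → u ≠ x → u <+: b) :
    dep S (a :: x) ≤ dep S b + 2 := by
  unfold dep
  have h1 : {v | IsNode S v ∧ v <+: a :: x ∧ v ≠ a :: x} ⊆
      insert [] ((fun u => a :: u) '' insert b {u | IsNode S u ∧ u <+: b ∧ u ≠ b}) := by
    rintro v ⟨h1, h2, h3⟩
    cases v with
    | nil => exact .inl rfl
    | cons c u =>
      obtain ⟨rfl, h4⟩ := List.cons_prefix_cons.1 h2
      have h5 := hb u h1.tail h1 h4 fun e => h3 (by rw [e])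
      right
      refine ⟨u, ?_, rfl⟩
      by_cases e : u = b
      · exact .inl e
      · exact .inr ⟨h1.tail, h5, e⟩
  have hf : (insert b {u | IsNode S u ∧ u <+: b ∧ u ≠ b}).Finite := (anc_finite b).insert b
  refine (Set.ncard_le_ncard h1 ((hf.image _).insert _)).trans ?_
  refine (Set.ncard_insert_le _ _).trans ?_
  have := Set.ncard_image_le hf (f := fun u => a :: u)
  have := Set.ncard_insert_le b {u | IsNode S u ∧ u <+: b ∧ u ≠ b}
  omega

theorem dep_cons_le_one (hb : ∀ u, IsNode S u → IsNode S (a :: u) → u <+: x → u ≠ x → False) :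
    dep S (a :: x) ≤ 1 := by
  unfold dep
  have h1 : {v | IsNode S v ∧ v <+: a :: x ∧ v ≠ a :: x} ⊆ {[]} := by
    rintro v ⟨h1, h2, h3⟩
    cases v with
    | nil => rfl
    | cons c u =>
      obtain ⟨rfl, h4⟩ := List.cons_prefix_cons.1 h2
      exact (hb u h1.tail h1 h4 fun e => h3 (by rw [e])).elim
  refine (Set.ncard_le_ncard h1 (Set.finite_singleton _)).trans ?_
  rw [Set.ncard_singleton]

end Count

/-! ### The list of net frequencies and its changes -/

/-- A circular doubly linked list, from the record at `p` on. The record of node `i` is at `64 * i + 8`,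
with the pointer to the previous record four cells further; the head of the list is a record at
`0`. -/
def DChain (M : ℕ → ℕ) : ℕ → List ℕ → Prop
  | p, [] => M p = 0 ∧ M 4 = p
  | p, i :: l => M p = 64 * i + 8 ∧ M (64 * i + 12) = p ∧ DChain M (64 * i + 8) l

theorem DChain.frame {M M' : ℕ → ℕ} : ∀ {l : List ℕ} {p : ℕ}, DChain M p l → M' p = M p →
    M' 4 = M 4 → (∀ j ∈ l, M' (64 * j + 8) = M (64 * j + 8) ∧ M' (64 * j + 12) = M (64 * j + 12)) →
    DChain M' p l
  | [], p, h, hp, h4, _ => ⟨hp.trans h.1, h4.trans h.2⟩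
  | i :: l, p, h, hp, h4, hl => by
    have hi := hl i (by simp)
    exact ⟨hp.trans h.1, hi.2.trans h.2.1, h.2.2.frame hi.1 h4 fun j hj => hl j (by simp [hj])⟩

theorem DChain.head_cases {M : ℕ → ℕ} {l : List ℕ} {p : ℕ} (h : DChain M p l) :
    (M p = 0 ∧ l = []) ∨ ∃ j l', M p = 64 * j + 8 ∧ l = j :: l' := by
  cases l with
  | nil => exact .inl ⟨h.1, rfl⟩
  | cons j l => exact .inr ⟨j, l, h.1, rfl⟩

theorem DChain.insert {M M' : ℕ → ℕ} {l : List ℕ} {i : ℕ} (h : DChain M 0 l) (hi : 1 ≤ i)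
    (hl : ∀ j ∈ l, 1 ≤ j) (hnd : (i :: l).Nodup) (e1 : M' 0 = 64 * i + 8) (e2 : M' (64 * i + 12) = 0)
    (e3 : M' (64 * i + 8) = M 0) (e4 : M' (M 0 + 4) = 64 * i + 8)
    (hne : ∀ c, (c = 4 ∨ (64 ≤ c ∧ (c % 64 = 8 ∨ c % 64 = 12))) → c ≠ 64 * i + 12 →
      c ≠ 64 * i + 8 → c ≠ M 0 + 4 → M' c = M c) :
    DChain M' 0 (i :: l) := by
  refine ⟨e1, e2, ?_⟩
  cases l with
  | nil =>
    obtain ⟨h1, h2⟩ := h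
    exact ⟨by rw [e3, h1], by rw [h1] at e4; exact e4⟩
  | cons j l =>
    obtain ⟨h1, h2, h3⟩ := h
    have hj := hl j (by simp)
    rw [h1] at e4 hne e3
    simp at hnd
    refine ⟨e3, by rw [← e4], h3.frame ?_ ?_ fun k hk => ?_⟩
    · exact hne _ (by omega) (by omega) (by omega) (by omega)
    · exact hne _ (by omega) (by omega) (by omega) (by omega)
    · have hk1 := hl k (by simp [hk])
      have hki : k ≠ i := by rintro rfl; exact hnd.1.2 hk
      have hkj : k ≠ j := by rintro rfl; exact hnd.2.1 hk
      exact ⟨hne _ (by omega) (by omega) (by omega) (by omega),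
        hne _ (by omega) (by omega) (by omega) (by omega)⟩

theorem DChain.prev_cases {M : ℕ → ℕ} {l₂ : List ℕ} {i : ℕ} : ∀ {l₁ : List ℕ} {p : ℕ},
    DChain M p (l₁ ++ i :: l₂) → M (64 * i + 12) = p ∨ ∃ k ∈ l₁, M (64 * i + 12) = 64 * k + 8
  | [], _, h => .inl h.2.1
  | k :: l₁, _, h => by
    rcases DChain.prev_cases h.2.2 with e | ⟨k', hk', e⟩
    · exact .inr ⟨k, by simp, e⟩
    · exact .inr ⟨k', by simp [hk'], e⟩

theorem DChain.next_cases {M : ℕ → ℕ} {l₂ : List ℕ} {i : ℕ} : ∀ {l₁ : List ℕ} {p : ℕ},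
    DChain M p (l₁ ++ i :: l₂) → M (64 * i + 8) = 0 ∨ ∃ k ∈ l₂, M (64 * i + 8) = 64 * k + 8
  | [], _, h => by
    rcases h.2.2.head_cases with ⟨e, -⟩ | ⟨k, l', e, e'⟩
    · exact .inl e
    · exact .inr ⟨k, by simp [e'], e⟩
  | _ :: _, _, h => DChain.next_cases h.2.2

/-- Deletion needs only the two neighbours of the record. -/
theorem DChain.erase {M M' : ℕ → ℕ} {l₂ : List ℕ} {i : ℕ} : ∀ {l₁ : List ℕ} {p : ℕ},
    DChain M p (l₁ ++ i :: l₂) → (p = 0 ∨ ∃ k, p = 64 * k + 8 ∧ 1 ≤ k ∧ k ∉ l₁ ++ i :: l₂) →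
    (∀ j ∈ l₁ ++ i :: l₂, 1 ≤ j) → (l₁ ++ i :: l₂).Nodup →
    M' (M (64 * i + 12)) = M (64 * i + 8) → M' (M (64 * i + 8) + 4) = M (64 * i + 12) →
    (∀ c, (c = 0 ∨ c = 4 ∨ (64 ≤ c ∧ (c % 64 = 8 ∨ c % 64 = 12))) → c ≠ M (64 * i + 12) →
      c ≠ M (64 * i + 8) + 4 → M' c = M c) → DChain M' p (l₁ ++ l₂)
  | [], p, h, hp, hl, hnd, e1, e2, hne => by
    obtain ⟨h1, h2, h3⟩ := h
    rw [h2] at e1 e2 hne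
    simp at hnd
    rw [List.nil_append]
    cases l₂ with
    | nil =>
      obtain ⟨h3, h4⟩ := h3
      rw [h3] at e1 e2
      exact ⟨e1, e2⟩
    | cons j l₂ =>
      obtain ⟨h3, h4, h5⟩ := h3
      rw [h3] at e1 e2 hne
      have hj := hl j (by simp)
      have hp8 : ∀ k, k ∈ l₂ → p ≠ 64 * k + 8 := by
        rintro k hk e
        rcases hp with e' | ⟨k', e', -, hk'⟩
        · omega
        · obtain rfl : k' = k := by omega
          exact hk' (by simp [hk])
      have hpj : p ≠ 64 * j + 8 := by
        intro e
        rcases hp with e' | ⟨k', e', -, hk'⟩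
        · omega
        · obtain rfl : k' = j := by omega
          exact hk' (by simp)
      have hpm : p ≠ 4 ∧ ∀ k, p ≠ 64 * k + 12 := by
        rcases hp with e' | ⟨k', e', -, hk'⟩
        · exact ⟨by omega, by omega⟩
        · exact ⟨by omega, by omega⟩
      refine ⟨e1, by rw [← e2], h5.frame ?_ ?_ fun k hk => ?_⟩
      · exact hne _ (by omega) (Ne.symm hpj) (by omega)
      · exact hne _ (by omega) (Ne.symm hpm.1) (by omega)
      · have hk1 := hl k (by simp [hk])
        have hkj : k ≠ j := by rintro rfl; exact (List.nodup_cons.1 hnd.2).1 hk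
        exact ⟨hne _ (by omega) (Ne.symm (hp8 k hk)) (by omega),
          hne _ (by omega) (Ne.symm (hpm.2 k)) (by omega)⟩
  | j :: l₁, p, h, hp, hl, hnd, e1, e2, hne => by
    obtain ⟨h1, h2, h3⟩ := h
    simp only [List.cons_append, List.nodup_cons] at hnd
    have hj := hl j (by simp)
    have hq' : M (64 * i + 12) ≠ p ∧ M (64 * i + 12) % 64 = 8 := by
      rcases h3.prev_cases with e | ⟨k, hk, e⟩
      · refine ⟨fun e' => ?_, by omega⟩
        rcases hp with e'' | ⟨k', e'', -, hk'⟩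
        · omega
        · obtain rfl : k' = j := by omega
          exact hk' (by simp)
      · refine ⟨fun e' => ?_, by omega⟩
        rcases hp with e'' | ⟨k', e'', -, hk'⟩
        · omega
        · obtain rfl : k' = k := by omega
          exact hk' (by simp [hk])
    have hn' : M (64 * i + 8) + 4 ≠ p ∧ M (64 * i + 8) + 4 ≠ 64 * j + 12 := by
      rcases h3.next_cases with e | ⟨k, hk, e⟩
      · refine ⟨?_, by omega⟩
        rcases hp with e'' | ⟨k', e'', -, hk'⟩ <;> omega
      · refine ⟨?_, ?_⟩
        · rcases hp with e'' | ⟨k', e'', -, hk'⟩ <;> omega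
        · have : k ≠ j := by rintro rfl; exact hnd.1 (by simp [hk])
          omega
    refine ⟨?_, ?_, DChain.erase h3 (.inr ⟨j, rfl, hj, hnd.1⟩) (fun k hk => hl k (by simp at hk ⊢; tauto))
      hnd.2 e1 e2 hne⟩
    · rw [hne _ ?_ hq'.1.symm hn'.1.symm, h1]
      rcases hp with e'' | ⟨k', e'', hk'', -⟩ <;> omega
    · rw [hne _ (by omega) (fun e => by have := hq'.2; omega) hn'.2.symm, h2]

/-- A linked list of records in the cells from `lo` to `hi - 1`. -/
def RecList (M : ℕ → ℕ) (lo hi : ℕ) : ℕ → List (ℕ × ℕ × ℕ) → Prop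
  | p, [] => p = 0
  | p, e :: L => p ≠ 0 ∧ lo ≤ p ∧ p + 4 ≤ hi ∧ M (p + 1) = e.1 ∧ M (p + 2) = e.2.1 ∧
      M (p + 3) = e.2.2 ∧ RecList M lo hi (M p) L

theorem RecList.frame {M M' : ℕ → ℕ} {lo hi hi' : ℕ} (hh : hi ≤ hi')
    (hM : ∀ c, lo ≤ c → c < hi → M' c = M c) : ∀ {L : List (ℕ × ℕ × ℕ)} {p : ℕ},
    RecList M lo hi p L → RecList M' lo hi' p L
  | [], _, h => h
  | _ :: _, p, ⟨h0, h1, h2, h3, h4, h5, h6⟩ =>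
    ⟨h0, h1, by omega, by rw [hM _ (by omega) (by omega), h3], by rw [hM _ (by omega) (by omega), h4],
      by rw [hM _ (by omega) (by omega), h5], by
        rw [hM _ (by omega) (by omega)]; exact RecList.frame hh hM h6⟩

/-- Bring the lists up to date with respect to the node in register `60`; the `k`-th records of the two
lists of changes are used. -/
def sync (k : ℕ) : Prog :=
  ldf 61 60 11 ;; ldf 62 60 3 ;;
  .ite (.eq 61 62) .nop
    (.const 63 0 ;; ldf 64 60 1 ;; ldf 65 60 2 ;;
      .ite (.eq 61 63)
        (lds 66 0 ;; stf 60 8 66 ;; stf 60 12 63 ;; addk 67 60 8 ;; stf 66 4 67 ;; sts 0 67)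
        (lds 66 2 ;; sts (40 + 4 * k) 66 ;; sts (40 + 4 * k + 1) 64 ;; sts (40 + 4 * k + 2) 65 ;;
          sts (40 + 4 * k + 3) 61 ;; .const 66 (40 + 4 * k) ;; sts 2 66) ;;
      .ite (.eq 62 63)
        (ldf 66 60 8 ;; ldf 67 60 12 ;; .store 67 66 ;; stf 66 4 67)
        (lds 66 1 ;; sts (8 + 4 * k) 66 ;; sts (8 + 4 * k + 1) 64 ;; sts (8 + 4 * k + 2) 65 ;;
          sts (8 + 4 * k + 3) 62 ;; .const 66 (8 + 4 * k) ;; sts 1 66) ;;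
      stf 60 11 62)

/-- The cells that are changed by `sync`. -/
abbrev SyncCell (c : ℕ) : Prop :=
  c ≤ 2 ∨ c = 4 ∨ (8 ≤ c ∧ c < 24) ∨ (40 ≤ c ∧ c < 56) ∨
    (64 ≤ c ∧ (c % 64 = 8 ∨ c % 64 = 11 ∨ c % 64 = 12))

/-- The state of the lists while they are brought up to date: the net frequency of the node with index
`j` was `sh j` and is `tg j` now, the node is denoted by `pp j` and `ll j`, the nodes `dn` have
been treated, and `l` is the list of the nodes. -/
structure SyncInv (M : ℕ → ℕ) (N : ℕ) (sh tg pp ll : ℕ → ℕ) (k : ℕ) (dn l : List ℕ) : Prop where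
  shadow : ∀ j, 1 ≤ j → j < N → M (64 * j + 11) = if j ∈ dn then tg j else sh j
  target : ∀ j, 1 ≤ j → j < N → M (64 * j + 3) = tg j
  pos : ∀ j, 1 ≤ j → j < N → M (64 * j + 1) = pp j
  len : ∀ j, 1 ≤ j → j < N → M (64 * j + 2) = ll j
  nodup : dn.Nodup
  mem : ∀ j ∈ dn, 1 ≤ j ∧ j < N ∧ sh j ≠ tg j
  nodupl : l.Nodup
  meml : ∀ j, j ∈ l ↔ 1 ≤ j ∧ j < N ∧ M (64 * j + 11) ≠ 0
  chain : DChain M 0 l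
  plus : RecList M 8 (8 + 4 * k) (M 1) ((dn.filter (tg · ≠ 0)).map fun j => (pp j, ll j, tg j))
  minus : RecList M 40 (40 + 4 * k) (M 2) ((dn.filter (sh · ≠ 0)).map fun j => (pp j, ll j, sh j))

section Sync

variable {A : Type u} [LinearOrder A] {B N : ℕ}

set_option maxHeartbeats 1600000 in
/-- If the net frequency of the node `i` has changed, `i` enters or leaves the list of `PNF` according to whether
the old or the new value is `0`, and the nonzero values are recorded as lost and new pairs. -/
theorem sync_wp {M : ℕ → ℕ} {sh tg pp ll : ℕ → ℕ} {k : ℕ} {dn l : List ℕ}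
    (H : SyncInv M N sh tg pp ll k dn l) (hk : k < 4) (hB : 64 * N ≤ B) {i : ℕ} (hi : 1 ≤ i)
    (hiN : i < N) {s : State A} (hM : s.mem.num = M) (h60 : s.reg 60 = 64 * i)
    {R : State A → ℕ → Prop}
    (hR : ∀ s' t dn' l', KeepsR 61 68 s s' → SyncInv s'.mem.num N sh tg pp ll (k + 1) dn' l' →
      dn ⊆ dn' → (i ∈ dn' ∨ sh i = tg i) → (∀ c, ¬ SyncCell c → s'.mem.num c = M c) → t ≤ 60 →
      R s' t) : WP B (sync k) s R := by
  have b : ∀ f, f < 64 → 64 * i + f < B := by omega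
  have b0 : ∀ f, f < 64 → f < B := by omega
  have b2 : 64 * i + 8 ≤ B := by omega
  have b3 : ∀ o, o ≤ 40 → o + 4 * k ≤ B ∧ o + 4 * k < B ∧ o + 4 * k + 1 < B ∧ o + 4 * k + 2 < B ∧
    o + 4 * k + 3 < B := by omega
  have b4 := b3 8 (by omega)
  have b5 := b3 40 (by omega)
  have hsh := H.shadow i hi hiN
  have htg := H.target i hi hiN
  have hpp := H.pos i hi hiN
  have hll := H.len i hi hiN
  have hl1 : ∀ j ∈ l, 1 ≤ j := fun j hj => ((H.meml j).1 hj).1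
  by_cases heq : M (64 * i + 11) = M (64 * i + 3)
  · simp [sync, h60, hM, b, heq]
    refine hR _ _ dn l (by simp) ?_ (fun _ h => h) ?_ (fun c _ => by simp [hM]) (by omega)
    · have hp := H.plus.frame (M' := M) (hi' := 8 + 4 * (k + 1)) (by omega) (fun _ _ _ => rfl)
      have hm := H.minus.frame (M' := M) (hi' := 40 + 4 * (k + 1)) (by omega) (fun _ _ _ => rfl)
      simp only [State.setReg_mem, hM]
      exact ⟨H.shadow, H.target, H.pos, H.len, H.nodup, H.mem, H.nodupl, H.meml, H.chain, hp, hm⟩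
    · by_cases hd : i ∈ dn
      · exact .inl hd
      · rw [if_neg hd] at hsh
        exact .inr (by rw [← hsh, heq, htg])
  · have hd : i ∉ dn := by
      intro hd
      rw [if_pos hd] at hsh
      exact heq (by rw [hsh, htg])
    rw [if_neg hd] at hsh
    have hst : sh i ≠ tg i := by rw [← hsh, ← htg]; exact heq
    -- the new list of treated nodes is `i :: dn`
    have gen : ∀ (s' : State A) t (l' : List ℕ), t ≤ 60 → KeepsR 61 68 s s' → l'.Nodup →
        (∀ j, j ∈ l' ↔ (j = i ∧ tg i ≠ 0) ∨ (j ≠ i ∧ j ∈ l)) → DChain s'.mem.num 0 l' →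
        s'.mem.num (64 * i + 11) = tg i →
        (∀ c, c ≠ 64 * i + 11 → ¬ (c ≤ 2 ∨ c = 4 ∨ (8 + 4 * k ≤ c ∧ c < 8 + 4 * (k + 1)) ∨
          (40 + 4 * k ≤ c ∧ c < 40 + 4 * (k + 1)) ∨ (64 ≤ c ∧ (c % 64 = 8 ∨ c % 64 = 12))) →
          s'.mem.num c = M c) →
        (∀ o g, (o = 8 ∧ g = tg i ∧ tg i ≠ 0) ∨ (o = 40 ∧ g = sh i ∧ sh i ≠ 0) →
          s'.mem.num (if o = 8 then 1 else 2) = o + 4 * k ∧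
          s'.mem.num (o + 4 * k) = M (if o = 8 then 1 else 2) ∧ s'.mem.num (o + 4 * k + 1) = pp i ∧
          s'.mem.num (o + 4 * k + 2) = ll i ∧ s'.mem.num (o + 4 * k + 3) = g) →
        (tg i = 0 → s'.mem.num 1 = M 1) → (sh i = 0 → s'.mem.num 2 = M 2) → R s' t := by
      intro s' t l' ht hk' g3 g4 g5 g1 g2 g6 g7 g9
      have hp := H.plus.frame (M' := s'.mem.num) (hi' := 8 + 4 * (k + 1)) (by omega)
        (fun c _ _ => g2 c (by omega) (by omega))
      have hm := H.minus.frame (M' := s'.mem.num) (hi' := 40 + 4 * (k + 1)) (by omega)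
        (fun c _ _ => g2 c (by omega) (by omega))
      have hf : ∀ j f, f < 4 → 1 ≤ j → s'.mem.num (64 * j + f) = M (64 * j + f) :=
        fun j f hf hj => g2 _ (by omega) (by omega)
      refine hR s' t (i :: dn) l' hk' ⟨fun j hj hjN => ?_,
        fun j hj hjN => by rw [hf j 3 (by omega) hj, H.target j hj hjN],
        fun j hj hjN => by rw [hf j 1 (by omega) hj, H.pos j hj hjN],
        fun j hj hjN => by rw [hf j 2 (by omega) hj, H.len j hj hjN],
        List.nodup_cons.2 ⟨hd, H.nodup⟩, List.forall_mem_cons.2 ⟨⟨hi, hiN, hst⟩, H.mem⟩, g3,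
        fun j => ?_, g5, ?_, ?_⟩ (by simp) (by simp)
        (fun c hc => by exact g2 c (by omega) (by omega)) ht
      · by_cases e : j = i
        · subst e; simp [g1]
        · rw [g2 _ (by omega) (by omega), H.shadow j hj hjN]; simp [e]
      · rw [g4, H.meml]
        by_cases e : j = i
        · subst e; simp [g1, hi, hiN]
        · by_cases hj : 1 ≤ j
          · rw [g2 _ (by omega) (by omega)]; simp [e]
          · simp [hj, e]
      · by_cases h0 : tg i = 0
        · simpa [h0, g7 h0] using hp
        · obtain ⟨k1, k2, k3, k4, k5⟩ := g6 8 _ (.inl ⟨rfl, rfl, h0⟩)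
          simp only [if_true] at k1 k2
          simp only [List.filter_cons, h0, k1, ne_eq, not_false_eq_true, decide_true, if_true,
            List.map_cons]
          exact ⟨by omega, by omega, by omega, k3, k4, k5, by rw [k2]; exact hp⟩
      · by_cases h0 : sh i = 0
        · simpa [h0, g9 h0] using hm
        · obtain ⟨k1, k2, k3, k4, k5⟩ := g6 40 _ (.inr ⟨rfl, rfl, h0⟩)
          simp only [show ¬ 40 = 8 by omega, if_false] at k1 k2
          simp only [List.filter_cons, h0, k1, ne_eq, not_false_eq_true, decide_true, if_true,
            List.map_cons]
          exact ⟨by omega, by omega, by omega, k3, k4, k5, by rw [k2]; exact hm⟩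
    by_cases h0 : sh i = 0
    · -- the node enters the list
      have h1 : tg i ≠ 0 := fun e => hst (h0.trans e.symm)
      have hil : i ∉ l := fun hh => ((H.meml i).1 hh).2.2 (by rw [hsh, h0])
      have hM0 : M 0 + 4 < B ∧ (M 0 = 0 ∨ (64 ≤ M 0 ∧ M 0 % 64 = 8)) ∧ M 0 ≠ 64 * i + 8 := by
        rcases H.chain.head_cases with ⟨e, -⟩ | ⟨j, l', e, rfl⟩
        · omega
        · have := (H.meml j).1 (by simp)
          have : j ≠ i := by rintro rfl; exact hil (by simp)
          omega
      have b1 := hM0.1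
      simp [sync, h60, hM, b, b0, hsh, htg, hpp, hll, h0, h1, Ne.symm h1, b1, b2, b4]
      refine gen _ _ (i :: l) (by omega) (by simp)
        (List.nodup_cons.2 ⟨hil, H.nodupl⟩) (fun j => by by_cases e : j = i <;> simp [e, h1])
        (H.chain.insert hi hl1 (List.nodup_cons.2 ⟨hil, H.nodupl⟩) ?_ ?_ ?_ ?_ ?_) ?_ ?_ ?_
        (fun e => absurd e h1) ?_
      all_goals simp only [State.setReg_mem, State.setNum_num, hM]
      all_goals intros
      on_goal 8 =>
        rcases ‹_ ∨ _› with ⟨rfl, rfl, -⟩ | ⟨-, -, h⟩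
        · refine ⟨?_, ?_, ?_, ?_, ?_⟩ <;> simp (disch := omega) only [upd_ne, upd_self, if_true]
        · exact absurd h0 h
      all_goals simp (disch := omega) only [upd_ne, upd_self]
    · have hil : i ∈ l := (H.meml i).2 ⟨hi, hiN, by rw [hsh]; exact h0⟩
      by_cases h1 : tg i = 0
      · -- the node leaves the list
        obtain ⟨l₁, l₂, rfl⟩ := List.append_of_mem hil
        have hnd := H.nodupl
        have hnd2 := List.nodup_cons.1 (List.nodup_middle.1 hnd)
        obtain ⟨q, hq⟩ : ∃ q, M (64 * i + 12) = q := ⟨_, rfl⟩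
        obtain ⟨n, hn⟩ : ∃ n, M (64 * i + 8) = n := ⟨_, rfl⟩
        have hmem : ∀ j ∈ l₁ ++ l₂, 1 ≤ j ∧ j < N ∧ j ≠ i := fun j hj => by
          have := (H.meml j).1 (by simp at hj ⊢; tauto)
          exact ⟨this.1, this.2.1, fun e => hnd2.1 (e ▸ hj)⟩
        have hq' : q = 0 ∨ (64 ≤ q ∧ q < 64 * N ∧ q % 64 = 8 ∧ q ≠ 64 * i + 8) := by
          rcases H.chain.prev_cases with e | ⟨j, hj, e⟩
          · exact .inl (hq.symm.trans e)
          · have := hmem j (by simp [hj]); omega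
        have hn' : n = 0 ∨ (64 ≤ n ∧ n + 56 ≤ 64 * N ∧ n % 64 = 8 ∧ n ≠ 64 * i + 8) := by
          rcases H.chain.next_cases with e | ⟨j, hj, e⟩
          · exact .inl (hn.symm.trans e)
          · have := hmem j (by simp [hj]); omega
        simp [sync, h60, hM, b, b0, hsh, htg, hpp, hll, h0, h1, b5]
        simp (disch := omega) only [upd_ne, hq, hn]
        refine ⟨by omega, by omega, gen _ _ (l₁ ++ l₂) (by omega)
          (by simp) hnd2.2 (fun j => ?_)
          (H.chain.erase (.inl rfl) hl1 hnd ?_ ?_ ?_) ?_ ?_ ?_ ?_ (fun e => absurd e h0)⟩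
        · by_cases e : j = i
          · subst e; simp only [h1]; simpa using hnd2.1
          · simp [e]
        all_goals simp only [State.setReg_mem, State.setNum_num, hM, hq, hn]
        all_goals intros
        on_goal 6 =>
          rcases ‹_ ∨ _› with ⟨-, -, h⟩ | ⟨rfl, rfl, -⟩
          · exact absurd h1 h
          · refine ⟨?_, ?_, ?_, ?_, ?_⟩ <;>
              simp (disch := omega) only [upd_ne, upd_self, show ¬ 40 = 8 by omega, if_false]
        all_goals simp (disch := omega) only [upd_ne, upd_self, h1]
      · simp [sync, h60, hM, b, b0, hsh, htg, hpp, hll, h0, h1, hst, b4, b5]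
        simp (disch := omega) only [upd_ne]
        refine gen _ _ l (by omega) (by simp) H.nodupl
          (fun j => ?_) (H.chain.frame ?_ ?_ fun j hj => ⟨?_, ?_⟩) ?_ ?_ ?_ (fun e => absurd e h1)
          (fun e => absurd e h0)
        · by_cases e : j = i <;> simp [e, h1, hil]
        all_goals simp only [State.setReg_mem, State.setNum_num, hM]
        on_goal 3 => have := hl1 j hj
        on_goal 4 => have := hl1 j hj
        all_goals intros
        on_goal 7 =>
          rcases ‹_ ∨ _› with ⟨rfl, rfl, -⟩ | ⟨rfl, rfl, -⟩ <;> refine ⟨?_, ?_, ?_, ?_, ?_⟩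
        all_goals simp (disch := omega) only [upd_ne, upd_self, if_true, show ¬ 40 = 8 by omega, if_false]

end Sync

/-! ### Child edges and Weiner links as dictionaries -/

section Links

variable {A : Type u}

/-- The nodes of the suffix tree of `S` are numbered from `1` to `N - 1`, the root being `1`. -/
structure Indexing (S : List A) (idx : List A → ℕ) (N : ℕ) : Prop where
  inj : ∀ x y, IsNode S x → IsNode S y → idx x = idx y → x = y
  pos : ∀ x, IsNode S x → 1 ≤ idx x ∧ idx x < N
  surj : ∀ j, 1 ≤ j → j < N → ∃ x, IsNode S x ∧ idx x = j
  root : idx [] = 1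

/-- The function `D` holds the child edges and the Weiner links of the suffix tree of `S`, at the keys
given by the numbers `ι c` of the characters. -/
structure LinkMap (S : List A) (idx : List A → ℕ) (ι : A → ℕ) (D : ℕ → ℕ → ℕ) : Prop where
  child : ∀ x c, IsNode S x → x ++ [c] <:+: S →
    D (64 * idx x + 5) (ι c) = 64 * idx (loc S (x ++ [c]))
  weiner : ∀ x c, IsNode S x → c :: x <:+: S →
    D (64 * idx x + 13) (ι c) = 64 * idx (loc S (c :: x))
  only : ∀ d j, D d j ≠ 0 → ∃ x c, IsNode S x ∧ j = ι c ∧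
    ((d = 64 * idx x + 5 ∧ x ++ [c] <:+: S) ∨ (d = 64 * idx x + 13 ∧ c :: x <:+: S))

variable {S : List A} {idx : List A → ℕ} {ι : A → ℕ} {N : ℕ} {D : ℕ → ℕ → ℕ}
  {x : List A} {c : A}

theorem mem_of_snoc_sub (h : x ++ [c] <:+: S) : c ∈ S :=
  h.subset (by simp)

theorem mem_of_cons_sub (h : c :: x <:+: S) : c ∈ S := h.subset (by simp)

theorem exists_linkMap (hx : Indexing S idx N) (hι : ∀ a ∈ S, ∀ b ∈ S, ι a = ι b → a = b) :
    ∃ D, LinkMap S idx ι D := by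
  classical
  let E : ℕ → ℕ → ℕ → Prop := fun d j v => ∃ x c, IsNode S x ∧ j = ι c ∧
    ((d = 64 * idx x + 5 ∧ x ++ [c] <:+: S ∧ v = 64 * idx (loc S (x ++ [c]))) ∨
      (d = 64 * idx x + 13 ∧ c :: x <:+: S ∧ v = 64 * idx (loc S (c :: x))))
  have hE : ∀ d j v v', E d j v → E d j v' → v = v' := by
    rintro d j v v' ⟨x, c, hn, hj, h⟩ ⟨x', c', hn', hj', h'⟩
    have key : idx x = idx x' → c ∈ S → c' ∈ S → x = x' ∧ c = c' := fun e hc hc' =>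
      ⟨hx.inj _ _ hn hn' e, hι _ hc _ hc' (hj.symm.trans hj')⟩
    rcases h with ⟨h1, h2, rfl⟩ | ⟨h1, h2, rfl⟩ <;> rcases h' with ⟨h1', h2', rfl⟩ | ⟨h1', h2', rfl⟩
    · obtain ⟨rfl, rfl⟩ := key (by omega) (mem_of_snoc_sub h2) (mem_of_snoc_sub h2'); rfl
    · omega
    · omega
    · obtain ⟨rfl, rfl⟩ := key (by omega) (mem_of_cons_sub h2) (mem_of_cons_sub h2'); rfl
  let D : ℕ → ℕ → ℕ := fun d j => if h : ∃ v, E d j v then h.choose else 0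
  have hD : ∀ d j v, E d j v → D d j = v := fun d j v h => by
    have h' : ∃ v, E d j v := ⟨v, h⟩
    simp only [D, dif_pos h']
    exact hE _ _ _ _ h'.choose_spec h
  refine ⟨D, ⟨fun x c h h' => hD _ _ _ ⟨x, c, h, rfl, .inl ⟨rfl, h', rfl⟩⟩,
    fun x c h h' => hD _ _ _ ⟨x, c, h, rfl, .inr ⟨rfl, h', rfl⟩⟩, fun d j h => ?_⟩⟩
  by_cases h' : ∃ v, E d j v
  · grind
  · grind

theorem LinkMap.child_zero (h : LinkMap S idx ι D) (hx : Indexing S idx N) (hn : IsNode S x)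
    (hc : ∀ b ∈ S, ι b = ι c → b = c) (hs : ¬ x ++ [c] <:+: S) : D (64 * idx x + 5) (ι c) = 0 := by
  by_contra h0
  obtain ⟨x', c', hn', hj, ⟨e, h'⟩ | ⟨e, h'⟩⟩ := h.only _ _ h0
  · obtain rfl := hx.inj _ _ hn hn' (by omega)
    obtain rfl := hc _ (mem_of_snoc_sub h') hj.symm
    exact hs h'
  · omega

theorem LinkMap.weiner_zero (h : LinkMap S idx ι D) (hx : Indexing S idx N) (hn : IsNode S x)
    (hc : ∀ b ∈ S, ι b = ι c → b = c) (hs : ¬ c :: x <:+: S) : D (64 * idx x + 13) (ι c) = 0 := by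
  by_contra h0
  obtain ⟨x', c', hn', hj, ⟨e, h'⟩ | ⟨e, h'⟩⟩ := h.only _ _ h0
  · omega
  · obtain rfl := hx.inj _ _ hn hn' (by omega)
    obtain rfl := hc _ (mem_of_cons_sub h') hj.symm
    exact hs h'

theorem LinkMap.lt (h : LinkMap S idx ι D) (hx : Indexing S idx N) {d j : ℕ} (h0 : D d j ≠ 0) :
    64 ≤ d ∧ d < 64 * N ∧ (d % 64 = 5 ∨ d % 64 = 13) := by
  obtain ⟨x, c, hn, -, h⟩ := h.only _ _ h0
  have := hx.pos _ hn
  have : d = 64 * idx x + 5 ∨ d = 64 * idx x + 13 := h.imp (·.1) (·.1)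
  omega

theorem LinkMap.key (h : LinkMap S idx ι D) {d j : ℕ} (h0 : D d j ≠ 0) : ∃ c ∈ S, j = ι c := by
  obtain ⟨x, c, hn, hj, ⟨-, h⟩ | ⟨-, h⟩⟩ := h.only _ _ h0
  · exact ⟨c, mem_of_snoc_sub h, hj⟩
  · exact ⟨c, mem_of_cons_sub h, hj⟩

theorem Indexing.ncard_le (hx : Indexing S idx N) : {x | IsNode S x}.ncard ≤ N - 1 := by
  have := finite_ncard_le (s := {x | IsNode S x}) (t := (Finset.Ico 1 N : Set ℕ)) (k := N - 1)
    (Finset.finite_toSet _) (by rw [Set.ncard_coe_finset]; simp) idx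
    (fun x hn => by simpa using hx.pos x hn) (fun x h y h' e => hx.inj x y h h' e)
  exact this.2

theorem LinkMap.support (h : LinkMap S idx ι D) (hx : Indexing S idx N) :
    ∃ Z : Finset (ℕ × ℕ), (∀ d j, D d j ≠ 0 → (d, j) ∈ Z) ∧ Z.card ≤ 2 * (N - 1) + S.length := by
  classical
  obtain ⟨f1, c1⟩ := childE_card hx.ncard_le
  obtain ⟨f2, c2⟩ := weinerE_card hx.ncard_le
  rw [Set.ncard_eq_toFinset_card _ f1] at c1
  rw [Set.ncard_eq_toFinset_card _ f2] at c2
  refine ⟨f1.toFinset.image (fun p => (64 * idx p.1 + 5, ι p.2)) ∪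
    f2.toFinset.image (fun p => (64 * idx p.1 + 13, ι p.2)), fun d j h0 => ?_, ?_⟩
  · obtain ⟨x, c, hn, rfl, ⟨rfl, h⟩ | ⟨rfl, h⟩⟩ := h.only _ _ h0
    · exact Finset.mem_union_left _ (Finset.mem_image.2 ⟨(x, c), by simpa [childE] using ⟨hn, h⟩, rfl⟩)
    · exact Finset.mem_union_right _
        (Finset.mem_image.2 ⟨(x, c), by simpa [weinerE] using ⟨hn, h⟩, rfl⟩)
  · grind

end Links

/-! ### Changing one family of dictionaries into another -/

open Classical in
/-- The function that agrees with `D'` on `T` and with `D` elsewhere: the dictionaries on the way from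
`D` to `D'`, when the entries in `T` have been written. -/
noncomputable def mix (T : Set (ℕ × ℕ)) (D D' : ℕ → ℕ → ℕ) : ℕ → ℕ → ℕ :=
  fun d j => if (d, j) ∈ T then D' d j else D d j

theorem mix_of_mem {T : Set (ℕ × ℕ)} {D D' : ℕ → ℕ → ℕ} {d j : ℕ} (h : (d, j) ∈ T) :
    mix T D D' d j = D' d j := if_pos h

theorem mix_of_notMem {T : Set (ℕ × ℕ)} {D D' : ℕ → ℕ → ℕ} {d j : ℕ} (h : (d, j) ∉ T) :
    mix T D D' d j = D d j := if_neg h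

theorem mix_of_eq {T : Set (ℕ × ℕ)} {D D' : ℕ → ℕ → ℕ} {d j : ℕ} (h : D d j = D' d j) :
    mix T D D' d j = D' d j := by
  by_cases h' : (d, j) ∈ T
  · exact mix_of_mem h'
  · rw [mix_of_notMem h', h]

/-- The dictionaries can be changed from `D` to `D'` without removing entries, within the bounds `N` for
the number of records and `J` for the keys. -/
structure DictBound (D D' : ℕ → ℕ → ℕ) (N J k : ℕ) : Prop where
  sub : ∀ d j, D d j ≠ 0 → D' d j ≠ 0
  key : ∀ d j, D' d j ≠ 0 → j < 2 ^ k ∧ j ≤ J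
  size : ∃ Z : Finset (ℕ × ℕ), (∀ d j, D' d j ≠ 0 → (d, j) ∈ Z) ∧ 1 + Z.card ≤ N

theorem DictStore.head_eq_zero {M : ℕ → ℕ} {D : ℕ → ℕ → ℕ} {r : ℕ} (h : DictStore M D r) {d : ℕ}
    (hd : IsDict d) : M (d + 1) = 0 ↔ ∀ j, D d j = 0 := by
  obtain ⟨rec, ls, Y, h⟩ := h
  have hc := h.chain d hd
  have hm := h.mem d
  cases e : ls d with
  | nil =>
    rw [e] at hc hm
    refine ⟨fun _ j => ?_, fun _ => hc⟩
    have := hm j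
    simpa using this
  | cons i l =>
    rw [e] at hc hm
    have hi : D d i ≠ 0 := (hm i).1 (by simp)
    have := (h.dom d i).2 hi
    have := hc.1
    exact ⟨fun e => by omega, fun e => absurd (e i) hi⟩

theorem DictStore.add_card_le {M : ℕ → ℕ} {D : ℕ → ℕ → ℕ} {r : ℕ} (h : DictStore M D r)
    {Z : Finset (ℕ × ℕ)} (hZ : ∀ d j, D d j ≠ 0 → (d, j) ∈ Z) {d : ℕ} {Y : Finset ℕ}
    (hY : ∀ j ∈ Y, (d, j) ∈ Z ∧ D d j = 0) : r + Y.card ≤ 1 + Z.card := by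
  classical
  obtain ⟨rec, ls, X, h⟩ := h
  rw [h.card, add_assoc]
  have : X.card + Y.card = (X ∪ Y.image fun j => (d, j)).card := by
    rw [Finset.card_union_of_disjoint, Finset.card_image_of_injective _ (fun _ _ e => by simpa using e)]
    rw [Finset.disjoint_left]
    rintro ⟨d', j⟩ hX hj
    obtain ⟨j', hj', e⟩ := Finset.mem_image.1 hj
    simp only [Prod.mk.injEq] at e
    obtain ⟨rfl, rfl⟩ := e
    exact (h.memY _ _).1 hX (hY _ hj').2
  rw [this]
  refine Nat.add_le_add_left (Finset.card_le_card ?_) 1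
  intro p hp
  rcases Finset.mem_union.1 hp with hp | hp
  · exact hZ _ _ ((h.memY _ _).1 hp)
  · grind

section Mix

variable {A : Type u} [LinearOrder A] {B N J r k : ℕ} {M : ℕ → ℕ} {D D' : ℕ → ℕ → ℕ}
  {T : Set (ℕ × ℕ)}
  {d j : ℕ} {s : State A}
  {R : State A → ℕ → Prop}

theorem DictBound.mix_sub (h : DictBound D D' N J k) (h0 : mix T D D' d j ≠ 0) : D' d j ≠ 0 := by
  by_cases h' : (d, j) ∈ T
  · rwa [mix_of_mem h'] at h0
  · rw [mix_of_notMem h'] at h0; exact h.sub _ _ h0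

theorem DictBound.rec_le (h : DictBound D D' N J k) (hs : DictStore M (mix T D D') r) : r ≤ N := by
  obtain ⟨Z, hZ, hc⟩ := h.size
  exact (hs.le_card fun d j h0 => hZ d j (h.mix_sub h0)).trans hc

theorem mget_wp (hb : DictBound D D' N J k) (hB : 64 * N ≤ B) (hbits : BitTable M J) (hJ : J < N)
    (h : DictStore M (mix T D D') r) (hM : s.mem.num = M) (h30 : s.reg 30 = d)
    (h31 : s.reg 31 = 64 * j) (hj : j ≤ J) (hd : IsDict d) (hdB : d < B)
    (hR : ∀ s' t, KeepsR 30 35 s s' → s'.mem = s.mem → s'.reg 32 = mix T D D' d j →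
      t ≤ 30 * k + 50 → R s' t) : WP B dget s R :=
  dget_wp hB hbits hJ h (hb.rec_le h) (fun d i h0 => (hb.key d i (hb.mix_sub h0)).1) hM h30 h31 hj hd
    hdB hR

theorem mset_wp (hb : DictBound D D' N J k) (hB : 64 * N ≤ B) (hbits : BitTable M J) (hJ : J < N)
    (h : DictStore M (mix T D D') r) {v : ℕ} (hM : s.mem.num = M) (h30 : s.reg 30 = d)
    (h31 : s.reg 31 = 64 * j) (h35 : s.reg 35 = v) (hv : v = D' d j) (hv0 : v ≠ 0) (hj : j ≤ J)
    (hd : IsDict d) (hdB : d + 1 < B) (hR : ∀ s' t r', KeepsR 30 39 s s' → r ≤ r' →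
      DictStore s'.mem.num (mix (insert (d, j) T) D D') r' →
      (∀ c, ¬ DictCell c → s'.mem.num c = M c) → t ≤ 30 * k + 90 → R s' t) : WP B dset s R := by
  obtain ⟨Z, hZ, hc⟩ := hb.size
  refine dset_wp hB hbits hJ h (hb.rec_le h) (fun d i h0 => (hb.key d i (hb.mix_sub h0)).1) hM h30 h31
    h35 hv0 hj hd hdB (fun h0 => ?_) fun s' t h1 h2 h3 h4 => ?_
  · have := h.lt_card (fun d j h0 => hZ d j (hb.mix_sub h0)) (hZ d j (hv ▸ hv0)) h0
    omega
  · refine hR s' t _ h1 ?_ (h2.congr fun d₁ j₁ => ?_) h3 h4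
    · split_ifs <;> omega
    · by_cases e : d₁ = d ∧ j₁ = j
      · obtain ⟨rfl, rfl⟩ := e
        simp [dupd, mix, hv]
      · have : ¬ (d₁, j₁) = (d, j) := by simpa using e
        rw [dupd, if_neg e]
        by_cases hT : (d₁, j₁) ∈ T
        · rw [mix_of_mem hT, mix_of_mem (Set.mem_insert_of_mem _ hT)]
        · rw [mix_of_notMem hT, mix_of_notMem fun h => hT (Set.mem_of_mem_insert_of_ne h this)]

theorem mcopy_wp (hb : DictBound D D' N J k) (hB : 64 * N ≤ B) (hbits : BitTable M J) (hJ : J < N)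
    (h : DictStore M (mix T D D') r) {d' : ℕ} (hM : s.mem.num = M) (h41 : s.reg 41 = d)
    (h42 : s.reg 42 = d') (hd : IsDict d) (hd' : IsDict d') (hne : d' ≠ d) (hdB : d + 1 < B)
    (hdB' : d' + 1 < B) (h0 : ∀ j, mix T D D' d' j = 0) (hcopy : ∀ j, mix T D D' d j = D' d' j)
    (hR : ∀ s' t r', KeepsR 30 44 s s' → r ≤ r' →
      DictStore s'.mem.num (mix (T ∪ {p | p.1 = d'}) D D') r' →
      (∀ c, ¬ DictCell c → s'.mem.num c = M c) →
      t ≤ (r' - r + 1) * (30 * k + 110) → R s' t) : WP B dcopy s R := by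
  obtain ⟨Z, hZ, hc⟩ := hb.size
  refine dcopy_wp hB hbits hJ h (fun d i h0 => hb.key d i (hb.mix_sub h0)) hM h41 h42 hd hd' hne hdB
    hdB' h0 (fun Y hY => ?_) fun s' t r' h1 h2 h3 h4 h5 => ?_
  · refine (h.add_card_le (fun d j h0 => hZ d j (hb.mix_sub h0)) (d := d') fun j hj =>
      ⟨hZ _ _ ?_, h0 j⟩).trans hc
    rw [← hcopy]; exact hY j hj
  · refine hR s' t r' h1 h2 (h3.congr fun d₁ j₁ => ?_) h4 h5
    by_cases e : d₁ = d'
    · subst e; rw [mix_of_mem (by simp)]; simp [hcopy]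
    · simp only [e, if_false]
      by_cases hT : (d₁, j₁) ∈ T
      · rw [mix_of_mem hT, mix_of_mem (.inl hT)]
      · rw [mix_of_notMem hT, mix_of_notMem fun h => h.elim hT e]

end Mix

/-! ### The text and the numbering of its characters -/

/-- The cells that hold the search structure for the characters and the numbers of the characters. -/
abbrev CharCell (c : ℕ) : Prop :=
  SkipCell c ∨ c = 61 ∨ c = 62 ∨ c % 64 = 32 ∨ c % 64 = 33

section Chars

variable {A : Type u} [LinearOrder A]

/-- The distinct characters of `S` are numbered from `1` on by `ι`, the other ones have number `0`. -/
structure CharNum (S : List A) (ι : A → ℕ) : Prop where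
  mem : ∀ a, ι a ≠ 0 ↔ a ∈ S
  inj : ∀ a b, ι a = ι b → ι a ≠ 0 → a = b
  le : ∀ a, ι a ≤ S.toFinset.card

/-- The character cells hold the text `S` and the numbering `ι` of its distinct characters; the
number of a character can be found by a search. -/
structure CharInv (S : List A) (ι : A → ℕ) (M : ℕ → ℕ) (chr : ℕ → Option A) : Prop
    extends CharNum S ι where
  text : ∀ i < S.length, chr i = S.reverse[i]?
  map : ∃ N h m d c L, CharMap M chr S.length ι S.toFinset.card N h m d c L
  bits : BitTable M S.toFinset.card
  last : M 62 = 64 * S.toFinset.card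

variable {S : List A} {a : A} {ι : A → ℕ} {M M' : ℕ → ℕ} {chr : ℕ → Option A} {B NB : ℕ}
  {s : State A} {σ : ℕ}
  {R : State A → ℕ → Prop}

theorem card_toFinset_le (S : List A) : S.toFinset.card ≤ S.length := List.toFinset_card_le S

theorem CharInv.frame (H : CharInv S ι M chr) (hM : ∀ c, CharCell c → M' c = M c) :
    CharInv S ι M' chr := by
  obtain ⟨h0, h1, ⟨N, h, m, d, c, L, h2⟩, h3, h4⟩ := H
  refine ⟨h0, h1, ⟨N, h, m, d, c, L, h2.frame le_rfl (fun _ _ => rfl) fun c hc => hM c (by omega)⟩,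
    fun j hj => ⟨?_, ?_⟩, ?_⟩
  · rw [hM _ (by omega), (h3 j hj).1]
  · rw [hM _ (by omega), (h3 j hj).2]
  · rw [hM _ (by omega), h4]

theorem CharInv.inj_on (H : CharInv S ι M chr) : ∀ a ∈ S, ∀ b ∈ S, ι a = ι b → a = b :=
  fun a ha b _ e => H.inj a b e ((H.mem a).2 ha)

theorem height_le {h l : ℕ} (h1 : 2 ^ h ≤ l) (h2 : l = σ + 1) : h ≤ 1 + Nat.log 2 σ := by
  have h3 : σ < 2 ^ (Nat.log 2 σ + 1) := Nat.lt_pow_succ_log_self (by norm_num) σ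
  have h4 : 2 ^ h ≤ 2 ^ (Nat.log 2 σ + 1) := by omega
  have := (Nat.pow_le_pow_iff_right (by norm_num : 1 < 2)).1 h4
  omega

theorem CharInv.find_wp (H : CharInv S ι M chr) (hB : 64 * NB ≤ B) (hNB : 10 * (S.length + 1) ≤ NB)
    {v : A} (hM : s.mem.num = M) (hchr : s.mem.chr = chr) (h9 : s.creg 9 = none)
    (h1 : s.creg 1 = some v)
    (hR : ∀ s' t, KeepsC 40 48 s s' → s'.mem = s.mem → s'.reg 40 = 64 * ι v →
      t ≤ 160 * logSigma S → R s' t) : WP B skipFind s R := by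
  obtain ⟨N, h, m, d, c, L, hm⟩ := H.map
  have hc := card_toFinset_le S
  obtain ⟨h2, h3⟩ := hm.sibs.size
  have h4 := hm.len
  have h5 := hm.hN
  have h6 := height_le h2 h4
  refine hm.skipFind_wp hB (by omega) (by omega) (by omega) hM hchr h9 h1
    fun s' t k1 k2 k3 k4 => hR s' t k1 k2 k3 ?_
  unfold logSigma
  omega

/-- Half of the number that follows the number with half in register `21` and parity in register `22`. -/
def nextHalf : Prog := .ite (.eq 22 29) .nop (addk 21 21 64)

/-- Give the next number to the character in character register `1`, the last one of the text. -/
def newChar : Prog :=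
  lds 20 62 ;; ldf 21 20 32 ;; ldf 22 20 33 ;; addk 23 20 64 ;; .const 24 1 ;; nextHalf ;;
  stf 23 32 21 ;; .sub 22 24 22 ;; stf 23 33 22 ;; sts 62 23 ;;
  .copy 50 2 ;; .copy 51 23 ;; skipInsert ;; .copy 40 23

/-- Append the character in character register `0` to the text and find its number, giving a new
number to a new character. -/
def addChar : Prog :=
  lds 1 56 ;; .ccopy 1 0 ;; .cstore 1 0 ;; addk 2 1 1 ;; sts 56 2 ;; skipFind ;;
  .ite (.eq 40 29) newChar .nop ;; .copy 3 40

theorem logSigma_mono (a : A) (S : List A) : logSigma S ≤ logSigma (a :: S) := by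
  unfold logSigma
  have : S.toFinset.card ≤ (a :: S).toFinset.card :=
    Finset.card_le_card fun x hx => by simp at hx ⊢; exact .inr hx
  have := Nat.log_mono_right (b := 2) this
  omega

theorem one_le_logSigma (S : List A) : 1 ≤ logSigma S := by unfold logSigma; omega

theorem text_cons (ht : ∀ i < S.length, chr i = S.reverse[i]?) (a : A) :
    ∀ i < (a :: S).length, Function.update chr S.length (some a) i = (a :: S).reverse[i]? := by
  intro i hi
  simp only [List.length_cons] at hi
  rw [List.reverse_cons]
  by_cases e : i = S.length
  · subst e; simp
  · rw [Function.update_of_ne e, ht i (by omega), List.getElem?_append_left (by simp; omega)]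

theorem CharNum.cons_old (H : CharNum S ι) (ha : a ∈ S) : CharNum (a :: S) ι := by
  obtain ⟨h1, h2, h3⟩ := H
  exact ⟨by grind, h2, by simpa [ha] using h3⟩

theorem CharNum.cons_new (H : CharNum S ι) (ha : a ∉ S) :
    CharNum (a :: S) (Function.update ι a (S.toFinset.card + 1)) := by
  obtain ⟨h1, h2, h3⟩ := H
  have : (a :: S).toFinset.card = S.toFinset.card + 1 := by simp [ha]
  constructor <;> grind [Function.update_apply]

theorem nextHalf_wp (h21 : s.reg 21 = 64 * (σ / 2)) (h22 : s.reg 22 = σ % 2) (h29 : s.reg 29 = 0)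
    (hB : 64 * (σ / 2) + 64 ≤ B)
    (hR : ∀ s' t, KeepsR 21 22 s s' → s'.mem = s.mem → s'.reg 21 = 64 * ((σ + 1) / 2) → t ≤ 3 →
      R s' t) : WP B nextHalf s R := by
  simp [nextHalf, h21, h22, h29, hB]
  exact ⟨fun e => hR _ _ (by simp) rfl (by omega) (by omega), fun e =>
    hR _ _ (by simp) rfl (by simp; omega) (by omega)⟩

set_option maxHeartbeats 1000000 in
/-- The halves and parities of the table are extended by one entry for the new number. -/
theorem newChar_wp {N h m d c : ℕ} {L : List (ℕ × ℕ)}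
    (hm : CharMap M chr (S.length + 1) ι σ N h m d c L) (hB : 64 * NB ≤ B)
    (hNB : 10 * (S.length + 2) ≤ NB) (ht : ∀ i < (a :: S).length, chr i = (a :: S).reverse[i]?)
    (hσ : S.toFinset.card = σ) (ha : a ∉ S) (hbits : BitTable M σ) (h62 : M 62 = 64 * σ)
    (H : CharNum S ι) (hM : s.mem.num = M) (hchr : s.mem.chr = chr) (h9 : s.creg 9 = none)
    (h1 : s.creg 1 = some a) (h29 : s.reg 29 = 0) (h2 : s.reg 2 = S.length + 1)
    (hR : ∀ s' t, s'.creg 9 = none → s'.reg 29 = 0 → s'.reg 1 = s.reg 1 → s'.reg 2 = s.reg 2 →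
      s'.reg 40 = 64 * (σ + 1) →
      CharInv (a :: S) (Function.update ι a (σ + 1)) s'.mem.num s'.mem.chr →
      (∀ c, ¬ CharCell c → s'.mem.num c = M c) → t ≤ 200 * (h + 2) + 150 → R s' t) :
    WP B newChar s R := by
  have hcard := card_toFinset_le S
  obtain ⟨z2, z3⟩ := hm.sibs.size
  have z4 := hm.len
  have z5 := hm.hN
  have z7 : h < 2 ^ h := Nat.lt_two_pow_self
  obtain ⟨e32, e33⟩ := hbits σ le_rfl
  have b1 : ∀ f, f < 64 → 64 * σ + f < B := by omega
  have b3 : 64 * σ + 64 ≤ B := by omega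
  have hN0 : 62 < B := by omega
  simp [newChar, hM, h62, e32, e33, hN0, b1, b3, show 1 ≤ B by omega]
  refine nextHalf_wp (σ := σ) (by simp) (by simp) (by simp [h29]) (by omega) fun s1 t1 k1 k2 k3 k4 => ?_
  obtain ⟨kc, kch, kr⟩ := k1
  have r23 : s1.reg 23 = 64 * (σ + 1) := by simp [kr]; omega
  have r24 : s1.reg 24 = 1 := by simp [kr]
  have r22 : s1.reg 22 = σ % 2 := by simp [kr]
  have r29 : s1.reg 29 = 0 := by simp [kr, h29]
  have r1 : s1.reg 1 = s.reg 1 := by simp [kr]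
  have r2 : s1.reg 2 = S.length + 1 := by simp [kr, h2]
  have mM : s1.mem.num = M := by simp [k2, hM]
  have mC : s1.mem.chr = chr := by simp [k2, hchr]
  have c1 : s1.creg 1 = some a := by simp [kc, h1]
  have c9 : s1.creg 9 = none := by simp [kc, h9]
  have b2 : ∀ f, f < 64 → 64 * (σ + 1) + f < B := by omega
  simp [r23, r24, r22, k3, r2, b2]
  obtain ⟨M2, hM2⟩ : ∃ M2, Function.update (Function.update (Function.update M
    (64 * (σ + 1) + 32) (64 * ((σ + 1) / 2))) (64 * (σ + 1) + 33) (1 - σ % 2)) 62 (64 * (σ + 1)) = M2 :=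
    ⟨_, rfl⟩
  have q11 : ∀ c, c ≠ 62 → c ≠ 64 * (σ + 1) + 32 → c ≠ 64 * (σ + 1) + 33 → M2 c = M c :=
    fun c g1 g2 g3 => by simp [← hM2, g1, g2, g3]
  have q12 : M2 62 = 64 * (σ + 1) := by rw [← hM2, upd_self]
  have q13 : M2 (64 * (σ + 1) + 32) = 64 * ((σ + 1) / 2) := by
    simp (disch := omega) only [← hM2, upd_ne, upd_self]
  have q14 : M2 (64 * (σ + 1) + 33) = (σ + 1) % 2 := by
    simp (disch := omega) only [← hM2, upd_ne, upd_self]; omega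
  have hm2 : CharMap M2 chr (S.length + 1) ι σ N h m d c L :=
    hm.frame le_rfl (fun _ _ => rfl) fun c hc => q11 c (by omega) (by omega) (by omega)
  have hv : ι a = 0 := by by_contra h; exact ha ((H.mem a).1 h)
  refine hm2.skipInsert_wp (v := a) (k := S.length + 1) (j := σ + 1) hB (by omega) (by omega) hv
    (by simp [mM, hM2]) (by simp [mC]) (by simp [c9]) (by simp [c1]) (by simp) (by simp) ?_ le_rfl
    (by omega) fun s3 t N' h' m' d' c' L' w1 w2 w3 w4 => ?_
  · have := ht S.length (by simp)
    simp [keyChr, this]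
  have frm : ∀ c, ¬ SkipCell c → c ≠ 61 → c ≠ 62 → c ≠ 64 * (σ + 1) + 32 →
      c ≠ 64 * (σ + 1) + 33 → s3.mem.num c = M c := fun c g1 g2 g3 g4 g5 => by
    rw [w3 c g1 g2, q11 c g3 g4 g5]
  have wr := w1.2.2
  refine hR _ _ (by simp [w1.1, c9]) (by simp [wr, r29]) (by simp [wr, r1]) (by simp [wr, r2, h2])
    (by simp [wr, r23]) ?_ (fun c hc => ?_) (by omega)
  · have wc : s3.mem.chr = chr := by simp [w1.2.1, mC]
    have hσ' : (a :: S).toFinset.card = σ + 1 := by simp [ha, hσ]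
    simp only [State.setReg_mem, wc]
    refine ⟨hσ ▸ H.cons_new ha, ht, hσ'.symm ▸ ⟨N', h', m', d', c', L', w2⟩, fun j hj => ?_, ?_⟩
    · by_cases ej : j = σ + 1
      · subst ej
        rw [w3 _ (by omega) (by omega), q13, w3 _ (by omega) (by omega), q14]
        exact ⟨rfl, rfl⟩
      · rw [frm _ (by omega) (by omega) (by omega) (by omega) (by omega),
          frm _ (by omega) (by omega) (by omega) (by omega) (by omega)]
        exact hbits j (by omega)
    · rw [w3 _ (by omega) (by omega), q12, hσ']
  · exact frm c (by tauto) (by tauto) (by omega) (by omega) (by omega)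

theorem addChar_wp (H : CharInv S ι M chr) (hB : 64 * NB ≤ B) (hNB : 10 * (S.length + 2) ≤ NB)
    (h56 : M 56 = S.length) (hM : s.mem.num = M) (hchr : s.mem.chr = chr) (h9 : s.creg 9 = none)
    (h0 : s.creg 0 = some a) (h29 : s.reg 29 = 0)
    (hR : ∀ s' t ι', s'.creg 9 = none → s'.reg 29 = 0 → s'.reg 1 = S.length →
      s'.reg 2 = S.length + 1 → s'.reg 3 = 64 * ι' a → CharInv (a :: S) ι' s'.mem.num s'.mem.chr →
      (∀ c ∈ S, ι' c = ι c) → s'.mem.num 56 = S.length + 1 →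
      (∀ c, ¬ CharCell c → c ≠ 56 → s'.mem.num c = M c) → t ≤ 1000 * logSigma (a :: S) → R s' t) :
    WP B addChar s R := by
  have hL := logSigma_mono a S
  have hL1 := one_le_logSigma (a :: S)
  have hcard := card_toFinset_le S
  have hN0 : ∀ f, f < 100 → f < B := by omega
  have hn1 : S.length < B := by omega
  have f1 : ∀ c, CharCell c → Function.update M 56 (S.length + 1) c = M c := fun c hc => by
    rw [upd_ne]; omega
  obtain ⟨N, h, m, d, c, L, hm⟩ := H.map
  have hm' : CharMap (Function.update M 56 (S.length + 1)) (Function.update chr S.length (some a))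
      (S.length + 1) ι S.toFinset.card N h m d c L :=
    hm.frame (by omega) (fun i hi => Function.update_of_ne (by omega) _ _)
      fun c hc => f1 c (by omega)
  obtain ⟨z2, z3⟩ := hm.sibs.size
  have z4 := hm.len
  have z5 := hm.hN
  have z6 : h ≤ logSigma (a :: S) := (height_le z2 z4).trans hL
  have bits : BitTable (Function.update M 56 (S.length + 1)) S.toFinset.card := fun j hj => by
    rw [f1 _ (by omega), f1 _ (by omega)]
    exact H.bits j hj
  have e62 := (f1 62 (by omega)).trans H.last
  simp [addChar, hM, h56, h0, hN0, hn1]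
  refine hm'.skipFind_wp (v := a) hB (by omega) (by omega) (by omega) (by simp [hM]) (by simp [hchr])
    (by simp [h9]) (by simp) ?_
  intro s' t k1 k2 k3 k4
  have kr := k1.2.2
  have r29 : s'.reg 29 = 0 := by simp [kr, h29]
  have r1 : s'.reg 1 = S.length := by simp [kr]
  have r2 : s'.reg 2 = S.length + 1 := by simp [kr]
  have c1 : s'.creg 1 = some a := by simp [k1.1]
  have c9 : s'.creg 9 = none := by simp [k1.1, h9]
  have mM : s'.mem.num = Function.update M 56 (S.length + 1) := by simp [k2, hM]
  have mC : s'.mem.chr = Function.update chr S.length (some a) := by simp [k2, hchr]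
  refine ⟨fun e => ?_, fun e => ?_⟩
  · rw [k3, r29] at e
    have ha : a ∉ S := fun h => (H.mem a).2 h (by omega)
    refine newChar_wp hm' hB hNB (text_cons H.text a) rfl ha bits e62 H.toCharNum mM mC c9 c1 r29 r2
      fun s3 t3 q1 q2 q3 q4 q5 q6 q7 q8 => ?_
    refine hR _ _ (Function.update ι a (S.toFinset.card + 1)) (by simp [q1]) (by simp [q2])
      (by simp [q3, r1]) (by simp [q4, r2]) (by simp [q5]) (by simpa using q6) (fun c hc => ?_) ?_
      (fun c hc hc' => ?_) (by omega)
    · rw [Function.update_of_ne]; rintro rfl; exact ha hc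
    · rw [State.setReg_mem, q7 _ (by omega), upd_self]
    · rw [State.setReg_mem, q7 _ hc, upd_ne hc']
  · rw [k3, r29] at e
    have ha : a ∈ S := (H.mem a).1 (by omega)
    refine hR _ _ ι (by simp [c9]) (by simp [r29]) (by simp [r1]) (by simp [r2]) (by simp [k3]) ?_
      (fun _ _ => rfl) (by simp [mM]) ?_ (by omega)
    · simp only [State.setReg_mem, mM, mC]
      have hσ : (a :: S).toFinset.card = S.toFinset.card := by simp [ha]
      exact ⟨H.cons_old ha, text_cons H.text a, hσ ▸ ⟨N, h, m, d, c, L, hm'⟩, hσ ▸ bits, hσ ▸ e62⟩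
    · intro c hc hc56
      simp [mM, hc56]

end Chars

/-! ### The records of the nodes, and walks towards the root -/

/-- The cells that hold the fields of the nodes except for the dictionaries and the list of net
frequencies. -/
abbrev NodeCell (c : ℕ) : Prop :=
  c = 3 ∨ c = 57 ∨ c = 58 ∨ (64 ≤ c ∧ (c % 64 ≤ 4 ∨ c % 64 = 9 ∨ c % 64 = 10))

/-- The records of the nodes of the suffix tree of `S`, with the numbers `f` in place of the net
frequencies. -/
structure NodeInv {A : Type u} (S : List A) (idx : List A → ℕ) (N : ℕ) (f : List A → ℕ)
    (M : ℕ → ℕ) : Prop where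
  ix : Indexing S idx N
  root0 : M (64 * idx []) = 0
  parent : ∀ x v, IsNode S x → IsParent S v x → M (64 * idx x) = 64 * idx v
  den : ∀ x, IsNode S x → Denotes S (M (64 * idx x + 1)) (M (64 * idx x + 2)) x
  den' : ∀ x, IsNode S x → M (64 * idx x + 9) = M (64 * idx x + 1) ∧
    M (64 * idx x + 10) = M (64 * idx x + 2)
  phi : ∀ x, IsNode S x → M (64 * idx x + 3) = f x
  slink : ∀ c v, IsNode S (c :: v) → M (64 * idx (c :: v) + 4) = 64 * idx v
  root : M 3 = 64
  top : M 57 = 64 * idx S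
  free : M 58 = 64 * N

theorem NodeInv.frame_phi {A : Type u} {S : List A} {idx : List A → ℕ} {N : ℕ} {f f' : List A → ℕ}
    {M M' : ℕ → ℕ} (H : NodeInv S idx N f M) (hM : ∀ c, NodeCell c → c = 3 ∨ c % 64 ≠ 3 → M' c = M c)
    (hf : ∀ x, IsNode S x → M' (64 * idx x + 3) = f' x) : NodeInv S idx N f' M' := by
  have hc : ∀ x, IsNode S x → ∀ g, (g = 1 ∨ g = 2 ∨ g = 4 ∨ g = 9 ∨ g = 10) →
      M' (64 * idx x + g) = M (64 * idx x + g) := fun x hx g hg => by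
    have := H.ix.pos x hx
    exact hM _ (by omega) (by omega)
  have h0 : ∀ x, IsNode S x → M' (64 * idx x) = M (64 * idx x) := fun x hx => by
    have := H.ix.pos x hx
    exact hM _ (by omega) (by omega)
  refine ⟨H.ix, ?_, fun x v hx h => ?_, fun x hx => ?_, fun x hx => ?_, hf, fun c v hx => ?_, ?_, ?_, ?_⟩
  · rw [h0 _ isNode_nil, H.root0]
  · rw [h0 _ hx, H.parent x v hx h]
  · rw [hc _ hx _ (by omega), hc _ hx _ (by omega)]; exact H.den x hx
  · simpa (disch := omega) only [hc _ hx] using H.den' x hx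
  · rw [hc _ hx _ (by omega), H.slink c v hx]
  · rw [hM _ (by omega) (by omega), H.root]
  · rw [hM _ (by omega) (by omega), H.top]
  · rw [hM _ (by omega) (by omega), H.free]

theorem NodeInv.frame {A : Type u} {S : List A} {idx : List A → ℕ} {N : ℕ} {f : List A → ℕ}
    {M M' : ℕ → ℕ} (H : NodeInv S idx N f M) (hM : ∀ c, NodeCell c → M' c = M c) :
    NodeInv S idx N f M' :=
  H.frame_phi (fun c h _ => hM c h) fun x hx => by
    have := H.ix.pos x hx
    rw [hM _ (by omega), H.phi x hx]

/-- Look up the link of the node in register `9`, unless that is the null pointer; register `11` tells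
whether the link is the address in register `q`. -/
def look (q : ℕ) : Prog :=
  .ite (.eq 9 29) (.const 11 0)
    (addk 30 9 13 ;; .copy 31 3 ;; dget ;; .ite (.eq 32 q) (.const 11 1) (.const 11 0))

/-- Set the link of the node in register `9` to the address in register `y`, and go to the parent. -/
def relink (y : ℕ) : Prog :=
  addk 30 9 13 ;; .copy 31 3 ;; .copy 35 y ;; dset ;; ldf 9 9 0

/-- Walk towards the root as long as the link is the address in register `q`, changing these links to the
address in register `y`. -/
def walk (q y : ℕ) : Prog := look q ;; .loop (.neg (.eq 11 29)) (relink y ;; look q)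

/-- The registers that survive a walk. -/
def KeepsW {A : Type u} (s s' : State A) : Prop :=
  s'.creg = s.creg ∧ s'.mem.chr = s.mem.chr ∧
    ∀ r, (r < 9 ∨ (12 ≤ r ∧ r < 30) ∨ 44 ≤ r) → r ≠ 99 → s'.reg r = s.reg r

theorem KeepsW.trans {A : Type u} {s s' s'' : State A} (h : KeepsW s s') (h' : KeepsW s' s'') :
    KeepsW s s'' :=
  ⟨h'.1.trans h.1, h'.2.1.trans h.2.1, fun r hr h9 => (h'.2.2 r hr h9).trans (h.2.2 r hr h9)⟩

section Walk

variable {A : Type u} [LinearOrder A] {B N J k Nn : ℕ} {D D' : ℕ → ℕ → ℕ} {S : List A}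
  {idx : List A → ℕ}

theorem look_wp (hb : DictBound D D' N J k) (hB : 64 * N ≤ B) (hJ : J < N) {T : Set (ℕ × ℕ)}
    {r i j q : ℕ} {s : State A} (hbits : BitTable s.mem.num J)
    (h : DictStore s.mem.num (mix T D D') r) (hi : i < N)
    (h9 : s.reg 9 = 64 * i) (h3 : s.reg 3 = 64 * j) (hj : j ≤ J) (hq : q = 29 ∨ q = 10)
    (h29 : s.reg 29 = 0) {R : State A → ℕ → Prop}
    (hR : ∀ s' t, KeepsW s s' → s'.mem = s.mem → s'.reg 9 = 64 * i → s'.reg 10 = s.reg 10 →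
      (i ≠ 0 → s'.reg 32 = mix T D D' (64 * i + 13) j) →
      (s'.reg 11 = 0 ↔ ¬ (i ≠ 0 ∧ mix T D D' (64 * i + 13) j = s.reg q)) →
      t ≤ 30 * k + 60 → R s' t) :
    WP B (look q) s R := by
  by_cases h0 : i = 0
  · subst h0
    simp [look, h9, h29]
    refine hR _ _ ⟨rfl, rfl, fun r hr h => ?_⟩ rfl (by simp [h9]) (by simp) (by simp) (by simp) (by omega)
    simp [show r ≠ 11 by omega]
  · have b1 : 64 * i + 13 ≤ B := by omega
    simp [look, h9, h29, h0, h3, b1]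
    refine mget_wp (d := 64 * i + 13) (j := j) hb hB hbits hJ h (by simp) (by simp) (by simp) hj
      ⟨by omega, by omega⟩ (by omega)
      fun s' t k1 k2 k3 k4 => ?_
    obtain ⟨kc, kch, kr⟩ := k1
    have e9 : s'.reg 9 = 64 * i := by simp [kr, h9]
    have e10 : s'.reg 10 = s.reg 10 := by simp [kr]
    have eq : s'.reg q = s.reg q := by rcases hq with rfl | rfl <;> simp [kr]
    have kw : KeepsW s s' := ⟨by simp [kc], by simp [k2], fun r hr h9 => by
      simp [kr r (by omega) h9, h9, show r ≠ 30 by omega, show r ≠ 31 by omega]⟩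
    have kw' : ∀ v, KeepsW s (s'.setReg 11 v) := fun v => ⟨kw.1, kw.2.1, fun r hr h9 => by
      simp [kw.2.2 r hr h9, show r ≠ 11 by omega]⟩
    rw [k3, eq]
    refine ⟨fun e => ⟨by omega, ?_⟩, fun e => ?_⟩
    · exact hR _ _ (kw' 1) (by simp [k2]) (by simp [e9]) (by simp [e10]) (by simp [k3])
        (by simp [e, h0]) (by omega)
    · exact hR _ _ (kw' 0) (by simp [k2]) (by simp [e9]) (by simp [e10]) (by simp [k3])
        (by simp [e, h0]) (by omega)

theorem prefix_parent {u v p : List A} (hu : IsNode S u) (huv : u <+: v) (hne : u ≠ v)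
    (hp : IsParent S p v) : u <+: p :=
  prefix_of_len huv hp.2.1 (hp.2.2.2 u hu huv hne)

/-- The walk from `v` stops at the first ancestor `x` whose link is not the one in register `q`, or past the
root. The nodes of length at least `L` have been relinked, where `L = |x| + 1`, or `L = 0` past the root.
The number `e` is what is left of the depth, that is, `dep x + 1`, or `0` past the root. -/
theorem walk_wp (hb : DictBound D D' N J k) (hB : 64 * N ≤ B) (hJ : J < N) (hix : Indexing S idx Nn)
    (hNn : Nn ≤ N) {j q y : ℕ} (hj : j ≤ J) (hq : q = 29 ∨ q = 10)
    (hy : y < 9 ∨ (12 ≤ y ∧ y < 30)) : ∀ (n : ℕ) {v : List A} {T : Set (ℕ × ℕ)} {r : ℕ} {s : State A},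
    v.length ≤ n → IsNode S v →
    (∀ u p, IsNode S u → u <+: v → IsParent S p u → s.mem.num (64 * idx u) = 64 * idx p) →
    s.mem.num (64 * idx []) = 0 → BitTable s.mem.num J →
    DictStore s.mem.num (mix T D D') r →
    (∀ u, IsNode S u → u <+: v → (64 * idx u + 13, j) ∉ T) →
    (∀ u, IsNode S u → u <+: v → D (64 * idx u + 13) j = s.reg q →
      D' (64 * idx u + 13) j = s.reg y) → s.reg y ≠ 0 →
    s.reg 9 = 64 * idx v → s.reg 3 = 64 * j → s.reg 29 = 0 → ∀ {R : State A → ℕ → Prop},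
    (∀ s' t r' L e, KeepsW s s' → r ≤ r' → ((L = 0 ∧ e = 0 ∧ s'.reg 9 = 0) ∨
        ∃ x, IsNode S x ∧ x <+: v ∧ D (64 * idx x + 13) j ≠ s.reg q ∧ L = x.length + 1 ∧
          e = dep S x + 1 ∧ s'.reg 9 = 64 * idx x ∧ s'.reg 32 = D (64 * idx x + 13) j) →
      (∀ u, IsNode S u → u <+: v → L ≤ u.length → D (64 * idx u + 13) j = s.reg q) →
      DictStore s'.mem.num (mix (T ∪ {p | ∃ u, IsNode S u ∧ u <+: v ∧ L ≤ u.length ∧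
        p = (64 * idx u + 13, j)}) D D') r' →
      (∀ c, ¬ DictCell c → s'.mem.num c = s.mem.num c) →
      t + (60 * k + 200) * e ≤ (60 * k + 200) * (dep S v + 2) → R s' t) →
    WP B (walk q y) s R := by
  intro n
  induction n with
  | zero => ?_
  | succ n ih => ?_
  all_goals
    intro v T r s hn hv hpar hroot hbits hD hT hD' hy0 h9 h3 h29 R hR
    have hpv := hix.pos v hv
    unfold walk
    rw [wp_seq]
    refine look_wp hb hB hJ hbits hD (i := idx v) (by omega) h9 h3 hj hq h29 fun s1 t1 k1 k2 k3 k10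
      k4 k5 k6 => ?_
    rw [mix_of_notMem (hT v hv List.prefix_rfl)] at k4 k5
    have r29 : s1.reg 29 = 0 := by simp [k1.2.2, h29]
    have r3 : s1.reg 3 = 64 * j := by simp [k1.2.2, h3]
    have ry : s1.reg y = s.reg y := k1.2.2 _ (by omega) (by omega)
    have rq : s1.reg q = s.reg q := by
      rcases hq with rfl | rfl
      · exact k1.2.2 _ (by omega) (by omega)
      · exact k10
    rw [wp_loop]
    simp only [Test.holds_neg, Test.holds_eq, not_not, r29]
    refine ⟨fun e => ?_, fun e => ?_⟩
    rotate_left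
    · have hl : ∀ u, u <+: v → ¬ v.length + 1 ≤ u.length := fun u h => by
        have := h.length_le; omega
      refine hR _ _ r _ _ k1 le_rfl (.inr ⟨v, hv, List.prefix_rfl, fun h => k5.1 e ⟨by omega, h⟩, rfl, rfl,
        k3, k4 (by omega)⟩) (fun u _ huv h => absurd h (hl u huv)) ?_ (fun c _ => by rw [k2]) ?_
      · rw [k2]
        refine hD.congr fun d i => congrArg (mix · D D' d i) (Set.union_eq_left.2 ?_)
        rintro _ ⟨u, -, h1, h2, -⟩
        exact absurd h2 (hl u h1)
      · rw [show dep S v + 2 = dep S v + 1 + 1 from rfl, Nat.mul_add_one _ (dep S v + 1)]; omega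
    have hgo : D (64 * idx v + 13) j = s.reg q := by
      by_contra h
      exact e (k5.2 fun h' => h h'.2)
    have hval := hD' v hv List.prefix_rfl hgo
    simp only [relink, wp_seq]
    simp [k3, r3]
    refine ⟨by omega, ?_⟩
    refine mset_wp (M := s.mem.num) hb hB hbits hJ (T := T) (r := r) hD (s := _)
      (d := 64 * idx v + 13) (j := j) (v := s.reg y) (by simp [k2]) (by simp) (by simp) ?_ hval.symm hy0 hj
      ⟨by omega, by omega⟩ (by omega) fun s2 t2 r2 g1 g2 g3 g4 g5 => ?_
    · simp [show y ≠ 30 by omega, show y ≠ 31 by omega, show y ≠ 99 by omega, ry]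
    obtain ⟨gc, gch, gr⟩ := g1
    have frm : ∀ c, ¬ DictCell c → s2.mem.num c = s.mem.num c := g4
    have e9 : s2.reg 9 = 64 * idx v := by simp [gr, k3]
    have nd : ∀ i, ¬ DictCell (64 * i) := fun i => by omega
    have kk : ∀ r w w', (r < 9 ∨ (12 ≤ r ∧ r < 30) ∨ 44 ≤ r) → r ≠ 99 →
        ((s2.setReg 99 w).setReg 9 w').reg r = s.reg r := fun r w w' hr h9' => by
      rw [← k1.2.2 r hr h9']
      simp [gr r (by omega) h9', h9', show r ≠ 9 by omega, show r ≠ 30 by omega, show r ≠ 31 by omega,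
        show r ≠ 35 by omega]
    have kc : ∀ w w', ((s2.setReg 99 w).setReg 9 w').creg = s.creg := fun w w' => by
      simp [gc, k1.1]
    have kh : ∀ w w', ((s2.setReg 99 w).setReg 9 w').mem.chr = s.mem.chr := fun w w' => by
      simp [gch, k2]
    have kw : ∀ w w', KeepsW s ((s2.setReg 99 w).setReg 9 w') := fun w w' =>
      ⟨kc w w', kh w w', fun r hr h9' => kk r w w' hr h9'⟩
    have e10 : ∀ w w', ((s2.setReg 99 w).setReg 9 w').reg q = s.reg q := fun w w' => by
      rw [← rq]
      rcases hq with rfl | rfl <;> simp [gr]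
    rw [e9]
    have hbits2 : BitTable s2.mem.num J := fun i hi => by
      rw [frm _ (by omega), frm _ (by omega)]; exact hbits i hi
    refine ⟨by omega, ?_⟩
    by_cases hvn : v = []
    · subst hvn
      rw [frm _ (nd _), hroot]
      refine look_wp hb hB hJ (T := insert (64 * idx ([] : List A) + 13, j) T) (r := r2) (i := 0)
        (j := j) (q := q)
        (by simpa using hbits2) (by simpa using g3)
        (by omega) (by simp) (by simp [gr, r3]) hj hq (by simp [gr, r29]) fun s3 t3 w1 w2 w3 w10 w4
        w5 w6 => ?_
      rw [wp_loop]
      have e11 : s3.reg 11 = 0 := w5.2 (by simp)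
      have e29 : s3.reg 29 = 0 := by simp [w1.2.2, gr, r29]
      simp only [Test.holds_neg, Test.holds_eq, e11, e29, not_true, false_implies, true_and]
      intro _
      refine hR _ _ r2 0 0 ((kw _ _).trans w1) g2 (.inl ⟨rfl, rfl, by rw [w3]⟩) (fun u _ huv _ => ?_) ?_
        (fun c hc => ?_) ?_
      · rw [List.prefix_nil.1 huv]; exact hgo
      · rw [w2]
        have : T ∪ {p | ∃ u, IsNode S u ∧ u <+: [] ∧ 0 ≤ u.length ∧ p = (64 * idx u + 13, j)} =
            insert (64 * idx ([] : List A) + 13, j) T := by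
          ext p
          simp only [Set.mem_union, Set.mem_ofPred_eq, Set.mem_insert_iff, List.prefix_nil]
          constructor
          · rintro (h | ⟨u, -, rfl, -, rfl⟩)
            · exact .inr h
            · exact .inl rfl
          · rintro (h | h)
            · exact .inr ⟨[], hv, rfl, le_rfl, h⟩
            · exact .inl h
        rw [this]; simpa using g3
      · rw [w2]; exact frm c hc
      · rw [Nat.mul_add _ _ 2]; omega
  · exact absurd (List.length_eq_zero_iff.1 (by omega)) hvn
  · obtain ⟨p, hp⟩ := exists_parent (S := S) hvn
    have hlp := prefix_lt_len hp.2.1 hp.2.2.1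
    rw [frm _ (nd _), hpar v p hv List.prefix_rfl hp]
    have hdep := hp.dep
    have hin : ∀ u, IsNode S u → u <+: v → u = v ∨ u <+: p := fun u hu huv => by
      by_cases hne : u = v
      · exact .inl hne
      · exact .inr (prefix_parent hu huv hne hp)
    suffices key : WP B (walk q y) ((s2.setReg 99 (64 * idx v)).setReg 9 (64 * idx p))
        (fun s'' t => R s'' (t1 + (2 + (1 + (1 + (t2 + 3))) + t + 1))) by
      rw [walk, wp_seq] at key
      simpa only [relink, add_assoc] using key
    -- the link of `v` has been changed, and the walk goes on from its parent `p`
    refine ih (v := p) (T := insert (64 * idx v + 13, j) T) (r := r2)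
      (s := (s2.setReg 99 (64 * idx v)).setReg 9 (64 * idx p)) (by omega) hp.1
      (fun u p' hu hup hp' => by
        simp only [State.setReg_mem]
        rw [frm _ (nd _)]; exact hpar u p' hu (hup.trans hp.2.1) hp')
      (by simp only [State.setReg_mem]; rw [frm _ (nd _), hroot])
      (by simpa using hbits2) (by simpa using g3)
      (fun u hu hup hmem => by
        rcases hmem with h | h
        · have : idx u = idx v := by
            have := congrArg Prod.fst h
            simp only at this; omega
          obtain rfl := hix.inj _ _ hu hv this
          have := hup.length_le; omega
        · exact hT u hu (hup.trans hp.2.1) h)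
      (fun u hu hup h => by
        rw [e10] at h
        rw [kk y _ _ (by omega) (by omega)]
        exact hD' u hu (hup.trans hp.2.1) h)
      (by rw [kk y _ _ (by omega) (by omega)]; exact hy0) (by simp)
      (by rw [kk _ _ _ (by omega) (by omega)]; exact h3)
      (by rw [kk _ _ _ (by omega) (by omega)]; exact h29)
      (fun s' t r' L e w1 w2 w3 w6 w9 w10 w11 => ?_)
    rw [e10] at w3
    have hL : L ≤ v.length := by
      rcases w3 with ⟨rfl, -⟩ | ⟨x, -, h, -, rfl, -⟩
      · omega
      · have := h.length_le; omega
    refine hR _ _ r' L e ((kw _ _).trans w1) (g2.trans w2) (w3.imp_right fun ⟨x, h1, h2, h⟩ =>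
      ⟨x, h1, h2.trans hp.2.1, h⟩) (fun u hu huv hl => ?_) ?_
      (fun c hc => by rw [w10 c hc]; exact frm c hc) ?_
    · rcases hin u hu huv with rfl | h
      · exact hgo
      · rw [← e10]; exact w6 u hu h hl
    · have : T ∪ {p | ∃ u, IsNode S u ∧ u <+: v ∧ L ≤ u.length ∧ p = (64 * idx u + 13, j)} =
          insert (64 * idx v + 13, j) T ∪
            {q | ∃ u, IsNode S u ∧ u <+: p ∧ L ≤ u.length ∧ q = (64 * idx u + 13, j)} := by
        ext e
        simp only [Set.mem_union, Set.mem_ofPred_eq, Set.mem_insert_iff]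
        constructor
        · rintro (h | ⟨u, h1, h2, h3, rfl⟩)
          · exact .inl (.inr h)
          · rcases hin u h1 h2 with rfl | h
            · exact .inl (.inl rfl)
            · exact .inr ⟨u, h1, h, h3, rfl⟩
        · rintro ((h | h) | ⟨u, h1, h2, h3, rfl⟩)
          · exact .inr ⟨v, hv, List.prefix_rfl, hL, h⟩
          · exact .inl h
          · exact .inr ⟨u, h1, h2.trans hp.2.1, h3, rfl⟩
      rw [this]; exact w9
    · rw [hdep, show dep S p + 1 + 2 = dep S p + 2 + 1 from rfl, Nat.mul_add_one _ (dep S p + 2)]; omega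

end Walk

/-! ### The change of the tree when a character is prepended -/

section Change

variable {A : Type u} {S : List A} {a : A} {z x : List A} {idx idx' : List A → ℕ} {ι : A → ℕ}
  {N N' : ℕ} {D D' : ℕ → ℕ → ℕ}
  {w : List A}

theorem LinkMap.congr {κ : A → ℕ} (h : LinkMap S idx ι D) (e : ∀ c ∈ S, κ c = ι c) :
    LinkMap S idx κ D := by
  refine ⟨fun x c hx hc => ?_, fun x c hx hc => ?_, fun d j h0 => ?_⟩
  · rw [e c (mem_of_snoc_sub hc)]; exact h.child x c hx hc
  · rw [e c (mem_of_cons_sub hc)]; exact h.weiner x c hx hc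
  · obtain ⟨x, c, hx, hj, hc⟩ := h.only d j h0
    refine ⟨x, c, hx, ?_, hc⟩
    rw [hj, e c]
    exact hc.elim (fun h => mem_of_snoc_sub h.2) fun h => mem_of_cons_sub h.2

theorem LinkMap.leaf (h : LinkMap S idx ι D) (hix : Indexing S idx N) (hw : IsNode S w) :
    (∀ j, D (64 * idx w + 5) j = 0) ↔ occ S w = 1 := by
  rw [← leaf_iff hw]
  constructor
  · intro h0 c hc
    have h1 := h.child w c hw hc
    have h2 := hix.pos _ (loc_node hc)
    rw [h0] at h1; omega
  · intro h0 j
    by_contra hj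
    obtain ⟨x, c, hx, -, ⟨e, hc⟩ | ⟨e, hc⟩⟩ := h.only _ _ hj
    · obtain rfl := hix.inj _ _ hw hx (by omega)
      exact h0 c hc
    · omega

theorem LinkMap.weiner_pos (h : LinkMap S idx ι D) (hix : Indexing S idx N) {c : A}
    (hw : IsNode S w) (hc : c :: w <:+: S) : D (64 * idx w + 13) (ι c) ≠ 0 := by
  rw [h.weiner w c hw hc]
  have := hix.pos _ (loc_node hc); omega

theorem LinkMap.ne_zero_cons (hD : LinkMap S idx ι D) (hix' : Indexing (a :: S) idx' N')
    (hold : ∀ x, IsNode S x → idx' x = idx x)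
    (hD' : LinkMap (a :: S) idx' ι D') (d j : ℕ) (h0 : D d j ≠ 0) : D' d j ≠ 0 := by
  obtain ⟨x, c, hx, rfl, ⟨rfl, hc⟩ | ⟨rfl, hc⟩⟩ := hD.only d j h0
  · have hc' := sub_cons (a := a).2 (.inl hc)
    rw [← hold x hx, hD'.child x c hx.cons hc']
    have := hix'.pos _ (loc_node hc'); omega
  · have hc' := sub_cons (a := a).2 (.inl hc)
    rw [← hold x hx, hD'.weiner x c hx.cons hc']
    have := hix'.pos _ (loc_node hc'); omega

/-- The entries that change when `a` is prepended to `S`. -/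
inductive Changed (a : A) (S z : List A) (idx : List A → ℕ) (ι : A → ℕ) : ℕ → ℕ → Prop
  | newLink {u} : IsNode S u → u <+: S → ¬ a :: u <:+: S →
      Changed a S z idx ι (64 * idx u + 13) (ι a)
  | newLeaf {b} : z ++ [b] <+: a :: S → ¬ z ++ [b] <:+: S → Changed a S z idx ι (64 * idx z + 5) (ι b)
  | copied {j} : ¬ IsNode S z → Changed a S z idx ι (64 * idx z + 13) j
  | upper {v c} : ¬ IsNode S z → IsParent S v (loc S z) → v ++ [c] <+: z →
      Changed a S z idx ι (64 * idx v + 5) (ι c)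
  | lower {c} : ¬ IsNode S z → z ++ [c] <+: loc S z → Changed a S z idx ι (64 * idx z + 5) (ι c)
  | redirected {x u} : ¬ IsNode S z → z = a :: x → IsNode S u → u <+: x →
      loc S (a :: u) = loc S z → Changed a S z idx ι (64 * idx u + 13) (ι a)

/-- An entry of the dictionaries that is not listed in `Changed` is the same before and after the update. -/
theorem IsHead.changed (h : IsHead a S z) (hix' : Indexing (a :: S) idx' N')
    (hold : ∀ x, IsNode S x → idx' x = idx x) (hD : LinkMap S idx ι D)
    (hD' : LinkMap (a :: S) idx' ι D') {d j : ℕ} (hne : D d j ≠ D' d j) :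
    Changed a S z idx' ι d j := by
  have h0 : D' d j ≠ 0 := by
    by_cases e : D d j = 0
    · omega
    · exact hD.ne_zero_cons hix' hold hD' d j e
  have long : ∀ q : List A, q <:+: a :: S → q.length ≤ S.length + 1 := fun q hq => hq.length_le
  obtain ⟨q, c, hq, rfl, ⟨rfl, hc⟩ | ⟨rfl, hc⟩⟩ := hD'.only d j h0
  · have hqS : q ≠ a :: S := by grind
    by_cases hqn : IsNode S q
    · by_cases hs : q ++ [c] <:+: S
      · rw [hD'.child q c hq hc, hold q hqn, hD.child q c hqn hs, ← hold _ (loc_node hs)] at hne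
        have hl : loc (a :: S) (q ++ [c]) ≠ loc S (q ++ [c]) := fun e => hne (by rw [e])
        obtain ⟨h1, h2, h3, -⟩ := h.old_child hqn hs hl
        exact .upper h1 h2 h3
      · obtain ⟨rfl, h2⟩ := h.new_child hqn.sub hs hc
        exact .newLeaf h2 hs
    · obtain rfl : q = z := by have := h.node_iff.1 hq; tauto
      by_cases hs : q ++ [c] <:+: S
      · exact .lower hqn (h.child_head hqn hs).1
      · exact .newLeaf (h.new_child h.sub hs hc).2 hs
  · have hqS : q ≠ a :: S := by grind
    by_cases hqn : IsNode S q
    · by_cases hs : c :: q <:+: S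
      · rw [hD'.weiner q c hq hc, hold q hqn, hD.weiner q c hqn hs, ← hold _ (loc_node hs)] at hne
        have hl : loc (a :: S) (c :: q) ≠ loc S (c :: q) := fun e => hne (by rw [e])
        rcases List.prefix_cons_iff.1 h.pre with rfl | ⟨x, rfl, -⟩
        · refine absurd ((h.loc_sub hs).2 fun h' => ?_) hl
          have := h'.1.length_le; simp at this
        · obtain ⟨rfl, h1, h2, -, h3⟩ := h.old_weiner hs hl
          exact .redirected h3 rfl hqn h1 h2
      · obtain ⟨rfl, h1⟩ := new_weiner hc hs
        exact .newLink hqn h1 hs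
    · obtain rfl : q = z := by have := h.node_iff.1 hq; tauto
      exact .copied hqn

/-- The new node and its old locus have the same Weiner links after the update. -/
theorem IsHead.copied_eq (h : IsHead a S z) (hix' : Indexing (a :: S) idx' N')
    (hι : ∀ c ∈ a :: S, ∀ b ∈ a :: S, ι c = ι b → c = b)
    (hD' : LinkMap (a :: S) idx' ι D') (j : ℕ) :
    D' (64 * idx' (loc S z) + 13) j = D' (64 * idx' z + 13) j := by
  have hw : IsNode (a :: S) (loc S z) := (loc_node h.sub).cons
  by_cases hj : ∃ c ∈ a :: S, j = ι c
  · obtain ⟨c, hc, rfl⟩ := hj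
    obtain ⟨h1, h2⟩ := h.weiner_head c
    by_cases hs : c :: z <:+: a :: S
    · rw [hD'.weiner _ c hw (h1.1 hs), hD'.weiner _ c h.isNode hs, h2 hs]
    · rw [hD'.weiner_zero hix' hw (fun b hb e => hι _ hb _ hc e) fun h' => hs (h1.2 h'),
        hD'.weiner_zero hix' h.isNode (fun b hb e => hι _ hb _ hc e) hs]
  · have : ∀ d, D' d j = 0 := fun d => by
      by_contra h0
      obtain ⟨c, hc, e⟩ := hD'.key h0
      exact hj ⟨c, hc, e⟩
    rw [this, this]

/-- The pair `(a, b)` is lost at the left of the longest repeated prefix `a x` of `a S` iff the suffix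
link of the leaf above `a x` leads to a leaf that is a child of `x`. -/
theorem IsHead.losesLeft_iff (h : IsHead a S (a :: x)) (ho : occ S (a :: x) = 1) {t : List A}
    (ht : loc S (a :: x) = a :: t) :
    LosesLeft a S (a :: x) x ↔ (a :: t).length ≠ x.length + 1 ∧ IsParent S x t ∧ occ S t = 1 := by
  have hw := loc_node h.sub
  have hp := prefix_loc h.sub
  have hwo : occ S (a :: t) = 1 := by rw [← ht, occ_loc h.sub, ho]
  rw [ht] at hw hp
  have hts : t <:+ S := (List.suffix_cons a t).trans (leaf_suffix hw hwo)
  have hxt : x <+: t := (List.cons_prefix_cons.1 hp).2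
  have hxn := h.tail_node
  constructor
  · rintro ⟨-, -, b, hb, hb1⟩
    have hb' : a :: x ++ [b] <+: a :: t := by
      obtain ⟨s, hs⟩ := sub_iff.1 hb
      have h2 : s ∈ suf S (a :: x) := suf_mono (List.prefix_append _ _) hs
      have h3 := loc_of_unique ho h2
      rw [← ht, h3]; exact hs.2
    have hbt : x ++ [b] <+: t := by simpa using hb'
    have hl : loc S (x ++ [b]) = t := loc_of_unique hb1 ⟨hts, hbt⟩
    have hbs : x ++ [b] <:+: S := hbt.isInfix.trans hts.isInfix
    refine ⟨?_, ?_, ?_⟩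
    · grind
    · rw [← hl]; exact isParent_loc hxn hbs
    · rw [← hl, occ_loc hbs, hb1]
  · rintro ⟨hl, hpar, hto⟩
    obtain ⟨b, hb⟩ := prefix_snoc hxt (by rintro rfl; simp at hl)
    refine ⟨rfl, ho, b, ?_, ?_⟩
    · have : a :: x ++ [b] <+: a :: t := by simpa using hb
      exact this.isInfix.trans hw.sub
    · rw [← occ_loc (hb.isInfix.trans hts.isInfix), hpar.loc_eq (isNode_of_suffix hts) hb, hto]

/-- With `w` the leaf that is the locus of `z`: the pair `(c, β)` is lost at the right iff the character `c`
before the suffix `w` makes `cv` unique. -/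
theorem losesRight_iff (h : z <:+: S) (ho : occ S z = 1) {v : List A} (hv : IsParent S v (loc S z)) :
    LosesRight S z v ↔ ∃ c, c :: loc S z <:+ S ∧ occ S (c :: v) = 1 := by
  have hw := loc_node h
  have hs := leaf_suffix hw (by rw [occ_loc h, ho])
  constructor
  · rintro ⟨-, -, c, hc, h1⟩
    refine ⟨c, ?_, h1⟩
    obtain ⟨t, ht⟩ := sub_iff.1 hc
    obtain ⟨t', rfl, ht', -⟩ := suf_of_cons ht
    have : t' = loc S z := by
      have h2 : occ S (loc S z) = 1 := by rw [occ_loc h, ho]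
      exact occ_le_one_iff.1 h2.le _ ht' _ ⟨hs, List.prefix_rfl⟩
    rw [← this]; exact ht.1
  · rintro ⟨c, hc, h1⟩
    exact ⟨ho, hv, c, hc.isInfix, h1⟩

theorem IsHead.dep_short (h : IsHead a S (a :: x)) : dep (a :: S) x = dep S x := by
  unfold dep
  congr 1
  ext v
  simp only [Set.mem_ofPred_eq]
  constructor
  · rintro ⟨h1, h2, h3⟩
    refine ⟨?_, h2, h3⟩
    have hl := h2.length_le
    rcases h.node_iff.1 h1 with h' | rfl | rfl
    · exact h'
    · have := h.pre.length_le; simp at this hl; omega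
    · simp at hl
  · rintro ⟨h1, h2, h3⟩
    exact ⟨h1.cons, h2, h3⟩

/-- A string that is not a node has no net occurrence. -/
theorem phi_not_node (h : ¬ IsNode S w) : phi S w = 0 := by
  by_contra h0
  exact h (node_of_phi (by omega))

open Classical in
/-- The numbering of the nodes after `a` has been prepended: the new leaf gets the number `N` and the
new branching node, if there is one, the next number. -/
noncomputable def nextIdx (a : A) (S z : List A) (idx : List A → ℕ) (N : ℕ) : List A → ℕ :=
  fun q => if q = a :: S then N else if q = z ∧ ¬ IsNode S z then N + 1 else idx q

open Classical in
/-- The number that follows the numbers of all nodes. -/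
noncomputable def nextNum (S z : List A) (N : ℕ) : ℕ := if IsNode S z then N + 1 else N + 2

theorem nextIdx_old {q : List A} (hq : IsNode S q) :
    nextIdx a S z idx N q = idx q := by
  have h1 : q ≠ a :: S := by rintro rfl; exact not_sub_cons hq.sub
  have h2 : ¬ (q = z ∧ ¬ IsNode S z) := by grind
  simp [nextIdx, h1, h2]

theorem nextIdx_leaf : nextIdx a S z idx N (a :: S) = N := by simp [nextIdx]

theorem IsHead.nextIdx_head (h : IsHead a S z) (hz : ¬ IsNode S z) :
    nextIdx a S z idx N z = N + 1 := by simp [nextIdx, h.ne, hz]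

theorem IsHead.indexing (h : IsHead a S z) (hix : Indexing S idx N) :
    Indexing (a :: S) (nextIdx a S z idx N) (nextNum S z N) := by
  have hc : ∀ q, IsNode (a :: S) q → (IsNode S q ∧ nextIdx a S z idx N q = idx q) ∨
      (q = a :: S ∧ nextIdx a S z idx N q = N) ∨
      (q = z ∧ ¬ IsNode S z ∧ nextIdx a S z idx N q = N + 1) := fun q hq => by
    by_cases hqn : IsNode S q
    · exact .inl ⟨hqn, nextIdx_old hqn⟩
    · rcases h.node_iff.1 hq with h' | rfl | rfl
      · exact absurd h' hqn
      · exact .inr (.inl ⟨rfl, nextIdx_leaf⟩)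
      · exact .inr (.inr ⟨rfl, hqn, h.nextIdx_head hqn⟩)
  have hN : N < nextNum S z N ∧ (¬ IsNode S z → N + 1 < nextNum S z N) ∧
      (∀ j, N < j → j < nextNum S z N → j = N + 1 ∧ ¬ IsNode S z) := by
    unfold nextNum
    split_ifs with hz
    · grind
    · grind
  refine ⟨fun x y hx hy e => ?_, fun q hq => ?_, fun j h1 h2 => ?_, ?_⟩
  · rcases hc x hx with ⟨h1, e1⟩ | ⟨h1, e1⟩ | ⟨h1, -, e1⟩ <;>
      rcases hc y hy with ⟨h2, e2⟩ | ⟨h2, e2⟩ | ⟨h2, -, e2⟩ <;> rw [e1, e2] at e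
    · exact hix.inj _ _ h1 h2 e
    · have := hix.pos _ h1; omega
    · have := hix.pos _ h1; omega
    · have := hix.pos _ h2; omega
    · rw [h1, h2]
    · omega
    · have := hix.pos _ h2; omega
    · omega
    · rw [h1, h2]
  · have h1 : 1 ≤ N := by have := hix.pos _ isNode_nil; omega
    rcases hc q hq with ⟨h2, e⟩ | ⟨-, e⟩ | ⟨-, hz, e⟩
    · have := hix.pos _ h2; omega
    · omega
    · have := hN.2.1 hz; omega
  · rcases lt_trichotomy j N with hj | rfl | hj
    · obtain ⟨x, hx, rfl⟩ := hix.surj j h1 hj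
      exact ⟨x, hx.cons, nextIdx_old hx⟩
    · exact ⟨_, isNode_of_suffix List.suffix_rfl, nextIdx_leaf⟩
    · obtain ⟨rfl, hz⟩ := hN.2.2 j hj h2
      exact ⟨z, h.isNode, h.nextIdx_head hz⟩
  · rw [nextIdx_old isNode_nil, hix.root]

theorem denotes_cons {p l : ℕ} (h : Denotes S p l w) : Denotes (a :: S) p l w := by
  obtain ⟨h1, t, h2, h3, h4⟩ := h
  exact ⟨h1, t, h2.trans (List.suffix_cons a S), h3, h4⟩

/-- The records of the nodes after `a` has been prepended. -/
theorem NodeInv.cons {f f' : List A → ℕ} {M M' : ℕ → ℕ} (H : NodeInv S idx N f M)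
    (h : IsHead a S z) (hidx : idx' = nextIdx a S z idx N) (hN' : N' = nextNum S z N)
    (l0 : M' (64 * N) = 64 * idx' z) (l1 : M' (64 * N + 1) = S.length + 1)
    (l2 : M' (64 * N + 2) = S.length + 1) (l9 : M' (64 * N + 9) = S.length + 1)
    (l10 : M' (64 * N + 10) = S.length + 1) (l3 : M' (64 * N + 3) = f' (a :: S))
    (l4 : M' (64 * N + 4) = 64 * idx S) (l57 : M' 57 = 64 * N) (l58 : M' 58 = 64 * N')
    (l03 : M' 3 = M 3)
    (hz : ¬ IsNode S z → M' (64 * idx (loc S z)) = 64 * (N + 1) ∧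
      (∀ v, IsParent S v (loc S z) → M' (64 * (N + 1)) = 64 * idx v) ∧
      M' (64 * (N + 1) + 1) = M (64 * idx (loc S z) + 1) ∧ M' (64 * (N + 1) + 2) = z.length ∧
      M' (64 * (N + 1) + 9) = M (64 * idx (loc S z) + 1) ∧ M' (64 * (N + 1) + 10) = z.length ∧
      M' (64 * (N + 1) + 3) = f' z ∧ ∀ c v, z = c :: v → M' (64 * (N + 1) + 4) = 64 * idx v)
    (hold : ∀ q, IsNode S q → ∀ g, (g ≤ 4 ∨ g = 9 ∨ g = 10) → (g = 0 → q = loc S z → IsNode S z) →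
      M' (64 * idx q + g) = M (64 * idx q + g))
    (hf : ∀ q, IsNode S q → f' q = f q) : NodeInv (a :: S) idx' N' f' M' := by
  subst hidx hN'
  have hix := h.indexing H.ix
  have e1 : ∀ q, IsNode S q → nextIdx a S z idx N q = idx q := fun q hq => nextIdx_old hq
  have hc : ∀ q, IsNode (a :: S) q → IsNode S q ∨ q = a :: S ∨ (q = z ∧ ¬ IsNode S z) := fun q hq => by
    by_cases hqn : IsNode S q
    · exact .inl hqn
    · rcases h.node_iff.1 hq with h' | rfl | rfl
      · exact absurd h' hqn
      · exact .inr (.inl rfl)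
      · grind
  have hl := fun hn : ¬ IsNode S z => h.nextIdx_head (idx := idx) (N := N) hn
  refine ⟨hix, ?_, fun q v hq hv => ?_, fun q hq => ?_, fun q hq => ?_, fun q hq => ?_, fun c v hq => ?_,
    by rw [l03, H.root], by rw [l57, nextIdx_leaf], l58⟩
  · rw [e1 _ isNode_nil, ← add_zero (64 * idx []), hold _ isNode_nil 0 (by omega) (fun _ e => ?_),
      add_zero, H.root0]
    have := prefix_loc h.sub
    rw [← e] at this
    rw [List.prefix_nil.1 this]; exact isNode_nil
  · rcases hc q hq with hqn | rfl | ⟨rfl, hqn⟩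
    · rw [e1 q hqn]
      by_cases hw : q = loc S z ∧ ¬ IsNode S z
      · obtain ⟨rfl, hzn⟩ := hw
        rw [(hz hzn).1, hv.unique (h.parent_loc hzn), hl hzn]
      · have hw' : q = loc S z → IsNode S z := fun e => by by_contra h'; exact hw ⟨e, h'⟩
        have hq0 : q ≠ [] := by
          rintro rfl
          exact hv.2.2.1 (List.prefix_nil.1 hv.2.1)
        obtain ⟨p, hp⟩ := exists_parent (S := S) hq0
        have := h.parent_old hqn hp hw'
        rw [← hv.unique this] at hp
        rw [← add_zero (64 * idx q), hold q hqn 0 (by omega) fun _ => hw', add_zero,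
          H.parent q v hqn hp, e1 v hp.1]
    · rw [nextIdx_leaf, l0, hv.unique h.parent_new]
    · have hz0 : loc S q ≠ [] := fun e => by
        have := prefix_loc h.sub
        rw [e] at this
        rw [List.prefix_nil.1 this] at hqn; exact hqn isNode_nil
      obtain ⟨p, hp⟩ := exists_parent (S := S) hz0
      rw [hl hqn, (hz hqn).2.1 p hp, hv.unique (h.parent_head hqn hp), e1 p hp.1]
  · rcases hc q hq with hqn | rfl | ⟨rfl, hqn⟩
    · rw [e1 q hqn, hold q hqn 1 (by omega) (by omega), hold q hqn 2 (by omega) (by omega)]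
      exact denotes_cons (H.den q hqn)
    · rw [nextIdx_leaf, l1, l2]
      exact ⟨by simp, a :: S, List.suffix_rfl, by simp, List.prefix_rfl⟩
    · rw [hl hqn, (hz hqn).2.2.1, (hz hqn).2.2.2.1]
      obtain ⟨-, t, h1, h2, h3⟩ := denotes_cons (a := a) (H.den _ (loc_node h.sub))
      exact ⟨rfl, t, h1, h2, (prefix_loc h.sub).trans h3⟩
  · rcases hc q hq with hqn | rfl | ⟨rfl, hqn⟩
    · rw [e1 q hqn, hold q hqn 1 (by omega) (by omega), hold q hqn 2 (by omega) (by omega),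
        hold q hqn 9 (by omega) (by omega), hold q hqn 10 (by omega) (by omega)]
      exact H.den' q hqn
    · rw [nextIdx_leaf, l1, l2, l9, l10]; exact ⟨rfl, rfl⟩
    · grind
  · rcases hc q hq with hqn | rfl | ⟨rfl, hqn⟩
    · rw [e1 q hqn, hold q hqn 3 (by omega) (by omega), H.phi q hqn, hf q hqn]
    · rw [nextIdx_leaf, l3]
    · grind
  · rcases hc _ hq with hqn | e | ⟨rfl, hqn⟩
    · rw [e1 _ hqn, hold _ hqn 4 (by omega) (by omega), H.slink c v hqn, e1 v hqn.tail]
    · obtain ⟨rfl, rfl⟩ := List.cons.inj e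
      rw [nextIdx_leaf, l4, e1 _ (isNode_of_suffix List.suffix_rfl)]
    · rw [hl hqn, (hz hqn).2.2.2.2.2.2.2 c v rfl, e1 v]
      have : c = a := by
        have := h.pre
        exact (List.cons_prefix_cons.1 this).1
      subst this
      exact h.tail_node

theorem NodeInv.setPhi {f : List A → ℕ} {M : ℕ → ℕ} (H : NodeInv S idx N f M) {q : List A}
    (hq : IsNode S q) {v : ℕ} [DecidableEq (List A)] :
    NodeInv S idx N (Function.update f q v) (Function.update M (64 * idx q + 3) v) := by
  have := H.ix.pos q hq
  refine H.frame_phi (fun c _ _ => upd_ne (by omega)) fun x hx => ?_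
  by_cases e : x = q
  · subst e; simp
  · have : idx x ≠ idx q := fun h => e (H.ix.inj _ _ hx hq h)
    rw [upd_ne (by omega), Function.update_of_ne e, H.phi x hx]

end Change

/-! ### The stages of the update: finding the place of the new leaf -/

section Stages

variable {A : Type u} [LinearOrder A] {S : List A} {a : A} {z : List A} {idx : List A → ℕ} {ι : A → ℕ}
  {N r : ℕ} {D D' : ℕ → ℕ → ℕ} {B NB : ℕ} {f : List A → ℕ} {M : ℕ → ℕ} {chr : ℕ → Option A}
  {s : State A} {x v : List A} {c : A} {i : ℕ}
  {R : State A → ℕ → Prop}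

theorem exists_isHead (a : A) (S : List A) : ∃ z, IsHead a S z := by
  classical
  have hf : {q | q <+: a :: S ∧ q <:+: S}.Finite :=
    ((a :: S).inits.toFinset.finite_toSet).subset fun q hq => by
      simpa only [List.coe_toFinset, List.mem_inits, Set.mem_ofPred_eq] using hq.1
  obtain ⟨z, hz, hmax⟩ := hf.exists_maximalFor List.length _ ⟨[], List.nil_prefix, List.nil_infix⟩
  refine ⟨z, hz.1, hz.2, fun q h1 h2 => prefix_of_len h1 hz.1 ?_⟩
  by_contra hl
  exact hl (hmax ⟨h1, h2⟩ (by omega))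

theorem IsHead.unique {z' : List A} (h : IsHead a S z) (h' : IsHead a S z') : z = z' := by
  have h1 := h.max _ h'.pre h'.sub
  have h2 := h'.max _ h.pre h.sub
  exact h2.eq_of_length_le h1.length_le

/-- What stays fixed during the update when `a` is prepended to `S`: the longest prefix `z` of `a S` that
occurs in `S`, the numbering of the nodes of `S`, the numbering of the characters, the links `D`
before and `D'` after the update, and the size of the memory. -/
structure Setting (a : A) (S z : List A) (idx : List A → ℕ) (ι : A → ℕ) (N : ℕ)
    (D D' : ℕ → ℕ → ℕ) (B NB : ℕ) : Prop where
  head : IsHead a S z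
  ix : Indexing S idx N
  old : LinkMap S idx ι D
  new : LinkMap (a :: S) (nextIdx a S z idx N) ι D'
  mem : ∀ c, ι c ≠ 0 ↔ c ∈ a :: S
  inj : ∀ b c, ι b = ι c → ι b ≠ 0 → b = c
  le : ∀ c, ι c ≤ (a :: S).toFinset.card
  hB : 64 * NB ≤ B
  hNB : 10 * (S.length + 2) ≤ NB
  hN : N ≤ 2 * S.length + 2

theorem Setting.inj_on (E : Setting a S z idx ι N D D' B NB) :
    ∀ c ∈ a :: S, ∀ b ∈ a :: S, ι c = ι b → c = b :=
  fun c hc b _ e => E.inj c b e ((E.mem c).2 hc)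

theorem Setting.ix' (E : Setting a S z idx ι N D D' B NB) :
    Indexing (a :: S) (nextIdx a S z idx N) (nextNum S z N) := E.head.indexing E.ix

theorem num_le_nextNum : N < nextNum S z N ∧ nextNum S z N ≤ N + 2 := by
  unfold nextNum; split_ifs <;> omega

theorem Setting.bound (E : Setting a S z idx ι N D D' B NB) :
    DictBound D D' NB (a :: S).toFinset.card (logSigma (a :: S)) := by
  refine ⟨E.old.ne_zero_cons E.ix' (fun _ => nextIdx_old) E.new, fun d j h0 => ?_, ?_⟩
  · obtain ⟨c, -, rfl⟩ := E.new.key h0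
    refine ⟨?_, E.le c⟩
    unfold logSigma
    rw [add_comm]
    exact (E.le c).trans_lt (Nat.lt_pow_succ_log_self (by norm_num) _)
  · obtain ⟨Z, hZ, hc⟩ := E.new.support E.ix'
    have := E.hNB
    have := E.hN
    have := num_le_nextNum (S := S) (z := z) (N := N)
    simp only [List.length_cons] at hc
    exact ⟨Z, hZ, by omega⟩

theorem Setting.card_lt (E : Setting a S z idx ι N D D' B NB) : (a :: S).toFinset.card < NB := by
  have := card_toFinset_le (a :: S)
  have h2 := E.hNB
  rw [List.length_cons] at this; omega

theorem Setting.changed (E : Setting a S z idx ι N D D' B NB) {d j : ℕ} (h : D d j ≠ D' d j) :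
    Changed a S z (nextIdx a S z idx N) ι d j :=
  E.head.changed E.ix' (fun _ => nextIdx_old) E.old E.new h

/-- The entries of the dictionaries that change during the first walk. -/
def newLinks (a : A) (S : List A) (idx : List A → ℕ) (ι : A → ℕ) : Set (ℕ × ℕ) :=
  {p | ∃ u, IsNode S u ∧ u <+: S ∧ ¬ a :: u <:+: S ∧ p = (64 * idx u + 13, ι a)}

theorem Setting.link_iff (E : Setting a S z idx ι N D D' B NB) {u : List A} (hu : IsNode S u) :
    D (64 * idx u + 13) (ι a) = 0 ↔ ¬ a :: u <:+: S := by
  refine ⟨fun h0 hs => E.old.weiner_pos E.ix hu hs h0, fun hs => ?_⟩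
  exact E.old.weiner_zero E.ix hu
    (fun b hb e => E.inj_on _ (by simp [hb]) _ (by simp) e) hs

/-- Walk from the longest suffix towards the root, giving a link to the new leaf to the nodes without a
link; register `8` tells whether the parent of the longest suffix has no link. -/
def firstWalk : Prog :=
  lds 4 58 ;; lds 6 57 ;; ldf 7 6 0 ;; .copy 9 7 ;; look 29 ;; .copy 8 11 ;; .copy 9 6 ;;
  walk 29 4 ;; .copy 10 32

/-- The factor in the time bound of a walk. -/
def unit (S : List A) : ℕ := 60 * logSigma S + 200

set_option maxHeartbeats 800000 in
/-- The first walk ends at `x` if `z = ax`, and past the root if `z` is empty; it has written `newLinks`. The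
steps of the walk are paid by the difference of `dep S S` and `e`. -/
theorem firstWalk_wp (E : Setting a S z idx ι N D D' B NB) (H : NodeInv S idx N f M)
    (HC : CharInv (a :: S) ι M chr) (HD : DictStore M D r) (hM : s.mem.num = M)
    (h3 : s.reg 3 = 64 * ι a) (h29 : s.reg 29 = 0)
    (hR : ∀ s' t r' e, s'.creg = s.creg → s'.mem.chr = s.mem.chr →
      (∀ i, (i ≤ 3 ∨ (12 ≤ i ∧ i < 30)) → s'.reg i = s.reg i) → s'.reg 4 = 64 * N →
      s'.reg 6 = 64 * idx S →
      ((S = [] ∧ s'.reg 7 = 0) ∨ ∃ y, IsParent S y S ∧ s'.reg 7 = 64 * idx y) →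
      (s'.reg 8 ≠ 0 ↔ ∃ y, Gains a S y) → r ≤ r' →
      ((z = [] ∧ s'.reg 9 = 0 ∧ e = 0) ∨ ∃ x, z = a :: x ∧ x <+: S ∧ s'.reg 9 = 64 * idx x ∧
        s'.reg 10 = 64 * idx (loc S z) ∧ e = dep S x) →
      DictStore s'.mem.num (mix (newLinks a S idx ι) D D') r' →
      (∀ c, ¬ DictCell c → s'.mem.num c = M c) →
      t + unit (a :: S) * e ≤ unit (a :: S) * (dep S S + 3) → R s' t) : WP B firstWalk s R := by
  have hSn : IsNode S S := isNode_of_suffix List.suffix_rfl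
  have hps := E.ix.pos _ hSn
  have hB := E.hB
  have hNB := E.hNB
  have hN := E.hN
  have hU : unit (a :: S) = 60 * logSigma (a :: S) + 200 := rfl
  set U := unit (a :: S) with hUdef
  have hb0 : ∀ c, c < 64 → c < B := by omega
  simp [firstWalk, hM, H.free, H.top, hb0]
  refine ⟨by omega, ?_⟩
  have hy : ∃ i, M (64 * idx S) = 64 * i ∧ i < N ∧ ((S = [] ∧ i = 0) ∨
    ∃ y, IsParent S y S ∧ i = idx y) := by
    by_cases h : S = []
    · refine ⟨0, ?_, by omega, .inl ⟨h, rfl⟩⟩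
      rw [h, H.root0]
    · obtain ⟨y, hy⟩ := exists_parent (S := S) h
      exact ⟨idx y, H.parent _ _ hSn hy, (E.ix.pos _ hy.1).2, .inr ⟨y, hy, rfl⟩⟩
  obtain ⟨i, hi, hiN, hy⟩ := hy
  rw [hi]
  have HD0 : DictStore M (mix ∅ D D') r := HD.congr fun d j => mix_of_notMem (by simp)
  refine look_wp E.bound hB E.card_lt (T := ∅) (r := r) (i := i) (j := ι a) (by simpa [hM] using HC.bits)
    (by simpa [hM] using HD0) (by omega) (by simp) (by simp [h3]) (E.le a) (.inl rfl) (by simp [h29])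
    fun s1 t1 k1 k2 k3 k10 k4 k5 k6 => ?_
  have kr := k1.2.2
  have hs0 : ∀ u, IsNode S u → (D (64 * idx u + 13) (ι a) =
      State.reg ((s1.setReg 8 (s1.reg 11)).setReg 9 (s1.reg 6)) 29 ↔ ¬ a :: u <:+: S) := fun u hu => by
    rw [← E.link_iff hu]; simp [kr, h29]
  have hregs : ∀ s' : State A, KeepsW ((s1.setReg 8 (s1.reg 11)).setReg 9 (s1.reg 6)) s' →
      (s'.setReg 10 (s'.reg 32)).creg = s.creg ∧ (s'.setReg 10 (s'.reg 32)).mem.chr = s.mem.chr ∧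
      (∀ i, (i ≤ 3 ∨ (12 ≤ i ∧ i < 30)) → (s'.setReg 10 (s'.reg 32)).reg i = s.reg i) ∧
      (s'.setReg 10 (s'.reg 32)).reg 4 = 64 * N ∧ (s'.setReg 10 (s'.reg 32)).reg 6 = 64 * idx S ∧
      ((S = [] ∧ (s'.setReg 10 (s'.reg 32)).reg 7 = 0) ∨
        ∃ y, IsParent S y S ∧ (s'.setReg 10 (s'.reg 32)).reg 7 = 64 * idx y) ∧
      ((s'.setReg 10 (s'.reg 32)).reg 8 ≠ 0 ↔ ∃ y, Gains a S y) := by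
    intro s' w1
    have wr := w1.2.2
    refine ⟨by simp [w1.1, k1.1], by simp [w1.2.1, k2], fun i hi => ?_, by simp [wr, kr],
      by simp [wr, kr], ?_, ?_⟩
    · have h1 : i ≠ 4 ∧ i ≠ 6 ∧ i ≠ 7 ∧ i ≠ 8 ∧ i ≠ 9 ∧ i ≠ 10 ∧ i ≠ 99 := by omega
      simp only [State.setReg_reg, h1, if_false]
      rw [wr i (by omega) h1.2.2.2.2.2.2]
      simp only [State.setReg_reg, h1, if_false]
      rw [kr i (by omega) h1.2.2.2.2.2.2]
      simp [h1]
    · refine hy.imp (fun h => ⟨h.1, ?_⟩) fun ⟨y, h, e⟩ => ⟨y, h, ?_⟩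
      · simp [wr, kr, h.2]
      · simp [wr, kr, e]
    · simp [wr]
      rw [k5]
      simp [h29]
      rcases hy with ⟨rfl, rfl⟩ | ⟨y, hy, rfl⟩
      · simp
        intro y hg
        exact hg.1.2.2.1 (List.prefix_nil.1 hg.1.2.1)
      · have := E.ix.pos _ hy.1
        rw [mix_of_notMem (by simp), E.link_iff hy.1]
        refine ⟨fun h => ⟨y, hy, h.2⟩, fun ⟨y', h1, h2⟩ => ⟨by omega, ?_⟩⟩
        rwa [hy.unique h1]
  refine walk_wp E.bound hB E.card_lt E.ix (by omega) (E.le a) (.inl rfl) (.inl (by omega)) S.length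
    (v := S) (T := ∅) (r := r) le_rfl hSn (fun u p hu _ hp => ?_) ?_ ?_ ?_ (fun _ _ _ => by simp)
    (fun u hu huS h0 => ?_) ?_ ?_ ?_ ?_ fun s' t r' L e w1 w2 w3 w6 w9 w10 w11 => ?_
  · simp [k2, hM]; exact H.parent u p hu hp
  · simp [k2, hM, H.root0]
  · simpa only [State.setReg_mem, k2, hM] using HC.bits
  · simp [k2, hM]; exact HD0
  · simp [kr, h29] at h0 ⊢
    have hs := (E.link_iff hu).1 h0
    have hp : a :: u <+: a :: S := by simpa using huS
    rw [← nextIdx_old (idx := idx) (N := N) hu, E.new.weiner _ _ hu.cons hp.isInfix, E.head.loc_new hp hs,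
      nextIdx_leaf]
  · simp [kr]; omega
  · simp [kr]
  · simp [kr, h3]
  · simp [kr, h29]
  · obtain ⟨q1, q2, q3, q4, q5, q6, q7⟩ := hregs s' w1
    obtain ⟨e', he, h9, hnew⟩ : ∃ e', e' ≤ e ∧ ((z = [] ∧ s'.reg 9 = 0 ∧ e' = 0) ∨ ∃ x, z = a :: x ∧
      x <+: S ∧
        s'.reg 9 = 64 * idx x ∧ s'.reg 32 = 64 * idx (loc S z) ∧ e' = dep S x) ∧
        ∀ u, u <+: S → ¬ a :: u <:+: S → L ≤ u.length := by
      rcases w3 with ⟨rfl, rfl, h9⟩ | ⟨x, w3, w4, w5, rfl, rfl, w7, w8⟩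
      · have hn := (hs0 _ isNode_nil).1 (w6 [] isNode_nil List.nil_prefix (by simp))
        exact ⟨0, le_rfl, .inl ⟨E.head.unique (isHead_nil hn), h9, rfl⟩, by simp⟩
      · rw [ne_eq, hs0 x w3, not_not] at w5
        have hx : IsHead a S (a :: x) := isHead_cons w4 w5 fun v hv hvS hav => by
          by_contra hn
          exact (hs0 v hv).1 (w6 v hv hvS (by by_contra hl; exact hn (prefix_of_len hvS w4 (by omega)))) hav
        obtain rfl := E.head.unique hx
        refine ⟨_, by omega, .inr ⟨x, rfl, w4, w7, by rw [w8, E.old.weiner x a w3 w5], rfl⟩,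
          fun u hu h => ?_⟩
        by_contra hl
        exact h ((show a :: u <+: a :: x by simpa using prefix_of_len hu w4 (by omega)).isInfix.trans w5)
    refine hR _ _ r' e' q1 q2 q3 q4 q5 q6 q7 w2 ?_ ?_ (fun c hc => by simp [w10 c hc, k2, hM]) ?_
    · simpa using h9
    · have : newLinks a S idx ι = ∅ ∪ {p | ∃ u, IsNode S u ∧ u <+: S ∧ L ≤ u.length ∧
          p = (64 * idx u + 13, ι a)} := by
        ext p
        simp only [newLinks, Set.mem_ofPred_eq, Set.empty_union]
        refine exists_congr fun u => and_congr_right fun hu => and_congr_right fun huS => ?_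
        refine and_congr_left fun _ => ⟨hnew u huS, fun h => (hs0 u hu).1 (w6 u hu huS h)⟩
      rw [this]; simpa using w9
    · have := Nat.mul_le_mul_left U he
      rw [← hU] at w11
      rw [show dep S S + 3 = dep S S + 2 + 1 from rfl, Nat.mul_add_one _ (dep S S + 2)]; omega

/-! ### The stages of the update: lost net occurrences -/

/-- Test whether the head loses a pair at the left. -/
def flagLeft : Prog :=
  .ite (.eq 18 19) .nop
    (ldf 20 10 4 ;; ldf 21 20 0 ;; ldf 22 20 6 ;;
      .ite (.eq 21 14) (.ite (.eq 22 29) (.const 15 1) .nop) .nop)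

/-- Test whether the parent of the leaf above the head loses a pair at the right. -/
def flagRight : Prog :=
  .ite (.lt 18 1)
    (.cload 1 18 ;; skipFind ;; addk 30 13 13 ;; .copy 31 40 ;; dget ;; ldf 22 32 6 ;;
      .ite (.eq 22 29) (.const 16 1) .nop)
    .nop

/-- Determine, for the node in register `9` and its link in register `10`, the parent of the latter, the
lengths of the link and of the head, and which net occurrences are lost. -/
def flags : Prog :=
  .copy 14 9 ;; ldf 13 10 0 ;; ldf 18 10 2 ;; ldf 19 14 2 ;; addk 19 19 1 ;; .const 15 0 ;;
  .const 16 0 ;; .const 17 0 ;; ldf 20 10 6 ;;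
  .ite (.eq 20 29) (.const 17 1 ;; flagLeft ;; flagRight) .nop

theorem Setting.leaf_test (E : Setting a S z idx ι N D D' B NB)
    (HD : DictStore M (mix (newLinks a S idx ι) D D') r) {u : List A} (hu : IsNode S u) :
    M (64 * idx u + 6) = 0 ↔ occ S u = 1 := by
  have := E.ix.pos u hu
  rw [← E.old.leaf E.ix hu, HD.head_eq_zero (d := 64 * idx u + 5) ⟨by omega, by omega⟩]
  refine forall_congr' fun j => ?_
  rw [mix_of_notMem]
  rintro ⟨v, -, -, -, e⟩
  have := congrArg Prod.fst e
  simp only at this; omega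

theorem exists_cons_suffix {w : List A} (hw : w <:+ S) (hl : w.length < S.length) :
    ∃ c, c :: w <:+ S := by
  obtain ⟨u, rfl⟩ := hw
  have : u ≠ [] := by rintro rfl; simp at hl
  obtain ⟨u', c, rfl⟩ := (List.eq_nil_or_concat u).resolve_left this
  exact ⟨c, u', by simp⟩

theorem CharInv.chr_eq (H : CharInv S ι M chr) {t : List A} (ht : t <:+ S) (hv : v ++ [c] <+: t) :
    chr (t.length - v.length - 1) = some c := by
  have h1 := ht.length_le
  have h2 := hv.length_le
  obtain ⟨u, rfl⟩ := hv
  obtain ⟨p, rfl⟩ := ht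
  simp at h1 h2
  rw [H.text _ (by simp; omega)]
  have e : (v ++ [c] ++ u).length - v.length - 1 = u.length := by simp
  rw [e]
  simp

open Classical in
/-- The test of `IsHead.losesLeft_iff`; a node is a leaf iff the list of its child edges is empty. -/
theorem flagLeft_wp (E : Setting a S (a :: x) idx ι N D D' B NB) (H : NodeInv S idx N f M)
    (HD : DictStore M (mix (newLinks a S idx ι) D D') r) (ho : occ S (a :: x) = 1)
    (hM : s.mem.num = M) (h10 : s.reg 10 = 64 * idx (loc S (a :: x))) (h14 : s.reg 14 = 64 * idx x)
    (h18 : s.reg 18 = (loc S (a :: x)).length) (h19 : s.reg 19 = x.length + 1) (h15 : s.reg 15 = 0)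
    (h29 : s.reg 29 = 0) (hR : ∀ s' t, s'.creg = s.creg → s'.mem = s.mem →
      (∀ i, i ≠ 15 → (i < 20 ∨ 23 ≤ i) → i ≠ 99 → s'.reg i = s.reg i) →
      (s'.reg 15 = if LosesLeft a S (a :: x) x then 1 else 0) → t ≤ 20 → R s' t) :
    WP B flagLeft s R := by
  have hw := loc_node E.head.sub
  have hxn := E.head.tail_node
  obtain ⟨t, ht⟩ : ∃ t, loc S (a :: x) = a :: t := by
    obtain ⟨t, ht⟩ := prefix_loc E.head.sub
    exact ⟨x ++ t, by rw [← ht]; rfl⟩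
  have hiff := E.head.losesLeft_iff ho ht
  have hB := E.hB
  have hNB := E.hNB
  have hN := E.hN
  rw [ht] at hw h10 h18
  have p1 := E.ix.pos _ hw
  have p2 := E.ix.pos _ hw.tail
  by_cases hl : (a :: t).length = x.length + 1
  · simp [flagLeft, h18, h19]
    refine ⟨fun _ => hR _ _ rfl rfl (fun _ _ _ _ => rfl) ?_ (by omega), fun h => absurd hl
      (by simpa using h)⟩
    rw [if_neg (by rw [hiff]; tauto), h15]
  · have h0 : t ≠ [] := by
      rintro rfl
      have := (prefix_loc E.head.sub).length_le
      rw [ht] at this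
      simp at this hl; exact hl this
    obtain ⟨p, hp⟩ := exists_parent (S := S) h0
    have e4 : M (64 * idx (a :: t) + 4) = 64 * idx t := H.slink a t hw
    have e0 : M (64 * idx t) = 64 * idx p := H.parent t p hw.tail hp
    have hpx : idx p = idx x ↔ IsParent S x t :=
      ⟨fun e => E.ix.inj _ _ hp.1 hxn e ▸ hp, fun h => by rw [hp.unique h]⟩
    have e6 := E.leaf_test HD hw.tail
    simp [flagLeft, h18, h19, h10, h14, h29, hM, e4, e0]
    refine ⟨fun h => absurd (by simpa using h) hl, fun _ => ⟨by omega, by omega, by omega, ?_⟩⟩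
    refine ⟨fun h => ⟨fun h6 => ⟨by omega, ?_⟩, fun h6 => ?_⟩, fun h => ?_⟩ <;>
      refine hR _ _ (by simp) (by simp) (fun i h1 h2 h3 => ?_) ?_ (by omega)
    · simp [h1, h3, show i ≠ 20 by omega, show i ≠ 21 by omega, show i ≠ 22 by omega]
    · rw [if_pos (hiff.2 ⟨hl, hpx.1 h, e6.1 h6⟩)]; simp
    · simp [h3, show i ≠ 20 by omega, show i ≠ 21 by omega, show i ≠ 22 by omega]
    · rw [if_neg (by rw [hiff, ← e6]; tauto)]; simp [h15]
    · simp [h3, show i ≠ 20 by omega, show i ≠ 21 by omega, show i ≠ 22 by omega]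
    · rw [if_neg (by rw [hiff, ← hpx]; tauto)]; simp [h15]

open Classical in
/-- The test of `losesRight_iff`; the character before a suffix is found in the text. -/
theorem flagRight_wp (E : Setting a S z idx ι N D D' B NB) (HC : CharInv (a :: S) ι M chr)
    (HD : DictStore M (mix (newLinks a S idx ι) D D') r) (ho : occ S z = 1)
    (hv : IsParent S v (loc S z)) (hM : s.mem.num = M) (hchr : s.mem.chr = chr)
    (h9 : s.creg 9 = none) (h1 : s.reg 1 = S.length) (h13 : s.reg 13 = 64 * idx v)
    (h18 : s.reg 18 = (loc S z).length) (h16 : s.reg 16 = 0) (h29 : s.reg 29 = 0)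
    (hR : ∀ s' t, s'.creg 9 = none → s'.mem = s.mem →
      (∀ i, i ≠ 16 → (i < 20 ∨ 28 ≤ i ∧ i < 30) → s'.reg i = s.reg i) →
      (s'.reg 16 = if LosesRight S z v then 1 else 0) → t ≤ 300 * logSigma (a :: S) → R s' t) :
    WP B flagRight s R := by
  have hw := loc_node E.head.sub
  have hws := leaf_suffix hw (by rw [occ_loc E.head.sub, ho])
  have hiff := losesRight_iff E.head.sub ho hv
  have hB := E.hB
  have hNB := E.hNB
  have hN := E.hN
  have hL := one_le_logSigma (a :: S)
  have p1 := E.ix.pos _ hv.1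
  by_cases hl : (loc S z).length < S.length
  · obtain ⟨c, hc⟩ := exists_cons_suffix hws hl
    have hchr' : chr (loc S z).length = some c := by
      have := HC.chr_eq (t := c :: loc S z) (v := []) (c := c) (hc.trans (List.suffix_cons a S)) (by simp)
      simpa using this
    have hcv : c :: v <:+: S := by
      have : c :: v <+: c :: loc S z := by simpa using hv.2.1
      exact this.isInfix.trans hc.isInfix
    have hcS : c ∈ S := mem_of_cons_sub hcv
    have hun := loc_node hcv
    have hmix : mix (newLinks a S idx ι) D D' (64 * idx v + 13) (ι c) = 64 * idx (loc S (c :: v)) := by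
      rw [mix_of_notMem, E.old.weiner v c hv.1 hcv]
      rintro ⟨u, hu, -, hn, e⟩
      have e1 := congrArg Prod.fst e
      have e2 := congrArg Prod.snd e
      simp only at e1 e2
      obtain rfl := E.ix.inj _ _ hv.1 hu (by omega)
      obtain rfl := E.inj_on c (by simp [hcS]) a (by simp) e2
      exact hn hcv
    have p2 := E.ix.pos _ hun
    have e6 := E.leaf_test HD hun
    have hiff' : LosesRight S z v ↔ occ S (c :: v) = 1 := by
      rw [hiff]
      refine ⟨fun ⟨c', hc', h⟩ => ?_, fun h => ⟨c, hc, h⟩⟩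
      have := suffix_eq_of_len hc' hc rfl
      rwa [(List.cons.inj this).1] at h
    simp [flagRight, h18, h1, hl]
    refine ⟨by omega, ?_⟩
    refine HC.find_wp (v := c) hB (by simpa using hNB) (by simpa using hM) (by simpa using hchr)
      (by simp [h9]) (by simp [hchr, hchr']) fun s1 t1 k1 k2 k3 k4 => ?_
    have kr := k1.2.2
    simp [kr, h13, k3]
    refine ⟨by omega, ?_⟩
    refine mget_wp (d := 64 * idx v + 13) (j := ι c) E.bound hB (M := M) HC.bits E.card_lt HD
      (by simp [k2, hM]) (by simp) (by simp) (E.le c) ⟨by omega, by omega⟩ (by omega)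
      fun s2 t2 g1 g2 g3 g4 => ?_
    rw [hmix] at g3
    have gr := g1.2.2
    have e29 : s2.reg 29 = 0 := by simp [gr, kr, h29]
    have em : s2.mem.num = M := by rw [g2]; simp [k2, hM]
    rw [g3, em]
    have hreg : ∀ i, (i < 20 ∨ 28 ≤ i ∧ i < 30) → s2.reg i = s.reg i := fun i hi => by
      rw [gr i (by omega) (by omega)]
      simp [show i ≠ 30 by omega, show i ≠ 31 by omega, show i ≠ 99 by omega]
      rw [kr i (by omega) (by omega)]
      simp
    refine ⟨by omega, fun h6 => ⟨by omega, ?_⟩, fun h6 => ?_⟩ <;> rw [e29, e6] at h6 <;>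
      refine hR _ _ (by simp [g1.1, k1.1, h9]) (by simp [g2, k2]) (fun i h1 h2 => ?_) ?_ (by omega)
    · simp [h1, hreg i h2, show i ≠ 22 by omega, show i ≠ 99 by omega]
    · rw [if_pos (hiff'.2 (by rwa [occ_loc hcv] at h6))]; simp
    · simp [hreg i h2, show i ≠ 22 by omega, show i ≠ 99 by omega]
    · rw [if_neg (by rw [hiff']; rwa [occ_loc hcv] at h6)]
      simp [hreg, h16]
  · simp [flagRight, h18, h1, hl]
    refine hR _ _ h9 rfl (fun _ _ _ => rfl) ?_ (by omega)
    rw [if_neg, h16]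
    rw [hiff]
    rintro ⟨c, hc, -⟩
    have := hc.length_le
    simp at this; omega

open Classical in
theorem flags_wp (E : Setting a S (a :: x) idx ι N D D' B NB) (H : NodeInv S idx N f M)
    (HC : CharInv (a :: S) ι M chr) (HD : DictStore M (mix (newLinks a S idx ι) D D') r)
    (hM : s.mem.num = M) (hchr : s.mem.chr = chr) (hc9 : s.creg 9 = none) (h1 : s.reg 1 = S.length)
    (h9 : s.reg 9 = 64 * idx x) (h10 : s.reg 10 = 64 * idx (loc S (a :: x))) (h29 : s.reg 29 = 0)
    (hR : ∀ s' t v, IsParent S v (loc S (a :: x)) → s'.creg 9 = none → s'.mem = s.mem →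
      (∀ i, (i ≤ 8 ∨ i = 10 ∨ i = 29) → s'.reg i = s.reg i) →
      s'.reg 13 = 64 * idx v → s'.reg 14 = 64 * idx x → s'.reg 18 = (loc S (a :: x)).length →
      s'.reg 19 = x.length + 1 →
      (s'.reg 15 = if LosesLeft a S (a :: x) x then 1 else 0) →
      (s'.reg 16 = if LosesRight S (a :: x) v then 1 else 0) →
      (s'.reg 17 = if occ S (a :: x) = 1 then 1 else 0) →
      t ≤ 400 * logSigma (a :: S) → R s' t) : WP B flags s R := by
  have hw := loc_node E.head.sub
  have hxn := E.head.tail_node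
  have hw0 : loc S (a :: x) ≠ [] := fun e => by
    have := prefix_loc E.head.sub
    rw [e] at this; simp at this
  obtain ⟨v, hv⟩ := exists_parent (S := S) hw0
  have p1 := E.ix.pos _ hw
  have p2 := E.ix.pos _ hxn
  have hB := E.hB
  have hNB := E.hNB
  have hN := E.hN
  have hL := one_le_logSigma (a :: S)
  have l1 := (H.den _ hw).1
  have l2 := (H.den _ hxn).1
  have l3 := hxn.sub.length_le
  have hb : ∀ g, g < 64 → 64 * idx (loc S (a :: x)) + g < B := by omega
  have hb' : ∀ g, g < 64 → 64 * idx x + g < B := by omega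
  have hbl : x.length + 1 ≤ B := by omega
  have h1B : 1 ≤ B := by omega
  have e6 := E.leaf_test HD hw
  rw [occ_loc E.head.sub] at e6
  have hb0 := hb 0 (by omega)
  rw [add_zero] at hb0
  simp [flags, hM, h9, h10, hb, hb', hb0, l1, l2, h1B, h29, H.parent _ v hw hv]
  refine ⟨by omega, fun h6 => ?_, fun h6 => ?_⟩ <;> rw [e6] at h6
  · refine flagLeft_wp E H HD h6 (by simp [hM]) (by simp [h10]) (by simp) (by simp) (by simp)
      (by simp) (by simp [h29]) fun s1 t1 k1 k2 k3 k4 k5 => ?_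
    refine flagRight_wp E HC HD h6 hv (by simp [k2, hM]) (by simp [k2, hchr]) (by simp [k1, hc9])
      (by simp [k3, h1]) (by simp [k3]) (by simp [k3]) (by simp [k3]) (by simp [k3, h29])
      fun s2 t2 g1 g2 g3 g4 g5 => ?_
    refine hR _ _ v hv g1 (by simp [g2, k2]) (fun i hi => ?_) (by simp [g3, k3]) (by simp [g3, k3])
      (by simp [g3, k3]) (by simp [g3, k3]) (by rw [g3 _ (by omega) (by omega), k4]) g4
      (by simp [g3, k3, h6]) (by omega)
    by_cases e : i = 10
    · subst e; simp [g3, k3]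
    · rw [g3 i (by omega) (by omega), k3 i (by omega) (by omega) (by omega)]
      have : i ≠ 13 ∧ i ≠ 14 ∧ i ≠ 15 ∧ i ≠ 16 ∧ i ≠ 17 ∧ i ≠ 18 ∧ i ≠ 19 ∧ i ≠ 20 ∧ i ≠ 99 := by omega
      simp [this]
  · refine hR _ _ v hv (by simp [hc9]) (by simp) (fun i hi => ?_) (by simp) (by simp)
      (by simp) (by simp) ?_ ?_ (by simp [h6]) (by omega)
    · have : i ≠ 13 ∧ i ≠ 14 ∧ i ≠ 15 ∧ i ≠ 16 ∧ i ≠ 17 ∧ i ≠ 18 ∧ i ≠ 19 ∧ i ≠ 20 ∧ i ≠ 99 := by omega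
      simp [this]
    · rw [if_neg fun h => h6 h.2.1]; simp
    · rw [if_neg fun h => h6 h.1]; simp

/-! ### The stages of the update: the new nodes and the net frequencies -/

/-- Fill the record of the new branching node in register `12`, and insert it above the node in register
`10`. -/
def newHead : Prog :=
  stf 12 0 13 ;; ldf 20 10 1 ;; stf 12 1 20 ;; stf 12 9 20 ;; stf 12 2 19 ;; stf 12 10 19 ;;
  stf 12 3 17 ;; stf 12 11 29 ;; stf 12 4 14 ;; stf 10 0 12

/-- Fill the record of the new leaf in register `4`, with the parent in register `12`. -/
def newLeaf : Prog :=
  stf 4 0 12 ;; stf 4 1 2 ;; stf 4 2 2 ;; stf 4 9 2 ;; stf 4 10 2 ;; stf 4 3 29 ;; stf 4 11 29 ;;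
  stf 4 4 6 ;; sts 57 4 ;; sts 58 5

/-- Add the number in register `d` to the net frequency of the node in register `q`, or subtract it if
`sub` holds. -/
def addPhi (q d : ℕ) (sub : Bool := false) : Prog :=
  ldf 20 q 3 ;; (if sub then .sub 20 20 d else .add 20 20 d) ;; stf q 3 20

/-- Determine the head in register `12`, creating it if necessary, when the first walk has found a link. -/
def found : Prog :=
  flags ;;
  .ite (.eq 18 19) (.copy 12 10 ;; .const 28 0 ;; addk 5 4 64)
    (addk 12 4 64 ;; newHead ;; .const 28 1 ;; addk 5 12 64)

/-- The head is the root when the first walk has found no link. -/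
def notFound : Prog :=
  .const 12 64 ;; .const 13 64 ;; .const 14 64 ;; .const 15 0 ;; .const 16 0 ;; .const 28 0 ;;
  addk 5 4 64

/-- Create the new nodes and update the net frequencies. -/
def build : Prog :=
  .ite (.eq 9 29) notFound found ;; newLeaf ;;
  .ite (.eq 8 29) .nop (.const 21 1 ;; addPhi 7 21) ;; addPhi 14 15 true ;; addPhi 13 16 true

theorem newHead_wp {w : ℕ} (hM : s.mem.num = M) (h12 : s.reg 12 = 64 * i) (h10 : s.reg 10 = 64 * w)
    (hne : w ≠ i) (hiB : 64 * i + 64 ≤ B) (hwB : 64 * w + 64 ≤ B)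
    (hR : ∀ s' t, KeepsR 20 21 s s' → s'.mem.num (64 * i) = s.reg 13 →
      s'.mem.num (64 * i + 1) = M (64 * w + 1) ∧ s'.mem.num (64 * i + 2) = s.reg 19 ∧
      s'.mem.num (64 * i + 9) = M (64 * w + 1) ∧ s'.mem.num (64 * i + 10) = s.reg 19 ∧
      s'.mem.num (64 * i + 3) = s.reg 17 ∧ s'.mem.num (64 * i + 11) = s.reg 29 ∧
      s'.mem.num (64 * i + 4) = s.reg 14 → s'.mem.num (64 * w) = 64 * i →
      (∀ c, c ≠ 64 * w → (c < 64 * i ∨ 64 * i + 12 ≤ c ∨ (64 * i + 5 ≤ c ∧ c ≤ 64 * i + 8)) →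
        s'.mem.num c = M c) → t ≤ 40 → R s' t) : WP B newHead s R := by
  have b1 : ∀ g, g < 64 → 64 * i + g < B := by omega
  have b2 : ∀ g, g < 64 → 64 * w + g < B := by omega
  have b10 := b1 0 (by omega)
  have b20 := b2 0 (by omega)
  rw [add_zero] at b10 b20
  simp [newHead, h12, h10, b1, b2, b10, b20, hM]
  refine hR _ _ (by simp) ?_ ?_ ?_ (fun c h1 h2 => ?_) (by omega)
  all_goals simp only [State.setReg_mem, State.setNum_num, hM]
  · simp (disch := omega) only [upd_ne, upd_self]
  · refine ⟨?_, ?_, ?_, ?_, ?_, ?_, ?_⟩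
    all_goals simp (disch := omega) only [upd_ne, upd_self]
  · simp (disch := omega) only [upd_ne, upd_self]
  · simp (disch := omega) only [upd_ne]

theorem newLeaf_wp (hM : s.mem.num = M) (h4 : s.reg 4 = 64 * i) (hi : 1 ≤ i) (hiB : 64 * i + 64 ≤ B)
    (hR : ∀ s' t, KeepsR 99 99 s s' → s'.mem.num (64 * i) = s.reg 12 →
      s'.mem.num (64 * i + 1) = s.reg 2 ∧ s'.mem.num (64 * i + 2) = s.reg 2 ∧
      s'.mem.num (64 * i + 9) = s.reg 2 ∧ s'.mem.num (64 * i + 10) = s.reg 2 ∧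
      s'.mem.num (64 * i + 3) = s.reg 29 ∧ s'.mem.num (64 * i + 11) = s.reg 29 ∧
      s'.mem.num (64 * i + 4) = s.reg 6 ∧ s'.mem.num 57 = 64 * i ∧ s'.mem.num 58 = s.reg 5 →
      (∀ c, c ≠ 57 → c ≠ 58 → (c < 64 * i ∨ 64 * i + 12 ≤ c ∨ (64 * i + 5 ≤ c ∧ c ≤ 64 * i + 8)) →
        s'.mem.num c = M c) → t ≤ 40 → R s' t) : WP B newLeaf s R := by
  have b1 : ∀ g, g < 64 → 64 * i + g < B := by omega
  have b10 := b1 0 (by omega)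
  rw [add_zero] at b10
  simp [newLeaf, h4, b1, b10, show 57 < B by omega, show 58 < B by omega]
  refine hR _ _ (by simp) ?_ ?_ (fun c h1 h2 h3 => ?_) (by omega)
  all_goals simp only [State.setReg_mem, State.setNum_num, hM]
  · simp (disch := omega) only [upd_ne, upd_self]
  · refine ⟨?_, ?_, ?_, ?_, ?_, ?_, ?_, ?_, ?_⟩
    all_goals simp (disch := omega) only [upd_ne, upd_self]
  · simp (disch := omega) only [upd_ne]

/-- The cells of the net frequencies. -/
abbrev PhiCell (c : ℕ) : Prop := 64 ≤ c ∧ c % 64 = 3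

open Classical in
theorem addPhi_wp {q d : ℕ} {sub : Bool} (hq : q < 20) (hd : d ≠ 20 ∧ d ≠ 99)
    (H : NodeInv S idx N f M) (hx : IsNode S x) (hB : 64 * N ≤ B) (hM : s.mem.num = M)
    (h : s.reg q = 64 * idx x) (hle : sub = false → f x + s.reg d ≤ B)
    (hR : ∀ s' t, KeepsR 20 21 s s' →
      NodeInv S idx N (Function.update f x (if sub then f x - s.reg d else f x + s.reg d)) s'.mem.num →
      (∀ c, ¬ PhiCell c → s'.mem.num c = M c) → t ≤ 10 → R s' t) : WP B (addPhi q d sub) s R := by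
  have hp := H.ix.pos x hx
  cases sub <;> simp at hle hR
  all_goals
    simp [addPhi, show q ≠ 99 by omega, show q ≠ 20 by omega, h, hd.1, hd.2, hM, H.phi x hx, hle]
    refine ⟨by omega, hR _ _ (by simp) ?_ (fun c hc => ?_) (by omega)⟩
    · simp only [State.setReg_mem, State.setNum_num, hM]
      exact H.setPhi hx
    · simp only [State.setReg_mem, State.setNum_num, hM]
      exact upd_ne (by omega)

open Classical in
/-- The net frequencies before they are updated: those in `S`, except for the pair that becomes a net
occurrence of a new branching node. -/
noncomputable def startPhi (S z : List A) (q : List A) : ℕ :=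
  if q = z ∧ occ S z = 1 ∧ ¬ IsNode S z then 1 else phi S q

open Classical in
theorem IsHead.startPhi_update (h : IsHead a S z) (q : List A) :
    phi (a :: S) q = startPhi S z q + (if Gains a S q then 1 else 0) -
      (if LosesLeft a S z q then 1 else 0) - (if LosesRight S z q then 1 else 0) := by
  unfold startPhi
  by_cases hq : q = z ∧ occ S z = 1 ∧ ¬ IsNode S z
  · obtain ⟨rfl, h1, h2⟩ := hq
    rw [h.phi_head h1 h2, if_pos ⟨rfl, h1, h2⟩, if_neg fun h => h2 h.1.1, if_neg fun h => ?_,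
      if_neg fun h => h2 h.2.1.1]
    have := congrArg List.length h.1
    simp at this
  · rw [if_neg hq]
    have := h.phi_update hq
    omega

/-- The node `x` is where the first walk ends, and `v` is the parent of the link; both are the root if
there is no link. -/
def Places (a : A) (S z x v : List A) : Prop :=
  (z = [] ∧ x = [] ∧ v = []) ∨ (z = a :: x ∧ IsParent S v (loc S z))

theorem IsHead.places_node (h : IsHead a S z) (hp : Places a S z x v) : IsNode S x ∧ IsNode S v := by
  rcases hp with ⟨-, rfl, rfl⟩ | ⟨rfl, hv⟩
  · exact ⟨isNode_nil, isNode_nil⟩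
  · exact ⟨h.tail_node, hv.1⟩

theorem loses_places {q : List A} (hp : Places a S z x v) :
    (LosesLeft a S z q → q = x) ∧ (LosesRight S z q → q = v) := by
  rcases hp with ⟨rfl, rfl, rfl⟩ | ⟨rfl, hv⟩
  · refine ⟨fun h => by simpa using h.1, fun h => ?_⟩
    have h1 := h.2.1
    rw [loc_of_node isNode_nil] at h1
    exact List.prefix_nil.1 h1.2.1
  · exact ⟨fun h => (List.cons.inj h.1).2, fun h => h.2.1.unique hv⟩

theorem IsHead.phi_same {q : List A} (h : IsHead a S z) (hp : Places a S z x v) (h1 : q ≠ z)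
    (h2 : ¬ Gains a S q) (h3 : q ≠ x) (h4 : q ≠ v) : phi (a :: S) q = phi S q := by
  have hl := loses_places (q := q) hp
  rw [h.startPhi_update, startPhi, if_neg (by tauto), if_neg h2, if_neg (by tauto), if_neg (by tauto)]
  omega

/-- The state of the machine when the head has been determined. -/
structure Prepared (a : A) (S z : List A) (idx : List A → ℕ) (N : ℕ) (M : ℕ → ℕ) (s s' : State A)
    (x v : List A) : Prop where
  places : Places a S z x v
  creg : s'.creg 9 = none
  chr : s'.mem.chr = s.mem.chr
  reg : ∀ i, (i ≤ 4 ∨ i = 6 ∨ i = 7 ∨ i = 8 ∨ i = 29) → s'.reg i = s.reg i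
  r5 : s'.reg 5 = 64 * nextNum S z N
  r12 : s'.reg 12 = 64 * nextIdx a S z idx N z
  r13 : s'.reg 13 = 64 * idx v
  r14 : s'.reg 14 = 64 * idx x
  r15 : s'.reg 15 = open Classical in if LosesLeft a S z x then 1 else 0
  r16 : s'.reg 16 = open Classical in if LosesRight S z v then 1 else 0
  r28 : s'.reg 28 = 0 ↔ IsNode S z
  r10 : ¬ IsNode S z → s'.reg 10 = 64 * idx (loc S z)
  same : IsNode S z → s'.mem.num = M
  new : ¬ IsNode S z → s'.mem.num (64 * idx (loc S z)) = 64 * (N + 1) ∧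
      (∀ v, IsParent S v (loc S z) → s'.mem.num (64 * (N + 1)) = 64 * idx v) ∧
      s'.mem.num (64 * (N + 1) + 1) = M (64 * idx (loc S z) + 1) ∧
      s'.mem.num (64 * (N + 1) + 2) = z.length ∧
      s'.mem.num (64 * (N + 1) + 9) = M (64 * idx (loc S z) + 1) ∧
      s'.mem.num (64 * (N + 1) + 10) = z.length ∧
      s'.mem.num (64 * (N + 1) + 3) = startPhi S z z ∧
      (∀ c v, z = c :: v → s'.mem.num (64 * (N + 1) + 4) = 64 * idx v) ∧
      s'.mem.num (64 * (N + 1) + 11) = 0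
  frame : ∀ c, c ≠ 64 * idx (loc S z) → (c < 64 * (N + 1) ∨ 64 * (N + 1) + 12 ≤ c ∨
    (64 * (N + 1) + 5 ≤ c ∧ c ≤ 64 * (N + 1) + 8)) → s'.mem.num c = M c

theorem notFound_wp (E : Setting a S [] idx ι N D D' B NB) (hM : s.mem.num = M)
    (hc9 : s.creg 9 = none) (h4 : s.reg 4 = 64 * N)
    (hR : ∀ s' t, Prepared a S [] idx N M s s' [] [] → t ≤ 10 → R s' t) : WP B notFound s R := by
  have hB := E.hB
  have hNB := E.hNB
  have hN := E.hN
  simp [notFound, h4]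
  refine ⟨by omega, by omega, hR _ _ ⟨.inl ⟨rfl, rfl, rfl⟩, by simp [hc9], by simp, fun i hi => ?_, ?_,
    ?_, ?_, ?_, ?_, ?_, ?_, fun h => absurd isNode_nil h, by simp [hM],
    fun h => absurd isNode_nil h, by simp [hM]⟩ (by omega)⟩
  · simp [show i ≠ 5 ∧ i ≠ 12 ∧ i ≠ 13 ∧ i ≠ 14 ∧ i ≠ 15 ∧ i ≠ 16 ∧ i ≠ 28 ∧ i ≠ 99 by omega]
  · simp [nextNum, isNode_nil]; omega
  · simp [nextIdx_old isNode_nil, E.ix.root]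
  · simp [E.ix.root]
  · simp [E.ix.root]
  · rw [if_neg fun h => by simpa using h.1]; simp
  · rw [if_neg fun h => ?_]
    · simp
    · have := h.2.1
      rw [loc_of_node isNode_nil] at this
      exact this.2.2.1 (List.prefix_nil.1 this.2.1)
  · simp [isNode_nil]

theorem found_wp (E : Setting a S (a :: x) idx ι N D D' B NB) (H : NodeInv S idx N f M)
    (HC : CharInv (a :: S) ι M chr) (HD : DictStore M (mix (newLinks a S idx ι) D D') r)
    (hM : s.mem.num = M) (hchr : s.mem.chr = chr) (hc9 : s.creg 9 = none) (h1 : s.reg 1 = S.length)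
    (h4 : s.reg 4 = 64 * N) (h9 : s.reg 9 = 64 * idx x) (h10 : s.reg 10 = 64 * idx (loc S (a :: x)))
    (h29 : s.reg 29 = 0)
    (hR : ∀ s' t v, Prepared a S (a :: x) idx N M s s' x v → t ≤ 500 * logSigma (a :: S) → R s' t) :
    WP B found s R := by
  have hB := E.hB
  have hNB := E.hNB
  have hN := E.hN
  have hL := one_le_logSigma (a :: S)
  have hw := loc_node E.head.sub
  have p1 := E.ix.pos _ hw
  rw [found, wp_seq]
  refine flags_wp E H HC HD hM hchr hc9 h1 h9 h10 h29 fun s1 t1 v k0 k1 k2 k3 k4 k5 k6 k7 k8 k9 k10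
    k11 => ?_
  have hp : Places a S (a :: x) x v := .inr ⟨rfl, k0⟩
  have hiff : (loc S (a :: x)).length = x.length + 1 ↔ IsNode S (a :: x) := by
    constructor
    · intro e
      have := (prefix_loc E.head.sub).eq_of_length (by simp [e])
      rw [this]; exact hw
    · intro h; rw [loc_of_node h]; simp
  have e4 := k3 4 (by omega)
  have e10 := k3 10 (by omega)
  have e29 := k3 29 (by omega)
  simp [k6, k7, e10, h10, e4, h4]
  refine ⟨fun e => ⟨by omega, ?_⟩, fun e => ⟨by omega, ?_⟩⟩ <;> rw [hiff] at e
  · refine hR _ _ v ⟨hp, by simp [k1], by simp [k2], fun i hi => ?_, ?_, ?_, by simp [k4], by simp [k5],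
      by simp [k8], by simp [k9], by simp [e], fun h => absurd e h, fun _ => by simp [k2, hM],
      fun h => absurd e h, fun c _ _ => by simp [k2, hM]⟩ (by omega)
    · rw [← k3 i (by omega)]
      simp [show i ≠ 5 ∧ i ≠ 12 ∧ i ≠ 28 ∧ i ≠ 99 by omega]
    · simp [nextNum, e]; omega
    · simp [nextIdx_old e, loc_of_node e]
  · refine newHead_wp (M := M) (i := N + 1) (w := idx (loc S (a :: x))) (by simp [k2, hM]) (by simp; omega)
      (by simp [e10, h10]) (by omega) (by omega) (by omega)
      fun s2 t2 g1 g2 g3 g4 g5 g6 => ?_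
    obtain ⟨gc, gch, gr⟩ := g1
    have q12 : s2.reg 12 = 64 * N + 64 := by simp [gr]
    simp [q12]
    refine ⟨by omega, by omega, hR _ _ v ⟨hp, by simp [gc, k1], by simp [gch, k2], fun i hi => ?_, ?_, ?_,
      by simp [gr, k4], by simp [gr, k5], by simp [gr, k8], by simp [gr, k9], by simp [e],
      fun _ => by simp [gr, e10, h10], fun h => absurd h e, fun _ => ?_, fun c h1 h2 => ?_⟩ (by omega)⟩
    · rw [← k3 i (by omega)]
      simp [gr i (by omega) (by omega), show i ≠ 5 ∧ i ≠ 12 ∧ i ≠ 28 ∧ i ≠ 99 by omega]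
    · simp [nextNum, e]; omega
    · rw [E.head.nextIdx_head e]; simp [q12]; omega
    · simp [k4, k5, k7, k10, e29, h29] at g2 g3
      obtain ⟨m1, m2, m3, m4, m5, m6, m7⟩ := g3
      refine ⟨by simp [g4], fun u hu => by simp [g2, k0.unique hu], by simp [m1], by simp [m2],
        by simp [m3],
        by simp [m4], ?_, fun c u e => ?_, by simp [m6]⟩
      · simp only [State.setReg_mem, m5, startPhi]
        by_cases ho : occ S (a :: x) = 1
        · simp [ho, e]
        · simp [ho, phi_not_node e]
      · simp [m7, (List.cons.inj e).2]
    · simp only [State.setReg_mem]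
      exact g5 c h1 (by omega)

theorem build_wp (E : Setting a S z idx ι N D D' B NB) (H : NodeInv S idx N (phi S) M)
    (HC : CharInv (a :: S) ι M chr) (HD : DictStore M (mix (newLinks a S idx ι) D D') r)
    (hM : s.mem.num = M) (hchr : s.mem.chr = chr) (hc9 : s.creg 9 = none) (h1 : s.reg 1 = S.length)
    (h2 : s.reg 2 = S.length + 1) (h4 : s.reg 4 = 64 * N) (h6 : s.reg 6 = 64 * idx S)
    (h7 : (S = [] ∧ s.reg 7 = 0) ∨ ∃ y, IsParent S y S ∧ s.reg 7 = 64 * idx y)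
    (h8 : s.reg 8 ≠ 0 ↔ ∃ y, Gains a S y)
    (h9 : (z = [] ∧ s.reg 9 = 0) ∨ ∃ x, z = a :: x ∧ x <+: S ∧ s.reg 9 = 64 * idx x ∧
      s.reg 10 = 64 * idx (loc S z)) (h29 : s.reg 29 = 0)
    (hR : ∀ s' t v x, Places a S z x v → (x = [] ∨ z = a :: x) → s'.creg 9 = none →
      s'.mem.chr = s.mem.chr → (∀ i, (i ≤ 4 ∨ i = 7 ∨ i = 29) → s'.reg i = s.reg i) →
      s'.reg 12 = 64 * nextIdx a S z idx N z → s'.reg 13 = 64 * idx v → s'.reg 14 = 64 * idx x →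
      (s'.reg 28 = 0 ↔ IsNode S z) → (¬ IsNode S z → s'.reg 10 = 64 * idx (loc S z)) →
      NodeInv (a :: S) (nextIdx a S z idx N) (nextNum S z N) (phi (a :: S)) s'.mem.num →
      s'.mem.num (64 * N + 11) = 0 → (¬ IsNode S z → s'.mem.num (64 * (N + 1) + 11) = 0) →
      (∀ c, ¬ NodeCell c → c ≠ 64 * N + 11 → c ≠ 64 * (N + 1) + 11 → s'.mem.num c = M c) →
      t ≤ 700 * logSigma (a :: S) → R s' t) : WP B build s R := by
  classical
  have hB := E.hB
  have hNB := E.hNB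
  have hN := E.hN
  have hL := one_le_logSigma (a :: S)
  have hw := loc_node E.head.sub
  have p1 := E.ix.pos _ hw
  have hN' := num_le_nextNum (S := S) (z := z) (N := N)
  have prep : ∀ R' : State A → ℕ → Prop, (∀ s' t x v, Prepared a S z idx N M s s' x v →
      t ≤ 501 * logSigma (a :: S) → R' s' t) → WP B (.ite (.eq 9 29) notFound found) s R' := by
    intro R' hR'
    rw [wp_ite]
    simp only [Test.holds_eq, h29]
    refine ⟨fun e => ?_, fun e => ?_⟩
    · rcases h9 with ⟨rfl, -⟩ | ⟨x, rfl, -, h, -⟩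
      · exact notFound_wp E hM hc9 h4 fun s' t hp ht => hR' _ _ _ _ hp (by omega)
      · have := E.ix.pos _ E.head.tail_node; omega
    · rcases h9 with ⟨-, h⟩ | ⟨x, rfl, -, h, h10⟩
      · exact absurd h e
      · exact found_wp E H HC HD hM hchr hc9 h1 h4 h h10 h29
          fun s' t v hp ht => hR' _ _ _ _ hp (by omega)
  rw [build, wp_seq]
  refine prep _ fun s1 t1 x v P ht1 => ?_
  obtain ⟨hxn, hvn⟩ := E.head.places_node P.places
  have hl := fun q => loses_places (q := q) P.places
  rw [wp_seq]
  refine newLeaf_wp (M := s1.mem.num) (i := N) rfl (by rw [P.reg 4 (by omega), h4]) (by omega) (by omega)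
    fun s2 t2 k1 k2 k3 k4 k5 => ?_
  rw [P.reg 2 (by omega), P.reg 6 (by omega), P.reg 29 (by omega), h2, h6, h29, P.r5] at k3
  rw [P.r12] at k2
  obtain ⟨m1, m2, m3, m4, m5, m6, m7, m8, m9⟩ := k3
  have f1 : ∀ c, (c ≠ 57 ∧ c ≠ 58 ∧ c ≠ 64 * idx (loc S z)) ∧ (c < 64 * N ∨ 64 * (N + 1) + 12 ≤ c ∨
      (64 * N + 12 ≤ c ∧ c < 64 * (N + 1)) ∨ c % 64 = 5 ∨ c % 64 = 6 ∨ c % 64 = 7 ∨ c % 64 = 8) →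
      s2.mem.num c = M c := fun c hc => by
    rw [k4 c hc.1.1 hc.1.2.1 (by omega), P.frame c hc.1.2.2 (by omega)]
  have H1 : NodeInv (a :: S) (nextIdx a S z idx N) (nextNum S z N) (startPhi S z) s2.mem.num := by
    refine H.cons E.head rfl rfl k2 m1 m2 m3 m4 ?_ m7 m8 m9 (f1 3 (by omega))
      (fun hz => ?_) (fun q hq g hg h0 => ?_) (fun q hq => ?_)
    · rw [m5, startPhi, if_neg fun h => E.head.ne h.1.symm, phi_not_node fun h => not_sub_cons h.sub]
    · obtain ⟨n1, n2, n3, n4, n5, n6, n7, n8, -⟩ := P.new hz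
      simp (disch := omega) only [k4]
      exact ⟨n1, n2, n3, n4, n5, n6, n7, n8⟩
    · have := E.ix.pos q hq
      by_cases hz : IsNode S z
      · rw [k4 _ (by omega) (by omega) (by omega), P.same hz]
      · refine f1 _ ⟨⟨by omega, by omega, fun e => ?_⟩, by omega⟩
        have hg0 : g = 0 := by omega
        exact hz (h0 hg0 (E.ix.inj _ _ hq hw (by omega)))
    · rw [startPhi, if_neg]
      rintro ⟨rfl, -, h⟩; exact h hq
  have hB' : 64 * nextNum S z N ≤ B := by omega
  have e1 : ∀ q, IsNode S q → nextIdx a S z idx N q = idx q := fun q hq => nextIdx_old hq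
  have gain : ∀ R' : State A → ℕ → Prop, (∀ s' t, KeepsR 20 22 s2 s' →
      NodeInv (a :: S) (nextIdx a S z idx N) (nextNum S z N)
        (fun q => startPhi S z q + if Gains a S q then 1 else 0) s'.mem.num →
      (∀ c, ¬ PhiCell c → s'.mem.num c = s2.mem.num c) → t ≤ 15 → R' s' t) →
      WP B (.ite (.eq 8 29) .nop (.const 21 1 ;; addPhi 7 21)) s2 R' := by
    intro R' hR'
    have r8 : s2.reg 8 = s.reg 8 := by rw [k1.reg _, P.reg 8 (by omega)]
    have r7 : s2.reg 7 = s.reg 7 := by rw [k1.reg _, P.reg 7 (by omega)]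
    have r29 : s2.reg 29 = 0 := by rw [k1.reg _, P.reg 29 (by omega), h29]
    simp only [wp_ite, Test.holds_eq, r8, r29, wp_nop, wp_seq, wp_const]
    refine ⟨fun e => ?_, fun e => ⟨by omega, ?_⟩⟩
    · have hg : ∀ q, ¬ Gains a S q := fun q hq => h8.2 ⟨q, hq⟩ e
      refine hR' _ _ .refl ?_ (fun _ _ => rfl) (by omega)
      simpa [hg] using H1
    · obtain ⟨y, hy⟩ := h8.1 e
      have hyn : IsNode S y := hy.1.1
      have h7' : s.reg 7 = 64 * idx y := by
        rcases h7 with ⟨rfl, -⟩ | ⟨y', hy', h⟩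
        · exact absurd (List.prefix_nil.1 hy.1.2.1) hy.1.2.2.1
        · rw [h, hy.1.unique hy']
      have hst : startPhi S z y = phi S y := if_neg fun h => h.2.2 (h.1 ▸ hyn)
      have := phi_le_length (S := S) (w := y)
      refine addPhi_wp (s := s2.setReg 21 1) (M := s2.mem.num) (x := y) (q := 7) (d := 21)
        (by omega) (by omega) H1 hyn.cons hB' rfl
        (by simp [r7, h7', e1 y hyn]) (fun _ => by rw [hst, State.setReg_reg, if_pos rfl]; omega)
        fun s' t w1 w2 w3 w4 => ?_
      refine hR' _ _ (by simpa using w1.mono (hi' := 22) le_rfl (by omega)) ?_ w3 (by omega)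
      · convert w2 using 1
        funext q
        by_cases hq : q = y
        · subst hq; simp [hy]
        · rw [Function.update_of_ne hq, if_neg fun h => hq (h.1.unique hy.1), add_zero]
  rw [wp_seq]
  refine gain _ fun s3 t3 g1 g2 g3 g4 => ?_
  have r3 : ∀ i, i < 20 → s3.reg i = s1.reg i := fun i hi => by rw [g1.reg i, k1.reg i]
  rw [wp_seq]
  refine addPhi_wp (M := s3.mem.num) (x := x) (q := 14) (d := 15) (by omega) (by omega) g2 hxn.cons hB' rfl
    (by rw [r3 _ (by omega), P.r14, e1 x hxn]) (by simp) fun s4 t4 w1 w2 w3 w4 => ?_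
  refine addPhi_wp (M := s4.mem.num) (x := v) (q := 13) (d := 16) (by omega) (by omega) w2 hvn.cons hB' rfl
    (by rw [w1.reg _, r3 _ (by omega), P.r13, e1 v hvn]) (by simp) fun s5 t5 u1 u2 u3 u4 => ?_
  rw [w1.reg 16, r3 16 (by omega), P.r16, r3 15 (by omega), P.r15] at u2
  have r5 : ∀ i, (i < 20 ∨ 22 ≤ i ∧ i < 99) → s5.reg i = s1.reg i := fun i hi => by
    rw [u1.reg i, w1.reg i, g1.reg i,
      k1.reg i]
  have f5 : ∀ c, ¬ PhiCell c → s5.mem.num c = s2.mem.num c := fun c hc => by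
    rw [u3 c hc, w3 c hc, g3 c hc]
  refine hR _ _ v x P.places (P.places.elim (fun h => .inl h.2.1) fun h => .inr h.1) ?_ ?_
    (fun i hi => by rw [r5 i (by omega), P.reg i (by omega)]) (by rw [r5 _ (by omega), P.r12])
    (by rw [r5 _ (by omega), P.r13]) (by rw [r5 _ (by omega), P.r14]) (by rw [r5 _ (by omega), P.r28])
    (fun hz => by rw [r5 _ (by omega), P.r10 hz]) ?_ ?_ (fun hz => ?_) (fun c c1 c2 c3 => ?_) (by omega)
  · rw [u1.1, w1.1, g1.1, k1.1, P.creg]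
  · rw [u1.2.1, w1.2.1, g1.2.1, k1.2.1, P.chr]
  · convert u2 using 1
    funext q
    rw [E.head.startPhi_update q]
    have h1 := (hl q).1
    have h2 := (hl q).2
    by_cases hqv : q = v <;> by_cases hqx : q = x
    · subst hqv hqx; simp
    · subst hqv; simp [hqx, show ¬ LosesLeft a S z q from fun h => hqx (h1 h)]
    · subst hqx; simp [hqv, show ¬ LosesRight S z q from fun h => hqv (h2 h)]
    · simp [hqv, hqx, show ¬ LosesLeft a S z q from fun h => hqx (h1 h),
        show ¬ LosesRight S z q from fun h => hqv (h2 h)]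
  · rw [f5 _ (by omega), m6]
  · rw [f5 _ (by omega), k4 _ (by omega) (by omega) (by omega)]
    exact (P.new hz).2.2.2.2.2.2.2.2
  · rw [f5 c (by omega), f1 c (by omega)]

/-! ### The stages of the update: child edges and redirected links -/

/-- Set the child of the node in register `u`, along the character that follows this node in the suffix
whose length is in register `p`, to the address in register `y`. -/
def childSet (u p y : ℕ) : Prog :=
  ldf 22 u 2 ;; .const 24 1 ;; .sub 23 p 22 ;; .sub 23 23 24 ;; .cload 1 23 ;; skipFind ;;
  addk 30 u 5 ;; .copy 31 40 ;; .copy 35 y ;; dset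

/-- Equip the new branching node with its links and its child, and redirect the links that lead to
it. -/
def splitDicts : Prog :=
  ldf 26 10 1 ;; addk 41 10 13 ;; addk 42 12 13 ;; dcopy ;; childSet 13 26 12 ;; childSet 12 26 10 ;;
  .copy 9 14 ;; walk 10 12

/-- What survives the setting of a child. -/
def KeepsD {A : Type u} (s s' : State A) : Prop :=
  s'.creg 9 = s.creg 9 ∧ s'.mem.chr = s.mem.chr ∧
    ∀ r, (r < 9 ∨ 10 = r ∨ (12 ≤ r ∧ r < 22) ∨ (25 ≤ r ∧ r < 30)) → s'.reg r = s.reg r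

theorem childSet_wp (hb : DictBound D D' NB S.toFinset.card (logSigma S)) (hB : 64 * NB ≤ B)
    (hNB : 10 * (S.length + 1) ≤ NB) (HC : CharInv S ι M chr) {T : Set (ℕ × ℕ)}
    (HD : DictStore M (mix T D D') r) {u p y : ℕ} (hu : 12 ≤ u ∧ u < 20)
    (hp : p < 9 ∨ 25 ≤ p ∧ p < 29) (hy : y < 9 ∨ y = 10 ∨ 12 ≤ y ∧ y < 20) (hM : s.mem.num = M)
    (hchr : s.mem.chr = chr) (hc9 : s.creg 9 = none) {t : List A} (hi : 1 ≤ i ∧ i < NB)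
    (h1 : s.reg u = 64 * i) (hl : M (64 * i + 2) = x.length) (h2 : s.reg p = t.length)
    (ht : t <:+ S) (hx : x ++ [c] <+: t) (h3 : s.reg y = D' (64 * i + 5) (ι c)) (h0 : s.reg y ≠ 0)
    (hR : ∀ s' t r', KeepsD s s' → r ≤ r' →
      DictStore s'.mem.num (mix (insert (64 * i + 5, ι c) T) D D') r' →
      (∀ c, ¬ DictCell c → s'.mem.num c = M c) → t ≤ 300 * logSigma S → R s' t) :
    WP B (childSet u p y) s R := by
  have hL := one_le_logSigma S
  have hcard := card_toFinset_le S
  have htl := ht.length_le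
  have hk := HC.chr_eq ht hx
  simp [childSet, h1, h2, hM, hl, show u ≠ 99 ∧ u ≠ 22 ∧ u ≠ 24 ∧ u ≠ 23 by omega,
    show p ≠ 99 ∧ p ≠ 22 ∧ p ≠ 24 ∧ p ≠ 23 by omega, hchr, hk]
  refine ⟨by omega, by omega, by omega, ?_⟩
  refine HC.find_wp (v := c) hB hNB (by simp [hM]) (by simp [hchr]) (by simp [hc9]) (by simp)
    fun s1 t1 k1 k2 k3 k4 => ?_
  have hr : ∀ q, (q < 22 ∨ 25 ≤ q ∧ q < 30) → s1.reg q = s.reg q := fun q hq => by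
    rw [k1.2.2 q (by omega) (by omega)]
    simp [show q ≠ 99 ∧ q ≠ 22 ∧ q ≠ 24 ∧ q ≠ 23 by omega]
  have e1 : s1.reg u = 64 * i := by rw [hr u (by omega), h1]
  simp [e1, k3, show y ≠ 30 ∧ y ≠ 31 ∧ y ≠ 99 by omega, hr y (by omega)]
  refine ⟨by omega, ?_⟩
  refine mset_wp (M := M) (d := 64 * i + 5) (j := ι c) (v := s.reg y) hb hB HC.bits (by omega) HD
    (by simp [k2, hM]) (by simp) (by simp) (by simp) h3 h0 (HC.le c) ⟨by omega, by omega⟩ (by omega)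
    fun s2 t2 r2 g1 g2 g3 g4 g5 => hR _ _ r2 ⟨?_, ?_, fun q hq => ?_⟩ g2 g3 g4 (by omega)
  · rw [g1.1]; simp [k1.1]
  · rw [g1.2.1]; simp [k1.2.1]
  · rw [g1.2.2 q (by omega) (by omega)]
    simp [hr q (by omega), show q ≠ 30 ∧ q ≠ 31 ∧ q ≠ 35 ∧ q ≠ 99 by omega]

/-- A child edge to the target of a parent pointer. -/
theorem LinkMap.child_parent (h : LinkMap S idx ι D) (hp : IsParent S v x) (hx : IsNode S x)
    (hc : v ++ [c] <+: x) : D (64 * idx v + 5) (ι c) = 64 * idx x := by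
  rw [h.child v c hp.1 (hc.isInfix.trans hx.sub), hp.loc_eq hx hc]

/-- All entries that change are in `T`, except for the edge to the new leaf. -/
def AllButLeaf (a : A) (S z : List A) (idx : List A → ℕ) (ι : A → ℕ) (T : Set (ℕ × ℕ)) : Prop :=
  ∀ d j, Changed a S z idx ι d j → (d, j) ∈ T ∨ ∃ b, z ++ [b] <+: a :: S ∧ d = 64 * idx z + 5 ∧ j = ι b

theorem allButLeaf_of_node (hz : IsNode S z) :
    AllButLeaf a S z (nextIdx a S z idx N) ι (newLinks a S idx ι) := by
  rintro d j (⟨h1, h2, h3⟩ | ⟨h1, h2⟩ | h1 | ⟨h1, h2, h3⟩ | ⟨h1, h2⟩ | ⟨h1, h2, h3, h4, h5⟩)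
  · exact .inl ⟨_, h1, h2, h3, by rw [nextIdx_old h1]⟩
  · exact .inr ⟨_, h1, rfl, rfl⟩
  all_goals exact absurd hz h1

/-- After the first walk, the old locus has the links that the new node is to receive. -/
theorem Setting.copy_source (E : Setting a S z idx ι N D D' B NB) (hz : ¬ IsNode S z) (j : ℕ) :
    mix (newLinks a S idx ι) D D' (64 * idx (loc S z) + 13) j =
      D' (64 * nextIdx a S z idx N z + 13) j := by
  have hw := loc_node E.head.sub
  rw [← E.head.copied_eq E.ix' E.inj_on E.new, nextIdx_old hw]
  by_cases hT : (64 * idx (loc S z) + 13, j) ∈ newLinks a S idx ι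
  · exact mix_of_mem hT
  refine mix_of_eq ?_
  by_contra hne
  have hl := (prefix_loc E.head.sub).length_le
  have := E.changed hne
  rw [← nextIdx_old (idx := idx) (N := N) hw] at this
  generalize hd : 64 * nextIdx a S z idx N (loc S z) + 13 = d at this
  have inj : ∀ q, IsNode (a :: S) q → d = 64 * nextIdx a S z idx N q + 13 → loc S z = q :=
    fun q hq e => E.ix'.inj _ _ hw.cons hq (by omega)
  rcases this with ⟨h1, h2, h3⟩ | ⟨h1, h2⟩ | h1 | ⟨h1, h2, h3⟩ | ⟨h1, h2⟩ | ⟨h1, rfl, h3, h4, h5⟩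
  · exact hT ⟨_, h1, h2, h3, by rw [inj _ h1.cons rfl]⟩
  · omega
  · exact hz (inj _ E.head.isNode rfl ▸ hw)
  · omega
  · omega
  · have := h4.length_le
    rw [inj _ h3.cons rfl] at hl
    simp at hl; omega

/-- All changes except for the edge to the new leaf are made. The second walk starts at `x` and is paid by
the depth of the new leaf, the copying by the new records. -/
theorem splitDicts_wp (E : Setting a S z idx ι N D D' B NB)
    (H : NodeInv (a :: S) (nextIdx a S z idx N) (nextNum S z N) f M) (HC : CharInv (a :: S) ι M chr)
    (HD : DictStore M (mix (newLinks a S idx ι) D D') r) (hz : ¬ IsNode S z) (hzx : z = a :: x)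
    (hv : IsParent S v (loc S z)) (hM : s.mem.num = M) (hchr : s.mem.chr = chr)
    (hc9 : s.creg 9 = none) (h3 : s.reg 3 = 64 * ι a) (h10 : s.reg 10 = 64 * idx (loc S z))
    (h12 : s.reg 12 = 64 * nextIdx a S z idx N z) (h13 : s.reg 13 = 64 * idx v)
    (h14 : s.reg 14 = 64 * idx x) (h29 : s.reg 29 = 0)
    (hR : ∀ s' t r' T, s'.creg 9 = none → s'.mem.chr = chr →
      (∀ i, (i < 9 ∨ 12 ≤ i ∧ i < 22 ∨ 27 ≤ i ∧ i < 30) → s'.reg i = s.reg i) → r ≤ r' →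
      DictStore s'.mem.num (mix T D D') r' →
      AllButLeaf a S z (nextIdx a S z idx N) ι T → (∀ c, ¬ DictCell c → s'.mem.num c = M c) →
      t + unit (a :: S) * dep (a :: S) (a :: S) ≤ unit (a :: S) * (dep S x + (r' - r) + 20) → R s' t) :
    WP B splitDicts s R := by
  obtain rfl := hzx
  have hw := loc_node E.head.sub
  have hB := E.hB
  have hNB := E.hNB
  have hN := E.hN
  have hcl := E.card_lt
  have hL := one_le_logSigma (a :: S)
  have hU : unit (a :: S) = 60 * logSigma (a :: S) + 200 := rfl
  set U := unit (a :: S) with hUdef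
  have hb := E.bound
  set k := logSigma (a :: S) with hk
  have hxn := E.head.tail_node
  have old : ∀ q, IsNode S q → nextIdx a S (a :: x) idx N q = idx q := fun q => nextIdx_old
  have p1 := E.ix.pos _ hw
  have p2 := E.ix.pos _ hxn
  have p3 := E.ix.pos _ hv.1
  have hhead := E.head.nextIdx_head (idx := idx) (N := N) hz
  set idx' := nextIdx a S (a :: x) idx N with hidx'
  have hz' := E.head.isNode
  have hpz := E.head.parent_head hz hv
  have hpw := E.head.parent_loc hz
  obtain ⟨c, hc⟩ := prefix_snoc hpz.2.1 hpz.2.2.1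
  obtain ⟨c', hc'⟩ := prefix_snoc hpw.2.1 hpw.2.2.1
  obtain ⟨-, t, ht, htl, hwt⟩ := H.den _ hw.cons
  rw [old _ hw] at htl
  have hl := prefix_loc E.head.sub
  have short : ∀ u, IsNode (a :: S) u → u <+: x → IsNode S u := fun u hu hux => by
    have h1 := hux.length_le
    have h2 := E.head.pre.length_le
    rcases E.head.node_iff.1 hu with h | rfl | rfl
    · exact h
    · simp at h1 h2; omega
    · simp at h1
  have sub : ∀ u, u <+: x → a :: u <+: a :: x := fun u hu => by simpa using hu
  have oldD : ∀ u, IsNode (a :: S) u → u <+: x →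
      D (64 * idx' u + 13) (ι a) = 64 * idx (loc S (a :: u)) := fun u hu hux => by
    rw [old _ (short u hu hux), E.old.weiner _ _ (short u hu hux) ((sub u hux).isInfix.trans E.head.sub)]
  have oldDw : ∀ u, IsNode (a :: S) u → u <+: x →
      (D (64 * idx' u + 13) (ι a) = 64 * idx (loc S (a :: x)) ↔ loc S (a :: u) = loc S (a :: x)) :=
    fun u hu hux => by
      rw [oldD u hu hux]
      refine ⟨fun e => E.ix.inj _ _ (loc_node ((sub u hux).isInfix.trans E.head.sub)) hw (by omega),
        fun e => by rw [e]⟩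
  -- a node whose link is redirected does not lead to an explicit node above the head
  have explicit : ∀ u, IsNode (a :: S) u → IsNode (a :: S) (a :: u) → u <+: x → u ≠ x →
      loc S (a :: u) ≠ loc S (a :: x) := fun u hu hau hux hne e => by
    have h1 := prefix_lt_len hux hne
    have h2 : IsNode S (a :: u) := by
      have := E.head.pre.length_le
      rcases E.head.node_iff.1 hau with h | h | h
      · exact h
      · obtain rfl : u = S := by simpa using h
        simp at this; omega
      · exact absurd (by simpa using h) hne
    rw [loc_of_node h2] at e
    have := hl.length_le
    rw [← e] at this
    simp at this; omega
  simp [splitDicts, h10, h12, hM]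
  refine ⟨by omega, by omega, by omega, ?_⟩
  refine mcopy_wp (M := M) (T := newLinks a S idx ι) (d := 64 * idx (loc S (a :: x)) + 13)
    (d' := 64 * idx' (a :: x) + 13) hb hB HC.bits hcl HD (by simp [hM]) (by simp) (by simp)
    ⟨by omega, by omega⟩ ⟨by omega, by omega⟩ (by omega) (by omega) (by omega) (fun j => ?_)
    (E.copy_source hz) fun s1 t1 r1 k1 k2 k3 k4 k5 => ?_
  · rw [mix_of_notMem]
    · by_contra h0
      have := E.old.lt E.ix h0
      omega
    · rintro ⟨u, hu, -, -, e⟩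
      have e1 := congrArg Prod.fst e
      have := E.ix.pos _ hu
      simp only at e1; omega
  have fr1 : ∀ g i, g ≤ 4 → s1.mem.num (64 * i + g) = M (64 * i + g) :=
    fun g i hg => k4 _ (by omega)
  have HC1 : CharInv (a :: S) ι s1.mem.num chr := HC.frame fun c hc => k4 c (by omega)
  have kr : ∀ q, (q < 26 ∨ 27 ≤ q ∧ q < 30) → s1.reg q = s.reg q := fun q hq => by
    rw [k1.2.2 q (by omega) (by omega)]; simp [show q ≠ 26 ∧ q ≠ 99 ∧ q ≠ 41 ∧ q ≠ 42 by omega]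
  have k26 : s1.reg 26 = t.length := by simp [k1.2.2, htl]
  have len : ∀ q, IsNode (a :: S) q → M (64 * idx' q + 2) = q.length := fun q hq => (H.den q hq).1
  have hzv : D' (64 * idx' v + 5) (ι c) = 64 * idx' (a :: x) := E.new.child_parent hpz hz' hc
  have hwz : D' (64 * idx' (a :: x) + 5) (ι c') = 64 * idx' (loc S (a :: x)) := E.new.child_parent
    hpw hw.cons hc'
  rw [old _ hw] at hwz
  rw [old _ hv.1] at hzv
  have hNB' : 10 * ((a :: S).length + 1) ≤ NB := by simp; omega
  -- the edge from `v` to the new node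
  refine childSet_wp (u := 13) (p := 26) (y := 12) (i := idx v) (x := v) (t := t) (c := c) hb hB hNB' HC1
    k3 (by omega) (by omega) (by omega) rfl (by rw [k1.2.1]; simp [hchr])
    (by rw [k1.1]; simp [hc9]) (by omega) (by rw [kr 13 (by omega), h13])
    (by rw [fr1 2 _ (by omega), ← old _ hv.1, len _ hv.1.cons]) k26 ht (hc.trans (hl.trans hwt))
    (by rw [hzv, kr 12 (by omega), h12]) (by rw [kr 12 (by omega), h12]; omega)
    fun s2 t2 r2 g1 g2 g3 g4 g5 => ?_
  -- the edge from the new node to its old locus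
  refine childSet_wp (u := 12) (p := 26) (y := 10) (i := idx' (a :: x)) (x := a :: x) (t := t) (c := c')
    hb hB hNB' (HC1.frame fun c hc => g4 c (by omega))
    g3 (by omega) (by omega) (by omega) rfl (by rw [g1.2.1, k1.2.1]; simp [hchr])
    (by rw [g1.1, k1.1]; simp [hc9]) (by omega) (by rw [g1.2.2 12 (by omega), kr 12 (by omega), h12])
    (by rw [g4 _ (by omega), fr1 2 _ (by omega), len _ hz'])
    (by rw [g1.2.2 26 (by omega), k26]) ht (hc'.trans hwt)
    (by rw [hwz, g1.2.2 10 (by omega), kr 10 (by omega), h10])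
    (by rw [g1.2.2 10 (by omega), kr 10 (by omega), h10]; omega)
    fun s3 t3 r3 w1 w2 w3 w4 w5 => ?_
  have r3' : ∀ q, (q < 9 ∨ 10 = q ∨ (12 ≤ q ∧ q < 22) ∨ (27 ≤ q ∧ q < 30)) → s3.reg q = s.reg q :=
    fun q hq => by rw [w1.2.2 q (by omega), g1.2.2 q (by omega), kr q (by omega)]
  have fr3 : ∀ c, ¬ DictCell c → s3.mem.num c = M c := fun c hc => by rw [w4 c hc, g4 c hc, k4 c hc]
  have fin : ∀ s', KeepsW (s3.setReg 9 (s3.reg 14)) s' →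
      s'.creg 9 = none ∧ s'.mem.chr = chr ∧
      (∀ i, (i < 9 ∨ 12 ≤ i ∧ i < 22 ∨ 27 ≤ i ∧ i < 30) → s'.reg i = s.reg i) := fun s' h => by
    refine ⟨?_, ?_, fun i hi => ?_⟩
    · rw [h.1, State.setReg_creg, w1.1, g1.1, k1.1]; simp [hc9]
    · rw [h.2.1, State.setReg_mem, w1.2.1, g1.2.1, k1.2.1]; simp [hchr]
    · rw [h.2.2 i (by omega) (by omega), State.setReg_reg, if_neg (by omega), r3' i (by omega)]
  set T3 := insert (64 * idx' (a :: x) + 5, ι c') (insert (64 * idx v + 5, ι c)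
    (newLinks a S idx ι ∪ {p | p.1 = 64 * idx' (a :: x) + 13})) with hT3
  -- what has been written so far, and the links `W` of the second walk, cover all changes
  have cover : ∀ W : Set (ℕ × ℕ), (∀ u, IsNode (a :: S) u → u <+: x → loc S (a :: u) = loc S (a :: x) →
      (64 * idx' u + 13, ι a) ∈ W) → AllButLeaf a S (a :: x) idx' ι (T3 ∪ W) := fun W hW => by
    rintro d j (⟨h1, h2, h3⟩ | ⟨h1, h2⟩ | h1 | ⟨h1, h2, h3⟩ | ⟨h1, h2⟩ | ⟨h1, h2, h3, h4, h5⟩)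
    · exact .inl (.inl (.inr (.inr (.inl ⟨_, h1, h2, h3, by rw [old _ h1]⟩))))
    · exact .inr ⟨_, h1, rfl, rfl⟩
    · exact .inl (.inl (.inr (.inr (.inr rfl))))
    · obtain rfl := h2.unique hv
      obtain rfl := snoc_inj h3 hc
      exact .inl (.inl (.inr (.inl (by rw [old _ h2.1]))))
    · obtain rfl := snoc_inj h2 hc'
      exact .inl (.inl (.inl rfl))
    · obtain rfl := (List.cons.inj h2).2
      exact .inl (.inr (hW _ h3.cons h4 h5))
  have hT : ∀ u, IsNode (a :: S) u → u <+: x → (64 * idx' u + 13, ι a) ∉ T3 := by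
    rintro u hu hux (h | h | ⟨q, hq, -, hqs, h⟩ | h)
    · have := congrArg Prod.fst h; simp only at this; omega
    · have := congrArg Prod.fst h; simp only at this; omega
    · have := congrArg Prod.fst h
      simp only [old _ (short u hu hux)] at this
      obtain rfl := E.ix.inj _ _ (short u hu hux) hq (by omega)
      exact hqs ((sub u hux).isInfix.trans E.head.sub)
    · simp only [Set.mem_ofPred_eq] at h
      have := E.ix.pos _ (short u hu hux)
      rw [old _ (short u hu hux)] at h; omega
  have e10 : (s3.setReg 9 (s3.reg 14)).reg 10 = 64 * idx (loc S (a :: x)) := by simp [r3', h10]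
  have time : ∀ t4 r4 m, r3 ≤ r4 → dep (a :: S) (a :: x) ≤ m + 2 →
      t4 + U * m ≤ U * (dep S x + 2) →
      3 + (2 + (2 + (t1 + (t2 + (t3 + (1 + t4)))))) + U * dep (a :: S) (a :: S) ≤
        U * (dep S x + (r4 - r) + 20) := fun t4 r4 m hr hm ht => by
    have q1 : (r1 - r + 1) * (30 * k + 110) ≤ (r1 - r + 1) * U := Nat.mul_le_mul_left _ (by omega)
    have q2 : (r1 - r + 1) * U ≤ (r4 - r + 1) * U := Nat.mul_le_mul_right _ (by omega)
    have q3 : U * dep (a :: S) (a :: S) ≤ U * (m + 3) :=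
      Nat.mul_le_mul_left _ (by rw [E.head.parent_new.dep]; omega)
    have e1 : (r4 - r + 1) * U = U * (r4 - r) + U := by ring
    have e2 : U * (m + 3) = U * m + 3 * U := by ring
    have e3 : U * (dep S x + (r4 - r) + 20) = U * dep S x + U * (r4 - r) + 20 * U := by ring
    have e4 : U * (dep S x + 2) = U * dep S x + 2 * U := by ring
    omega
  have hds := E.head.dep_short
  refine walk_wp (q := 10) (y := 12) hb hB hcl E.ix'
    (by have := num_le_nextNum (S := S) (z := a :: x) (N := N); omega) (E.le a) (.inr rfl)
    (.inr (by omega)) x.length (v := x) (T := T3) (r := r3) (s := s3.setReg 9 (s3.reg 14)) le_rfl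
    hxn.cons (fun u p hu _ hp => ?_) ?_ ?_ w3 hT
    (fun u hu hux h0 => ?_) ?_ ?_ ?_ ?_ fun s' t r' L e y1 y2 y3 y6 y9 y10 y11 => ?_
  · simp only [State.setReg_mem]
    rw [fr3 _ (by omega)]; exact H.parent u p hu hp
  · simp only [State.setReg_mem]
    rw [fr3 _ (by omega)]; exact H.root0
  · exact (HC1.frame (M' := s3.mem.num) fun c hc => by
      have : ¬ DictCell c := by omega
      rw [w4 c this, g4 c this]).bits
  · rw [e10, oldDw u hu hux] at h0
    simp [r3', h12]
    rw [E.new.weiner u a hu ((sub u hux).trans E.head.pre).isInfix, E.head.redirect hux h0]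
  · simp [r3', h12]; omega
  · simp [r3', h14, ← old _ hxn, hidx']
  · simp [r3', h3]
  · simp [r3', h29]
  · obtain ⟨f1, f2, f3⟩ := fin s' y1
    simp only [e10] at y3 y6
    obtain ⟨hmono, hdep⟩ : (∀ u, u <+: x → loc S (a :: u) = loc S (a :: x) → L ≤ u.length) ∧
        dep (a :: S) (a :: x) ≤ e + 2 := by
      rcases y3 with ⟨rfl, rfl, -⟩ | ⟨b, y3, y4, y5, rfl, rfl, -⟩
      · have := dep_cons_le_one (S := a :: S) (a := a) (x := x) fun u hu hau hux hne =>
          explicit u hu hau hux hne ((oldDw u hu hux).1 (y6 u hu hux (by simp)))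
        exact ⟨by simp, by omega⟩
      · rw [ne_eq, oldDw b y3 y4] at y5
        refine ⟨fun u hux e => ?_, (dep_cons_le (b := b) fun u hu hau hux hne => ?_).trans (by omega)⟩
        · by_contra hlt
          refine y5 (IsLocus.eq_loc ⟨hw, (sub b y4).trans hl, fun w' h1 h2 => ?_⟩).symm
          have hub : a :: u <+: a :: b := by simpa using prefix_of_len hux y4 (by omega)
          rw [← e]
          exact (isLocus_loc ((sub u hux).isInfix.trans E.head.sub)).2.2 w' h1 (hub.trans h2)
        · by_contra hn
          have hlt : b.length + 1 ≤ u.length := by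
            by_contra hl'
            exact hn (prefix_of_len hux y4 (by omega))
          exact explicit u hu hau hux hne ((oldDw u hu hux).1 (y6 u hu hux hlt))
    refine hR _ _ r' _ f1 f2 f3 (k2.trans (g2.trans (w2.trans y2))) y9
      (cover _ fun u hu hux e => ⟨u, hu, hux, hmono u hux e, rfl⟩)
      (fun c hc => by rw [y10 c hc]; exact fr3 c hc) (time _ _ e y2 hdep ?_)
    rwa [hds, ← hU] at y11

/-! ### The update -/

/-- Bring the dictionaries up to date. -/
def links : Prog := .ite (.eq 28 29) .nop splitDicts ;; childSet 12 2 4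

/-- The node in register `7`, or the root if that is the null pointer, is to be compared first. -/
def firstPlace : Prog := .ite (.eq 7 29) (.const 60 64) (.copy 60 7)

/-- Bring the list of net frequencies up to date, recording the changes; the net frequency can change only
at the four nodes in the registers `7`, `14`, `13` and `12`. -/
def syncs : Prog :=
  sts 1 29 ;; sts 2 29 ;; firstPlace ;; sync 0 ;; .copy 60 14 ;; sync 1 ;;
  .copy 60 13 ;; sync 2 ;; .copy 60 12 ;; sync 3

/-- Prepend the character in register `0`. -/
def update : Prog := addChar ;; firstWalk ;; build ;; links ;; syncs

/-- Here `e` is the depth at which the first walk has ended. -/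
theorem links_wp (E : Setting a S z idx ι N D D' B NB)
    (H : NodeInv (a :: S) (nextIdx a S z idx N) (nextNum S z N) f M) (HC : CharInv (a :: S) ι M chr)
    (HD : DictStore M (mix (newLinks a S idx ι) D D') r) {e : ℕ} (hp : Places a S z x v)
    (he : e = if z = [] then 0 else dep S x) (hM : s.mem.num = M) (hchr : s.mem.chr = chr)
    (hc9 : s.creg 9 = none) (h2 : s.reg 2 = S.length + 1) (h3 : s.reg 3 = 64 * ι a)
    (h4 : s.reg 4 = 64 * N) (h10 : ¬ IsNode S z → s.reg 10 = 64 * idx (loc S z))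
    (h12 : s.reg 12 = 64 * nextIdx a S z idx N z) (h13 : s.reg 13 = 64 * idx v)
    (h14 : s.reg 14 = 64 * idx x) (h28 : s.reg 28 = 0 ↔ IsNode S z) (h29 : s.reg 29 = 0)
    (hR : ∀ s' t r', s'.mem.chr = chr → (∀ i, (i < 9 ∨ 12 ≤ i ∧ i < 22 ∨ 27 ≤ i ∧ i < 30) →
      s'.reg i = s.reg i) → r ≤ r' → DictStore s'.mem.num D' r' →
      (∀ c, ¬ DictCell c → s'.mem.num c = M c) →
      t + unit (a :: S) * dep (a :: S) (a :: S) ≤ unit (a :: S) * (e + (r' - r) + 30) → R s' t) :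
    WP B links s R := by
  have hB := E.hB
  have hNB := E.hNB
  have hL := one_le_logSigma (a :: S)
  have hU : unit (a :: S) = 60 * logSigma (a :: S) + 200 := rfl
  have hN := num_le_nextNum (S := S) (z := z) (N := N)
  have hN2 := E.hN
  have old : ∀ q, IsNode S q → nextIdx a S z idx N q = idx q := fun q => nextIdx_old
  have pz := E.ix'.pos z E.head.isNode
  have p0 := E.ix.pos [] isNode_nil
  have hpar := E.head.parent_new
  obtain ⟨c, hc⟩ := prefix_snoc hpar.2.1 hpar.2.2.1
  have hpz := E.new.child_parent hpar (isNode_of_suffix List.suffix_rfl) hc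
  rw [nextIdx_leaf] at hpz
  have split : ∀ R' : State A → ℕ → Prop, (∀ s' t r' T, s'.creg 9 = none → s'.mem.chr = chr →
      (∀ i, (i < 9 ∨ 12 ≤ i ∧ i < 22 ∨ 27 ≤ i ∧ i < 30) → s'.reg i = s.reg i) → r ≤ r' →
      DictStore s'.mem.num (mix T D D') r' →
      AllButLeaf a S z (nextIdx a S z idx N) ι T → (∀ c, ¬ DictCell c → s'.mem.num c = M c) →
      t + unit (a :: S) * dep (a :: S) (a :: S) ≤ unit (a :: S) * (e + (r' - r) + 21) → R' s' t) →
      WP B (.ite (.eq 28 29) .nop splitDicts) s R' := by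
    intro R' hR'
    rw [wp_ite]
    simp only [Test.holds_eq, h29, h28, wp_nop]
    refine ⟨fun hz => hR' _ _ r _ hc9 hchr (fun _ _ => rfl) le_rfl (by rw [hM]; exact HD)
      (allButLeaf_of_node hz) (fun _ _ => by rw [hM]) ?_, fun hz => ?_⟩
    · have : dep (a :: S) (a :: S) ≤ e + 3 := by
        rw [E.head.dep_new, he]
        rcases hp with ⟨rfl, -⟩ | ⟨rfl, -⟩
        · simp [dep_nil]
        · have := dep_cons_le (S := S) (a := a) (x := x) fun u _ _ h _ => h
          simp; omega
      have h1 := Nat.mul_le_mul_left (unit (a :: S)) this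
      have h2 : unit (a :: S) * (e + (r - r) + 21) = unit (a :: S) * (e + 3) + 18 * unit (a :: S) := by
        rw [Nat.sub_self]; ring
      omega
    · rcases hp with ⟨rfl, -⟩ | ⟨hzx, hv⟩
      · exact absurd isNode_nil hz
      refine splitDicts_wp E H HC HD hz hzx hv hM hchr hc9 h3 (h10 hz) h12 h13 h14 h29
        fun s' t r' T k1 k2 k3 k4 k5 k6 k7 k8 => hR' _ _ r' T k1 k2 k3 k4 k5 k6 k7 ?_
      rw [he, if_neg (by simp [hzx])]
      have e1 : unit (a :: S) * (dep S x + (r' - r) + 21) =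
        unit (a :: S) * (dep S x + (r' - r) + 20) + unit (a :: S) := by ring
      omega
  rw [links, wp_seq]
  refine split _ fun s1 t1 r1 T k1 k2 k3 k4 k5 k6 k7 k8 => ?_
  refine childSet_wp (M := s1.mem.num) (u := 12) (p := 2) (y := 4) (i := nextIdx a S z idx N z) (x := z)
    (t := a :: S) (c := c) E.bound hB (by simp; omega) (HC.frame fun c hc => k7 c (by omega)) k5
    (by omega) (by omega) (by omega) rfl k2 k1
    (by omega) (by rw [k3 12 (by omega), h12])
    (by rw [k7 _ (by omega)]; exact (H.den z E.head.isNode).1)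
    (by rw [k3 2 (by omega), h2]; rfl) List.suffix_rfl hc (by rw [hpz, k3 4 (by omega), h4])
    (by rw [k3 4 (by omega), h4]; omega) fun s2 t2 r2 g1 g2 g3 g4 g5 => ?_
  refine hR _ _ r2 (by rw [g1.2.1, k2]) (fun i hi => by rw [g1.2.2 i (by omega), k3 i hi]) (k4.trans g2)
    (g3.congr fun d j => ?_) (fun c hc => by rw [g4 c hc, k7 c hc]) ?_
  · by_cases hd : D d j = D' d j
    · exact (mix_of_eq hd).symm
    · rw [mix_of_mem]
      rcases k6 d j (E.changed hd) with h | ⟨b, hb, rfl, rfl⟩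
      · exact .inr h
      · obtain rfl := snoc_inj hb hc
        exact .inl rfl
  · have h1 : unit (a :: S) * (r1 - r) ≤ unit (a :: S) * (r2 - r) := Nat.mul_le_mul_left _ (by omega)
    have e1 : unit (a :: S) * (e + (r1 - r) + 21) =
      unit (a :: S) * e + unit (a :: S) * (r1 - r) + 21 * unit (a :: S) := by ring
    have e2 : unit (a :: S) * (e + (r2 - r) + 30) =
      unit (a :: S) * e + unit (a :: S) * (r2 - r) + 30 * unit (a :: S) := by ring
    omega

/-- The four nodes need not be distinct: `sync` does nothing when it meets a node again. -/
theorem syncs_wp {sh tg : ℕ → ℕ} {l : List ℕ} {y x v k : ℕ}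
    (hsh : ∀ j, 1 ≤ j → j < N → M (64 * j + 11) = sh j)
    (htg : ∀ j, 1 ≤ j → j < N → M (64 * j + 3) = tg j)
    (hl : l.Nodup)
    (hm : ∀ j, j ∈ l ↔ 1 ≤ j ∧ j < N ∧ M (64 * j + 11) ≠ 0) (hc : DChain M 0 l) (hB : 64 * N ≤ B)
    (hx : 1 ≤ x ∧ x < N) (hv : 1 ≤ v ∧ v < N) (hk : 1 ≤ k ∧ k < N) (hM : s.mem.num = M)
    (h7 : s.reg 7 = 64 * y) (hy : y < N) (h14 : s.reg 14 = 64 * x) (h13 : s.reg 13 = 64 * v)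
    (h12 : s.reg 12 = 64 * k) (h29 : s.reg 29 = 0)
    (hR : ∀ s' t dn l', s'.mem.chr = s.mem.chr → SyncInv s'.mem.num N sh tg
    (fun j => M (64 * j + 1)) (fun j => M (64 * j + 2)) 4 dn l' →
      (∀ i, (i = y ∧ y ≠ 0 ∨ i = x ∨ i = v ∨ i = k) → i ∈ dn ∨ sh i = tg i) →
      (∀ c, ¬ SyncCell c → s'.mem.num c = M c) → t ≤ 300 → R s' t) : WP B syncs s R := by
  have fr : ∀ c, c ≠ 1 → c ≠ 2 → Function.update (Function.update M 1 0) 2 0 c = M c := fun c h1 h2 => by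
    rw [Function.update_of_ne h2, Function.update_of_ne h1]
  have H : SyncInv (Function.update (Function.update M 1 0) 2 0) N sh tg (fun j => M (64 * j + 1))
      (fun j => M (64 * j + 2)) 0 [] l := by
    refine ⟨fun j h1 h2 => ?_, fun j h1 h2 => ?_, fun j h1 h2 => ?_, fun j h1 h2 => ?_,
      List.nodup_nil, by simp,
      hl, fun j => ?_, hc.frame (fr _ (by omega) (by omega)) (fr _ (by omega) (by omega)) fun j hj =>
        ⟨fr _ (by omega) (by omega), fr _ (by omega) (by omega)⟩, by simp [RecList], by simp [RecList]⟩
    · simpa [fr] using hsh j h1 h2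
    · rw [fr _ (by omega) (by omega), htg j h1 h2]
    · rw [fr _ (by omega) (by omega)]
    · rw [fr _ (by omega) (by omega)]
    · rw [fr _ (by omega) (by omega), hm j]
  obtain ⟨i, hi1, hiN, hi⟩ : ∃ i, 1 ≤ i ∧ i < N ∧ (if y = 0 then i = 1 else i = y) := by
    by_cases h : y = 0
    · exact ⟨1, by omega, by omega, by simp [h]⟩
    · exact ⟨y, by omega, by omega, by simp [h]⟩
  have start : ∀ R' : State A → ℕ → Prop, (∀ s' t, s'.mem.chr = s.mem.chr → s'.mem.num =
      Function.update (Function.update M 1 0) 2 0 → (∀ q, q < 30 → s'.reg q = s.reg q) →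
      s'.reg 60 = 64 * i → t ≤ 10 → R' s' t) →
      WP B firstPlace
        ((((s.setReg 99 1).setNum 1 0).setReg 99 2).setNum 2 0) R' := by
    intro R' hR'
    simp [firstPlace, h7, h29]
    refine ⟨fun e => ⟨by omega, hR' _ _ (by simp) (by simp [hM]) (fun q hq => ?_) ?_ (by omega)⟩,
      fun e => hR' _ _ (by simp) (by simp [hM]) (fun q hq => ?_) ?_ (by omega)⟩
    · simp [show q ≠ 60 ∧ q ≠ 99 by omega]
    · simp [e] at hi; simp [hi]
    · simp [show q ≠ 60 ∧ q ≠ 99 by omega]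
    · simp [e] at hi; simp [hi]
  simp only [syncs, wp_seq]
  simp [h29, show 2 < B ∧ 1 < B by omega]
  refine start _ fun s0 t0 k0 k1 k2 k3 k4 => ?_
  refine sync_wp (M := s0.mem.num) (by rw [k1]; exact H) (by omega) hB hi1 hiN rfl k3
    fun s1 t1 d1 l1 q1 q2 q3 q4 q5 q6 => ?_
  refine sync_wp (M := s1.mem.num) (i := x) q2 (by omega) hB hx.1 hx.2 (by simp)
    (by simp [q1.2.2, k2, h14]) fun s2 t2 d2 l2 w1 w2 w3 w4 w5 w6 => ?_
  refine sync_wp (M := s2.mem.num) (i := v) w2 (by omega) hB hv.1 hv.2 (by simp)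
    (by simp [w1.2.2, q1.2.2, k2, h13]) fun s3 t3 d3 l3 v1 v2 v3 v4 v5 v6 => ?_
  refine sync_wp (M := s3.mem.num) (i := k) v2 (by omega) hB hk.1 hk.2 (by simp)
    (by simp [v1.2.2, w1.2.2, q1.2.2, k2, h12]) fun s4 t4 d4 l4 u1 u2 u3 u4 u5 u6 => ?_
  refine hR _ _ d4 l4 (by rw [u1.2.1, State.setReg_mem, v1.2.1, State.setReg_mem, w1.2.1,
    State.setReg_mem, q1.2.1, k0])
    u2 ?_ (fun c hc => ?_) (by omega)
  · rintro j (⟨rfl, h⟩ | rfl | rfl | rfl)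
    · simp [h] at hi
      subst hi
      exact q4.imp (fun h => u3 (v3 (w3 h))) id
    · exact w4.imp (fun h => u3 (v3 h)) id
    · exact v4.imp (fun h => u3 h) id
    · exact u4
  · rw [u5 c hc, v5 c hc, w5 c hc, q5 c hc, k1, fr c (fun h => hc (by omega))
      (fun h => hc (by omega))]

end Stages

/-! ### The invariant of the algorithm -/

section Invariant

variable {A : Type u} [LinearOrder A] {S : List A} {a : A} {z : List A} {idx : List A → ℕ} {ι : A → ℕ}
  {N r : ℕ} {D D' : ℕ → ℕ → ℕ} {B NB : ℕ} {f : List A → ℕ} {m : Memory A} {l : List ℕ}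
  {C : ℕ} {x : List A}

/-- The memory after `S` has been read: `r` is the number of records of the dictionaries, and `l` lists
the numbers of the nodes of positive net frequency. -/
structure TreeInv (S : List A) (idx : List A → ℕ) (ι : A → ℕ) (N : ℕ) (D : ℕ → ℕ → ℕ) (r : ℕ)
    (l : List ℕ) (m : Memory A) : Prop where
  nodes : NodeInv S idx N (phi S) m.num
  chars : CharInv S ι m.num m.chr
  dicts : DictStore m.num D r
  links : LinkMap S idx ι D
  len : m.num 56 = S.length
  le : N ≤ 2 * S.length + 2
  shadow : ∀ x, IsNode S x → m.num (64 * idx x + 11) = phi S x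
  nodup : l.Nodup
  mem : ∀ j, j ∈ l ↔ 1 ≤ j ∧ j < N ∧ m.num (64 * j + 11) ≠ 0
  chain : DChain m.num 0 l

theorem storesSet_of_map {p : ℕ} {K : List ℕ} {nd : ℕ → List A} {g : List A → ℕ} {X : Set (List A × ℕ)}
    (h : IsLinkedList S m p (K.map fun j => (nd j, g (nd j)))) (hK : K.Nodup)
    (hnd : ∀ j ∈ K, idx (nd j) = j)
    (hX : ∀ w f, (w, f) ∈ X ↔ f = g w ∧ ∃ j ∈ K, nd j = w) : StoresSet S m p X := by
  refine ⟨_, h, ?_, ?_⟩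
  · refine List.Nodup.map_on (fun i hi j hj e => ?_) hK
    rw [← hnd i hi, ← hnd j hj, (Prod.mk.inj e).1]
  · ext ⟨w, f⟩
    rw [hX]
    simp only [Set.mem_ofPred_eq, List.mem_map, Prod.mk.injEq]
    constructor
    · rintro ⟨j, hj, rfl, rfl⟩; exact ⟨rfl, j, hj, rfl⟩
    · rintro ⟨rfl, j, hj, rfl⟩; exact ⟨j, hj, rfl, rfl⟩

theorem RecList.isLinkedList {lo hi : ℕ} {pp ll g : ℕ → ℕ} {nd : ℕ → List A} : ∀ {K : List ℕ} {p : ℕ},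
    RecList m.num lo hi p (K.map fun j => (pp j, ll j, g j)) →
    (∀ j ∈ K, Denotes S (pp j) (ll j) (nd j)) → IsLinkedList S m p (K.map fun j => (nd j, g j))
  | [], p, h, _ => by obtain rfl : p = 0 := h; exact .nil
  | j :: K, p, h, hd => by
    obtain ⟨h1, -, -, h2, h3, h4, h5⟩ := h
    refine .cons h1 ?_ h4 (RecList.isLinkedList h5 fun i hi => hd i (List.mem_cons_of_mem _ hi))
    rw [h2, h3]; exact hd j List.mem_cons_self

theorem DChain.isLinkedList {g : ℕ → ℕ} {nd : ℕ → List A} : ∀ {K : List ℕ} {p : ℕ},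
    DChain m.num p K → (∀ j ∈ K, Denotes S (m.num (64 * j + 9)) (m.num (64 * j + 10)) (nd j) ∧
      m.num (64 * j + 11) = g j) → IsLinkedList S m (m.num p) (K.map fun j => (nd j, g j))
  | [], p, h, _ => by rw [h.1]; exact .nil
  | j :: K, p, h, hd => by
    obtain ⟨h1, -, h2⟩ := h
    obtain ⟨h3, h4⟩ := hd j List.mem_cons_self
    rw [h1]
    exact .cons (by omega) h3 h4 (DChain.isLinkedList h2 fun i hi => hd i (List.mem_cons_of_mem _ hi))

/-- The inverse of a numbering. -/
theorem Indexing.exists_inv (h : Indexing S idx N) :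
    ∃ nd : ℕ → List A, (∀ j, 1 ≤ j → j < N → IsNode S (nd j) ∧ idx (nd j) = j) ∧
      ∀ x, IsNode S x → nd (idx x) = x := by
  have : ∀ j, ∃ x, 1 ≤ j → j < N → IsNode S x ∧ idx x = j := fun j => by
    by_cases hj : 1 ≤ j ∧ j < N
    · obtain ⟨x, hx⟩ := h.surj j hj.1 hj.2
      exact ⟨x, fun _ _ => hx⟩
    · exact ⟨[], fun h1 h2 => absurd ⟨h1, h2⟩ hj⟩
  choose nd hnd using this
  refine ⟨nd, hnd, fun x hx => ?_⟩
  obtain ⟨h1, h2⟩ := h.pos x hx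
  exact h.inj _ _ (hnd _ h1 h2).1 hx (hnd _ h1 h2).2

theorem mem_PNF {w : List A} {f : ℕ} : (w, f) ∈ PNF S ↔ f = phi S w ∧ phi S w ≠ 0 := by
  rw [PNF_eq, Set.mem_ofPred_eq, and_comm, Nat.one_le_iff_ne_zero]

theorem mem_PNF_diff {S' w : List A} {f : ℕ} :
    (w, f) ∈ PNF S \ PNF S' ↔ f = phi S w ∧ phi S w ≠ 0 ∧ phi S w ≠ phi S' w := by
  rw [Set.mem_sdiff, mem_PNF, mem_PNF]
  constructor
  · rintro ⟨⟨rfl, h1⟩, h2⟩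
    exact ⟨rfl, h1, fun e => h2 ⟨e, e ▸ h1⟩⟩
  · rintro ⟨rfl, h1, h2⟩
    exact ⟨⟨rfl, h1⟩, fun h => h2 h.1⟩

theorem TreeInv.storesSet (H : TreeInv S idx ι N D r l m) : StoresSet S m (m.num 0) (PNF S) := by
  obtain ⟨nd, hnd, hinv⟩ := H.nodes.ix.exists_inv
  refine storesSet_of_map (K := l) (nd := nd) (g := phi S) (idx := idx)
    (H.chain.isLinkedList fun j hj => ?_) H.nodup (fun j hj => ?_) fun w f => ?_
  · obtain ⟨h1, h2, -⟩ := (H.mem j).1 hj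
    obtain ⟨h3, h4⟩ := hnd j h1 h2
    have h5 := H.nodes.den _ h3
    have h6 := H.nodes.den' _ h3
    rw [← h6.1, ← h6.2, h4] at h5
    exact ⟨h5, by rw [← H.shadow _ h3, h4]⟩
  · obtain ⟨h1, h2, -⟩ := (H.mem j).1 hj
    exact (hnd j h1 h2).2
  · rw [mem_PNF]
    refine and_congr_right fun _ => ⟨fun h => ?_, ?_⟩
    · have hw : IsNode S w := node_of_phi (by omega)
      obtain ⟨h1, h2⟩ := H.nodes.ix.pos w hw
      exact ⟨idx w, (H.mem _).2 ⟨h1, h2, by rwa [H.shadow w hw]⟩, hinv w hw⟩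
    · rintro ⟨j, hj, rfl⟩
      obtain ⟨h1, h2, h3⟩ := (H.mem j).1 hj
      obtain ⟨h4, h5⟩ := hnd j h1 h2
      rwa [← H.shadow _ h4, h5]

/-- The result of an update on the memory: the new tree and the changes of the net frequencies. -/
structure Updated (a : A) (S : List A) (idx' : List A → ℕ) (ι : A → ℕ) (N : ℕ) (D : ℕ → ℕ → ℕ) (r : ℕ)
    (l : List ℕ) (m : Memory A) : Prop where
  tree : TreeInv (a :: S) idx' ι N D r l m
  plus : StoresSet (a :: S) m (m.num 1) (PNF (a :: S) \ PNF S)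
  minus : StoresSet (a :: S) m (m.num 2) (PNF S \ PNF (a :: S))

/-- The amortized time bound of an update, with the potentials `dep S S` and `- r`. -/
theorem update_wp (I : TreeInv S idx ι N D r l m) (hB : 64 * NB ≤ B) (hNB : 10 * (S.length + 2) ≤ NB)
    (a : A) : WP B update (m.call 0 (some a)) fun s t => ∃ idx' ι' N' D' r' l',
      Updated a S idx' ι' N' D' r' l' s.mem ∧ r ≤ r' ∧
      t + unit (a :: S) * dep (a :: S) (a :: S) ≤ unit (a :: S) * (dep S S + (r' - r) + 80) := by
  have hL := one_le_logSigma (a :: S)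
  have hU : unit (a :: S) = 60 * logSigma (a :: S) + 200 := rfl
  obtain ⟨z, hz⟩ := exists_isHead a S
  -- the links `D'` after the update are known in advance, as the numbering of the new nodes is
  rw [update, wp_seq]
  refine addChar_wp (M := m.num) (chr := m.chr) (a := a) I.chars hB hNB I.len rfl rfl
    (by simp [Memory.call])
    (by simp [Memory.call]) (by simp [Memory.call]) fun s1 t1 ι' k1 k2 k3 k4 k5 k6 k7 k8 k9 k10 => ?_
  obtain ⟨D', hD'⟩ := exists_linkMap (hz.indexing I.nodes.ix) k6.inj_on
  have hcard := card_toFinset_le (a :: S)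
  have E : Setting a S z idx ι' N D D' B NB := ⟨hz, I.nodes.ix, I.links.congr k7, hD', k6.mem, k6.inj,
    k6.le, hB, hNB, I.le⟩
  have hN' := num_le_nextNum (S := S) (z := z) (N := N)
  rw [wp_seq]
  refine firstWalk_wp (M := s1.mem.num) E (I.nodes.frame fun c hc => k9 c (by omega) (by omega))
    k6 (I.dicts.frame fun c hc => k9 c (by omega) (by omega)) rfl k5 k2
    fun s2 t2 r2 e q1 q2 q3 q4 q5 q6 q7 q8 q9 q10 q11 q12 => ?_
  have c2 : ∀ c, CharCell c → s2.mem.num c = s1.mem.num c := fun c hc => q11 c (by omega)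
  have n2 : ∀ c, NodeCell c → s2.mem.num c = m.num c := fun c hc => by
    rw [q11 c (by omega), k9 c (by omega) (by omega)]
  rw [wp_seq]
  refine build_wp (M := s2.mem.num) (chr := s1.mem.chr) E (I.nodes.frame n2) (k6.frame c2) q10 rfl q2
    (by rw [q1, k1]) (by rw [q3 1 (by omega), k3]) (by rw [q3 2 (by omega), k4]) q4 q5 q6 q7
    (q9.imp (fun h => ⟨h.1, h.2.1⟩) fun ⟨x, h1, h2, h3, h4, h5⟩ => ⟨x, h1, h2, h3, h4⟩)
    (by rw [q3 29 (by omega), k2])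
    fun s3 t3 v x w1 w2 w3 w4 w5 w6 w7 w8 w9 w10 w11 w12 w13 w14 w15 => ?_
  have fr3 : ∀ c, ¬ NodeCell c → c % 64 ≠ 11 → s3.mem.num c = s2.mem.num c := fun c hc h =>
    w14 c hc (by omega) (by omega)
  have he : e = if z = [] then 0 else dep S x := by
    rcases q9 with ⟨rfl, -, h⟩ | ⟨x', rfl, -, -, -, h⟩
    · simp [h]
    · rcases w1 with ⟨h1, -⟩ | ⟨h1, -⟩
      · cases h1
      · obtain rfl := (List.cons.inj h1).2
        simp [h]
  rw [wp_seq]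
  refine links_wp (M := s3.mem.num) (chr := s1.mem.chr) E w11
    ((k6.frame c2).frame fun c hc => fr3 c (by omega) (by omega))
    (q10.frame fun c hc => fr3 c (by omega) (by omega)) w1 he rfl (by rw [w4, q2]) w3
    (by rw [w5 2 (by omega), q3 2 (by omega), k4]) (by rw [w5 3 (by omega), q3 3 (by omega), k5])
    (by rw [w5 4 (by omega), q4]) w10 w6 w7 w8 w9 (by rw [w5 29 (by omega), q3 29 (by omega), k2])
    fun s4 t4 r4 u1 u2 u3 u4 u5 u6 => ?_
  obtain ⟨nd, hnd, hinv⟩ := E.ix'.exists_inv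
  obtain ⟨hxn, hvn⟩ := E.head.places_node w1
  have old : ∀ q, IsNode S q → nextIdx a S z idx N q = idx q := fun q => nextIdx_old
  have H4 : NodeInv (a :: S) (nextIdx a S z idx N) (nextNum S z N) (phi (a :: S)) s4.mem.num :=
    w11.frame fun c hc => u5 c (by omega)
  -- the cells of the list have not been touched yet, except for the new nodes
  have f4 : ∀ c, ¬ (NodeCell c ∨ DictCell c ∨ CharCell c ∨ c = 56 ∨ c = 64 * N + 11 ∨
      c = 64 * (N + 1) + 11) → s4.mem.num c = m.num c := fun c h => by
    rw [u5 c (by omega), w14 c (by omega) (by omega) (by omega), q11 c (by omega), k9 c (by omega)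
      (by omega)]
  have sh4 : ∀ q, IsNode (a :: S) q → s4.mem.num (64 * nextIdx a S z idx N q + 11) = phi S q :=
    fun q hq => by
    by_cases hqn : IsNode S q
    · have := E.ix.pos q hqn
      rw [old q hqn, f4 _ (by omega), I.shadow q hqn]
    · rw [phi_not_node hqn, u5 _ (by omega)]
      rcases E.head.node_iff.1 hq with h | rfl | rfl
      · exact absurd h hqn
      · rw [nextIdx_leaf, w12]
      · rw [E.head.nextIdx_head hqn, w13 hqn]
  have shj : ∀ j, 1 ≤ j → j < nextNum S z N → s4.mem.num (64 * j + 11) = phi S (nd j) := fun j h1 h2 => by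
    obtain ⟨h3, h4⟩ := hnd j h1 h2
    rw [← sh4 _ h3, h4]
  have tgj : ∀ j, 1 ≤ j → j < nextNum S z N → s4.mem.num (64 * j + 3) = phi (a :: S) (nd j) :=
    fun j h1 h2 => by
      obtain ⟨h3, h4⟩ := hnd j h1 h2
      rw [← H4.phi _ h3, h4]
  have hN0 := E.hN
  have hidx : ∀ q, IsNode S q → 1 ≤ idx q ∧ idx q < nextNum S z N := fun q hq => by
    have := E.ix.pos q hq; omega
  obtain ⟨y, hy7, hyN, hyg⟩ : ∃ y, s4.reg 7 = 64 * y ∧ y < nextNum S z N ∧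
      ∀ q, Gains a S q → y ≠ 0 ∧ y = idx q := by
    rw [u2 7 (by omega), w5 7 (by omega)]
    rcases q6 with ⟨rfl, h⟩ | ⟨y, hy, h⟩
    · exact ⟨0, h, by omega, fun q hq => absurd (List.prefix_nil.1 hq.1.2.1) hq.1.2.2.1⟩
    · have := hidx y hy.1
      exact ⟨idx y, h, by omega, fun q hq => ⟨by omega, by rw [hy.unique hq.1]⟩⟩
  refine syncs_wp (M := s4.mem.num) (N := nextNum S z N) (y := y) (x := idx x) (v := idx v)
    (k := nextIdx a S z idx N z) shj tgj I.nodup (fun j => ?_)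
    (I.chain.frame (f4 _ (by omega)) (f4 _ (by omega)) fun j hj => ?_) (by omega) (hidx x hxn)
    (hidx v hvn) (E.ix'.pos z E.head.isNode) rfl hy7 hyN (by rw [u2 14 (by omega), w8])
    (by rw [u2 13 (by omega), w7]) (by rw [u2 12 (by omega), w6])
    (by rw [u2 29 (by omega), w5 29 (by omega), q3 29 (by omega), k2]) fun s5 t5 dn l' g1 g2 g3 g4 g5 => ?_
  · rw [I.mem]
    refine ⟨fun ⟨h1, h2, h3⟩ => ⟨h1, by omega, by rwa [f4 _ (by omega)]⟩,
      fun ⟨h1, h2, h3⟩ => ?_⟩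
    have hjN : j < N := by
      by_contra hn
      obtain ⟨h4, h5⟩ := hnd j h1 h2
      rw [shj j h1 h2] at h3
      have hS : IsNode S (nd j) := node_of_phi (by omega)
      have := E.ix.pos _ hS
      rw [old _ hS] at h5; omega
    exact ⟨h1, hjN, by rwa [f4 _ (by omega)] at h3⟩
  · obtain ⟨h1, h2, -⟩ := (I.mem j).1 hj
    exact ⟨f4 _ (by omega), f4 _ (by omega)⟩
  -- the nodes in `dn` are those whose net frequency changes
  have hdn : ∀ j, 1 ≤ j → j < nextNum S z N → phi S (nd j) ≠ phi (a :: S) (nd j) → j ∈ dn := by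
    intro j h1 h2 hne
    obtain ⟨h3, h4⟩ := hnd j h1 h2
    by_contra hj
    have key : ¬ (j = y ∧ y ≠ 0 ∨ j = idx x ∨ j = idx v ∨ j = nextIdx a S z idx N z) := fun h =>
      (g3 j h).elim hj hne
    refine hne (E.head.phi_same w1 (fun e => key ?_) (fun hg => key ?_) (fun e => key ?_)
      fun e => key ?_).symm
    · rw [e] at h4; exact .inr (.inr (.inr h4.symm))
    · obtain ⟨h5, h6⟩ := hyg _ hg
      rw [old _ hg.1.1] at h4
      exact .inl ⟨by omega, h5⟩
    · rw [e, old _ hxn] at h4; exact .inr (.inl h4.symm)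
    · rw [e, old _ hvn] at h4; exact .inr (.inr (.inl h4.symm))
  have hdn' : ∀ j ∈ dn, 1 ≤ j ∧ j < nextNum S z N ∧ phi S (nd j) ≠ phi (a :: S) (nd j) := g2.mem
  have diff : ∀ g g' : List A → ℕ, (∀ q, (g q ≠ g' q ↔ phi S q ≠ phi (a :: S) q)) →
      (∀ q, g q ≠ 0 → IsNode (a :: S) q) → ∀ w f, (f = g w ∧ g w ≠ 0 ∧ g w ≠ g' w ↔
      f = g w ∧ ∃ j ∈ dn.filter (fun j => g (nd j) ≠ 0), nd j = w) := by
    intro g g' hg hg0 w f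
    refine and_congr_right fun _ => ⟨fun ⟨h1, h2⟩ => ?_, ?_⟩
    · have hw := hg0 w h1
      obtain ⟨h3, h4⟩ := E.ix'.pos w hw
      have h5 := hinv w hw
      exact ⟨_, List.mem_filter.2 ⟨hdn _ h3 h4 (by rw [h5]; exact (hg w).1 h2), by simpa [h5] using h1⟩, h5⟩
    · rintro ⟨j, hj, rfl⟩
      obtain ⟨h1, h2⟩ := List.mem_filter.1 hj
      exact ⟨by simpa using h2, (hg _).2 (hdn' j h1).2.2⟩
  have den : ∀ j ∈ dn, Denotes (a :: S) (s4.mem.num (64 * j + 1)) (s4.mem.num (64 * j + 2))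
    (nd j) := fun j hj => by
    obtain ⟨h1, h2, -⟩ := hdn' j hj
    obtain ⟨h3, h4⟩ := hnd j h1 h2
    have := H4.den _ h3
    rwa [h4] at this
  have hidn : ∀ g : ℕ → Prop, ∀ [DecidablePred g], ∀ j ∈ dn.filter (fun j => g j),
    nextIdx a S z idx N (nd j) = j :=
    fun g _ j hj => by
      obtain ⟨h1, h2, -⟩ := hdn' j (List.mem_filter.1 hj).1
      exact (hnd j h1 h2).2
  refine ⟨nextIdx a S z idx N, ι', nextNum S z N, D', r4, l',
    ⟨⟨?_, ?_, ?_, hD', ?_, ?_, ?_, g2.nodupl, g2.meml,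
    g2.chain⟩, ?_, ?_⟩, by omega, ?_⟩
  · exact H4.frame fun c hc => g4 c (by omega)
  · rw [g1, u1]
    refine k6.frame fun c hc => ?_
    rw [g4 c (by omega), u5 c (by omega), fr3 c (by omega) (by omega), c2 c hc]
  · exact u4.frame fun c hc => g4 c (by omega)
  · rw [g4 _ (by omega), u5 _ (by omega),
      fr3 _ (by omega) (by omega), q11 _ (by omega), k8]; rfl
  · simp; omega
  · intro q hq
    obtain ⟨h1, h2⟩ := E.ix'.pos q hq
    rw [g2.shadow _ h1 h2, hinv q hq]
    split_ifs with h
    · rfl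
    · by_contra hne
      exact h (hdn _ h1 h2 (by rwa [hinv q hq]))
  · refine storesSet_of_map (nd := nd) (g := phi (a :: S)) (idx := nextIdx a S z idx N)
      (g2.plus.isLinkedList fun j hj => den j (List.mem_filter.1 hj).1) (g2.nodup.filter _) (hidn _)
      fun w f => ?_
    rw [mem_PNF_diff]
    exact diff _ (phi S) (fun q => ne_comm) (fun q h => node_of_phi (by omega)) w f
  · refine storesSet_of_map (nd := nd) (g := phi S) (idx := nextIdx a S z idx N)
      (g2.minus.isLinkedList fun j hj => den j (List.mem_filter.1 hj).1) (g2.nodup.filter _)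
      (hidn _) fun w f => ?_
    rw [mem_PNF_diff]
    exact diff _ (phi (a :: S)) (fun q => Iff.rfl) (fun q h => IsNode.cons (node_of_phi (by omega))) w f
  · have e1 : unit (a :: S) * (e + (r4 - r2) + 30) =
      unit (a :: S) * e + unit (a :: S) * (r4 - r2) + 30 * unit (a :: S) := by ring
    have e2 : unit (a :: S) * (dep S S + (r4 - r) + 80) =
      unit (a :: S) * (dep S S + 3) + unit (a :: S) * (r4 - r) + 77 * unit (a :: S) := by ring
    have e3 : unit (a :: S) * (r4 - r2) ≤ unit (a :: S) * (r4 - r) := Nat.mul_le_mul_left _ (by omega)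
    omega

/-! ### Queries, initialization, and the run of the algorithm -/

/-- Look up the character in register `0` in the dictionary at offset `f` of the node in register
`0`. -/
def query (f : ℕ) : Prog :=
  .ccopy 1 0 ;; skipFind ;; addk 30 0 f ;; .copy 31 40 ;; dget ;; .copy 0 32

/-- Set up the root, the sentinel of the search structure and the pointers to free records. -/
def init : Prog :=
  .const 1 64 ;; sts 3 1 ;; sts 57 1 ;; sts 59 1 ;; sts 61 1 ;; .const 1 128 ;; sts 58 1 ;; sts 60 1

theorem TreeInv.rec_le (H : TreeInv S idx ι N D r l m) : r ≤ 5 * S.length + 3 := by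
  obtain ⟨Z, hZ, hc⟩ := H.links.support H.nodes.ix
  have h1 := H.dicts.le_card hZ
  have h2 := H.le
  omega

/-- A lookup first finds the number of the character; a character that does not occur has number `0`, which
is no key of a dictionary. -/
theorem TreeInv.query (H : TreeInv S idx ι N D r l m) (hC : 1000 ≤ C) {d v : ℕ} (hx : IsNode S x)
    (hf : d = 5 ∨ d = 13) {c : A} (hv : D (64 * idx x + d) (ι c) = v) :
    Answers C S m (query d) (64 * idx x) c v := by
  have h1 := H.nodes.ix.pos x hx
  have hB : 64 * (10 * (S.length + 1)) ≤ C * (S.length + 1) := by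
    rw [← mul_assoc]; exact Nat.mul_le_mul_right _ (by omega)
  have hL := one_le_logSigma S
  have hr := H.rec_le
  have hN := H.le
  have hcard := card_toFinset_le S
  suffices h : WP (C * (S.length + 1)) (NetFrequency.query d) (m.call (64 * idx x) (some c)) fun s t =>
      s.mem = m ∧ s.reg 0 = v ∧ t ≤ 300 * logSigma S by
    obtain ⟨s, t, h1, h2, h3, h4⟩ := h
    exact ⟨s, t, h1, h2, h3, h4.trans (Nat.mul_le_mul_right _ (by omega))⟩
  rw [NetFrequency.query]
  simp
  refine H.chars.find_wp (v := c) hB le_rfl (by simp [Memory.call]) (by simp [Memory.call])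
    (by simp [Memory.call]) (by simp [Memory.call]) fun s1 t1 k1 k2 k3 k4 => ?_
  have k0 : s1.reg 0 = 64 * idx x := by simp [k1.2.2, Memory.call]
  simp [k0, k3]
  refine ⟨by omega, dget_wp (M := m.num) (d := 64 * idx x + d) (j := ι c) (k := logSigma S) hB H.chars.bits
    (by omega) H.dicts (by omega) (fun d i h0 => ?_) (by simp [k2, Memory.call]) (by simp) (by simp)
    (H.chars.le c) ⟨by omega, by omega⟩ (by omega) fun s2 t2 g1 g2 g3 g4 => ⟨?_, ?_, by omega⟩⟩
  · obtain ⟨b, -, rfl⟩ := H.links.key h0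
    unfold logSigma
    rw [add_comm]
    exact (H.chars.le b).trans_lt (Nat.lt_pow_succ_log_self (by norm_num) _)
  · simp [g2, k2, Memory.call]
  · rw [g3, hv]

/-- The algorithm. -/
def algorithm : OnlineAlgorithm := ⟨init, update, query 5, query 13⟩

theorem TreeInv.storesSuffixTree (H : TreeInv S idx ι N D r l m) (hC : 1000 ≤ C) :
    StoresSuffixTree algorithm C S m := by
  have hι : ∀ c, ∀ b ∈ S, ι b = ι c → b = c := fun c b hb e => H.chars.inj b c e ((H.chars.mem b).2 hb)
  refine ⟨H.chars.text, fun x => 64 * idx x, by simp [H.nodes.root, H.nodes.ix.root], fun x hx =>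
    ⟨by have := H.nodes.ix.pos x hx; dsimp only; omega, ?_, fun v hv => H.nodes.parent x v hx hv,
    H.nodes.den x hx,
      H.nodes.phi x hx, ?_, fun c w hw => H.query hC hx (.inl rfl) ?_, fun c hc => H.query hC hx
        (.inl rfl) ?_,
      fun c w hw => H.query hC hx (.inr rfl) ?_, fun c hc => H.query hC hx (.inr rfl) ?_⟩⟩
  · rintro rfl; exact H.nodes.root0
  · rintro c v rfl; exact H.nodes.slink c v hx
  · rw [H.links.child x c hx hw.sub, hw.eq_loc]
  · exact H.links.child_zero H.nodes.ix hx (hι c) hc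
  · rw [H.links.weiner x c hx hw.sub, hw.eq_loc]
  · exact H.links.weiner_zero H.nodes.ix hx (hι c) hc

/-- The invariant together with the amortized time bound, in which the depth of the last leaf and the
number of records of the dictionaries serve as potentials. -/
def Reached (S : List A) (m : Memory A) (T : ℕ) : Prop :=
  ∃ idx ι N D r l X, TreeInv S idx ι N D r l m ∧ T ≤ unit S * X ∧ X + dep S S ≤ 80 * S.length + r

theorem not_sub_nil {c : A} (h : c ∈ x) : ¬ x <:+: [] := fun hs => by
  rw [List.infix_nil.1 hs] at h; cases h

theorem isNode_nil_iff : IsNode [] x ↔ x = [] := by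
  refine ⟨fun h => List.infix_nil.1 h.sub, ?_⟩
  rintro rfl; exact isNode_nil

theorem treeInv_nil (hm : ∀ c, m.num c =
      if c = 3 ∨ c = 57 ∨ c = 59 ∨ c = 61 then 64 else if c = 58 ∨ c = 60 then 128 else 0) :
    TreeInv [] (fun _ => 1) (fun _ => 0) 2 (fun _ _ => 0) 1 [] m := by
  have hphi : ∀ x : List A, phi [] x = 0 := fun x => by
    have := phi_le_length (S := ([] : List A)) (w := x); simpa using this
  refine ⟨⟨⟨fun x y hx hy _ => ?_, fun x hx => by omega, fun j h1 h2 => ⟨[], isNode_nil, by omega⟩,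
    rfl⟩, by simp [hm],
    fun x v hx hv => ?_, fun x hx => ?_, fun x hx => by simp [hm], fun x hx => by simp [hm, hphi],
    fun c v hx => ?_, by simp [hm], by simp [hm], by simp [hm]⟩,
    ⟨⟨by simp, by simp, by simp⟩, by simp, ⟨2, 0, 1, 1, 1, [(0, 0)], .one ?_, by omega,
    by simp [hm], by simp [hm], rfl, by simp [KeySorted],
      ⟨[], rfl⟩, by simp, by simp, by simp, by simp⟩, fun j hj => ?_, by simp [hm]⟩,
    ⟨fun _ _ => 0, fun _ => [], ∅, fun d hd => .nil ?_ fun _ => rfl, by simp, by simp, by simp,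
    by simp, by simp, by simp,
      fun d hd => ?_, by simp, by simp, by simp [hm], by simp, by simp⟩,
    ⟨fun x c hx hc => ?_, fun x c hx hc => ?_, by simp⟩, by simp [hm], by simp,
    fun x hx => by simp [hm, hphi],
    List.nodup_nil, fun j => ?_, by simp [DChain, hm]⟩
  · rw [isNode_nil_iff.1 hx, isNode_nil_iff.1 hy]
  · rw [isNode_nil_iff.1 hx] at hv
    exact absurd (List.prefix_nil.1 hv.2.1) hv.2.2.1
  · rw [isNode_nil_iff.1 hx]
    exact ⟨by simp [hm], [], List.suffix_rfl, by simp [hm], List.nil_prefix⟩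
  · exact absurd (isNode_nil_iff.1 hx) (by simp)
  · simp [SkipTree, hm]
  · obtain rfl : j = 0 := by simpa using hj
    simp [hm]
  · rw [hm, if_neg (by omega), if_neg (by omega)]
  · change m.num (d + 1) = 0
    rw [hm, if_neg (by omega), if_neg (by omega)]
  · exact absurd hc (not_sub_nil (c := c) (by simp))
  · exact absurd hc (not_sub_nil (c := c) (by simp))
  · simp only [List.not_mem_nil, false_iff, not_and, not_not]
    intro h1 h2
    rw [hm, if_neg (by omega), if_neg (by omega)]

theorem init_reached (hC : 1000 ≤ C) :
    ∃ s t, Exec (C * (0 + 1)) init ((Memory.blank A).call 0 none) s t ∧ Reached [] s.mem t := by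
  change WP (C * (0 + 1)) init ((Memory.blank A).call 0 none) fun s t => Reached [] s.mem t
  rw [zero_add, mul_one]
  simp [init, show 64 ≤ C ∧ 3 < C ∧ 57 < C ∧ 59 < C ∧ 61 < C ∧ 128 ≤ C ∧ 58 < C ∧ 60 < C by omega]
  have hl : logSigma ([] : List A) = 1 := by simp [logSigma]
  refine ⟨_, _, _, _, _, _, 1, treeInv_nil fun c => ?_, by simp [unit, hl], by simp [dep_nil]⟩
  simp only [State.setNum_num, State.setReg_mem, Function.update_apply, Memory.call, Memory.blank]
  split_ifs <;> first | rfl | omega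

theorem Reached.update {T : ℕ} (H : Reached S m T) (hC : 1000 ≤ C) (a : A) :
    ∃ s t, Exec (C * ((a :: S).length + 1)) update (m.call 0 (some a)) s t ∧ Reached (a :: S) s.mem
      (T + t) ∧
      StoresSet (a :: S) s.mem (s.mem.num 1) (PNF (a :: S) \ PNF S) ∧
      StoresSet (a :: S) s.mem (s.mem.num 2) (PNF S \ PNF (a :: S)) := by
  obtain ⟨idx, ι, N, D, r, l, X, I, hT, hX⟩ := H
  have hB : 64 * (10 * (S.length + 2)) ≤ C * ((a :: S).length + 1) := by
    rw [← mul_assoc, List.length_cons]; exact Nat.mul_le_mul_right _ (by omega)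
  obtain ⟨s, t, hs, idx', ι', N', D', r', l', ⟨h1, h2, h3⟩, hr, ht⟩ := update_wp I hB le_rfl a
  refine ⟨s, t, hs, ⟨idx', ι', N', D', r', l', X + (dep S S + (r' - r) + 80 - dep (a :: S)
    (a :: S)), h1, ?_, ?_⟩, h2, h3⟩
  · have hU : unit S ≤ unit (a :: S) := by
      have := logSigma_mono a S; unfold unit; omega
    have h4 := hT.trans (Nat.mul_le_mul_right X hU)
    rw [Nat.mul_add, Nat.mul_sub]
    omega
  · have hU : 0 < unit (a :: S) := by unfold unit; omega
    have h5 : dep (a :: S) (a :: S) ≤ dep S S + (r' - r) + 80 :=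
      Nat.le_of_mul_le_mul_left ((Nat.le_add_left _ _).trans ht) hU
    simp only [List.length_cons]; omega

theorem exists_run (hC : 1000 ≤ C) : ∀ S : List A, ∃ m T, algorithm.Run C S m T ∧ Reached S m T
  | [] => by
    obtain ⟨s, t, h1, h2⟩ := init_reached (A := A) hC
    exact ⟨_, _, .nil h1, h2⟩
  | a :: S => by
    obtain ⟨m, T, h1, h2⟩ := exists_run hC S
    obtain ⟨s, t, h3, h4, -⟩ := h2.update hC a
    exact ⟨_, _, .cons h1 h3, h4⟩

theorem Reached.time_le {T : ℕ} (H : Reached S m T) : T ≤ 30000 * (S.length + 1) * logSigma S := by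
  obtain ⟨idx, ι, N, D, r, l, X, I, hT, hX⟩ := H
  have hr := I.rec_le
  have hL := one_le_logSigma S
  calc T ≤ unit S * X := hT
    _ ≤ (260 * logSigma S) * (85 * (S.length + 1)) := Nat.mul_le_mul (by unfold unit; omega) (by omega)
    _ = 22100 * (S.length + 1) * logSigma S := by ring
    _ ≤ _ := Nat.mul_le_mul_right _ (Nat.mul_le_mul_right _ (by norm_num))

end Invariant

end NetFrequency

open NetFrequency in
theorem mainTheorem1 :
    ∃ (D : OnlineAlgorithm) (C : ℕ), ∀ (A : Type u) [LinearOrder A] (S : List A),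
      (∃ m T, D.Run C S m T) ∧
      ∀ m T, D.Run C S m T →
        -- amortized time `O(log σ)` per character
        T ≤ C * (S.length + 1) * logSigma S ∧
        -- the suffix tree with its links and the list storing `PNF S` are maintained
        StoresSuffixTree D C S m ∧
        StoresSet S m (m.num 0) (PNF S) ∧
        -- the two parts of the symmetric difference are computed when `a` is prepended to `S`
        ∀ a m' T', D.Run C (a :: S) m' T' →
          StoresSet (a :: S) m' (m'.num 1) (PNF (a :: S) \ PNF S) ∧
          StoresSet (a :: S) m' (m'.num 2) (PNF S \ PNF (a :: S)) := by
  -- large enough for `Reached.time_le`; memory and queries need less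
  refine ⟨algorithm, 30000, fun A _ S => ?_⟩
  obtain ⟨m₀, T₀, h, H⟩ := exists_run (C := 30000) (by norm_num) S
  refine ⟨⟨m₀, T₀, h⟩, fun m T hr => ?_⟩
  obtain ⟨rfl, rfl⟩ := h.deterministic hr
  refine ⟨H.time_le, ?_, ?_, fun a m' T' hr' => ?_⟩
  · obtain ⟨idx, ι, N, D, r, l, X, I, -⟩ := H
    exact I.storesSuffixTree (by norm_num)
  · obtain ⟨idx, ι, N, D, r, l, X, I, -⟩ := H
    exact I.storesSet
  · obtain ⟨s, t, h1, -, h2, h3⟩ := H.update (C := 30000) (by norm_num) a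
    obtain ⟨rfl, -⟩ := (OnlineAlgorithm.Run.cons h h1).deterministic hr'
    exact ⟨h2, h3⟩
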